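/- **Setting.** For $i=1,\dots,N$ let $y_{i,t}=\alpha_i+x_{i,t}'\beta_i+u_{i,t}$ with $x_{i,t}\in\mathbb R^{k_i}$, $k=\sum_i k_i$. Put $x_t=(x_{1,t}',\dots,x_{N,t}')'$, $u_t=(u_{1,t},\dots,u_{N,t})'$, $Z_t'=[I_N,X_t']$ with $X_t'=\mathrm{blkdiag}(x_{1,t}',\dots,x_{N,t}')$, and $\kappa=(\alpha',\beta')'$, so that $y_t=Z_t'\kappa+u_t$. Let $\mu_x=E[x_t]$, $E[u_t]=0$, $\bar z_t=((x_t-\mu_x)',u_t')'$ ($t\in\mathbb Z$), and let $\varepsilon_t$ be $\bar z_t$ minus its componentwise $L^2$-projection on the closed linear span $H_{t-1}$ of the components of $\bar z_{t-1},\bar z_{t-2},\dots$. **Assumptions.** (1) $\{\bar z_t\}$ is covariance-stationary and purely nondeterministic ($\bigcap_t H_t=\{0\}$); for some finite $p_0\ge 1$ the projection of $\bar z_t$ on $H_{t-1}$ lies in the span of $\bar z_{t-1},\dots,\bar z_{t-p_0}$, i.e. $\bar z_t=\sum_{j=1}^{p_0}\Psi_j\bar z_{t-j}+\varepsilon_t$;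 for some $\delta>0$ the innovations are strongly mixing with $\sum_{\ell\ge1}\alpha_\varepsilon(\ell)^{\delta/(2+\delta)}<\infty$ and $\sup_t E\|\varepsilon_t\|^{4+2\delta}<\infty$; $\Sigma=E[\varepsilon_t\varepsilon_t']$ is positive definite. (2) $Q_Z=E[Z_tZ_t']$ is positive definite. (3) $E[\tilde Z_t\Sigma_{uu}^{-1}\tilde Z_t']$ is positive definite, where $\tilde Z_t'=A(L)Z_t'$ and $A(L)=I_N-\sum_j\Psi_{uu,j}L^j$. Partition $\Psi_j,\Sigma$ into $x$- and $u$-blocks. $EBD$ means $\Sigma_{xu}=0$ (and $\Sigma_{ux}=0$); $GEXOG$ means $EBD$ and $\Psi_{ux,j}=0$ for all $j$; $BD$ means $GEXOG$ and $\Psi_{xu,j}=0$ for all $j$. The parameter space is the set of $(\Psi_1,\dots,\Psi_{p_0},\Sigma)$ with $\Sigma$ positive definite and $\det(I-\sum_j\Psi_jz^j)\ne0$ for $|z|\le1$. **Estimators.** $\hat\kappa^{OLS}$ is OLS of $y_t$ on $Z_t'$, $t=1,\dots,T$, with residuals $\hat u_t$. A VAR($\hat p$) without intercept, with $\hat p=p_0$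 or any data-dependent order with $P(\hat p= p_0)\to1$, is fitted by least squares to $\hat u_1,\dots,\hat u_T$, giving $\hat\Psi_{uu,j}$, $\hat A(L)=I_N-\sum_j\hat\Psi_{uu,j}L^j$ and the residual covariance $\hat\Sigma_{uu}$. The CO-type estimator is $$\hat\kappa^{CO}=\Big(\sum_{t=\hat p+1}^T \hat A(L)Z_t'{}^{\top}\,\hat\Sigma_{uu}^{-1}\,\hat A(L)Z_t'\Big)^{-1}\sum_{t=\hat p+1}^T \hat A(L)Z_t'{}^{\top}\,\hat\Sigma_{uu}^{-1}\,\hat A(L)y_t ,$$ where $\hat A(L)Z_t'{}^{\top}$ is the transpose of $\hat A(L)Z_t'$. The infeasible GLS estimator $\hat\kappa^{GLS}$ is given by the same formula with the true $p_0$, $A(L)$ and $\Sigma_{uu}$. **Proposition 5.** (i) $BD$ holds if and only if $E[u_tx_s']=0$ for all $t,s$. Under $BD$, $\hat\kappa^{CO}\to_p\kappa$; it is asymptotically equivalent to infeasible GLS, $\sqrt T(\hat\kappa^{CO}-\hat\kappa^{GLS})\to_p0$; and it is efficient in the sense that it attains the GLS bound: $\sqrt T(\hat\kappa^{CO}-\kappa)$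 converges in distribution to a law $\nu$ if and only if $\sqrt T(\hat\kappa^{GLS}-\kappa)$ does. (ii) For every data-generating process that satisfies the assumptions (in $BD$ or not) there are pseudo-true values such that: $\hat\kappa^{OLS}\to_p\kappa+b$ with $Q_Zb=E[Z_tu_t]$; the residuals converge to $u_t^*=u_t-Z_t'b$, both at each fixed date in probability and in the sense that $T^{-1}\sum_{t\le T}\|\hat u_t-u_t^*\|^2\to_p0$; $\hat\Psi_{uu,j}$ and $\hat\Sigma_{uu}$ from the VAR($p_0$) fit converge in probability to the coefficients $\Psi^*_j$ and the error covariance $\Sigma^*\succ0$ of the population least-squares projection of $u_t^*$ on $u^*_{t-1},\dots,u^*_{t-p_0}$; and $\hat\kappa^{CO}\to_p\kappa^*$, a minimizer of $E\big[(A^*(L)(y_t-Z_t'\kappa'))^\top\Sigma^{*-1}A^*(L)(y_t-Z_t'\kappa')\big]$ over $\kappa'$, where $A^*(L)=I_N-\sum_j\Psi_j^*L^j$. Let $C$ be the set of parameters outside $BD$, or in $GEXOG\setminus BD$, or in $EBD\setminus BD$. There is a polynomial in the entries of $(\Psi_1,\dots,\Psi_{p_0},\Sigma)$, depending only on $N,(k_i),p_0$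 and $C$, whose non-zeros in $C$ are dense in $C$, such that every data-generating process with parameters in $C$ at which the polynomial does not vanish has the following properties: $\hat\kappa^{OLS}$ is inconsistent and $b\neq0$; $\hat u_t\not\to_p u_t$ at every fixed date and $T^{-1}\sum_{t\le T}\|\hat u_t-u_t\|^2\not\to_p0$; $(\Psi_j^*)_j\ne(\Psi_{uu,j})_j$; and $\hat\kappa^{CO}$ is inconsistent, with $\kappa^*\neq\kappa$. Moreover, if $k\ge1$, then there is a data-generating process in $GEXOG\setminus BD\subset EBD\setminus BD$ with these properties. -/

import Mathlib

open MeasureTheory Filter Topology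

universe v

noncomputable section

namespace CORegression

/-! ### Paths, regressors, estimators -/

/-- Index set of the stacked regressor vector: equation `i` has `k i` regressors of its own. -/
abbrev Reg {N : ℕ} (k : Fin N → ℕ) : Type := (i : Fin N) × Fin (k i)

/-- Index set of the joint vector `z = (x', u')'`. -/
abbrev Joint {N : ℕ} (k : Fin N → ℕ) : Type := Reg k ⊕ Fin N

/-- Index set of the coefficient vector `κ = (α', β')'`. -/
abbrev Coef {N : ℕ} (k : Fin N → ℕ) : Type := Fin N ⊕ Reg k

variable {N : ℕ} {k : Fin N → ℕ}

/-- The `N × (N + k)` matrix `Z' = [I_N, X']`, where row `n` of `X'` carries the regressors of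
equation `n` in the block of equation `n` and zeros elsewhere. -/
def design (x : Reg k → ℝ) : Matrix (Fin N) (Coef k) ℝ :=
  Matrix.fromCols 1 (Matrix.of fun n c => if c.1 = n then x c else 0)

/-- `y = Z' κ + u`. -/
def response (κ : Coef k → ℝ) (x : ℤ → Reg k → ℝ) (u : ℤ → Fin N → ℝ) (t : ℤ) : Fin N → ℝ :=
  Matrix.mulVec (design (x t)) κ + u t

/-- The OLS estimator from the sample `t = 1, …, T`. -/
def ols (x : ℤ → Reg k → ℝ) (y : ℤ → Fin N → ℝ) (T : ℕ) : Coef k → ℝ :=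
  Matrix.mulVec (∑ t ∈ Finset.Icc (1 : ℤ) T, (design (x t)).transpose * design (x t))⁻¹
    (∑ t ∈ Finset.Icc (1 : ℤ) T, Matrix.mulVec (design (x t)).transpose (y t))

/-- The OLS residual at time `t`, computed from the sample of size `T`. -/
def olsResidual (x : ℤ → Reg k → ℝ) (y : ℤ → Fin N → ℝ) (T : ℕ) (t : ℤ) : Fin N → ℝ :=
  y t - Matrix.mulVec (design (x t)) (ols x y T)

/-- `A(L) w_t` for a vector series `w`, where `A(L) = I - ∑_{j=1}^p Φ_j L^j`.
The index `j : Fin p` stands for the lag `j + 1`. -/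
def filterVec {p : ℕ} (Φ : Fin p → Matrix (Fin N) (Fin N) ℝ) (w : ℤ → Fin N → ℝ) (t : ℤ) :
    Fin N → ℝ :=
  w t - ∑ j : Fin p, Matrix.mulVec (Φ j) (w (t - ((j : ℕ) + 1 : ℤ)))

/-- `A(L) Z_t'`. -/
def filterDesign {p : ℕ} (Φ : Fin p → Matrix (Fin N) (Fin N) ℝ) (x : ℤ → Reg k → ℝ) (t : ℤ) :
    Matrix (Fin N) (Coef k) ℝ :=
  design (x t) - ∑ j : Fin p, Φ j * design (x (t - ((j : ℕ) + 1 : ℤ)))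

/-- The GLS estimator with filter `A(L) = I - ∑ Φ_j L^j` and innovation covariance `S`, from the
transformed observations `t = p + 1, …, T`. -/
def gls {p : ℕ} (Φ : Fin p → Matrix (Fin N) (Fin N) ℝ) (S : Matrix (Fin N) (Fin N) ℝ)
    (x : ℤ → Reg k → ℝ) (y : ℤ → Fin N → ℝ) (T : ℕ) : Coef k → ℝ :=
  Matrix.mulVec
    (∑ t ∈ Finset.Icc ((p : ℤ) + 1) T,
      (filterDesign Φ x t).transpose * S⁻¹ * filterDesign Φ x t)⁻¹
    (∑ t ∈ Finset.Icc ((p : ℤ) + 1) T,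
      Matrix.mulVec ((filterDesign Φ x t).transpose * S⁻¹) (filterVec Φ y t))

/-- `(w_{t-1}', …, w_{t-p}')'`. -/
def lagStack (p : ℕ) (w : ℤ → Fin N → ℝ) (t : ℤ) : Fin p × Fin N → ℝ :=
  fun q => w (t - ((q.1 : ℕ) + 1 : ℤ)) q.2

/-- Coefficients of the least-squares fit of a VAR(`p`) to `w_1, …, w_T`. -/
def varFit (p : ℕ) (w : ℤ → Fin N → ℝ) (T : ℕ) : Fin p → Matrix (Fin N) (Fin N) ℝ :=
  fun j => Matrix.of fun a c =>
    ((∑ t ∈ Finset.Icc ((p : ℤ) + 1) T, Matrix.vecMulVec (w t) (lagStack p w t)) *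
      (∑ t ∈ Finset.Icc ((p : ℤ) + 1) T,
        Matrix.vecMulVec (lagStack p w t) (lagStack p w t))⁻¹) a (j, c)

/-- Residual covariance matrix of the fitted VAR(`p`). -/
def varFitCov (p : ℕ) (w : ℤ → Fin N → ℝ) (T : ℕ) : Matrix (Fin N) (Fin N) ℝ :=
  ((T : ℝ) - p)⁻¹ • ∑ t ∈ Finset.Icc ((p : ℤ) + 1) T,
    Matrix.vecMulVec (filterVec (varFit p w T) w t) (filterVec (varFit p w T) w t)

/-- The two-step Cochrane–Orcutt-type estimator with VAR order `p`: OLS, VAR(`p`) fit to the OLS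
residuals, then GLS with the fitted filter and the fitted innovation covariance. -/
def coEstimator (p : ℕ) (x : ℤ → Reg k → ℝ) (y : ℤ → Fin N → ℝ) (T : ℕ) : Coef k → ℝ :=
  gls (varFit p (olsResidual x y T) T) (varFitCov p (olsResidual x y T) T) x y T

/-! ### The data-generating process -/

section DataGenerating

variable {Ω : Type*} [MeasurableSpace Ω] (P : Measure Ω)
  (x : ℤ → Ω → Reg k → ℝ) (u : ℤ → Ω → Fin N → ℝ) (μ : Reg k → ℝ)

/-- The centred joint vector `z̄_t = ((x_t - μ)', u_t')'`. -/
def zbar (t : ℤ) (ω : Ω) : Joint k → ℝ := Sum.elim (fun c => x t ω c - μ c) (u t ω)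

open Classical in
/-- The class of `f` in `L²` (zero if `f` is not square integrable). -/
def toL2 (f : Ω → ℝ) : Lp ℝ 2 P := if h : MemLp f 2 P then h.toLp f else 0

/-- Component `a` of `z̄_t`, as an element of `L²`. -/
def zL2 (t : ℤ) (a : Joint k) : Lp ℝ 2 P := toL2 P fun ω => zbar x u μ t ω a

/-- `H_t`: the closed linear span in `L²` of the components of `z̄_t, z̄_{t-1}, …`. -/
def past (t : ℤ) : Submodule ℝ (Lp ℝ 2 P) :=
  (Submodule.span ℝ {g | ∃ s ≤ t, ∃ a, g = zL2 P x u μ s a}).topologicalClosure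

instance (t : ℤ) : (past P x u μ t).HasOrthogonalProjection :=
  inferInstanceAs (Submodule.topologicalClosure _).HasOrthogonalProjection

/-- The best linear one-step-ahead predictor of component `a` of `z̄_t`. -/
def predictor (t : ℤ) (a : Joint k) : Lp ℝ 2 P :=
  (past P x u μ (t - 1)).starProjection (zL2 P x u μ t a)

/-- The one-step-ahead innovation `ε_t`. -/
def innovation (t : ℤ) (a : Joint k) : Lp ℝ 2 P := zL2 P x u μ t a - predictor P x u μ t a

/-- `E[ε_t ε_t']`. -/
def innovationCov (t : ℤ) : Matrix (Joint k) (Joint k) ℝ :=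
  Matrix.of fun a b => ∫ ω, innovation P x u μ t a ω * innovation P x u μ t b ω ∂P

/-- The σ-algebra generated by the innovations at the times in `I`. -/
@[reducible]
def innovationSigma (I : Set ℤ) : MeasurableSpace Ω :=
  ⨆ s ∈ I, ⨆ a, MeasurableSpace.comap (fun ω => innovation P x u μ s a ω) inferInstance

/-- The strong mixing coefficients of the innovation sequence:
`α(ℓ) = sup_t sup { |P(A ∩ B) - P(A) P(B)| : A ∈ σ(ε_s, s ≤ t), B ∈ σ(ε_s, s ≥ t + ℓ) }`. -/
def mixingCoeff (l : ℕ) : ℝ :=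
  sSup {r | ∃ t : ℤ, ∃ A B : Set Ω,
    MeasurableSet[innovationSigma P x u μ (Set.Iic t)] A ∧
    MeasurableSet[innovationSigma P x u μ (Set.Ici (t + l))] B ∧
    r = |P.real (A ∩ B) - P.real A * P.real B|}

/-- Finite-predictor exactness at lag `p`, with the accompanying regularity conditions. The moments
of order `4 + 2δ` of the innovations are bounded uniformly in time, since only second moments are
assumed to be stationary. -/
structure FinitePredictor (p : ℕ) : Prop where
  memLp : ∀ t a, MemLp (fun ω => zbar x u μ t ω a) 2 P
  mean_zero : ∀ t a, ∫ ω, zbar x u μ t ω a ∂P = 0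
  cov_stationary : ∀ s t h a b, ∫ ω, zbar x u μ (t + h) ω a * zbar x u μ t ω b ∂P =
    ∫ ω, zbar x u μ (s + h) ω a * zbar x u μ s ω b ∂P
  purely_nondeterministic : ⨅ t, past P x u μ t = ⊥
  exact_predictor : ∀ t a, predictor P x u μ t a ∈
    Submodule.span ℝ {g | ∃ j : Fin p, ∃ b, g = zL2 P x u μ (t - ((j : ℕ) + 1 : ℤ)) b}
  mixing_moments : ∃ δ : ℝ, 0 < δ ∧
    Summable (fun l : ℕ => mixingCoeff P x u μ (l + 1) ^ (δ / (2 + δ))) ∧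
    ∃ C : NNReal, ∀ t a,
      eLpNorm (innovation P x u μ t a) (ENNReal.ofReal (4 + 2 * δ)) P ≤ C
  innovationCov_posDef : ∀ t, (innovationCov P x u μ t).PosDef

/-- VAR(`p`) parameters: coefficient matrices `Ψ_1, …, Ψ_p` (the index `j : Fin p` stands for the
lag `j + 1`) and the innovation covariance matrix `Σ`. -/
abbrev Param (k : Fin N → ℕ) (p : ℕ) : Type :=
  (Fin p → Matrix (Joint k) (Joint k) ℝ) × Matrix (Joint k) (Joint k) ℝ

/-- `θ = (Ψ, Σ)` are the parameters of the canonical VAR(`p`) innovations representation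
`z̄_t = ∑_j Ψ_j z̄_{t-j} + ε_t`, `E[ε_t ε_t'] = Σ`. -/
structure HasParam {p : ℕ} (θ : Param k p) : Prop where
  predictor_eq : ∀ t a, predictor P x u μ t a =
    ∑ j : Fin p, ∑ b, θ.1 j a b • zL2 P x u μ (t - ((j : ℕ) + 1 : ℤ)) b
  cov_eq : ∀ t, innovationCov P x u μ t = θ.2

/-- `Ψ_{uu,1}, …, Ψ_{uu,p}`. -/
def psiUU {p : ℕ} (θ : Param k p) : Fin p → Matrix (Fin N) (Fin N) ℝ :=
  fun j => (θ.1 j).toBlocks₂₂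

/-- `Σ_uu`. -/
def sigmaUU {p : ℕ} (θ : Param k p) : Matrix (Fin N) (Fin N) ℝ := θ.2.toBlocks₂₂

/-- `Q_Z = E[Z_t Z_t']`. -/
def designMoment (t : ℤ) : Matrix (Coef k) (Coef k) ℝ :=
  Matrix.of fun a b => ∫ ω, ((design (x t ω)).transpose * design (x t ω)) a b ∂P

/-- `E[Z̃_t Σ_uu⁻¹ Z̃_t']` with `Z̃_t' = A(L) Z_t'`. -/
def filteredMoment {p : ℕ} (θ : Param k p) (t : ℤ) : Matrix (Coef k) (Coef k) ℝ :=
  Matrix.of fun a b => ∫ ω, ((filterDesign (psiUU θ) (fun s => x s ω) t).transpose *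
    (sigmaUU θ)⁻¹ * filterDesign (psiUU θ) (fun s => x s ω) t) a b ∂P

/-- The standing assumptions on a data-generating process with parameters `θ`: finite-predictor
exactness and the two full-rank conditions on the (transformed) regressors. -/
structure IsDGP {p : ℕ} (θ : Param k p) : Prop where
  finitePredictor : FinitePredictor P x u μ p
  hasParam : HasParam P x u μ θ
  designMoment_posDef : ∀ t, (designMoment P x t).PosDef
  filteredMoment_posDef : ∀ t, (filteredMoment P x θ t).PosDef

/-- Covariance-based strict exogeneity: `E[u_t x_s'] = 0` for all `t, s`. -/
def StrictlyExogenous : Prop := ∀ t s i c, ∫ ω, u t ω i * x s ω c ∂P = 0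

end DataGenerating

/-! ### Exogeneity classes, as restrictions on the parameters -/

/-- Block-diagonal dynamics and block-diagonal innovation covariance. -/
def BD {p : ℕ} (θ : Param k p) : Prop :=
  (∀ j, (θ.1 j).toBlocks₁₂ = 0 ∧ (θ.1 j).toBlocks₂₁ = 0) ∧
    θ.2.toBlocks₁₂ = 0 ∧ θ.2.toBlocks₂₁ = 0

/-- No feedback from `x` to `u`, block-diagonal innovation covariance. -/
def GEXOG {p : ℕ} (θ : Param k p) : Prop :=
  (∀ j, (θ.1 j).toBlocks₂₁ = 0) ∧ θ.2.toBlocks₁₂ = 0 ∧ θ.2.toBlocks₂₁ = 0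

/-- Block-diagonal innovation covariance. -/
def EBD {p : ℕ} (θ : Param k p) : Prop := θ.2.toBlocks₁₂ = 0 ∧ θ.2.toBlocks₂₁ = 0

/-- `det(I - ∑_j Ψ_j z^j) ≠ 0` for `|z| ≤ 1`, and `Σ` is positive definite. -/
def Admissible {p : ℕ} (θ : Param k p) : Prop :=
  (∀ z : ℂ, ‖z‖ ≤ 1 →
    (1 - ∑ j : Fin p, z ^ ((j : ℕ) + 1) • (θ.1 j).map Complex.ofReal).det ≠ 0) ∧ θ.2.PosDef

/-- Coordinates of the parameter space: the entries of `Ψ_1, …, Ψ_p` and of `Σ`. -/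
abbrev Coord (k : Fin N → ℕ) (p : ℕ) : Type :=
  (Fin p × Joint k × Joint k) ⊕ (Joint k × Joint k)

/-- The coordinates of `θ`. -/
def coords {p : ℕ} (θ : Param k p) : Coord k p → ℝ :=
  Sum.elim (fun q => θ.1 q.1 q.2.1 q.2.2) (fun q => θ.2 q.1 q.2)

/-- `Q` holds for generic parameters in `C`: at all points of `C` off the zero set of a polynomial
in the entries of `(Ψ, Σ)` whose non-zeros in `C` are dense in `C`. The classes `C` to which this
is applied are relatively open subsets of linear spaces of parameters, so that the exceptional
set is closed, nowhere dense and Lebesgue-null in `C`. -/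
def HoldsGenerically {p : ℕ} (C : Set (Param k p)) (Q : Param k p → Prop) : Prop :=
  ∃ f : MvPolynomial (Coord k p) ℝ,
    C ⊆ closure {θ | θ ∈ C ∧ MvPolynomial.eval (coords θ) f ≠ 0} ∧
    ∀ θ ∈ C, MvPolynomial.eval (coords θ) f ≠ 0 → Q θ

/-! ### Estimators on a process; population limits -/

section Limits

variable {Ω : Type*} [MeasurableSpace Ω] (P : Measure Ω)
  (x : ℤ → Ω → Reg k → ℝ) (u : ℤ → Ω → Fin N → ℝ) (κ : Coef k → ℝ)

/-- The path of `y` at `ω`. -/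
def yPath (ω : Ω) : ℤ → Fin N → ℝ := response κ (fun t => x t ω) (fun t => u t ω)

/-- The OLS estimator as a random vector. -/
def olsHat (T : ℕ) (ω : Ω) : Coef k → ℝ := ols (fun t => x t ω) (yPath x u κ ω) T

/-- The OLS residuals as a random path. -/
def uHat (T : ℕ) (ω : Ω) : ℤ → Fin N → ℝ := olsResidual (fun t => x t ω) (yPath x u κ ω) T

/-- The infeasible GLS estimator, which uses the true `Ψ_{uu,j}` and `Σ_uu`. -/
def glsHat {p : ℕ} (θ : Param k p) (T : ℕ) (ω : Ω) : Coef k → ℝ :=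
  gls (psiUU θ) (sigmaUU θ) (fun t => x t ω) (yPath x u κ ω) T

/-- The feasible CO-type estimator, with (possibly data-dependent) VAR order `phat`. -/
def coHat (phat : ℕ → Ω → ℕ) (T : ℕ) (ω : Ω) : Coef k → ℝ :=
  coEstimator (phat T ω) (fun t => x t ω) (yPath x u κ ω) T

/-- `phat` selects the order `p` consistently (for instance `phat` is constantly `p`). -/
def SelectsOrder (p : ℕ) (phat : ℕ → Ω → ℕ) : Prop :=
  (∀ T, Measurable (phat T)) ∧ Tendsto (fun T => P {ω | phat T ω ≠ p}) atTop (𝓝 0)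

/-- `T⁻¹ ∑_{t=1}^T ‖û_t - w_t‖²`, with the Euclidean norm. -/
def residualMSE (w : ℤ → Ω → Fin N → ℝ) (T : ℕ) (ω : Ω) : ℝ :=
  (T : ℝ)⁻¹ * ∑ t ∈ Finset.Icc (1 : ℤ) T, ∑ i, (uHat x u κ T ω t i - w t ω i) ^ 2

/-- The limit `u*_t = u_t - Z_t' b` of the OLS residuals. -/
def uStar (b : Coef k → ℝ) (t : ℤ) (ω : Ω) : Fin N → ℝ :=
  u t ω - Matrix.mulVec (design (x t ω)) b

/-- The pseudo-true values of the two-step procedure: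
* `b` solves the population normal equations `Q_Z b = E[Z_t u_t]`;
* `Φ` gives the population least-squares projection of `u*_t` on `u*_{t-1}, …, u*_{t-p}`;
* `S` is the covariance matrix of the projection error, and is positive definite;
* `κs` minimizes `E[(A*(L)(y_t - Z_t' κ'))' S⁻¹ (A*(L)(y_t - Z_t' κ'))]` over `κ'`, where
  `A*(L) = I - ∑_j Φ_j L^j`. -/
structure IsPseudoTrue {p : ℕ} (b : Coef k → ℝ) (Φ : Fin p → Matrix (Fin N) (Fin N) ℝ)
    (S : Matrix (Fin N) (Fin N) ℝ) (κs : Coef k → ℝ) : Prop where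
  bias : ∀ t c, Matrix.mulVec (designMoment P x t) b c =
    ∫ ω, Matrix.mulVec (design (x t ω)).transpose (u t ω) c ∂P
  filter : ∀ t, IsMinOn (fun Φ' : Fin p → Matrix (Fin N) (Fin N) ℝ =>
    ∫ ω, ∑ i, (filterVec Φ' (fun s => uStar x u b s ω) t i) ^ 2 ∂P) Set.univ Φ
  cov : ∀ t i j, S i j = ∫ ω, filterVec Φ (fun s => uStar x u b s ω) t i *
    filterVec Φ (fun s => uStar x u b s ω) t j ∂P
  cov_posDef : S.PosDef
  coef : ∀ t, IsMinOn (fun κ' : Coef k → ℝ =>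
    ∫ ω, dotProduct
      (filterVec Φ (fun s => yPath x u κ ω s - Matrix.mulVec (design (x s ω)) κ') t)
      (Matrix.mulVec S⁻¹
        (filterVec Φ (fun s => yPath x u κ ω s - Matrix.mulVec (design (x s ω)) κ') t)) ∂P)
    Set.univ κs

/-- The stochastic limits of the steps of the procedure, in probability: the OLS estimator tends
to `κ + b`, the OLS residuals to `u*`, the VAR filter and covariance fitted to the residuals to
`Φ` and `S`, and the CO-type estimator to `κs`. -/
structure ConvergesTo {p : ℕ} (b : Coef k → ℝ) (Φ : Fin p → Matrix (Fin N) (Fin N) ℝ)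
    (S : Matrix (Fin N) (Fin N) ℝ) (κs : Coef k → ℝ) : Prop where
  ols : TendstoInMeasure P (olsHat x u κ) atTop (fun _ => κ + b)
  residual : ∀ t, TendstoInMeasure P (fun T ω => uHat x u κ T ω t) atTop (uStar x u b t)
  residual_mse : TendstoInMeasure P (residualMSE x u κ (uStar x u b)) atTop (fun _ => 0)
  filter : ∀ j a c, TendstoInMeasure P (fun T ω => varFit p (uHat x u κ T ω) T j a c) atTop
    (fun _ => Φ j a c)
  cov : ∀ a c, TendstoInMeasure P (fun T ω => varFitCov p (uHat x u κ T ω) T a c) atTop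
    (fun _ => S a c)
  coef : ∀ phat, SelectsOrder P p phat →
    TendstoInMeasure P (coHat x u κ phat) atTop (fun _ => κs)

/-- Failure of the two-step procedure: the OLS estimator is inconsistent, the OLS residuals do not
recover the disturbances (neither at a fixed date nor in mean square over the sample), the
pseudo-true filter differs from the true one, and the CO-type estimator is inconsistent, with a
pseudo-true value different from `κ`. -/
structure Fails {p : ℕ} (θ : Param k p) : Prop where
  ols : ¬ TendstoInMeasure P (olsHat x u κ) atTop (fun _ => κ)
  residual : ∀ t, ¬ TendstoInMeasure P (fun T ω => uHat x u κ T ω t) atTop (u t)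
  residual_mse : ¬ TendstoInMeasure P (residualMSE x u κ u) atTop (fun _ => 0)
  pseudoTrue : ∀ b Φ S κs, IsPseudoTrue P x u κ (p := p) b Φ S κs →
    b ≠ 0 ∧ Φ ≠ psiUU θ ∧ κs ≠ κ
  coef : ∀ phat, SelectsOrder P p phat →
    ¬ TendstoInMeasure P (coHat x u κ phat) atTop (fun _ => κ)

/-- Good behaviour of the CO-type estimator: consistency, `√T`-equivalence to the infeasible GLS
estimator, and attainment of the GLS efficiency bound, that is, the limit laws of
`√T (κ̂ - κ)` for the two estimators coincide. -/
structure Efficient {p : ℕ} [IsProbabilityMeasure P] (θ : Param k p) (phat : ℕ → Ω → ℕ) :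
    Prop where
  consistent : TendstoInMeasure P (coHat x u κ phat) atTop (fun _ => κ)
  equivalent : TendstoInMeasure P
    (fun (T : ℕ) ω => √(T : ℝ) • (coHat x u κ phat T ω - glsHat x u κ θ T ω)) atTop (fun _ => 0)
  limit_law : ∀ (ν : Measure (Coef k → ℝ)) [IsProbabilityMeasure ν],
    TendstoInDistribution (fun (T : ℕ) ω => √(T : ℝ) • (glsHat x u κ θ T ω - κ)) atTop
      (id : (Coef k → ℝ) → (Coef k → ℝ)) (fun _ => P) ν ↔
    TendstoInDistribution (fun (T : ℕ) ω => √(T : ℝ) • (coHat x u κ phat T ω - κ)) atTop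
      (id : (Coef k → ℝ) → (Coef k → ℝ)) (fun _ => P) ν

end Limits

end CORegression

end

open CORegression MeasureTheory

/-! Everything is reduced to one finite matrix. Stack the constant and the centred vectors at lags
`0, …, p` into one vector. Up to the dates over which the sums run, OLS, the VAR fit and GLS are,
identically in the sample, functions of the second moments of this vector (`ols_eq`, `varFit_eq`,
`gls_eq`, `coEstimator_eq`), and these functions are continuous at the population matrix. All limits
in probability then follow from a law of large numbers for second moments and the nondegeneracy of
the population matrix.

For the law of large numbers, pure nondeterminism and the positive definite `Σ` force the powers of
the companion matrix to vanish (`IsVAR.tendsto_companion_pow`), hence geometrically, so that the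
process is a moving average of its innovations. Strong mixing with moments of order `4 + 2δ` bounds
sums of centred products of innovations by a multiple of `√T` in `L²`, with a constant linear in the
distance of the two lags (`IsMixingNoise.exists_integral_sq_sum_le`); geometric coefficients absorb
this growth (`exists_eLpNorm_sum_product_le`). For nondegeneracy, finitely many lags are linearly
independent, which makes the Gram matrices of OLS and of the VAR fit invertible. The GLS Gram matrix
also requires `det A*(1) ≠ 0`; this is a consequence of stationarity
(`IsPopMoment.filterAtOne_varFun_det_ne_zero`).

Inside `BD` the regressors and the disturbances are moving averages in two orthogonal sets of
innovations, so the population cross moment of GLS vanishes for every filter and every weight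
matrix. The error of GLS is therefore `T^{-1/2}` times `L²`-bounded scaled moment deviations, with
coefficients that depend continuously on filter, weight and Gram matrix. Estimating filter and
weight changes these coefficients by `o_p(1)`, which gives the `√T`-equivalence
(`FinitePredictor.tendsto_sqrt_sub`), and Slutsky's argument transfers limit laws.

Outside `BD`, the population moments solve a Lyapunov equation and are rational functions of `(Ψ,
Σ)`. Hence so is `discrepancy`, whose nonvanishing implies every form of failure
(`FinitePredictor.fails_of_discrepancy`), and its numerator is the required polynomial. A polynomial
that is nonzero at one point has finitely many zeros on any segment to that point. Since the
restrictions of `GEXOG` and `EBD` are linear, while admissibility and the complement of `BD` persist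
near the start of the segment, a single witness in `GEXOG ∖ BD` gives density in all three classes.
The witness has one regressor that responds to the lagged disturbance of its equation; it is
realized with independent signs as innovations, and its population values are explicit. -/

set_option linter.unusedSectionVars false
set_option linter.unusedDecidableInType false

noncomputable section

namespace CORegression

/-! ### Vector autoregressions in a Hilbert space -/

section HilbertVAR

open scoped InnerProductSpace

variable {E : Type*} [NormedAddCommGroup E] [InnerProductSpace ℝ E] {J : Type*} [Fintype J]
  [DecidableEq J] {p : ℕ}

/-- The closed linear span of the components of `z_s`, `s ≤ t`. -/
def closedPast (z : ℤ → J → E) (t : ℤ) : Submodule ℝ E :=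
  (Submodule.span ℝ {g | ∃ s ≤ t, ∃ a, g = z s a}).topologicalClosure

lemma mem_closedPast (z : ℤ → J → E) {s t : ℤ} (h : s ≤ t) (a : J) : z s a ∈ closedPast z t :=
  Submodule.le_topologicalClosure _ (Submodule.subset_span ⟨s, h, a, rfl⟩)

lemma closedPast_mono (z : ℤ → J → E) : Monotone (closedPast z) := fun _ _ h =>
  Submodule.topologicalClosure_mono (Submodule.span_mono fun _ ⟨r, hr, a, ha⟩ =>
    ⟨r, hr.trans h, a, ha⟩)

/-- The orthogonal complement of `e` is a closed subspace, so it contains the closed span once it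
contains the generators. -/
lemma inner_eq_zero_of_mem_closedPast {z : ℤ → J → E} {t : ℤ} {e g : E}
    (h : ∀ s ≤ t, ∀ a, ⟪e, z s a⟫_ℝ = 0) (hg : g ∈ closedPast z t) : ⟪e, g⟫_ℝ = 0 := by
  have hle : closedPast z t ≤ (Submodule.span ℝ {e})ᗮ := by
    refine Submodule.topologicalClosure_minimal _ (Submodule.span_le.2 ?_)
      (Submodule.isClosed_orthogonal _)
    rintro _ ⟨s, hs, a, rfl⟩
    exact (Submodule.mem_orthogonal_singleton_iff_inner_right).2 (h s hs a)
  exact (Submodule.mem_orthogonal_singleton_iff_inner_right).1 (hle hg)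

/-- A covariance-stationary, purely nondeterministic vector autoregression in a Hilbert space, with
its innovations. -/
structure IsVAR (Ψ : Fin p → Matrix J J ℝ) (S : Matrix J J ℝ) (z ε : ℤ → J → E) : Prop where
  eq : ∀ t a, z t a = ∑ j : Fin p, ∑ b, Ψ j a b • z (t - ((j : ℕ) + 1 : ℤ)) b + ε t a
  orth : ∀ t a s b, s < t → ⟪ε t a, z s b⟫_ℝ = 0
  cov : ∀ t a b, ⟪ε t a, ε t b⟫_ℝ = S a b
  pos : S.PosDef
  stat : ∀ s t h a b, ⟪z (t + h) a, z t b⟫_ℝ = ⟪z (s + h) a, z s b⟫_ℝ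
  pnd : ⨅ t, closedPast z t = ⊥

/-- The companion matrix of `I - ∑ Ψ_j L^j`, on the stacked vector `(z_t, …, z_{t-p+1})`. -/
def companion (Ψ : Fin p → Matrix J J ℝ) : Matrix (Fin p × J) (Fin p × J) ℝ :=
  Matrix.of fun r s => if (r.1 : ℕ) = 0 then Ψ s.1 r.2 s.2
    else if (r.1 : ℕ) = s.1 + 1 ∧ r.2 = s.2 then 1 else 0

namespace IsVAR

variable {Ψ : Fin p → Matrix J J ℝ} {S : Matrix J J ℝ} {z ε : ℤ → J → E}

lemma innovation_mem (h : IsVAR Ψ S z ε) (t : ℤ) (a : J) : ε t a ∈ closedPast z t := by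
  have : ε t a = z t a - ∑ j : Fin p, ∑ b, Ψ j a b • z (t - ((j : ℕ) + 1 : ℤ)) b := by
    rw [h.eq t a]; abel
  rw [this]
  refine Submodule.sub_mem _ (mem_closedPast z le_rfl a) (Submodule.sum_mem _ fun j _ =>
    Submodule.sum_mem _ fun b _ => Submodule.smul_mem _ _ (mem_closedPast z (by omega) b))

lemma inner_innovation_past (h : IsVAR Ψ S z ε) {s t : ℤ} (hst : s < t) (a : J) {g : E}
    (hg : g ∈ closedPast z s) : ⟪ε t a, g⟫_ℝ = 0 :=
  inner_eq_zero_of_mem_closedPast (fun r hr b => h.orth t a r b (by omega)) hg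

lemma inner_innovation_ne (h : IsVAR Ψ S z ε) {s t : ℤ} (hst : s ≠ t) (a b : J) :
    ⟪ε t a, ε s b⟫_ℝ = 0 := by
  rcases lt_or_gt_of_ne hst with h' | h'
  · exact h.inner_innovation_past h' a (h.innovation_mem s b)
  · rw [real_inner_comm]; exact h.inner_innovation_past h' b (h.innovation_mem t a)

lemma inner_innovation_self (h : IsVAR Ψ S z ε) (t : ℤ) (a b : J) : ⟪ε t b, z t a⟫_ℝ = S b a := by
  rw [h.eq t a, inner_add_right, h.cov, inner_sum, Finset.sum_eq_zero, zero_add]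
  intro j _
  rw [inner_sum, Finset.sum_eq_zero]
  intro c _
  rw [inner_smul_right, h.orth _ _ _ _ (by omega), mul_zero]

/-- One step of the state equation. -/
lemma state_eq (h : IsVAR Ψ S z ε) (t : ℤ) (r : Fin p × J) :
    z (t - (r.1 : ℕ)) r.2 = ∑ s, companion Ψ r s • z (t - 1 - (s.1 : ℕ)) s.2
      + if (r.1 : ℕ) = 0 then ε t r.2 else 0 := by
  obtain ⟨i, a⟩ := r
  rcases Nat.eq_zero_or_pos (i : ℕ) with hi | hi
  · simp only [companion, Matrix.of_apply, hi, if_true, Nat.cast_zero, sub_zero]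
    rw [h.eq t a, Fintype.sum_prod_type]
    congr 1
    refine Finset.sum_congr rfl fun j _ => Finset.sum_congr rfl fun b _ => ?_
    have : t - 1 - ((j : ℕ) : ℤ) = t - ((j : ℕ) + 1 : ℤ) := by ring
    rw [this]
  · have hne : ¬ (i : ℕ) = 0 := by omega
    simp only [companion, Matrix.of_apply, hne, if_false, add_zero]
    rw [Finset.sum_eq_single (⟨⟨i - 1, by omega⟩, a⟩ : Fin p × J)]
    · have : (i : ℕ) = (i : ℕ) - 1 + 1 := by omega
      rw [if_pos ⟨this, rfl⟩, one_smul]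
      congr 1
      push_cast [Nat.cast_sub hi]; ring
    · rintro ⟨j, b⟩ _ hjb
      rw [if_neg, zero_smul]
      rintro ⟨h1, h2⟩
      apply hjb
      ext
      · simp only at h1 ⊢; omega
      · exact h2.symm
    · simp

/-- `m` steps of the state equation. -/
lemma state_pow (h : IsVAR Ψ S z ε) (hp : 0 < p) (m : ℕ) (t : ℤ) (r : Fin p × J) :
    z (t - (r.1 : ℕ)) r.2 =
      ∑ n ∈ Finset.range m, ∑ b, (companion Ψ ^ n) r (⟨0, hp⟩, b) • ε (t - n) b
      + ∑ s, (companion Ψ ^ m) r s • z (t - m - (s.1 : ℕ)) s.2 := by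
  induction m with
  | zero => simp [Matrix.one_apply]
  | succ m ih =>
    rw [ih, Finset.sum_range_succ, add_assoc]
    congr 1
    have h1 : ∀ s : Fin p × J, (companion Ψ ^ m) r s • z (t - m - (s.1 : ℕ)) s.2
        = ∑ q, ((companion Ψ ^ m) r s * companion Ψ s q) • z (t - (m + 1 : ℕ) - (q.1 : ℕ)) q.2
          + if (s.1 : ℕ) = 0 then (companion Ψ ^ m) r s • ε (t - m) s.2 else 0 := by
      intro s
      conv_lhs => rw [h.state_eq (t - m) s]
      rw [smul_add, Finset.smul_sum]
      congr 1
      · refine Finset.sum_congr rfl fun q _ => ?_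
        rw [smul_smul]
        congr 2; push_cast; ring
      · split_ifs <;> simp
    rw [Finset.sum_congr rfl fun s _ => h1 s, Finset.sum_add_distrib, add_comm]
    congr 1
    · rw [Fintype.sum_prod_type, Finset.sum_eq_single (⟨0, hp⟩ : Fin p)]
      · simp
      · intro j _ hj
        have : ¬ (j : ℕ) = 0 := fun h0 => hj (Fin.ext h0)
        simp [this]
      · simp
    · rw [Finset.sum_comm]
      refine Finset.sum_congr rfl fun q _ => ?_
      rw [← Finset.sum_smul, pow_succ, Matrix.mul_apply]

variable [CompleteSpace E]

/-- The hypotheses say that `w n` is the projection of `x` on the past at `t - n`, so `x - w n` is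
its projection on the orthogonal complement. These complements increase, and their union is dense
because the pasts intersect in zero; hence `x - w n` tends to `x`. -/
lemma tendsto_starProjection_closedPast (hz : ⨅ t, closedPast z t = ⊥) (t : ℤ) (x : E)
    (w : ℕ → E) (hw : ∀ n : ℕ, w n ∈ closedPast z (t - n))
    (hxw : ∀ n : ℕ, ∀ g ∈ closedPast z (t - n), ⟪x - w n, g⟫_ℝ = 0) :
    Tendsto w atTop (𝓝 0) := by
  have hcl : ∀ n : ℕ, IsClosed (closedPast z (t - n) : Set E) := fun n =>
    Submodule.isClosed_topologicalClosure _
  have hcp : ∀ n : ℕ, CompleteSpace (closedPast z (t - n)) := fun n =>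
    (hcl n).completeSpace_coe
  have hUp : ∀ n : ℕ, (closedPast z (t - n)).HasOrthogonalProjection := fun n => inferInstance
  let U : ℕ → Submodule ℝ E := fun n => (closedPast z (t - n))ᗮ
  have hU : Monotone U := fun m n hmn =>
    Submodule.orthogonal_le (closedPast_mono z (by omega))
  have hUo : ∀ n, (U n).HasOrthogonalProjection := fun n => inferInstance
  have htop : ⊤ ≤ (⨆ n, U n).topologicalClosure := by
    rw [Submodule.topologicalClosure_eq_top_iff.2]
    rw [← Submodule.iInf_orthogonal U]
    have : ∀ n, (U n)ᗮ = closedPast z (t - n) := fun n =>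
      @Submodule.orthogonal_orthogonal ℝ E _ _ _ _ (hUp n)
    simp only [this]
    rw [eq_bot_iff, ← hz]
    refine le_iInf fun s => ?_
    exact (iInf_le _ (t - s).toNat).trans (closedPast_mono z (by omega))
  have key := Submodule.starProjection_tendsto_self U hU x htop
  have hpr : ∀ n, (U n).starProjection x = x - w n := by
    intro n
    refine Submodule.eq_starProjection_of_mem_of_inner_eq_zero (K := U n) ?_ ?_
    · rw [Submodule.mem_orthogonal']; exact hxw n
    · intro g hg
      rw [sub_sub_cancel]
      exact hg _ (hw n)
  simp only [hpr] at key
  have := key.const_sub x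
  simpa using this

lemma state_mem (z : ℤ → J → E) (m : ℕ) (t : ℤ) (M : Matrix (Fin p × J) (Fin p × J) ℝ)
    (r : Fin p × J) : ∑ s, M r s • z (t - m - (s.1 : ℕ)) s.2 ∈ closedPast z (t - m) :=
  Submodule.sum_mem _ fun s _ => Submodule.smul_mem _ _ (mem_closedPast z (by omega) _)

/-- After `m` steps the remainder lies in the past at `t - m`, and what has been split off consists
of later innovations, which are orthogonal to that past. -/
lemma tendsto_remainder (h : IsVAR Ψ S z ε) (hp : 0 < p) (t : ℤ) (r : Fin p × J) :
    Tendsto (fun m : ℕ => ∑ s, (companion Ψ ^ m) r s • z (t - m - (s.1 : ℕ)) s.2) atTop (𝓝 0) := by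
  refine tendsto_starProjection_closedPast h.pnd t (z (t - (r.1 : ℕ)) r.2) _
    (fun m => state_mem z m t _ r) fun m g hg => ?_
  rw [h.state_pow hp m t r, add_sub_cancel_right, sum_inner]
  refine Finset.sum_eq_zero fun n hn => ?_
  rw [sum_inner]
  refine Finset.sum_eq_zero fun b _ => ?_
  rw [inner_smul_left, h.inner_innovation_past _ b hg, mul_zero]
  have := Finset.mem_range.1 hn
  omega

/-- Stability is not assumed but deduced here. The covariance of the vanishing remainder with the
innovation at `-m`, whose norm does not depend on `m`, is the first block of `F ^ m` times `S`; an
invertible `S` can be removed. -/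
lemma tendsto_companion_pow_first (h : IsVAR Ψ S z ε) (hp : 0 < p) (r : Fin p × J) (b : J) :
    Tendsto (fun m : ℕ => (companion Ψ ^ m) r (⟨0, hp⟩, b)) atTop (𝓝 0) := by
  have key : ∀ b', Tendsto (fun m : ℕ => ∑ b, (companion Ψ ^ m) r (⟨0, hp⟩, b) * S b b') atTop
      (𝓝 0) := by
    intro b'
    -- Comparing the expansions with `m` and `m + 1` steps, the remainder is the term in the
    -- innovation at `-m` plus the next remainder, which is orthogonal to that innovation.
    have h1 : ∀ m : ℕ, ∑ b, (companion Ψ ^ m) r (⟨0, hp⟩, b) * S b b' =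
        ⟪∑ s, (companion Ψ ^ m) r s • z (0 - m - (s.1 : ℕ)) s.2, ε (0 - m) b'⟫_ℝ := by
      intro m
      have e1 := h.state_pow hp m 0 r
      have e2 := h.state_pow hp (m + 1) 0 r
      rw [e1, Finset.sum_range_succ, add_assoc] at e2
      rw [add_left_cancel e2, inner_add_left]
      have : ⟪∑ s, (companion Ψ ^ (m + 1)) r s • z (0 - (m + 1 : ℕ) - (s.1 : ℕ)) s.2,
          ε (0 - m) b'⟫_ℝ = 0 := by
        rw [real_inner_comm]
        exact h.inner_innovation_past (by push_cast; omega) b' (state_mem z (m + 1) 0 _ r)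
      rw [this, add_zero, sum_inner]
      refine Finset.sum_congr rfl fun b _ => ?_
      rw [inner_smul_left, h.cov]; rfl
    have h2 := h.tendsto_remainder hp 0 r
    rw [tendsto_zero_iff_norm_tendsto_zero] at h2
    have h3 := h2.mul_const (√(S b' b'))
    rw [zero_mul] at h3
    refine squeeze_zero_norm (fun m => ?_) h3
    rw [h1 m]
    refine (abs_real_inner_le_norm _ _).trans ?_
    rw [← h.cov (0 - m) b' b', real_inner_self_eq_norm_sq, Real.sqrt_sq (norm_nonneg _)]
  have hdet : IsUnit S.det := h.pos.isUnit.map Matrix.detMonoidHom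
  have h4 : ∀ m : ℕ, (companion Ψ ^ m) r (⟨0, hp⟩, b) =
      ∑ b', (∑ b, (companion Ψ ^ m) r (⟨0, hp⟩, b) * S b b') * S⁻¹ b' b := by
    intro m
    simp only [Finset.sum_mul, mul_assoc]
    rw [Finset.sum_comm]
    simp only [← Finset.mul_sum, ← Matrix.mul_apply, Matrix.mul_nonsing_inv S hdet,
      Matrix.one_apply]
    simp
  simp only [h4]
  have := tendsto_finsetSum Finset.univ fun b' (_ : b' ∈ Finset.univ) =>
    (key b').mul_const (S⁻¹ b' b)
  simpa using this

end IsVAR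

/-- If the powers of the companion matrix vanish on the first block, they vanish. -/
lemma tendsto_companion_pow (Ψ : Fin p → Matrix J J ℝ) (hp : 0 < p)
    (h : ∀ r b, Tendsto (fun m : ℕ => (companion Ψ ^ m) r (⟨0, hp⟩, b)) atTop (𝓝 0))
    (r s : Fin p × J) : Tendsto (fun m : ℕ => (companion Ψ ^ m) r s) atTop (𝓝 0) := by
  obtain ⟨⟨i, hi⟩, a⟩ := s
  induction i generalizing r a with
  | zero => exact h r a
  | succ i ih =>
    -- By the shift structure, column block `i` of `F ^ (m + 1)` is column block `i + 1` of `F ^ m`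
    -- plus block `0` of `F ^ m` times a coefficient matrix. Thus convergence passes from one block
    -- to the next.
    have key : ∀ m : ℕ, (companion Ψ ^ m) r (⟨i + 1, hi⟩, a) =
        (companion Ψ ^ (m + 1)) r (⟨i, by omega⟩, a) -
          ∑ b, (companion Ψ ^ m) r (⟨0, hp⟩, b) * Ψ ⟨i, by omega⟩ b a := by
      intro m
      rw [pow_succ, Matrix.mul_apply, eq_sub_iff_add_eq]
      have : ∀ q : Fin p × J, (companion Ψ ^ m) r q * companion Ψ q (⟨i, by omega⟩, a) =
          (if q = (⟨i + 1, hi⟩, a) then (companion Ψ ^ m) r q else 0) +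
          (if q.1 = ⟨0, hp⟩ then (companion Ψ ^ m) r q * Ψ ⟨i, by omega⟩ q.2 a else 0) := by
        rintro ⟨⟨j, hj⟩, b⟩
        simp only [companion, Matrix.of_apply, Prod.mk.injEq, Fin.mk.injEq]
        rcases Nat.eq_zero_or_pos j with h0 | h0
        · subst h0; simp
        · have : j ≠ 0 := by omega
          simp only [this, if_false, add_zero]
          split_ifs <;> simp
      rw [Finset.sum_congr rfl fun q _ => this q, Finset.sum_add_distrib]
      congr 1
      · simp
      · rw [Fintype.sum_prod_type, Finset.sum_eq_single (⟨0, hp⟩ : Fin p)]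
        · simp
        · intro j _ hj; simp [hj]
        · simp
    simp only [key]
    have h1 := (tendsto_add_atTop_iff_nat 1).2 (ih r a (by omega))
    have h2 := tendsto_finsetSum Finset.univ fun b (_ : b ∈ Finset.univ) =>
      (h r b).mul_const (Ψ ⟨i, by omega⟩ b a)
    simpa using h1.sub h2

lemma IsVAR.tendsto_companion_pow [CompleteSpace E] {Ψ : Fin p → Matrix J J ℝ} {S : Matrix J J ℝ}
    {z ε : ℤ → J → E} (h : IsVAR Ψ S z ε) (hp : 0 < p) (r s : Fin p × J) :
    Tendsto (fun m : ℕ => (companion Ψ ^ m) r s) atTop (𝓝 0) :=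
  CORegression.tendsto_companion_pow Ψ hp (h.tendsto_companion_pow_first hp) r s

/-- Powers of a matrix that tend to zero do so geometrically. -/
lemma exists_geometric_bound {R : Type*} [Fintype R] [DecidableEq R] (F : Matrix R R ℝ)
    (h : ∀ r s, Tendsto (fun m : ℕ => (F ^ m) r s) atTop (𝓝 0)) :
    ∃ K ρ : ℝ, 0 ≤ K ∧ 0 ≤ ρ ∧ ρ < 1 ∧ ∀ n r s, |(F ^ n) r s| ≤ K * ρ ^ n := by
  let _ : NormedRing (Matrix R R ℝ) := Matrix.linftyOpNormedRing
  have hle : ∀ (M : Matrix R R ℝ) r s, |M r s| ≤ ‖M‖ := by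
    intro M r s
    rw [Matrix.linfty_opNorm_def]
    have h1 : ‖M r s‖₊ ≤ ∑ j, ‖M r j‖₊ :=
      Finset.single_le_sum (f := fun j => ‖M r j‖₊) (fun _ _ => zero_le) (Finset.mem_univ s)
    have h2 := h1.trans (Finset.le_sup (f := fun i => ∑ j, ‖M i j‖₊) (Finset.mem_univ r))
    exact_mod_cast h2
  have hlim : Tendsto (fun m : ℕ => ‖F ^ m‖) atTop (𝓝 0) := by
    have : Tendsto (fun m : ℕ => F ^ m) atTop (𝓝 0) :=
      tendsto_pi_nhds.2 fun r => tendsto_pi_nhds.2 fun s => h r s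
    have h2 := tendsto_zero_iff_norm_tendsto_zero.1 this
    exact h2
  obtain ⟨n0, hn0⟩ := ((hlim.eventually (gt_mem_nhds (show (0 : ℝ) < 1 / 2 by norm_num))).and
    (eventually_gt_atTop 0)).exists
  obtain ⟨hF, hn0⟩ := hn0
  obtain ⟨B, hB⟩ := hlim.bddAbove_range
  have hB' : ∀ m, ‖F ^ m‖ ≤ B := fun m => hB ⟨m, rfl⟩
  have hB0 : 0 ≤ B := (norm_nonneg _).trans (hB' 0)
  -- Chosen so that `ρ ^ n0 = 1 / 2`, the bound on the norm of `F ^ n0`. The incomplete cycle `n %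
  -- n0` costs the bound `B` and a factor `ρ ^ (n % n0) ≥ 1 / 2`, whence the constant `2 * B`.
  set ρ : ℝ := (1 / 2 : ℝ) ^ ((1 : ℝ) / n0) with hρ
  have hρ0 : 0 < ρ := Real.rpow_pos_of_pos (by norm_num) _
  have hρ1 : ρ < 1 := Real.rpow_lt_one (by norm_num) (by norm_num) (by positivity)
  have hρn : ρ ^ n0 = 1 / 2 := by
    rw [hρ, ← Real.rpow_natCast, ← Real.rpow_mul (by norm_num)]
    have : (n0 : ℝ) ≠ 0 := by positivity
    rw [one_div_mul_cancel this, Real.rpow_one]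
  refine ⟨2 * B, ρ, by positivity, hρ0.le, hρ1, fun n r s => (hle _ r s).trans ?_⟩
  have hq : ∀ q m, ‖F ^ (n0 * q + m)‖ ≤ (1 / 2) ^ q * B := by
    intro q m
    induction q with
    | zero => simpa using hB' m
    | succ q ih =>
      have : F ^ (n0 * (q + 1) + m) = F ^ n0 * F ^ (n0 * q + m) := by rw [← pow_add]; congr 1; ring
      rw [this, pow_succ']
      calc _ ≤ ‖F ^ n0‖ * ‖F ^ (n0 * q + m)‖ := norm_mul_le _ _
        _ ≤ (1 / 2) * ((1 / 2) ^ q * B) := by gcongr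
        _ = _ := by ring
  have h1 := hq (n / n0) (n % n0)
  rw [Nat.div_add_mod] at h1
  refine h1.trans ?_
  have h2 : ρ ^ n = (1 / 2) ^ (n / n0) * ρ ^ (n % n0) := by
    conv_lhs => rw [← Nat.div_add_mod n n0, pow_add, pow_mul, hρn]
  have h3 : 1 / 2 ≤ ρ ^ (n % n0) := by
    rw [← hρn]
    exact pow_le_pow_of_le_one hρ0.le hρ1.le (Nat.mod_lt _ hn0).le
  rw [h2]
  have h4 : (0 : ℝ) ≤ (1 / 2) ^ (n / n0) * B := by positivity
  nlinarith [mul_le_mul_of_nonneg_left h3 h4]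

namespace IsVAR

variable {Ψ : Fin p → Matrix J J ℝ} {S : Matrix J J ℝ} {z ε : ℤ → J → E}

/-- The coefficients of the moving-average representation. -/
def maCoeff (Ψ : Fin p → Matrix J J ℝ) (hp : 0 < p) (n : ℕ) (a b : J) : ℝ :=
  (companion Ψ ^ n) (⟨0, hp⟩, a) (⟨0, hp⟩, b)

lemma hasMA [CompleteSpace E] (h : IsVAR Ψ S z ε) (hp : 0 < p) (t : ℤ) (a : J) :
    Tendsto (fun m : ℕ => ∑ n ∈ Finset.range m, ∑ b, maCoeff Ψ hp n a b • ε (t - n) b) atTop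
      (𝓝 (z t a)) := by
  have h1 := h.tendsto_remainder hp t (⟨0, hp⟩, a)
  have h2 := h1.const_sub (z t a)
  rw [sub_zero] at h2
  refine h2.congr fun m => ?_
  have h3 := h.state_pow hp m t (⟨0, hp⟩, a)
  simp only [Nat.cast_zero, sub_zero] at h3
  rw [sub_eq_iff_eq_add]
  exact h3

/-- The components of finitely many lags of a nondegenerate autoregression are linearly
independent. -/
lemma eq_zero_of_lag_combination (h : IsVAR Ψ S z ε) (m : ℕ) (t : ℤ) (α : Fin m × J → ℝ)
    (hα : ∑ q, α q • z (t - (q.1 : ℕ)) q.2 = 0) : α = 0 := by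
  have key : ∀ i : ℕ, ∀ hi : i < m, ∀ a, α (⟨i, hi⟩, a) = 0 := by
    intro i
    induction i using Nat.strong_induction_on with
    | _ i ih =>
      intro hi
      -- Pair the relation with the innovation at `t - i`. The coefficients of later dates vanish by
      -- induction, and earlier dates are orthogonal to this innovation.
      have h1 : ∀ b, ∑ a, α (⟨i, hi⟩, a) * S b a = 0 := by
        intro b
        have h2 := congrArg (fun g => ⟪ε (t - i) b, g⟫_ℝ) hα
        simp only [inner_sum, inner_smul_right, inner_zero_right] at h2
        rw [Fintype.sum_prod_type, Finset.sum_eq_single (⟨i, hi⟩ : Fin m)] at h2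
        · simpa only [h.inner_innovation_self] using h2
        · rintro ⟨j, hj⟩ _ hji
          refine Finset.sum_eq_zero fun a _ => ?_
          rcases lt_trichotomy j i with hlt | heq | hgt
          · rw [ih j hlt hj a, zero_mul]
          · exact absurd (Fin.ext heq) hji
          · rw [h.orth _ _ _ _ (by simpa using hgt), mul_zero]
        · simp
      have h3 : S.mulVec (fun a => α (⟨i, hi⟩, a)) = 0 := by
        ext b
        simp only [Matrix.mulVec, dotProduct, Pi.zero_apply]
        rw [← h1 b]
        exact Finset.sum_congr rfl fun a _ => mul_comm _ _
      have hdet : IsUnit S.det := h.pos.isUnit.map Matrix.detMonoidHom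
      have h4 := congrArg (Matrix.mulVec S⁻¹) h3
      rw [Matrix.mulVec_mulVec, Matrix.nonsing_inv_mul S hdet, Matrix.one_mulVec,
        Matrix.mulVec_zero] at h4
      exact fun a => congrFun h4 a
  ext ⟨⟨i, hi⟩, a⟩
  exact key i hi a

end IsVAR

end HilbertVAR

/-! ### Covariance inequalities under strong mixing -/

section Mixing

variable {Ω : Type*} {𝒜 ℬ : MeasurableSpace Ω} [mΩ : MeasurableSpace Ω] {P : Measure Ω} [IsProbabilityMeasure P]

/-- A layer-cake formula: the integer part counts the levels `1, …, n` that do not exceed `y * n`.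
-/
lemma natFloor_eq_sum_indicator (n : ℕ) {y : ℝ} (hy1 : y ≤ 1) :
    (⌊y * n⌋₊ : ℝ) = ∑ i ∈ Finset.range n, if ((i + 1 : ℕ) : ℝ) ≤ y * n then (1 : ℝ) else 0 := by
  rw [Finset.sum_boole]
  congr 1
  have hle : ⌊y * n⌋₊ ≤ n := by
    apply Nat.floor_le_of_le
    nlinarith [(Nat.cast_nonneg n : (0 : ℝ) ≤ n)]
  have : {i ∈ Finset.range n | ((i + 1 : ℕ) : ℝ) ≤ y * n} = Finset.range ⌊y * n⌋₊ := by
    ext i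
    simp only [Finset.mem_filter, Finset.mem_range]
    constructor
    · rintro ⟨_, h⟩
      have := Nat.le_floor h
      omega
    · intro h
      exact ⟨by omega, (Nat.le_floor_iff' (by omega)).1 (by omega)⟩
  rw [this, Finset.card_range]

/-- Rounded down to multiples of `1 / n`, each variable is an average of `n` indicators of its level
sets. The covariance of the roundings is an average of `n²` quantities bounded by `α`; then `n → ∞`
by dominated convergence. -/
lemma abs_cov_unitInterval_le (hA : 𝒜 ≤ mΩ) (hB : ℬ ≤ mΩ) {α : ℝ}
    (hα : ∀ A B : Set Ω, MeasurableSet[𝒜] A → MeasurableSet[ℬ] B →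
      |P.real (A ∩ B) - P.real A * P.real B| ≤ α)
    {X Y : Ω → ℝ} (hX : Measurable[𝒜] X) (hY : Measurable[ℬ] Y)
    (hX0 : ∀ ω, 0 ≤ X ω) (hX1 : ∀ ω, X ω ≤ 1) (hY0 : ∀ ω, 0 ≤ Y ω) (hY1 : ∀ ω, Y ω ≤ 1) :
    |∫ ω, X ω * Y ω ∂P - (∫ ω, X ω ∂P) * ∫ ω, Y ω ∂P| ≤ α := by
  have happ : ∀ {Z : Ω → ℝ}, (∀ ω, 0 ≤ Z ω) → ∀ ω,
      Tendsto (fun n : ℕ => (⌊Z ω * n⌋₊ : ℝ) / n) atTop (𝓝 (Z ω)) := fun h ω =>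
    (tendsto_nat_floor_mul_div_atTop (h ω)).comp tendsto_natCast_atTop_atTop
  have hbd : ∀ {Z : Ω → ℝ}, (∀ ω, 0 ≤ Z ω) → (∀ ω, Z ω ≤ 1) → ∀ n : ℕ, ∀ ω,
      0 ≤ (⌊Z ω * n⌋₊ : ℝ) / n ∧ (⌊Z ω * n⌋₊ : ℝ) / n ≤ 1 := by
    intro Z h0 h1 n ω
    refine ⟨by positivity, div_le_one_of_le₀ ?_ (by positivity)⟩
    have := Nat.floor_le (show 0 ≤ Z ω * n from mul_nonneg (h0 ω) (by positivity))
    nlinarith [h1 ω, (Nat.cast_nonneg n : (0 : ℝ) ≤ n)]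
  have hm : ∀ {Z : Ω → ℝ}, Measurable Z → ∀ n : ℕ,
      Measurable fun ω => (⌊Z ω * n⌋₊ : ℝ) / n := by
    intro Z hZ n
    have : Measurable fun ω => ⌊Z ω * n⌋₊ := Nat.measurable_floor.comp (hZ.mul_const _)
    exact (measurable_from_top.comp this).div_const _
  have hXm := hX.mono hA le_rfl
  have hYm := hY.mono hB le_rfl
  have lim1 : Tendsto (fun n : ℕ => ∫ ω, (⌊X ω * n⌋₊ : ℝ) / n * ((⌊Y ω * n⌋₊ : ℝ) / n) ∂P) atTop
      (𝓝 (∫ ω, X ω * Y ω ∂P)) := by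
    refine tendsto_integral_of_dominated_convergence (fun _ => 1)
      (fun n => ((hm hXm n).mul (hm hYm n)).aestronglyMeasurable) (integrable_const _)
      (fun n => ae_of_all _ fun ω => ?_) (ae_of_all _ fun ω => (happ hX0 ω).mul (happ hY0 ω))
    have h1 := hbd hX0 hX1 n ω
    have h2 := hbd hY0 hY1 n ω
    rw [Real.norm_eq_abs, abs_of_nonneg (mul_nonneg h1.1 h2.1)]
    exact mul_le_one₀ h1.2 h2.1 h2.2
  have lim2 : ∀ {Z : Ω → ℝ}, Measurable Z → (∀ ω, 0 ≤ Z ω) → (∀ ω, Z ω ≤ 1) →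
      Tendsto (fun n : ℕ => ∫ ω, (⌊Z ω * n⌋₊ : ℝ) / n ∂P) atTop (𝓝 (∫ ω, Z ω ∂P)) := by
    intro Z hZ h0 h1
    refine tendsto_integral_of_dominated_convergence (fun _ => 1)
      (fun n => (hm hZ n).aestronglyMeasurable) (integrable_const _)
      (fun n => ae_of_all _ fun ω => ?_) (ae_of_all _ fun ω => happ h0 ω)
    have h := hbd h0 h1 n ω
    rw [Real.norm_eq_abs, abs_of_nonneg h.1]
    exact h.2
  have lim := (lim1.sub ((lim2 hXm hX0 hX1).mul (lim2 hYm hY0 hY1))).abs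
  refine le_of_tendsto lim (eventually_atTop.2 ⟨1, fun n hn => ?_⟩)
  have hn0 : (0 : ℝ) < n := by exact_mod_cast hn
  let A : ℕ → Set Ω := fun i => {ω | ((i + 1 : ℕ) : ℝ) ≤ X ω * n}
  let B : ℕ → Set Ω := fun i => {ω | ((i + 1 : ℕ) : ℝ) ≤ Y ω * n}
  have hAm : ∀ i, MeasurableSet[𝒜] (A i) := fun i =>
    hX (t := {y | ((i + 1 : ℕ) : ℝ) ≤ y * n})
      (measurableSet_le measurable_const (measurable_id.mul_const _))
  have hBm : ∀ i, MeasurableSet[ℬ] (B i) := fun i =>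
    hY (t := {y | ((i + 1 : ℕ) : ℝ) ≤ y * n})
      (measurableSet_le measurable_const (measurable_id.mul_const _))
  have eX : ∀ ω, (⌊X ω * n⌋₊ : ℝ) / n = ∑ i ∈ Finset.range n, (n : ℝ)⁻¹ * (A i).indicator 1 ω := by
    intro ω
    rw [natFloor_eq_sum_indicator n (hX1 ω), div_eq_inv_mul, Finset.mul_sum]
    simp [A, Set.indicator_apply]
  have eY : ∀ ω, (⌊Y ω * n⌋₊ : ℝ) / n = ∑ i ∈ Finset.range n, (n : ℝ)⁻¹ * (B i).indicator 1 ω := by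
    intro ω
    rw [natFloor_eq_sum_indicator n (hY1 ω), div_eq_inv_mul, Finset.mul_sum]
    simp [B, Set.indicator_apply]
  have int1 : ∀ {S : Set Ω}, MeasurableSet S → Integrable (S.indicator (1 : Ω → ℝ)) P :=
    fun hS => (integrable_const (1 : ℝ)).indicator hS
  have e1 : ∫ ω, (⌊X ω * n⌋₊ : ℝ) / n ∂P = ∑ i ∈ Finset.range n, (n : ℝ)⁻¹ * P.real (A i) := by
    simp only [eX]
    rw [integral_finsetSum _ fun i _ => (int1 (hA _ (hAm i))).const_mul _]
    refine Finset.sum_congr rfl fun i _ => ?_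
    rw [integral_const_mul, integral_indicator_one (hA _ (hAm i))]
  have e2 : ∫ ω, (⌊Y ω * n⌋₊ : ℝ) / n ∂P = ∑ i ∈ Finset.range n, (n : ℝ)⁻¹ * P.real (B i) := by
    simp only [eY]
    rw [integral_finsetSum _ fun i _ => (int1 (hB _ (hBm i))).const_mul _]
    refine Finset.sum_congr rfl fun i _ => ?_
    rw [integral_const_mul, integral_indicator_one (hB _ (hBm i))]
  have e3 : ∫ ω, (⌊X ω * n⌋₊ : ℝ) / n * ((⌊Y ω * n⌋₊ : ℝ) / n) ∂P =
      ∑ i ∈ Finset.range n, ∑ j ∈ Finset.range n, ((n : ℝ)⁻¹ * (n : ℝ)⁻¹) * P.real (A i ∩ B j) := by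
    have : ∀ ω, (⌊X ω * n⌋₊ : ℝ) / n * ((⌊Y ω * n⌋₊ : ℝ) / n) =
        ∑ i ∈ Finset.range n, ∑ j ∈ Finset.range n,
          ((n : ℝ)⁻¹ * (n : ℝ)⁻¹) * (A i ∩ B j).indicator (1 : Ω → ℝ) ω := by
      intro ω
      rw [eX, eY, Finset.sum_mul_sum]
      refine Finset.sum_congr rfl fun i _ => Finset.sum_congr rfl fun j _ => ?_
      rw [Set.inter_indicator_one, Pi.mul_apply]; ring
    simp only [this]
    have hAB : ∀ i j, MeasurableSet (A i ∩ B j) := fun i j => (hA _ (hAm i)).inter (hB _ (hBm j))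
    rw [integral_finsetSum _ fun i _ => integrable_finsetSum _ fun j _ =>
      (int1 (hAB i j)).const_mul _]
    refine Finset.sum_congr rfl fun i _ => ?_
    rw [integral_finsetSum _ fun j _ => (int1 (hAB i j)).const_mul _]
    refine Finset.sum_congr rfl fun j _ => ?_
    rw [integral_const_mul, integral_indicator_one (hAB i j)]
  rw [e1, e2, e3, Finset.sum_mul_sum, ← Finset.sum_sub_distrib]
  have hb : ∀ i ∈ Finset.range n, |(∑ j ∈ Finset.range n, ((n : ℝ)⁻¹ * (n : ℝ)⁻¹) * P.real (A i ∩ B j))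
      - ∑ j ∈ Finset.range n, (n : ℝ)⁻¹ * P.real (A i) * ((n : ℝ)⁻¹ * P.real (B j))|
      ≤ (n : ℝ)⁻¹ * α := by
    intro i _
    rw [← Finset.sum_sub_distrib]
    refine (Finset.abs_sum_le_sum_abs _ _).trans ?_
    calc _ ≤ ∑ j ∈ Finset.range n, ((n : ℝ)⁻¹ * (n : ℝ)⁻¹) * α := by
          refine Finset.sum_le_sum fun j _ => ?_
          have : (n : ℝ)⁻¹ * (n : ℝ)⁻¹ * P.real (A i ∩ B j) -
              (n : ℝ)⁻¹ * P.real (A i) * ((n : ℝ)⁻¹ * P.real (B j)) =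
              ((n : ℝ)⁻¹ * (n : ℝ)⁻¹) * (P.real (A i ∩ B j) - P.real (A i) * P.real (B j)) := by ring
          rw [this, abs_mul, abs_of_nonneg (by positivity)]
          exact mul_le_mul_of_nonneg_left (hα _ _ (hAm i) (hBm j)) (by positivity)
      _ = _ := by
          rw [Finset.sum_const, Finset.card_range, nsmul_eq_mul]
          field_simp
  refine (Finset.abs_sum_le_sum_abs _ _).trans ((Finset.sum_le_sum hb).trans ?_)
  rw [Finset.sum_const, Finset.card_range, nsmul_eq_mul, ← mul_assoc, mul_inv_cancel₀ hn0.ne',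
    one_mul]

/-- The affine map that takes `[-M, M]` to `[0, 1]` divides the covariance by `4 * M ^ 2`. -/
lemma abs_cov_bounded_le (hA : 𝒜 ≤ mΩ) (hB : ℬ ≤ mΩ) {α M : ℝ}
    (hM : 0 < M)
    (hα : ∀ A B : Set Ω, MeasurableSet[𝒜] A → MeasurableSet[ℬ] B →
      |P.real (A ∩ B) - P.real A * P.real B| ≤ α)
    {X Y : Ω → ℝ} (hX : Measurable[𝒜] X) (hY : Measurable[ℬ] Y)
    (hXM : ∀ ω, |X ω| ≤ M) (hYM : ∀ ω, |Y ω| ≤ M) :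
    |∫ ω, X ω * Y ω ∂P - (∫ ω, X ω ∂P) * ∫ ω, Y ω ∂P| ≤ 4 * M ^ 2 * α := by
  have hiX : Integrable X P := Integrable.of_bound (hX.mono hA le_rfl).aestronglyMeasurable M
    (ae_of_all _ hXM)
  have hiY : Integrable Y P := Integrable.of_bound (hY.mono hB le_rfl).aestronglyMeasurable M
    (ae_of_all _ hYM)
  have hiXY : Integrable (fun ω => X ω * Y ω) P := hiX.mul_bdd (c := M)
    (hY.mono hB le_rfl).aestronglyMeasurable (ae_of_all _ hYM)
  have h := abs_cov_unitInterval_le (P := P) hA hB hα (X := fun ω => (X ω + M) / (2 * M))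
    (Y := fun ω => (Y ω + M) / (2 * M)) ((hX.add_const _).div_const _)
    ((hY.add_const _).div_const _)
    (fun ω => div_nonneg (by linarith [(abs_le.1 (hXM ω)).1]) (by positivity))
    (fun ω => div_le_one_of_le₀ (by linarith [(abs_le.1 (hXM ω)).2]) (by positivity))
    (fun ω => div_nonneg (by linarith [(abs_le.1 (hYM ω)).1]) (by positivity))
    (fun ω => div_le_one_of_le₀ (by linarith [(abs_le.1 (hYM ω)).2]) (by positivity))
  have e : ∀ ω, (X ω + M) / (2 * M) * ((Y ω + M) / (2 * M)) =
      (X ω * Y ω + (M * X ω + (M * Y ω + M * M))) / (4 * M ^ 2) := by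
    intro ω; field_simp; ring
  simp only [e] at h
  rw [integral_div, integral_div, integral_div, integral_add hiXY, integral_add (hiX.const_mul _),
    integral_add (hiY.const_mul _) (integrable_const _), integral_add hiX (integrable_const _),
    integral_add hiY (integrable_const _), integral_const_mul, integral_const_mul] at h
  · simp only [integral_const, probReal_univ, smul_eq_mul, one_mul] at h
    have e2 : ∫ ω, X ω * Y ω ∂P - (∫ ω, X ω ∂P) * ∫ ω, Y ω ∂P = 4 * M ^ 2 *
        ((∫ ω, X ω * Y ω ∂P + (M * ∫ ω, X ω ∂P + (M * ∫ ω, Y ω ∂P + M * M))) / (4 * M ^ 2) -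
          (∫ ω, X ω ∂P + M) / (2 * M) * ((∫ ω, Y ω ∂P + M) / (2 * M))) := by
      field_simp; ring
    rw [e2, abs_mul, abs_of_nonneg (by positivity)]
    exact mul_le_mul_of_nonneg_left h (by positivity)
  · exact (hiY.const_mul _).add (integrable_const _)
  · exact (hiX.const_mul _).add ((hiY.const_mul _).add (integrable_const _))

/-- Truncation at level `M`. -/
def clip (M x : ℝ) : ℝ := max (-M) (min x M)

lemma measurable_clip (M : ℝ) : Measurable (clip M) := by unfold clip; fun_prop

lemma abs_clip_le {M : ℝ} (hM : 0 < M) (x : ℝ) : |clip M x| ≤ M := by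
  unfold clip
  rw [abs_le]
  exact ⟨le_max_left _ _, max_le (by linarith) (min_le_right _ _)⟩

lemma abs_clip_le_abs {M : ℝ} (hM : 0 < M) (x : ℝ) : |clip M x| ≤ |x| := by
  unfold clip
  rcases max_cases (-M) (min x M) with h | h <;> rcases min_cases x M with h' | h' <;>
    rcases abs_cases x with h'' | h'' <;> rw [abs_le] <;> constructor <;> linarith

lemma clip_eq {M x : ℝ} (h : |x| ≤ M) : clip M x = x := by
  unfold clip
  rw [min_eq_left (abs_le.1 h).2, max_eq_right (abs_le.1 h).1]

lemma abs_sub_clip_le {M : ℝ} (hM : 0 < M) (x : ℝ) : |x - clip M x| ≤ |x| := by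
  unfold clip
  rcases max_cases (-M) (min x M) with h | h <;> rcases min_cases x M with h' | h' <;>
    rcases abs_cases x with h'' | h'' <;> rw [abs_le] <;> constructor <;> linarith

lemma sq_le_rpow_div {M δ x : ℝ} (hM : 0 < M) (hδ : 0 < δ) (hx : M ≤ |x|) :
    |x| ^ 2 ≤ |x| ^ (2 + δ) * M ^ (-δ) := by
  have hx0 : 0 < |x| := hM.trans_le hx
  have h1 : |x| ^ 2 = |x| ^ (2 + δ) * |x| ^ (-δ) := by
    rw [← Real.rpow_add hx0, ← Real.rpow_natCast]; congr 1; push_cast; ring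
  rw [h1]
  exact mul_le_mul_of_nonneg_left (Real.rpow_le_rpow_of_nonpos hM hx (by linarith)) (by positivity)

/-- Only `|x| > M` contributes. Then the larger of `|x|` and `|y|` exceeds `M`, and its square is at
most its power `2 + δ` times `M ^ (-δ)`. -/
lemma abs_sub_clip_mul_le {M δ : ℝ} (hM : 0 < M) (hδ : 0 < δ) (x y : ℝ) :
    |x - clip M x| * |y| ≤ (|x| ^ (2 + δ) + |y| ^ (2 + δ)) * M ^ (-δ) := by
  have hp1 : 0 ≤ |x| ^ (2 + δ) := by positivity
  have hp2 : 0 ≤ |y| ^ (2 + δ) := by positivity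
  have hp3 : 0 ≤ M ^ (-δ) := by positivity
  rcases le_or_gt |x| M with h | h
  · rw [clip_eq h, sub_self, abs_zero, zero_mul]; positivity
  · have h1 := abs_sub_clip_le hM x
    rcases le_or_gt |y| |x| with h2 | h2
    · have := sq_le_rpow_div hM hδ h.le
      have h4 := mul_le_mul h1 h2 (abs_nonneg y) (abs_nonneg x)
      nlinarith [mul_nonneg hp2 hp3]
    · have := sq_le_rpow_div hM hδ (h.trans h2).le
      have h4 := mul_le_mul (h1.trans h2.le) (le_refl |y|) (abs_nonneg y) (abs_nonneg y)
      nlinarith [mul_nonneg hp1 hp3]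

lemma abs_mul_sub_clip_mul_clip_le {M δ : ℝ} (hM : 0 < M) (hδ : 0 < δ) (x y : ℝ) :
    |x * y - clip M x * clip M y| ≤ 2 * M ^ (-δ) * (|x| ^ (2 + δ) + |y| ^ (2 + δ)) := by
  have e : x * y - clip M x * clip M y = (x - clip M x) * y + (y - clip M y) * clip M x := by ring
  rw [e]
  refine (abs_add_le _ _).trans ?_
  rw [abs_mul, abs_mul]
  have h1 := abs_sub_clip_mul_le hM hδ x y
  have h2 := abs_sub_clip_mul_le hM hδ y x
  have h3 := mul_le_mul_of_nonneg_left (abs_clip_le_abs hM x) (abs_nonneg (y - clip M y))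
  linarith

/-- Covariance inequality for strongly mixing σ-algebras, with a free truncation level. -/
lemma abs_cov_le_of_moment (hA : 𝒜 ≤ mΩ) (hB : ℬ ≤ mΩ) {α M δ C : ℝ}
    (hM : 0 < M) (hδ : 0 < δ)
    (hα : ∀ A B : Set Ω, MeasurableSet[𝒜] A → MeasurableSet[ℬ] B →
      |P.real (A ∩ B) - P.real A * P.real B| ≤ α)
    {X Y : Ω → ℝ} (hX : Measurable[𝒜] X) (hY : Measurable[ℬ] Y)
    (iX : Integrable X P) (iY : Integrable Y P) (iXY : Integrable (fun ω => X ω * Y ω) P)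
    (mX : Integrable (fun ω => |X ω| ^ (2 + δ)) P) (mY : Integrable (fun ω => |Y ω| ^ (2 + δ)) P)
    (hCX : ∫ ω, |X ω| ^ (2 + δ) ∂P ≤ C) (hCY : ∫ ω, |Y ω| ^ (2 + δ) ∂P ≤ C) :
    |∫ ω, X ω * Y ω ∂P - (∫ ω, X ω ∂P) * ∫ ω, Y ω ∂P| ≤ 4 * M ^ 2 * α + 8 * C * M ^ (-δ) := by
  have hXm := hX.mono hA le_rfl
  have hYm := hY.mono hB le_rfl
  have key := abs_cov_bounded_le (P := P) hA hB hM hα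
    ((measurable_clip M).comp hX) ((measurable_clip M).comp hY)
    (fun ω => abs_clip_le hM (X ω)) (fun ω => abs_clip_le hM (Y ω))
  simp only [Function.comp_apply] at key
  have icX : Integrable (fun ω => clip M (X ω)) P :=
    Integrable.of_bound ((measurable_clip M).comp hXm).aestronglyMeasurable M
      (ae_of_all _ fun ω => abs_clip_le hM _)
  have icY : Integrable (fun ω => clip M (Y ω)) P :=
    Integrable.of_bound ((measurable_clip M).comp hYm).aestronglyMeasurable M
      (ae_of_all _ fun ω => abs_clip_le hM _)
  have icXY : Integrable (fun ω => clip M (X ω) * clip M (Y ω)) P :=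
    icX.mul_bdd (c := M) ((measurable_clip M).comp hYm).aestronglyMeasurable
      (ae_of_all _ fun ω => abs_clip_le hM _)
  have hMδ : 0 ≤ M ^ (-δ) := by positivity
  have b1 : |∫ ω, X ω * Y ω ∂P - ∫ ω, clip M (X ω) * clip M (Y ω) ∂P| ≤ 4 * C * M ^ (-δ) := by
    rw [← integral_sub iXY icXY]
    refine abs_integral_le_integral_abs.trans ?_
    calc _ ≤ ∫ ω, 2 * M ^ (-δ) * (|X ω| ^ (2 + δ) + |Y ω| ^ (2 + δ)) ∂P :=
          integral_mono (iXY.sub icXY).abs ((mX.add mY).const_mul _)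
            fun ω => abs_mul_sub_clip_mul_clip_le hM hδ _ _
      _ ≤ _ := by
          rw [integral_const_mul, integral_add mX mY]
          nlinarith
  have b2 : |(∫ ω, X ω ∂P) * ∫ ω, Y ω ∂P - (∫ ω, clip M (X ω) ∂P) * ∫ ω, clip M (Y ω) ∂P|
      ≤ 4 * C * M ^ (-δ) := by
    -- A product of expectations is the expectation of a product of independent copies, so the
    -- pointwise truncation bound applies on the product space too.
    rw [← integral_prod_mul, ← integral_prod_mul,
      ← integral_sub (iX.mul_prod iY) (icX.mul_prod icY)]
    refine abs_integral_le_integral_abs.trans ?_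
    have m1 : Integrable (fun z : Ω × Ω => |X z.1| ^ (2 + δ)) (P.prod P) := mX.comp_fst P
    have m2 : Integrable (fun z : Ω × Ω => |Y z.2| ^ (2 + δ)) (P.prod P) := mY.comp_snd P
    calc _ ≤ ∫ z : Ω × Ω, 2 * M ^ (-δ) * (|X z.1| ^ (2 + δ) + |Y z.2| ^ (2 + δ)) ∂(P.prod P) :=
          integral_mono ((iX.mul_prod iY).sub (icX.mul_prod icY)).abs ((m1.add m2).const_mul _)
            fun z => abs_mul_sub_clip_mul_clip_le hM hδ _ _
      _ ≤ _ := by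
          rw [integral_const_mul, integral_add m1 m2,
            integral_fun_fst (μ := P) (ν := P) (fun ω => |X ω| ^ (2 + δ)),
            integral_fun_snd (μ := P) (ν := P) (fun ω => |Y ω| ^ (2 + δ))]
          simp only [probReal_univ, one_smul]
          nlinarith
  calc _ = |(∫ ω, X ω * Y ω ∂P - ∫ ω, clip M (X ω) * clip M (Y ω) ∂P)
        + (∫ ω, clip M (X ω) * clip M (Y ω) ∂P -
            (∫ ω, clip M (X ω) ∂P) * ∫ ω, clip M (Y ω) ∂P)
        - ((∫ ω, X ω ∂P) * ∫ ω, Y ω ∂P -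
            (∫ ω, clip M (X ω) ∂P) * ∫ ω, clip M (Y ω) ∂P)| := by congr 1; ring
    _ ≤ _ := by
      refine (abs_sub _ _).trans ?_
      have := abs_add_le (∫ ω, X ω * Y ω ∂P - ∫ ω, clip M (X ω) * clip M (Y ω) ∂P)
        (∫ ω, clip M (X ω) * clip M (Y ω) ∂P -
            (∫ ω, clip M (X ω) ∂P) * ∫ ω, clip M (Y ω) ∂P)
      linarith

/-- The bound `8 C α^{δ/(2+δ)}`-type inequality, with an arbitrary positive slack `τ`. -/
lemma abs_cov_le_rpow (hA : 𝒜 ≤ mΩ) (hB : ℬ ≤ mΩ) {α δ C τ : ℝ}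
    (hα0 : 0 ≤ α) (hτ : 0 < τ) (hδ : 0 < δ)
    (hα : ∀ A B : Set Ω, MeasurableSet[𝒜] A → MeasurableSet[ℬ] B →
      |P.real (A ∩ B) - P.real A * P.real B| ≤ α)
    {X Y : Ω → ℝ} (hX : Measurable[𝒜] X) (hY : Measurable[ℬ] Y)
    (iX : Integrable X P) (iY : Integrable Y P) (iXY : Integrable (fun ω => X ω * Y ω) P)
    (mX : Integrable (fun ω => |X ω| ^ (2 + δ)) P) (mY : Integrable (fun ω => |Y ω| ^ (2 + δ)) P)
    (hCX : ∫ ω, |X ω| ^ (2 + δ) ∂P ≤ C) (hCY : ∫ ω, |Y ω| ^ (2 + δ) ∂P ≤ C) :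
    |∫ ω, X ω * Y ω ∂P - (∫ ω, X ω ∂P) * ∫ ω, Y ω ∂P| ≤
      (4 + 8 * C) * (α ^ (δ / (2 + δ)) + τ) := by
  -- The truncation level `M = a ^ (-1 / δ)` makes `M ^ (-δ)` equal to `a` and keeps `M ^ 2 * α`
  -- below `a`. The slack `τ` keeps `a` positive when `α = 0`.
  set a := α ^ (δ / (2 + δ)) + τ with ha
  have hα' : 0 ≤ α ^ (δ / (2 + δ)) := by positivity
  have ha0 : 0 < a := by positivity
  have hM : 0 < a ^ (-1 / δ) := by positivity
  have h := abs_cov_le_of_moment hA hB hM hδ hα hX hY iX iY iXY mX mY hCX hCY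
  have e1 : (a ^ (-1 / δ)) ^ (-δ) = a := by
    rw [← Real.rpow_mul ha0.le]
    have : -1 / δ * -δ = 1 := by field_simp
    rw [this, Real.rpow_one]
  have e2 : (a ^ (-1 / δ)) ^ 2 * α ≤ a := by
    have h1 : α ≤ a ^ ((2 + δ) / δ) := by
      calc α = (α ^ (δ / (2 + δ))) ^ ((2 + δ) / δ) := by
            rw [← Real.rpow_mul hα0]
            have : δ / (2 + δ) * ((2 + δ) / δ) = 1 := by
              have : (2 + δ) ≠ 0 := by positivity
              field_simp
            rw [this, Real.rpow_one]
        _ ≤ _ := Real.rpow_le_rpow hα' (by linarith) (by positivity)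
    calc (a ^ (-1 / δ)) ^ 2 * α ≤ (a ^ (-1 / δ)) ^ 2 * a ^ ((2 + δ) / δ) :=
          mul_le_mul_of_nonneg_left h1 (by positivity)
      _ = a := by
          rw [← Real.rpow_natCast, ← Real.rpow_mul ha0.le, ← Real.rpow_add ha0]
          have : -1 / δ * ((2 : ℕ) : ℝ) + (2 + δ) / δ = 1 := by push_cast; field_simp; ring
          rw [this, Real.rpow_one]
  rw [e1] at h
  nlinarith

end Mixing

/-! ### Quadratic forms in a strongly mixing white noise -/

section Noise

variable {Ω : Type*} [mΩ : MeasurableSpace Ω] {P : Measure Ω} {J : Type*}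

/-- The σ-algebra generated by the variables `ε_{s,a}`, `s ∈ I`. -/
@[reducible]
def noiseSigma (ε : ℤ → J → Ω → ℝ) (I : Set ℤ) : MeasurableSpace Ω :=
  ⨆ s ∈ I, ⨆ a, MeasurableSpace.comap (fun ω => ε s a ω) inferInstance

lemma measurable_noiseSigma (ε : ℤ → J → Ω → ℝ) {I : Set ℤ} {s : ℤ} (hs : s ∈ I) (a : J) :
    Measurable[noiseSigma ε I] (ε s a) := by
  have h : MeasurableSpace.comap (fun ω => ε s a ω) inferInstance ≤ noiseSigma ε I :=
    le_iSup₂_of_le s hs (le_iSup_of_le a le_rfl)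
  exact (comap_measurable (ε s a)).mono h le_rfl

lemma noiseSigma_le {ε : ℤ → J → Ω → ℝ} (h : ∀ t a, Measurable (ε t a)) (I : Set ℤ) :
    noiseSigma ε I ≤ mΩ :=
  iSup₂_le fun s _ => iSup_le fun a => (h s a).comap_le

/-- White noise with covariance matrix `S`, moments of order `4 + 2δ` bounded by `C`, and strong
mixing coefficients `α`. -/
structure IsMixingNoise (P : Measure Ω) (ε : ℤ → J → Ω → ℝ) [DecidableEq J] (S : Matrix J J ℝ)
    (δ C : ℝ) (α : ℕ → ℝ) : Prop where
  meas : ∀ t a, Measurable (ε t a)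
  pos : 0 < δ
  integrable : ∀ t a, Integrable (fun ω => |ε t a ω| ^ (4 + 2 * δ)) P
  moment : ∀ t a, ∫ ω, |ε t a ω| ^ (4 + 2 * δ) ∂P ≤ C
  white : ∀ t s a b, ∫ ω, ε t a ω * ε s b ω ∂P = if t = s then S a b else 0
  nonneg : ∀ l, 0 ≤ α l
  mix : ∀ (t : ℤ) (l : ℕ), ∀ A B : Set Ω, MeasurableSet[noiseSigma ε (Set.Iic t)] A →
    MeasurableSet[noiseSigma ε (Set.Ici (t + l))] B →
    |P.real (A ∩ B) - P.real A * P.real B| ≤ α l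
  summable : Summable fun l : ℕ => α (l + 1) ^ (δ / (2 + δ))

lemma pow_le_one_add_rpow {r : ℝ} {m : ℕ} (hr : (m : ℝ) ≤ r) (x : ℝ) : |x| ^ m ≤ 1 + |x| ^ r := by
  have hr0 : 0 ≤ |x| ^ r := by positivity
  rcases le_or_gt |x| 1 with h | h
  · have := pow_le_one₀ (n := m) (abs_nonneg x) h
    linarith
  · have : |x| ^ m ≤ |x| ^ r := by
      rw [← Real.rpow_natCast]
      exact Real.rpow_le_rpow_of_exponent_le h.le hr
    linarith

/-- Moments of order `4 + 2δ` of the noise thereby control moments of order `2 + δ` of its products,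
which is what the covariance inequality requires. -/
lemma abs_mul_rpow_le {δ : ℝ} (hδ : 0 < δ) (x y : ℝ) :
    |x * y| ^ (2 + δ) ≤ |x| ^ (4 + 2 * δ) + |y| ^ (4 + 2 * δ) := by
  have h1 : 0 ≤ |x| ^ (4 + 2 * δ) := by positivity
  have h2 : 0 ≤ |y| ^ (4 + 2 * δ) := by positivity
  have key : ∀ z : ℝ, (|z| * |z|) ^ (2 + δ) = |z| ^ (4 + 2 * δ) := by
    intro z
    rw [← pow_two, ← Real.rpow_natCast, ← Real.rpow_mul (abs_nonneg z)]
    congr 1; push_cast; ring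
  rw [abs_mul]
  rcases le_total |x| |y| with h | h
  · have := Real.rpow_le_rpow (z := 2 + δ) (by positivity)
      (mul_le_mul_of_nonneg_right h (abs_nonneg y)) (by positivity)
    rw [key] at this; linarith
  · have := Real.rpow_le_rpow (z := 2 + δ) (by positivity)
      (mul_le_mul_of_nonneg_left h (abs_nonneg x)) (by positivity)
    rw [key] at this; linarith

lemma abs_mul_mul_le_sum (a b c d : ℝ) :
    |a * b * (c * d)| ≤ |a| ^ 4 + |b| ^ 4 + (|c| ^ 4 + |d| ^ 4) := by
  have h : |a * b * (c * d)| = |a| * |b| * (|c| * |d|) := by simp [abs_mul]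
  rw [h]
  generalize |a| = a, |b| = b, |c| = c, |d| = d
  nlinarith [sq_nonneg (a * b - c * d), sq_nonneg (a ^ 2 - b ^ 2), sq_nonneg (c ^ 2 - d ^ 2),
    sq_nonneg (a ^ 2), sq_nonneg (b ^ 2), sq_nonneg (c ^ 2), sq_nonneg (d ^ 2)]

lemma eLpNorm_two_le_of_integral_sq {f : Ω → ℝ} (hf : MemLp f 2 P) {B : ℝ}
    (h : ∫ ω, f ω ^ 2 ∂P ≤ B) : eLpNorm f 2 P ≤ ENNReal.ofReal √B := by
  rw [hf.eLpNorm_eq_integral_rpow_norm (by norm_num) (by norm_num)]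
  apply ENNReal.ofReal_le_ofReal
  rw [Real.sqrt_eq_rpow]
  have e : ∀ ω, ‖f ω‖ ^ (2 : ENNReal).toReal = f ω ^ 2 := by
    intro ω
    simp
  simp only [e]
  have h0 : 0 ≤ ∫ ω, f ω ^ 2 ∂P := integral_nonneg fun ω => sq_nonneg _
  have : (2 : ENNReal).toReal⁻¹ = 1 / 2 := by norm_num
  rw [this]
  exact Real.rpow_le_rpow h0 h (by norm_num)

/-- Sums of a function of the distance to a point of an interval. -/
lemma sum_natAbs_sub_le {g : ℕ → ℝ} (hg : ∀ h, 0 ≤ g h) {G : ℝ}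
    (hG : ∀ H, ∑ h ∈ Finset.range H, g h ≤ G) (I : Finset ℤ) (t : ℤ) :
    ∑ s ∈ I, g (t - s).natAbs ≤ 2 * G := by
  have key : ∀ I' : Finset ℤ, Set.InjOn (fun s : ℤ => (t - s).natAbs) I' →
      ∑ s ∈ I', g (t - s).natAbs ≤ G := by
    intro I' hI
    rw [← Finset.sum_image (f := g) (g := fun s : ℤ => (t - s).natAbs) hI]
    refine (Finset.sum_le_sum_of_subset_of_nonneg ?_ fun h _ _ => hg h).trans
      (hG ((I'.image fun s : ℤ => (t - s).natAbs).sup id + 1))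
    intro h hh
    exact Finset.mem_range.2 (Nat.lt_succ_of_le (Finset.le_sup (f := id) hh))
  -- The distance to `t` is injective on either side of `t`, whence the factor two.
  rw [← Finset.sum_filter_add_sum_filter_not I (fun s => s ≤ t)]
  have h1 := key (I.filter fun s => s ≤ t) (by
    intro a ha b hb hab
    simp only [Finset.coe_filter, Set.mem_ofPred_eq] at ha hb hab
    omega)
  have h2 := key (I.filter fun s => ¬ s ≤ t) (by
    intro a ha b hb hab
    simp only [Finset.coe_filter, Set.mem_ofPred_eq] at ha hb hab
    omega)
  linarith

namespace IsMixingNoise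

variable [DecidableEq J] {ε : ℤ → J → Ω → ℝ} {S : Matrix J J ℝ} {δ C : ℝ} {α : ℕ → ℝ}

section

variable [IsProbabilityMeasure P]

lemma moment_nonneg (h : IsMixingNoise P ε S δ C α) (t : ℤ) (a : J) : 0 ≤ C :=
  (integral_nonneg fun _ => by positivity).trans (h.moment t a)

lemma integrable_pow (h : IsMixingNoise P ε S δ C α) {m : ℕ} (hm : m ≤ 4) (t : ℤ) (a : J) :
    Integrable (fun ω => |ε t a ω| ^ m) P := by
  have hr : (m : ℝ) ≤ 4 + 2 * δ := by
    have : (m : ℝ) ≤ 4 := by exact_mod_cast hm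
    linarith [h.pos]
  refine Integrable.mono' ((integrable_const (1 : ℝ)).add (h.integrable t a))
    ((h.meas t a).abs.pow_const m).aestronglyMeasurable (ae_of_all _ fun ω => ?_)
  rw [Real.norm_of_nonneg (by positivity)]
  exact pow_le_one_add_rpow hr _

lemma integral_pow_le (h : IsMixingNoise P ε S δ C α) {m : ℕ} (hm : m ≤ 4) (t : ℤ) (a : J) :
    ∫ ω, |ε t a ω| ^ m ∂P ≤ 1 + C := by
  have hr : (m : ℝ) ≤ 4 + 2 * δ := by
    have : (m : ℝ) ≤ 4 := by exact_mod_cast hm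
    linarith [h.pos]
  calc _ ≤ ∫ ω, (1 + |ε t a ω| ^ (4 + 2 * δ)) ∂P :=
        integral_mono (h.integrable_pow hm t a) ((integrable_const _).add (h.integrable t a))
          fun ω => pow_le_one_add_rpow hr _
    _ ≤ _ := by
        rw [integral_add (integrable_const _) (h.integrable t a)]
        simp only [integral_const, probReal_univ, smul_eq_mul, one_mul]
        linarith [h.moment t a]

lemma integrable_mul (h : IsMixingNoise P ε S δ C α) (t s : ℤ) (a b : J) :
    Integrable (fun ω => ε t a ω * ε s b ω) P := by
  refine Integrable.mono' ((h.integrable_pow (m := 2) (by norm_num) t a).add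
    (h.integrable_pow (m := 2) (by norm_num) s b))
    ((h.meas t a).mul (h.meas s b)).aestronglyMeasurable (ae_of_all _ fun ω => ?_)
  rw [Real.norm_eq_abs, abs_mul]
  simp only [Pi.add_apply]
  nlinarith [sq_nonneg (|ε t a ω| - |ε s b ω|), abs_nonneg (ε t a ω), abs_nonneg (ε s b ω)]

lemma integrable_mul_mul (h : IsMixingNoise P ε S δ C α) (t s t' s' : ℤ) (a b a' b' : J) :
    Integrable (fun ω => ε t a ω * ε s b ω * (ε t' a' ω * ε s' b' ω)) P := by
  refine Integrable.mono' (((h.integrable_pow (m := 4) le_rfl t a).add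
    (h.integrable_pow (m := 4) le_rfl s b)).add ((h.integrable_pow (m := 4) le_rfl t' a').add
    (h.integrable_pow (m := 4) le_rfl s' b')))
    (((h.meas t a).mul (h.meas s b)).mul
      ((h.meas t' a').mul (h.meas s' b'))).aestronglyMeasurable (ae_of_all _ fun ω => ?_)
  exact abs_mul_mul_le_sum _ _ _ _

lemma abs_integral_mul_mul_le (h : IsMixingNoise P ε S δ C α) (t s t' s' : ℤ) (a b a' b' : J) :
    |∫ ω, ε t a ω * ε s b ω * (ε t' a' ω * ε s' b' ω) ∂P| ≤ 4 * (1 + C) := by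
  refine abs_integral_le_integral_abs.trans ?_
  have i1 := h.integrable_pow (m := 4) le_rfl t a
  have i2 := h.integrable_pow (m := 4) le_rfl s b
  have i3 := h.integrable_pow (m := 4) le_rfl t' a'
  have i4 := h.integrable_pow (m := 4) le_rfl s' b'
  calc _ ≤ ∫ ω, (|ε t a ω| ^ 4 + |ε s b ω| ^ 4 + (|ε t' a' ω| ^ 4 + |ε s' b' ω| ^ 4)) ∂P :=
        integral_mono (h.integrable_mul_mul t s t' s' a b a' b').abs ((i1.add i2).add (i3.add i4))
          fun ω => abs_mul_mul_le_sum _ _ _ _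
    _ ≤ _ := by
        rw [integral_add (f := fun ω => |ε t a ω| ^ 4 + |ε s b ω| ^ 4)
            (g := fun ω => |ε t' a' ω| ^ 4 + |ε s' b' ω| ^ 4) (i1.add i2) (i3.add i4),
          integral_add i1 i2, integral_add i3 i4]
        linarith [h.integral_pow_le (m := 4) le_rfl t a, h.integral_pow_le (m := 4) le_rfl s b,
          h.integral_pow_le (m := 4) le_rfl t' a', h.integral_pow_le (m := 4) le_rfl s' b']

lemma abs_integral_mul_le (h : IsMixingNoise P ε S δ C α) (t s : ℤ) (a b : J) :
    |∫ ω, ε t a ω * ε s b ω ∂P| ≤ 2 * (1 + C) := by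
  refine abs_integral_le_integral_abs.trans ?_
  have i1 := h.integrable_pow (m := 2) (by norm_num) t a
  have i2 := h.integrable_pow (m := 2) (by norm_num) s b
  calc _ ≤ ∫ ω, (|ε t a ω| ^ 2 + |ε s b ω| ^ 2) ∂P := by
        refine integral_mono (h.integrable_mul t s a b).abs (i1.add i2) fun ω => ?_
        simp only [abs_mul]
        nlinarith [sq_nonneg (|ε t a ω| - |ε s b ω|), abs_nonneg (ε t a ω), abs_nonneg (ε s b ω)]
    _ ≤ _ := by
        rw [integral_add i1 i2]
        linarith [h.integral_pow_le (m := 2) (by norm_num) t a,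
          h.integral_pow_le (m := 2) (by norm_num) s b]

/-- Autocovariances of the products `ε_{t-m,a} ε_{t-n,b}`. -/
lemma abs_cov_product_le (h : IsMixingNoise P ε S δ C α) (m n s t : ℤ) (a b : J) (l : ℕ)
    (hl : s + ((m - n).natAbs : ℕ) + l = t) :
    |∫ ω, ε (s - m) a ω * ε (s - n) b ω * (ε (t - m) a ω * ε (t - n) b ω) ∂P -
      (∫ ω, ε (s - m) a ω * ε (s - n) b ω ∂P) * ∫ ω, ε (t - m) a ω * ε (t - n) b ω ∂P| ≤
      (4 + 8 * (2 * C)) * (α l ^ (δ / (2 + δ)) + (1 / 2) ^ l) := by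
  have mom : ∀ t, Integrable (fun ω => |ε (t - m) a ω * ε (t - n) b ω| ^ (2 + δ)) P ∧
      ∫ ω, |ε (t - m) a ω * ε (t - n) b ω| ^ (2 + δ) ∂P ≤ 2 * C := by
    intro t
    have i := (h.integrable (t - m) a).add (h.integrable (t - n) b)
    have i' : Integrable (fun ω => |ε (t - m) a ω * ε (t - n) b ω| ^ (2 + δ)) P := by
      refine Integrable.mono' i
        ((((h.meas _ a).mul (h.meas _ b)).abs).pow_const _).aestronglyMeasurable
        (ae_of_all _ fun ω => ?_)
      rw [Real.norm_of_nonneg (by positivity)]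
      exact abs_mul_rpow_le h.pos _ _
    refine ⟨i', (integral_mono i' i fun ω => abs_mul_rpow_le h.pos _ _).trans ?_⟩
    simp only [Pi.add_apply]
    rw [integral_add (h.integrable (t - m) a) (h.integrable (t - n) b)]
    linarith [h.moment (t - m) a, h.moment (t - n) b]
  -- The first product uses dates up to `s - min m n`. The second uses dates from `t - max m n` on,
  -- and this equals `s - min m n + l` by `hl`.
  refine abs_cov_le_rpow (P := P) (noiseSigma_le h.meas (Set.Iic (s - min m n)))
    (noiseSigma_le h.meas (Set.Ici (s - min m n + l))) (h.nonneg l) (by positivity) h.pos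
    (h.mix (s - min m n) l) ?_ ?_ (h.integrable_mul _ _ _ _) (h.integrable_mul _ _ _ _)
    (h.integrable_mul_mul _ _ _ _ _ _ _ _) (mom s).1 (mom t).1 (mom s).2 (mom t).2
  · exact (measurable_noiseSigma ε (by simp only [Set.mem_Iic]; omega) a).mul
      (measurable_noiseSigma ε (by simp only [Set.mem_Iic]; omega) b)
  · exact (measurable_noiseSigma ε (by simp only [Set.mem_Ici]; omega) a).mul
      (measurable_noiseSigma ε (by simp only [Set.mem_Ici]; omega) b)

/-- Sums of centred products of the noise are of order `√T` in mean square. -/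
lemma exists_integral_sq_sum_le (h : IsMixingNoise P ε S δ C α) (hC : 0 ≤ C) :
    ∃ K : ℝ, 0 ≤ K ∧ ∀ (m n : ℤ) (a b : J) (I : Finset ℤ),
      eLpNorm (fun ω => ∑ t ∈ I, (ε (t - m) a ω * ε (t - n) b ω -
        ∫ ω', ε (t - m) a ω' * ε (t - n) b ω' ∂P)) 2 P ≤
      ENNReal.ofReal (K * (1 + (m - n).natAbs) * √(I.card : ℝ)) := by
  set A : ℝ := ∑' l : ℕ, α (l + 1) ^ (δ / (2 + δ))
  have hA : 0 ≤ A := tsum_nonneg fun l => Real.rpow_nonneg (h.nonneg _) _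
  set K₁ : ℝ := 4 + 8 * (2 * C)
  have hK₁ : 0 ≤ K₁ := by positivity
  set K₂ : ℝ := 4 * (1 + C) + (2 * (1 + C)) * (2 * (1 + C))
  have hK₂ : 0 ≤ K₂ := by positivity
  refine ⟨1 + 2 * (K₂ + K₁ * (A + 2)), by positivity, fun m n a b I => ?_⟩
  set d := (m - n).natAbs with hd
  set W : ℤ → Ω → ℝ := fun t ω => ε (t - m) a ω * ε (t - n) b ω with hW
  have iW : ∀ t, Integrable (W t) P := fun t => h.integrable_mul _ _ _ _
  have iWW : ∀ s t, Integrable (fun ω => W s ω * W t ω) P := fun s t =>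
    h.integrable_mul_mul _ _ _ _ _ _ _ _
  -- A bound on the covariance of two products at distance `k`. Up to `d` their date ranges can
  -- overlap and only the moment bound is available; beyond, mixing at lag `k - d` applies. The sum
  -- over `k` is linear in `d`.
  set g : ℕ → ℝ := fun k => if k ≤ d then K₂ else
    K₁ * (α (k - d) ^ (δ / (2 + δ)) + (1 / 2) ^ (k - d)) with hg
  have hg0 : ∀ k, 0 ≤ g k := by
    intro k
    simp only [hg]
    split_ifs
    · exact hK₂
    · have := Real.rpow_nonneg (h.nonneg (k - d)) (δ / (2 + δ))
      positivity
  have hG : ∀ H, ∑ k ∈ Finset.range H, g k ≤ K₂ * (d + 1) + K₁ * (A + 2) := by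
    intro H
    calc _ ≤ ∑ k ∈ Finset.range ((d + 1) + H), g k :=
          Finset.sum_le_sum_of_subset_of_nonneg (Finset.range_subset_range.2 (by omega))
            fun k _ _ => hg0 k
      _ = ∑ k ∈ Finset.range (d + 1), K₂ + ∑ k ∈ Finset.range H,
            K₁ * (α (k + 1) ^ (δ / (2 + δ)) + (1 / 2) ^ (k + 1)) := by
          rw [Finset.sum_range_add]
          congr 1
          · refine Finset.sum_congr rfl fun k hk => ?_
            simp only [hg]
            rw [if_pos (by have := Finset.mem_range.1 hk; omega)]
          · refine Finset.sum_congr rfl fun k _ => ?_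
            simp only [hg]
            rw [if_neg (by omega)]
            have : d + 1 + k - d = k + 1 := by omega
            rw [this]
      _ ≤ _ := by
          rw [Finset.sum_const, Finset.card_range, nsmul_eq_mul, ← Finset.mul_sum,
            Finset.sum_add_distrib]
          have h1 : ∑ k ∈ Finset.range H, α (k + 1) ^ (δ / (2 + δ)) ≤ A :=
            h.summable.sum_le_tsum _ fun l _ => Real.rpow_nonneg (h.nonneg _) _
          have h2 : ∑ k ∈ Finset.range H, ((1 : ℝ) / 2) ^ (k + 1) ≤ 2 := by
            calc _ ≤ ∑ k ∈ Finset.range H, ((1 : ℝ) / 2) ^ k := by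
                  refine Finset.sum_le_sum fun k _ => ?_
                  rw [pow_succ]
                  have : (0 : ℝ) ≤ (1 / 2) ^ k := by positivity
                  linarith
              _ ≤ ∑' k : ℕ, ((1 : ℝ) / 2) ^ k :=
                  summable_geometric_two.sum_le_tsum _ fun _ _ => by positivity
              _ = 2 := tsum_geometric_two
          have h3 := mul_le_mul_of_nonneg_left (add_le_add h1 h2) hK₁
          push_cast
          linarith
  have hcov : ∀ s t, ∫ ω, W s ω * W t ω ∂P - (∫ ω, W s ω ∂P) * ∫ ω, W t ω ∂P
      ≤ g (s - t).natAbs := by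
    have key : ∀ s t, s ≤ t → ∫ ω, W s ω * W t ω ∂P - (∫ ω, W s ω ∂P) * ∫ ω, W t ω ∂P
        ≤ g (s - t).natAbs := by
      intro s t hst
      refine (le_abs_self _).trans ?_
      simp only [hg]
      split_ifs with hle
      · have h1 := h.abs_integral_mul_mul_le (s - m) (s - n) (t - m) (t - n) a b a b
        have h2 := h.abs_integral_mul_le (s - m) (s - n) a b
        have h3 := h.abs_integral_mul_le (t - m) (t - n) a b
        refine (abs_sub _ _).trans ?_
        rw [abs_mul]
        exact add_le_add h1 (mul_le_mul h2 h3 (abs_nonneg _) (by positivity))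
      · exact h.abs_cov_product_le m n s t a b _ (by omega)
    intro s t
    rcases le_total s t with hst | hst
    · exact key s t hst
    · have := key t s hst
      rw [mul_comm (∫ ω, W t ω ∂P)] at this
      simp only [mul_comm (W t _)] at this
      have e : (s - t).natAbs = (t - s).natAbs := by omega
      rwa [e]
  set w : ℤ → ℝ := fun t => ∫ ω, W t ω ∂P
  have iWw : ∀ s t, Integrable (fun ω => (W s ω - w s) * (W t ω - w t)) P := by
    intro s t
    have : ∀ ω, (W s ω - w s) * (W t ω - w t) =
        W s ω * W t ω - w t * W s ω - w s * W t ω + w s * w t := fun ω => by ring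
    simp only [this]
    exact (((iWW s t).sub ((iW s).const_mul _)).sub ((iW t).const_mul _)).add (integrable_const _)
  have eWw : ∀ s t, ∫ ω, (W s ω - w s) * (W t ω - w t) ∂P =
      ∫ ω, W s ω * W t ω ∂P - w s * w t := by
    intro s t
    have : ∀ ω, (W s ω - w s) * (W t ω - w t) =
        W s ω * W t ω - w t * W s ω - w s * W t ω + w s * w t := fun ω => by ring
    simp only [this]
    have i1 : Integrable (fun ω => W s ω * W t ω - w t * W s ω) P :=
      (iWW s t).sub ((iW s).const_mul _)
    have i2 : Integrable (fun ω => W s ω * W t ω - w t * W s ω - w s * W t ω) P :=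
      i1.sub ((iW t).const_mul _)
    rw [integral_add i2 (integrable_const _), integral_sub i1 ((iW t).const_mul _),
      integral_sub (iWW s t) ((iW s).const_mul _), integral_const_mul, integral_const_mul]
    simp only [integral_const, probReal_univ, smul_eq_mul, one_mul]
    ring
  have hm : Measurable fun ω => ∑ t ∈ I, (W t ω - w t) :=
    Finset.measurable_sum _ fun t _ => ((h.meas _ a).mul (h.meas _ b)).sub_const _
  have hsq : ∀ ω, (∑ t ∈ I, (W t ω - w t)) ^ 2 =
      ∑ s ∈ I, ∑ t ∈ I, (W s ω - w s) * (W t ω - w t) := by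
    intro ω; rw [pow_two, Finset.sum_mul_sum]
  have iS : Integrable (fun ω => (∑ t ∈ I, (W t ω - w t)) ^ 2) P := by
    simp only [hsq]
    exact integrable_finsetSum _ fun s _ => integrable_finsetSum _ fun t _ => iWw s t
  have hmem : MemLp (fun ω => ∑ t ∈ I, (W t ω - w t)) 2 P :=
    (memLp_two_iff_integrable_sq hm.aestronglyMeasurable).2 iS
  have hint : ∫ ω, (∑ t ∈ I, (W t ω - w t)) ^ 2 ∂P ≤
      I.card * (2 * (K₂ * (d + 1) + K₁ * (A + 2))) := by
    simp only [hsq]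
    rw [integral_finsetSum _ fun s _ => integrable_finsetSum _ fun t _ => iWw s t]
    calc _ ≤ ∑ s ∈ I, 2 * (K₂ * (d + 1) + K₁ * (A + 2)) := by
          refine Finset.sum_le_sum fun s _ => ?_
          rw [integral_finsetSum _ fun t _ => iWw s t]
          refine (Finset.sum_le_sum fun t _ => ?_).trans (sum_natAbs_sub_le hg0 hG I s)
          rw [eWw]; exact hcov s t
      _ = _ := by rw [Finset.sum_const, nsmul_eq_mul]
  refine (eLpNorm_two_le_of_integral_sq hmem hint).trans (ENNReal.ofReal_le_ofReal ?_)
  rw [mul_comm, Real.sqrt_mul' _ (by positivity)]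
  refine mul_le_mul_of_nonneg_right ?_ (by positivity)
  have hd0 : (0 : ℝ) ≤ d := by positivity
  set y := 2 * (K₂ * (d + 1) + K₁ * (A + 2)) with hy
  have hy0 : 0 ≤ y := by positivity
  have hAK : 0 ≤ K₁ * (A + 2) := by positivity
  calc √y ≤ 1 + y := by
        rw [Real.sqrt_le_left (by positivity)]
        nlinarith
    _ ≤ _ := by nlinarith [mul_nonneg hAK hd0]

end

end IsMixingNoise

end Noise

/-! ### Sample moments of moving averages of mixing noise -/

section MovingAverage

variable {Ω : Type*} [mΩ : MeasurableSpace Ω] {P : Measure Ω}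

/-- Convergence in measure means that every subsequence has an almost surely convergent further
subsequence; along a common one, limits multiply. -/
lemma tendstoInMeasure_mul [IsFiniteMeasure P] {f g : ℕ → Ω → ℝ} {f₀ g₀ : Ω → ℝ}
    (hf : ∀ n, AEStronglyMeasurable (f n) P) (hg : ∀ n, AEStronglyMeasurable (g n) P)
    (h₁ : TendstoInMeasure P f atTop f₀) (h₂ : TendstoInMeasure P g atTop g₀) :
    TendstoInMeasure P (fun n ω => f n ω * g n ω) atTop (fun ω => f₀ ω * g₀ ω) := by
  refine (exists_seq_tendstoInMeasure_atTop_iff (f := fun n ω => f n ω * g n ω)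
    fun n => (hf n).mul (hg n)).2 ?_
  intro ns hns
  obtain ⟨ms, hms, h1⟩ := (exists_seq_tendstoInMeasure_atTop_iff hf).1 h₁ ns hns
  obtain ⟨ls, hls, h2⟩ := (exists_seq_tendstoInMeasure_atTop_iff hg).1 h₂ _ (hns.comp hms)
  refine ⟨ms ∘ ls, hms.comp hls, ?_⟩
  filter_upwards [h1, h2] with ω w1 w2
  exact (w1.comp hls.tendsto_atTop).mul w2

lemma tendstoInMeasure_add [IsFiniteMeasure P] {f g : ℕ → Ω → ℝ} {f₀ g₀ : Ω → ℝ}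
    (hf : ∀ n, AEStronglyMeasurable (f n) P) (hg : ∀ n, AEStronglyMeasurable (g n) P)
    (h₁ : TendstoInMeasure P f atTop f₀) (h₂ : TendstoInMeasure P g atTop g₀) :
    TendstoInMeasure P (fun n ω => f n ω + g n ω) atTop (fun ω => f₀ ω + g₀ ω) := by
  refine (exists_seq_tendstoInMeasure_atTop_iff (f := fun n ω => f n ω + g n ω)
    fun n => (hf n).add (hg n)).2 ?_
  intro ns hns
  obtain ⟨ms, hms, h1⟩ := (exists_seq_tendstoInMeasure_atTop_iff hf).1 h₁ ns hns
  obtain ⟨ls, hls, h2⟩ := (exists_seq_tendstoInMeasure_atTop_iff hg).1 h₂ _ (hns.comp hms)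
  refine ⟨ms ∘ ls, hms.comp hls, ?_⟩
  filter_upwards [h1, h2] with ω w1 w2
  exact (w1.comp hls.tendsto_atTop).add w2

lemma tendstoInMeasure_const_of_tendsto [IsFiniteMeasure P] {c : ℕ → ℝ} {c₀ : ℝ}
    (h : Tendsto c atTop (𝓝 c₀)) :
    TendstoInMeasure P (fun n (_ : Ω) => c n) atTop (fun _ => c₀) :=
  tendstoInMeasure_of_tendsto_ae (fun _ => aestronglyMeasurable_const) (ae_of_all _ fun _ => h)

lemma tendstoInMeasure_sum [IsFiniteMeasure P] {ι : Type*} (s : Finset ι) {f : ι → ℕ → Ω → ℝ}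
    {f₀ : ι → Ω → ℝ} (hf : ∀ i n, AEStronglyMeasurable (f i n) P)
    (h : ∀ i, TendstoInMeasure P (f i) atTop (f₀ i)) :
    TendstoInMeasure P (fun n ω => ∑ i ∈ s, f i n ω) atTop (fun ω => ∑ i ∈ s, f₀ i ω) := by
  classical
  induction s using Finset.induction_on with
  | empty => simpa using tendstoInMeasure_const_of_tendsto (P := P) (tendsto_const_nhds (x := (0 : ℝ)))
  | insert i s hi ih =>
    simp only [Finset.sum_insert hi]
    exact tendstoInMeasure_add (hf i)
      (fun n => Finset.aestronglyMeasurable_fun_sum s fun i _ => hf i n) (h i) ih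

lemma L2_inner_eq_integral (f g : Lp ℝ 2 P) : inner ℝ f g = ∫ ω, f ω * g ω ∂P := by
  rw [L2.inner_def]
  refine integral_congr_ae (ae_of_all _ fun ω => ?_)
  simp [mul_comm]

variable {J : Type*} [Fintype J] [DecidableEq J]

/-- Truncated moving average. -/
def maPartial (E : ℤ → J → Lp ℝ 2 P) (c : ℕ → J → J → ℝ) (M : ℕ) (t : ℤ) (a : J) : Lp ℝ 2 P :=
  ∑ n ∈ Finset.range M, ∑ b, c n a b • E (t - n) b

lemma maPartial_coeFn (E : ℤ → J → Lp ℝ 2 P) (c : ℕ → J → J → ℝ) (M : ℕ) (t : ℤ) (a : J) :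
    (⇑(maPartial E c M t a) : Ω → ℝ) =ᵐ[P]
      fun ω => ∑ x ∈ Finset.range M ×ˢ Finset.univ, c x.1 a x.2 * E (t - x.1) x.2 ω := by
  unfold maPartial
  rw [← Finset.sum_product' (f := fun n b => c n a b • E (t - (n : ℕ)) b)]
  have h2 : ∀ᵐ ω ∂P, ∀ x : ℕ × J,
      (c x.1 a x.2 • E (t - x.1) x.2 : Lp ℝ 2 P) ω = c x.1 a x.2 * E (t - x.1) x.2 ω := by
    rw [ae_all_iff]
    intro x
    filter_upwards [Lp.coeFn_smul (c x.1 a x.2) (E (t - x.1) x.2)] with ω hω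
    rw [hω]; rfl
  filter_upwards [Lp.coeFn_fun_finsetSum (Finset.range M ×ˢ Finset.univ)
    (fun x : ℕ × J => c x.1 a x.2 • E (t - x.1) x.2), h2] with ω h3 h4
  rw [h3]
  exact Finset.sum_congr rfl fun x _ => h4 x

/-- The weight `1 + n` is the price of the lag distance in the bound for products of the noise;
geometric decay pays it. -/
lemma exists_weighted_sum_le {c : ℕ → J → J → ℝ} {K ρ : ℝ} (hρ0 : 0 ≤ ρ) (hρ : ρ < 1)
    (hc : ∀ n a b, |c n a b| ≤ K * ρ ^ n) (a : J) :
    ∃ L : ℝ, 0 ≤ L ∧ ∀ M : ℕ,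
      ∑ x ∈ Finset.range M ×ˢ Finset.univ, |c x.1 a x.2| * (1 + x.1) ≤ L := by
  rcases isEmpty_or_nonempty J with hJ | ⟨⟨b₀⟩⟩
  · exact ⟨0, le_rfl, fun M => by simp⟩
  have hK : 0 ≤ K := by have := (abs_nonneg _).trans (hc 0 a b₀); simpa using this
  have hs : Summable fun n : ℕ => (1 + (n : ℝ)) * ρ ^ n := by
    have h1 := summable_geometric_of_lt_one hρ0 hρ
    have h2 := summable_pow_mul_geometric_of_norm_lt_one 1
      (show ‖ρ‖ < 1 by rwa [Real.norm_of_nonneg hρ0])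
    refine (h1.add h2).congr fun n => ?_
    ring
  refine ⟨Fintype.card J * K * ∑' n : ℕ, (1 + (n : ℝ)) * ρ ^ n,
    mul_nonneg (by positivity) (tsum_nonneg fun n => by positivity), fun M => ?_⟩
  rw [Finset.sum_product]
  calc _ ≤ ∑ n ∈ Finset.range M, Fintype.card J * K * ((1 + (n : ℝ)) * ρ ^ n) := by
        refine Finset.sum_le_sum fun n _ => ?_
        calc _ ≤ ∑ b : J, K * ρ ^ n * (1 + n) := Finset.sum_le_sum fun b _ =>
              mul_le_mul_of_nonneg_right (hc n a b) (by positivity)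
          _ = _ := by rw [Finset.sum_const, Finset.card_univ, nsmul_eq_mul]; ring
    _ ≤ _ := by
        rw [← Finset.mul_sum]
        exact mul_le_mul_of_nonneg_left (hs.sum_le_tsum _ fun n _ => by positivity) (by positivity)

/-- A product of two truncated moving averages is a double sum of products of innovations.
Minkowski's inequality and the bound for each pair of lags give an estimate uniform in the
truncation, which survives the limit in measure by lower semicontinuity of the `L²` norm. -/
theorem exists_eLpNorm_sum_product_le [IsProbabilityMeasure P] {E Z : ℤ → J → Lp ℝ 2 P}
    {S : Matrix J J ℝ} {δ C : ℝ} {α : ℕ → ℝ}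
    (h : IsMixingNoise P (fun t a ω => E t a ω) S δ C α) {c : ℕ → J → J → ℝ} {K ρ : ℝ}
    (hρ0 : 0 ≤ ρ) (hρ : ρ < 1) (hc : ∀ n a b, |c n a b| ≤ K * ρ ^ n)
    (hZ : ∀ t a, Tendsto (fun M => maPartial E c M t a) atTop (𝓝 (Z t a)))
    (i j : ℤ) (a b : J) :
    ∃ B : ℝ, 0 ≤ B ∧ ∀ I : Finset ℤ, eLpNorm (fun ω => ∑ t ∈ I, (Z (t - i) a ω * Z (t - j) b ω -
      ∫ ω', Z (t - i) a ω' * Z (t - j) b ω' ∂P)) 2 P ≤ ENNReal.ofReal (B * √(I.card : ℝ)) := by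
  have hC := h.moment_nonneg 0 a
  obtain ⟨K', hK', hquad⟩ := h.exists_integral_sq_sum_le hC
  obtain ⟨L₁, hL₁, hL₁'⟩ := exists_weighted_sum_le hρ0 hρ hc a
  obtain ⟨L₂, hL₂, hL₂'⟩ := exists_weighted_sum_le hρ0 hρ hc b
  refine ⟨K' * (1 + i.natAbs + j.natAbs) * (L₁ * L₂), by positivity, fun I => ?_⟩
  set W : ℕ → Ω → ℝ := fun M ω => ∑ t ∈ I, (maPartial E c M (t - i) a ω *
    maPartial E c M (t - j) b ω - ∫ ω', maPartial E c M (t - i) a ω' *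
      maPartial E c M (t - j) b ω' ∂P) with hW
  have hmeas : ∀ M t a, AEStronglyMeasurable (⇑(maPartial E c M t a) : Ω → ℝ) P := fun M t a =>
    Lp.aestronglyMeasurable _
  have hWm : ∀ M, AEStronglyMeasurable (W M) P := fun M =>
    Finset.aestronglyMeasurable_fun_sum I fun t _ =>
      ((hmeas M _ _).mul (hmeas M _ _)).sub aestronglyMeasurable_const
  refine eLpNorm_le_of_tendstoInMeasure (f := W) (u := atTop) (Eventually.of_forall fun M => ?_)
    ?_ hWm
  · set D : Finset (ℕ × J) := Finset.range M ×ˢ Finset.univ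
    have hprod : ∀ t, (fun ω => maPartial E c M (t - i) a ω * maPartial E c M (t - j) b ω) =ᵐ[P]
        fun ω => ∑ x ∈ D, ∑ y ∈ D, (c x.1 a x.2 * c y.1 b y.2) *
          (E (t - (i + x.1)) x.2 ω * E (t - (j + y.1)) y.2 ω) := by
      intro t
      filter_upwards [maPartial_coeFn E c M (t - i) a, maPartial_coeFn E c M (t - j) b] with ω h1 h2
      rw [h1, h2, Finset.sum_mul_sum]
      refine Finset.sum_congr rfl fun x _ => Finset.sum_congr rfl fun y _ => ?_
      rw [sub_sub, sub_sub]; ring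
    have hint : ∀ t, ∫ ω, maPartial E c M (t - i) a ω * maPartial E c M (t - j) b ω ∂P =
        ∑ x ∈ D, ∑ y ∈ D, (c x.1 a x.2 * c y.1 b y.2) *
          ∫ ω, E (t - (i + x.1)) x.2 ω * E (t - (j + y.1)) y.2 ω ∂P := by
      intro t
      rw [integral_congr_ae (hprod t), integral_finsetSum _ fun x _ => integrable_finsetSum _
        fun y _ => (h.integrable_mul _ _ _ _).const_mul _]
      refine Finset.sum_congr rfl fun x _ => ?_
      rw [integral_finsetSum _ fun y _ => (h.integrable_mul _ _ _ _).const_mul _]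
      exact Finset.sum_congr rfl fun y _ => integral_const_mul _ _
    set V : ℕ × J → ℕ × J → Ω → ℝ := fun x y ω => ∑ t ∈ I,
      (E (t - (i + x.1)) x.2 ω * E (t - (j + y.1)) y.2 ω -
        ∫ ω', E (t - (i + x.1)) x.2 ω' * E (t - (j + y.1)) y.2 ω' ∂P) with hV
    have hWV : W M =ᵐ[P] ∑ x ∈ D, ∑ y ∈ D, (c x.1 a x.2 * c y.1 b y.2) • V x y := by
      have : ∀ᵐ ω ∂P, ∀ t, maPartial E c M (t - i) a ω * maPartial E c M (t - j) b ω =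
          ∑ x ∈ D, ∑ y ∈ D, (c x.1 a x.2 * c y.1 b y.2) *
          (E (t - (i + x.1)) x.2 ω * E (t - (j + y.1)) y.2 ω) := ae_all_iff.2 hprod
      filter_upwards [this] with ω hω
      simp only [hW, hω, hint, Finset.sum_apply, Pi.smul_apply, smul_eq_mul, hV, Finset.mul_sum]
      simp only [← Finset.sum_sub_distrib, ← mul_sub]
      rw [Finset.sum_comm]
      exact Finset.sum_congr rfl fun x _ => Finset.sum_comm
    have hVm : ∀ x y, AEStronglyMeasurable (V x y) P := fun x y =>
      Finset.aestronglyMeasurable_fun_sum I fun t _ =>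
        ((Lp.aestronglyMeasurable _).mul (Lp.aestronglyMeasurable _)).sub aestronglyMeasurable_const
    have hVb : ∀ x y, eLpNorm ((c x.1 a x.2 * c y.1 b y.2) • V x y) 2 P ≤ ENNReal.ofReal
        ((|c x.1 a x.2| * (1 + x.1)) * ((|c y.1 b y.2| * (1 + y.1)) *
          (K' * (1 + i.natAbs + j.natAbs) * √(I.card : ℝ)))) := by
      intro x y
      rw [eLpNorm_const_smul]
      refine (mul_le_mul_right (hquad _ _ _ _ _) _).trans ?_
      rw [Real.enorm_eq_ofReal_abs, ← ENNReal.ofReal_mul (abs_nonneg _)]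
      apply ENNReal.ofReal_le_ofReal
      rw [abs_mul]
      -- The dependence on the lag distance is split into one factor for each moving average, so
      -- that the double sum factorizes.
      have hd : (1 + ((i + x.1 - (j + y.1)).natAbs : ℝ)) ≤
          (1 + x.1) * ((1 + y.1) * (1 + i.natAbs + j.natAbs)) := by
        have h1 : (i + x.1 - (j + y.1)).natAbs ≤ i.natAbs + x.1 + (j.natAbs + y.1) := by omega
        have h2 : ((i + x.1 - (j + y.1)).natAbs : ℝ) ≤ i.natAbs + x.1 + (j.natAbs + y.1) := by
          exact_mod_cast h1
        have hx : (0 : ℝ) ≤ x.1 := by positivity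
        have hy : (0 : ℝ) ≤ y.1 := by positivity
        have hi : (0 : ℝ) ≤ (i.natAbs : ℝ) + j.natAbs := by positivity
        nlinarith [mul_nonneg hx hy, mul_nonneg hx hi, mul_nonneg hy hi,
          mul_nonneg (mul_nonneg hx hy) hi]
      have hc0 : 0 ≤ |c x.1 a x.2| * |c y.1 b y.2| := by positivity
      have := mul_le_mul_of_nonneg_left (mul_le_mul_of_nonneg_right
        (mul_le_mul_of_nonneg_left hd hK') (Real.sqrt_nonneg (I.card : ℝ))) hc0
      refine this.trans (le_of_eq ?_)
      ring
    rw [eLpNorm_congr_ae hWV]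
    refine (eLpNorm_sum_le (fun x _ => Finset.aestronglyMeasurable_sum _ fun y _ =>
      (hVm x y).const_smul _) (by norm_num)).trans ?_
    have hb : ∀ x ∈ D, eLpNorm (∑ y ∈ D, (c x.1 a x.2 * c y.1 b y.2) • V x y) 2 P ≤
        ENNReal.ofReal (∑ y ∈ D, (|c x.1 a x.2| * (1 + x.1)) * ((|c y.1 b y.2| * (1 + y.1)) *
          (K' * (1 + i.natAbs + j.natAbs) * √(I.card : ℝ)))) := by
      intro x _
      refine (eLpNorm_sum_le (fun y _ => (hVm x y).const_smul _) (by norm_num)).trans ?_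
      rw [ENNReal.ofReal_sum_of_nonneg fun y _ => by positivity]
      exact Finset.sum_le_sum fun y _ => hVb x y
    refine (Finset.sum_le_sum hb).trans ?_
    rw [← ENNReal.ofReal_sum_of_nonneg fun x _ => Finset.sum_nonneg fun y _ => by positivity]
    apply ENNReal.ofReal_le_ofReal
    simp only [← Finset.mul_sum, ← Finset.sum_mul]
    have h1 := hL₁' M
    have h2 := hL₂' M
    have h0 : 0 ≤ ∑ y ∈ D, |c y.1 b y.2| * (1 + (y.1 : ℝ)) :=
      Finset.sum_nonneg fun y _ => by positivity
    have h3 : 0 ≤ K' * (1 + i.natAbs + j.natAbs) * √(I.card : ℝ) := by positivity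
    calc _ ≤ L₁ * (L₂ * (K' * (1 + i.natAbs + j.natAbs) * √(I.card : ℝ))) :=
          mul_le_mul h1 (mul_le_mul_of_nonneg_right h2 h3) (mul_nonneg h0 h3) hL₁
      _ = _ := by ring
  · have hconv : ∀ t a, TendstoInMeasure P (fun M => (⇑(maPartial E c M t a) : Ω → ℝ)) atTop
        (Z t a) := fun t a => tendstoInMeasure_of_tendsto_Lp (hZ t a)
    refine tendstoInMeasure_sum I (fun t M =>
      ((hmeas M _ _).mul (hmeas M _ _)).sub aestronglyMeasurable_const) fun t => ?_
    simp only [sub_eq_add_neg]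
    refine tendstoInMeasure_add (fun M => (hmeas M _ _).mul (hmeas M _ _))
      (fun M => aestronglyMeasurable_const) (tendstoInMeasure_mul (hmeas · _ _) (hmeas · _ _)
        (hconv _ _) (hconv _ _)) (tendstoInMeasure_const_of_tendsto ?_)
    simp only [← L2_inner_eq_integral]
    exact ((hZ _ _).inner (hZ _ _)).neg

/-- Sums of a moving average of white noise are of order `√T` in mean square. -/
theorem exists_norm_sum_le [IsProbabilityMeasure P] {E Z : ℤ → J → Lp ℝ 2 P}
    {S : Matrix J J ℝ} {δ C : ℝ} {α : ℕ → ℝ}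
    (h : IsMixingNoise P (fun t a ω => E t a ω) S δ C α) {c : ℕ → J → J → ℝ} {K ρ : ℝ}
    (hρ0 : 0 ≤ ρ) (hρ : ρ < 1) (hc : ∀ n a b, |c n a b| ≤ K * ρ ^ n)
    (hZ : ∀ t a, Tendsto (fun M => maPartial E c M t a) atTop (𝓝 (Z t a)))
    (i : ℤ) (a : J) :
    ∃ B : ℝ, 0 ≤ B ∧ ∀ I : Finset ℤ, ‖∑ t ∈ I, Z (t - i) a‖ ≤ B * √(I.card : ℝ) := by
  obtain ⟨L, hL, hL'⟩ := exists_weighted_sum_le hρ0 hρ hc a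
  have hwhite : ∀ (I : Finset ℤ) (n : ℤ) (b : J), ‖∑ t ∈ I, E (t - n) b‖ =
      √(S b b) * √(I.card : ℝ) := by
    intro I n b
    have hS : 0 ≤ S b b := by
      have := h.white 0 0 b b
      rw [if_pos rfl] at this
      rw [← this]
      exact integral_nonneg fun ω => mul_self_nonneg _
    rw [← Real.sqrt_mul hS, eq_comm, Real.sqrt_eq_iff_mul_self_eq (by positivity) (norm_nonneg _),
      ← real_inner_self_eq_norm_mul_norm, sum_inner]
    have : ∀ s ∈ I, inner ℝ (E (s - n) b) (∑ t ∈ I, E (t - n) b) = S b b := by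
      intro s hs
      rw [inner_sum, Finset.sum_eq_single s]
      · rw [L2_inner_eq_integral, h.white, if_pos rfl]
      · intro t _ hts
        rw [L2_inner_eq_integral, h.white, if_neg (by omega)]
      · exact fun h => absurd hs h
    rw [Finset.sum_congr rfl this, Finset.sum_const, nsmul_eq_mul, mul_comm]
  set σ : ℝ := ∑ b, √(S b b)
  have hσ : ∀ b, √(S b b) ≤ σ := fun b =>
    Finset.single_le_sum (f := fun b => √(S b b)) (fun _ _ => Real.sqrt_nonneg _) (Finset.mem_univ b)
  have hσ0 : 0 ≤ σ := Finset.sum_nonneg fun _ _ => Real.sqrt_nonneg _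
  refine ⟨L * σ, by positivity, fun I => ?_⟩
  have hlim := (tendsto_finsetSum I fun t _ => hZ (t - i) a).norm
  refine le_of_tendsto hlim (Eventually.of_forall fun M => ?_)
  have e : ∑ t ∈ I, maPartial E c M (t - i) a =
      ∑ x ∈ Finset.range M ×ˢ Finset.univ, c x.1 a x.2 • ∑ t ∈ I, E (t - (i + x.1)) x.2 := by
    simp only [maPartial, Finset.smul_sum]
    rw [Finset.sum_comm (s := Finset.range M ×ˢ Finset.univ)]
    refine Finset.sum_congr rfl fun t _ => ?_
    rw [Finset.sum_product]
    simp only [sub_sub]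
  rw [e]
  refine (norm_sum_le _ _).trans ?_
  calc _ ≤ ∑ x ∈ Finset.range M ×ˢ Finset.univ,
        (|c x.1 a x.2| * (1 + x.1)) * (σ * √(I.card : ℝ)) := by
        refine Finset.sum_le_sum fun x _ => ?_
        rw [norm_smul, hwhite, Real.norm_eq_abs, mul_assoc]
        refine mul_le_mul_of_nonneg_left ?_ (abs_nonneg _)
        have h1 := mul_le_mul_of_nonneg_right (hσ x.2) (Real.sqrt_nonneg (I.card : ℝ))
        have h2 : 0 ≤ σ * √(I.card : ℝ) := by positivity
        have h3 : (0 : ℝ) ≤ x.1 := by positivity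
        nlinarith [mul_nonneg h3 h2]
    _ ≤ _ := by
        rw [← Finset.sum_mul, mul_assoc]
        exact mul_le_mul_of_nonneg_right (hL' M) (by positivity)

end MovingAverage

/-! ### Second moments of a data-generating process -/

section Observed

variable {N : ℕ} {k : Fin N → ℕ} {Ω : Type*} [mΩ : MeasurableSpace Ω] {P : Measure Ω}
  {x : ℤ → Ω → Reg k → ℝ} {u : ℤ → Ω → Fin N → ℝ} {μ : Reg k → ℝ} {p : ℕ}

lemma FinitePredictor.zL2_coeFn (h : FinitePredictor P x u μ p) (t : ℤ) (a : Joint k) :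
    (⇑(zL2 P x u μ t a) : Ω → ℝ) =ᵐ[P] fun ω => zbar x u μ t ω a := by
  unfold zL2 toL2
  rw [dif_pos (h.memLp t a)]
  exact (h.memLp t a).coeFn_toLp

lemma FinitePredictor.inner_zL2 (h : FinitePredictor P x u μ p) (s t : ℤ) (a b : Joint k) :
    inner ℝ (zL2 P x u μ s a) (zL2 P x u μ t b) = ∫ ω, zbar x u μ s ω a * zbar x u μ t ω b ∂P := by
  rw [L2_inner_eq_integral]
  refine integral_congr_ae ?_
  filter_upwards [h.zL2_coeFn s a, h.zL2_coeFn t b] with ω h1 h2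
  rw [h1, h2]

/-- Passage to the Hilbert-space model: an innovation is the residual of a projection on the closed
past, hence orthogonal to it. -/
lemma FinitePredictor.isVAR (h : FinitePredictor P x u μ p) {θ : Param k p}
    (hθ : HasParam P x u μ θ) :
    IsVAR θ.1 θ.2 (zL2 P x u μ) (innovation P x u μ) where
  eq t a := by rw [innovation, ← hθ.predictor_eq t a]; abel
  orth t a s b hst := by
    have hmem : zL2 P x u μ s b ∈ past P x u μ (t - 1) :=
      Submodule.le_topologicalClosure _ (Submodule.subset_span ⟨s, by omega, b, rfl⟩)
    exact Submodule.starProjection_inner_eq_zero _ _ hmem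
  cov t a b := by
    rw [L2_inner_eq_integral, ← hθ.cov_eq t]; rfl
  pos := by rw [← hθ.cov_eq 0]; exact h.innovationCov_posDef 0
  stat s t j a b := by rw [h.inner_zL2, h.inner_zL2]; exact h.cov_stationary s t j a b
  pnd := h.purely_nondeterministic

lemma abs_inter_sub_mul_le_one [IsProbabilityMeasure P] (A B : Set Ω) :
    |P.real (A ∩ B) - P.real A * P.real B| ≤ 1 := by
  have h1 : P.real (A ∩ B) ≤ 1 := measureReal_le_one
  have h2 : P.real A ≤ 1 := measureReal_le_one
  have h3 : P.real B ≤ 1 := measureReal_le_one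
  have h4 : 0 ≤ P.real (A ∩ B) := measureReal_nonneg
  have h5 : 0 ≤ P.real A := measureReal_nonneg
  have h6 : 0 ≤ P.real B := measureReal_nonneg
  rw [abs_le]
  constructor <;> nlinarith

/-- Whiteness comes from the projection structure. The mixing coefficients are suprema of sets
bounded by `1`, so they dominate each of their members. -/
lemma FinitePredictor.exists_isMixingNoise [IsProbabilityMeasure P]
    (h : FinitePredictor P x u μ p) {θ : Param k p} (hθ : HasParam P x u μ θ) :
    ∃ δ C, IsMixingNoise P (fun t a ω => innovation P x u μ t a ω) θ.2 δ C
      (mixingCoeff P x u μ) := by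
  obtain ⟨δ, hδ, hsum, C, hC⟩ := h.mixing_moments
  have hr : 0 < 4 + 2 * δ := by positivity
  have hr0 : ENNReal.ofReal (4 + 2 * δ) ≠ 0 := by simpa using hr
  have hmem : ∀ t a, MemLp (innovation P x u μ t a) (ENNReal.ofReal (4 + 2 * δ)) P := fun t a =>
    ⟨Lp.aestronglyMeasurable _, (hC t a).trans_lt ENNReal.coe_lt_top⟩
  have hint : ∀ t a, Integrable (fun ω => |innovation P x u μ t a ω| ^ (4 + 2 * δ)) P := by
    intro t a
    have := (hmem t a).integrable_norm_rpow hr0 ENNReal.ofReal_ne_top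
    rwa [ENNReal.toReal_ofReal hr.le] at this
  refine ⟨δ, (C : ℝ) ^ (4 + 2 * δ), ⟨fun t a => (Lp.stronglyMeasurable _).measurable, hδ, hint,
    fun t a => ?_, fun t s a b => ?_, fun l => ?_, fun t l A B hA hB => ?_, hsum⟩⟩
  · have h1 := hC t a
    rw [(hmem t a).eLpNorm_eq_integral_rpow_norm hr0 ENNReal.ofReal_ne_top,
      ENNReal.toReal_ofReal hr.le] at h1
    have h0 : 0 ≤ ∫ ω, ‖innovation P x u μ t a ω‖ ^ (4 + 2 * δ) ∂P :=
      integral_nonneg fun ω => by positivity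
    have h2 : (∫ ω, ‖innovation P x u μ t a ω‖ ^ (4 + 2 * δ) ∂P) ^ (4 + 2 * δ)⁻¹ ≤ (C : ℝ) := by
      have := ENNReal.toReal_mono ENNReal.coe_ne_top h1
      rwa [ENNReal.toReal_ofReal (by positivity), ENNReal.coe_toReal] at this
    have h3 := Real.rpow_le_rpow (by positivity) h2 hr.le
    rwa [← Real.rpow_mul h0, inv_mul_cancel₀ hr.ne', Real.rpow_one] at h3
  · rw [← L2_inner_eq_integral]
    split_ifs with hts
    · subst hts; exact (h.isVAR hθ).cov t a b
    · exact (h.isVAR hθ).inner_innovation_ne (Ne.symm hts) a b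
  · refine Real.sSup_nonneg ?_
    rintro r ⟨t, A, B, -, -, rfl⟩
    exact abs_nonneg _
  · refine le_csSup ⟨1, ?_⟩ ⟨t, A, B, hA, hB, rfl⟩
    rintro r ⟨t, A, B, -, -, rfl⟩
    exact abs_inter_sub_mul_le_one A B

/-- Index set of the vector `(1, z̄_t', …, z̄_{t-p}')'`. -/
abbrev ObsIdx (k : Fin N → ℕ) (p : ℕ) : Type := Option (Fin (p + 1) × Joint k)

/-- The vector `(1, z̄_t', …, z̄_{t-p}')'` of a path. -/
def obs (p : ℕ) (μ : Reg k → ℝ) (x : ℤ → Reg k → ℝ) (u : ℤ → Fin N → ℝ) (t : ℤ) :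
    ObsIdx k p → ℝ
  | none => 1
  | some q => Sum.elim (fun c => x (t - (q.1 : ℕ)) c - μ c) (u (t - (q.1 : ℕ))) q.2

/-- The bilinear form `α' V β`. -/
def bil {Q : Type*} [Fintype Q] (V : Q → Q → ℝ) (α β : Q → ℝ) : ℝ :=
  ∑ q, ∑ r, α q * β r * V q r

/-- `v` is a sequence of square-integrable random vectors whose sample second moments converge to `V`
at the rate `√T`. -/
structure HasMoments {Q : Type*} [Fintype Q] (P : Measure Ω) (v : ℤ → Ω → Q → ℝ)
    (V : Q → Q → ℝ) : Prop where
  memLp : ∀ t q, MemLp (fun ω => v t ω q) 2 P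
  bound : ∃ B : ℝ, 0 ≤ B ∧ ∀ q r (I : Finset ℤ),
    eLpNorm (fun ω => ∑ t ∈ I, (v t ω q * v t ω r - V q r)) 2 P ≤
      ENNReal.ofReal (B * √(I.card : ℝ))

/-- The second-moment matrix of `(1, z̄_0', …, z̄_{-p}')'`. -/
def obsMoment (P : Measure Ω) (x : ℤ → Ω → Reg k → ℝ) (u : ℤ → Ω → Fin N → ℝ) (μ : Reg k → ℝ)
    (p : ℕ) (q r : ObsIdx k p) : ℝ :=
  ∫ ω, obs p μ (fun s => x s ω) (fun s => u s ω) 0 q *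
    obs p μ (fun s => x s ω) (fun s => u s ω) 0 r ∂P

lemma obs_some (p : ℕ) (μ : Reg k → ℝ) (ω : Ω) (t : ℤ) (q : Fin (p + 1) × Joint k) :
    obs p μ (fun s => x s ω) (fun s => u s ω) t (some q) = zbar x u μ (t - (q.1 : ℕ)) ω q.2 := rfl

lemma obs_none (p : ℕ) (μ : Reg k → ℝ) (ω : Ω) (t : ℤ) :
    obs p μ (fun s => x s ω) (fun s => u s ω) t none = 1 := rfl

lemma bil_eq_integral {Q : Type*} [Fintype Q] {v : Ω → Q → ℝ} {V : Q → Q → ℝ}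
    (hm : ∀ q, MemLp (fun ω => v ω q) 2 P) (hV : ∀ q r, ∫ ω, v ω q * v ω r ∂P = V q r)
    (α β : Q → ℝ) : bil V α β = ∫ ω, (∑ q, α q * v ω q) * (∑ r, β r * v ω r) ∂P := by
  have hi : ∀ q r, Integrable (fun ω => v ω q * v ω r) P := fun q r => (hm q).integrable_mul (hm r)
  have e : ∀ ω, (∑ q, α q * v ω q) * (∑ r, β r * v ω r) =
      ∑ q, ∑ r, α q * β r * (v ω q * v ω r) := by
    intro ω
    rw [Finset.sum_mul_sum]
    refine Finset.sum_congr rfl fun q _ => Finset.sum_congr rfl fun r _ => by ring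
  simp only [e]
  rw [integral_finsetSum _ fun q _ => integrable_finsetSum _ fun r _ => (hi q r).const_mul _, bil]
  refine Finset.sum_congr rfl fun q _ => ?_
  rw [integral_finsetSum _ fun r _ => (hi q r).const_mul _]
  refine Finset.sum_congr rfl fun r _ => ?_
  rw [integral_const_mul, hV]

variable [IsProbabilityMeasure P]

lemma FinitePredictor.memLp_obs (h : FinitePredictor P x u μ p) (m : ℕ) (t : ℤ) (q : ObsIdx k m) :
    MemLp (fun ω => obs m μ (fun s => x s ω) (fun s => u s ω) t q) 2 P := by
  rcases q with _ | q
  · exact memLp_const 1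
  · exact h.memLp _ _

lemma FinitePredictor.integral_obs (h : FinitePredictor P x u μ p) (m : ℕ) (t : ℤ)
    (q r : ObsIdx k m) :
    ∫ ω, obs m μ (fun s => x s ω) (fun s => u s ω) t q *
      obs m μ (fun s => x s ω) (fun s => u s ω) t r ∂P = obsMoment P x u μ m q r := by
  unfold obsMoment
  rcases q with _ | q <;> rcases r with _ | r
  · simp [obs]
  · simp only [obs_some, obs_none, one_mul]
    rw [h.mean_zero, h.mean_zero]
  · simp only [obs_some, obs_none, mul_one]
    rw [h.mean_zero, h.mean_zero]
  · simp only [obs_some]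
    have := h.cov_stationary (0 - (r.1 : ℕ)) (t - (r.1 : ℕ)) ((r.1 : ℕ) - (q.1 : ℕ)) q.2 r.2
    simp only [sub_add_sub_cancel] at this
    exact this

/-- The constant is orthogonal to the centred components, so the form splits into two nonnegative
parts; the second vanishes only at zero because lags are linearly independent. -/
lemma FinitePredictor.obsMoment_eq_zero (h : FinitePredictor P x u μ p) {θ : Param k p}
    (hθ : HasParam P x u μ θ) (m : ℕ) (α : ObsIdx k m → ℝ)
    (hα : bil (obsMoment P x u μ m) α α = 0) : α = 0 := by
  have hsplit : bil (obsMoment P x u μ m) α α =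
      α none ^ 2 + inner ℝ (∑ q, α (some q) • zL2 P x u μ (0 - (q.1 : ℕ)) q.2)
        (∑ q, α (some q) • zL2 P x u μ (0 - (q.1 : ℕ)) q.2) := by
    have h00 : obsMoment P x u μ m none none = 1 := by simp [obsMoment, obs]
    have h01 : ∀ q, obsMoment P x u μ m none (some q) = 0 := by
      intro q
      simp only [obsMoment, obs_some, obs_none, one_mul]
      exact h.mean_zero _ _
    have h10 : ∀ q, obsMoment P x u μ m (some q) none = 0 := by
      intro q
      simp only [obsMoment, obs_some, obs_none, mul_one]
      exact h.mean_zero _ _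
    have h11 : ∀ q r, obsMoment P x u μ m (some q) (some r) =
        inner ℝ (zL2 P x u μ (0 - (q.1 : ℕ)) q.2) (zL2 P x u μ (0 - (r.1 : ℕ)) r.2) := by
      intro q r
      rw [h.inner_zL2]; rfl
    simp only [bil, Fintype.sum_option, h00, h01, h10, h11, mul_zero, Finset.sum_const_zero,
      add_zero, zero_add, mul_one, sum_inner, inner_sum, inner_smul_left, inner_smul_right]
    rw [pow_two]
    congr 1
    refine Finset.sum_congr rfl fun q _ => ?_
    rw [Finset.mul_sum]
    refine Finset.sum_congr rfl fun r _ => ?_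
    rw [conj_trivial, real_inner_comm]
    ring
  rw [hsplit] at hα
  have h1 := sq_nonneg (α none)
  have h2 := real_inner_self_nonneg (x := ∑ q, α (some q) • zL2 P x u μ (0 - (q.1 : ℕ)) q.2)
  have h3 : α none = 0 := pow_eq_zero_iff (two_ne_zero) |>.1 (by linarith)
  have h4 : ∑ q, α (some q) • zL2 P x u μ (0 - (q.1 : ℕ)) q.2 = 0 :=
    inner_self_eq_zero.1 (by linarith : inner ℝ _ _ = (0 : ℝ))
  have h5 := (h.isVAR hθ).eq_zero_of_lag_combination (m + 1) 0 (fun q => α (some q)) h4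
  ext q
  rcases q with _ | q
  · exact h3
  · exact congrFun h5 q

/-- Entries with the constant involve sums of the moving average itself, and all others involve sums
of products of two moving averages. The geometric bound on the companion powers supplies the
coefficients for both estimates. -/
lemma FinitePredictor.hasMoments (h : FinitePredictor P x u μ p) (hp : 0 < p) {θ : Param k p}
    (hθ : HasParam P x u μ θ) (m : ℕ) :
    HasMoments P (fun t ω => obs m μ (fun s => x s ω) (fun s => u s ω) t)
      (obsMoment P x u μ m) where
  memLp := h.memLp_obs m
  bound := by
    have hV := h.isVAR hθ
    obtain ⟨δ, C, hN⟩ := h.exists_isMixingNoise hθ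
    obtain ⟨K, ρ, hK, hρ0, hρ, hF⟩ := exists_geometric_bound (companion θ.1)
      (hV.tendsto_companion_pow hp)
    have hc : ∀ n a b, |IsVAR.maCoeff θ.1 hp n a b| ≤ K * ρ ^ n := fun n a b => hF n _ _
    have hZ : ∀ t a, Tendsto (fun M => maPartial (innovation P x u μ) (IsVAR.maCoeff θ.1 hp) M t a)
        atTop (𝓝 (zL2 P x u μ t a)) := fun t a => hV.hasMA hp t a
    have haz : ∀ᵐ ω ∂P, ∀ t a, zL2 P x u μ t a ω = zbar x u μ t ω a :=
      ae_all_iff.2 fun t => ae_all_iff.2 fun a => h.zL2_coeFn t a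
    have key : ∀ q r : ObsIdx k m, ∃ B : ℝ, 0 ≤ B ∧ ∀ I : Finset ℤ,
        eLpNorm (fun ω => ∑ t ∈ I, (obs m μ (fun s => x s ω) (fun s => u s ω) t q *
          obs m μ (fun s => x s ω) (fun s => u s ω) t r - obsMoment P x u μ m q r)) 2 P ≤
          ENNReal.ofReal (B * √(I.card : ℝ)) := by
      have mean : ∀ r : Fin (m + 1) × Joint k, ∃ B : ℝ, 0 ≤ B ∧ ∀ I : Finset ℤ,
          eLpNorm (fun ω => ∑ t ∈ I, zbar x u μ (t - (r.1 : ℕ)) ω r.2) 2 P ≤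
          ENNReal.ofReal (B * √(I.card : ℝ)) := by
        intro r
        obtain ⟨B, hB, hB'⟩ := exists_norm_sum_le hN hρ0 hρ hc hZ (r.1 : ℕ) r.2
        refine ⟨B, hB, fun I => ?_⟩
        refine le_trans (le_of_eq ?_) (ENNReal.ofReal_le_ofReal (hB' I))
        rw [Lp.norm_def, ENNReal.ofReal_toReal (Lp.memLp _).2.ne]
        refine eLpNorm_congr_ae ?_
        filter_upwards [Lp.coeFn_fun_finsetSum I fun t => zL2 P x u μ (t - (r.1 : ℕ)) r.2, haz]
          with ω h1 h2
        rw [h1]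
        exact Finset.sum_congr rfl fun t _ => (h2 _ _).symm
      intro q r
      rcases q with _ | q <;> rcases r with _ | r
      · refine ⟨0, le_rfl, fun I => ?_⟩
        simp [obs, obsMoment]
      · obtain ⟨B, hB, hB'⟩ := mean r
        refine ⟨B, hB, fun I => ?_⟩
        have : obsMoment P x u μ m none (some r) = 0 := by
          simp only [obsMoment, obs_some, obs_none, one_mul]
          exact h.mean_zero _ _
        simpa only [this, sub_zero, obs_some, obs_none, one_mul] using hB' I
      · obtain ⟨B, hB, hB'⟩ := mean q
        refine ⟨B, hB, fun I => ?_⟩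
        have : obsMoment P x u μ m (some q) none = 0 := by
          simp only [obsMoment, obs_some, obs_none, mul_one]
          exact h.mean_zero _ _
        simpa only [this, sub_zero, obs_some, obs_none, mul_one] using hB' I
      · obtain ⟨B, hB, hB'⟩ := exists_eLpNorm_sum_product_le hN hρ0 hρ hc hZ
          (q.1 : ℕ) (r.1 : ℕ) q.2 r.2
        refine ⟨B, hB, fun I => ?_⟩
        refine le_trans (le_of_eq (eLpNorm_congr_ae ?_)) (hB' I)
        filter_upwards [haz] with ω hω
        refine Finset.sum_congr rfl fun t _ => ?_
        rw [← h.integral_obs m t, obs_some, obs_some, hω, hω]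
        congr 1
        refine integral_congr_ae ?_
        filter_upwards [haz] with ω' hω'
        rw [obs_some, obs_some, hω', hω']
    choose B hB0 hB using key
    refine ⟨∑ q, ∑ r, B q r, Finset.sum_nonneg fun q _ => Finset.sum_nonneg fun r _ => hB0 q r,
      fun q r I => (hB q r I).trans (ENNReal.ofReal_le_ofReal
        (mul_le_mul_of_nonneg_right ?_ (Real.sqrt_nonneg _)))⟩
    calc B q r ≤ ∑ r, B q r := Finset.single_le_sum (f := fun r => B q r) (fun r _ => hB0 q r)
          (Finset.mem_univ r)
      _ ≤ _ := Finset.single_le_sum (f := fun q => ∑ r, B q r)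
          (fun q _ => Finset.sum_nonneg fun r _ => hB0 q r) (Finset.mem_univ q)

end Observed

/-! ### The estimators as functions of the second moments of `(1, z̄_t', …, z̄_{t-p}')'` -/

section Forms

variable {N : ℕ} {k : Fin N → ℕ} {p : ℕ}

/-- The coefficients of the entry `(n, c)` of `Z_{t-i}'`. -/
def zForm (μ : Reg k → ℝ) (i : Fin (p + 1)) (n : Fin N) : Coef k → ObsIdx k p → ℝ
  | Sum.inl m => if n = m then Pi.single none 1 else 0
  | Sum.inr c => if c.1 = n then Pi.single (some (i, Sum.inl c)) 1 + μ c • Pi.single none 1 else 0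

/-- The coefficients of `u_{t-i,n}`. -/
def uForm (i : Fin (p + 1)) (n : Fin N) : ObsIdx k p → ℝ := Pi.single (some (i, Sum.inr n)) 1

/-- The coefficients of the entry `n` of `u_{t-i} - Z_{t-i}' b`. -/
def wForm (μ : Reg k → ℝ) (b : Coef k → ℝ) (i : Fin (p + 1)) (n : Fin N) : ObsIdx k p → ℝ :=
  uForm i n - ∑ c, b c • zForm μ i n c

/-- The filter `A(L) = I - ∑ Φ_j L^j` applied to a family of linear forms. -/
def filt (Φ : Fin p → Matrix (Fin N) (Fin N) ℝ) {Q : Type*} (g : Fin (p + 1) → Fin N → Q → ℝ)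
    (n : Fin N) : Q → ℝ :=
  g 0 n - ∑ j : Fin p, ∑ m, Φ j n m • g j.succ m

/-- The coefficients of the entry `(n, c)` of `A(L) Z_t'`. -/
def fzForm (μ : Reg k → ℝ) (Φ : Fin p → Matrix (Fin N) (Fin N) ℝ) (n : Fin N) (c : Coef k) :
    ObsIdx k p → ℝ :=
  filt Φ (fun i m => zForm μ i m c) n

/-- Sample second moments of `v` over the dates in `I`. -/
def sampleMoment {Q : Type*} (v : ℤ → Q → ℝ) (I : Finset ℤ) (q r : Q) : ℝ := ∑ t ∈ I, v t q * v t r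

/-- The bridge from sums over dates to moment matrices: each entry of a sum in an estimator is such
a sum of products of two linear forms. -/
lemma sum_mul_eq_bil {Q : Type*} [Fintype Q] (v : ℤ → Q → ℝ) (I : Finset ℤ) (α β : Q → ℝ) :
    ∑ t ∈ I, (α ⬝ᵥ v t) * (β ⬝ᵥ v t) = bil (sampleMoment v I) α β := by
  simp only [bil, sampleMoment, dotProduct, Finset.sum_mul_sum]
  simp only [Finset.mul_sum]
  rw [Finset.sum_comm]
  refine Finset.sum_congr rfl fun q _ => ?_
  rw [Finset.sum_comm]
  refine Finset.sum_congr rfl fun r _ => Finset.sum_congr rfl fun t _ => by ring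

lemma bil_smul {Q : Type*} [Fintype Q] (c : ℝ) (V : Q → Q → ℝ) (α β : Q → ℝ) :
    bil (c • V) α β = c * bil V α β := by
  simp only [bil, Finset.mul_sum, Pi.smul_apply, smul_eq_mul]
  exact Finset.sum_congr rfl fun q _ => Finset.sum_congr rfl fun r _ => by ring

section BilLinear

variable {Q : Type*} [Fintype Q] (V : Q → Q → ℝ)

lemma bil_add_left (α β γ : Q → ℝ) : bil V (α + β) γ = bil V α γ + bil V β γ := by
  simp only [bil, ← Finset.sum_add_distrib, Pi.add_apply]
  exact Finset.sum_congr rfl fun q _ => Finset.sum_congr rfl fun r _ => by ring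

lemma bil_add_right (α β γ : Q → ℝ) : bil V α (β + γ) = bil V α β + bil V α γ := by
  simp only [bil, ← Finset.sum_add_distrib, Pi.add_apply]
  exact Finset.sum_congr rfl fun q _ => Finset.sum_congr rfl fun r _ => by ring

lemma bil_smul_left (c : ℝ) (α β : Q → ℝ) : bil V (c • α) β = c * bil V α β := by
  simp only [bil, Finset.mul_sum, Pi.smul_apply, smul_eq_mul]
  exact Finset.sum_congr rfl fun q _ => Finset.sum_congr rfl fun r _ => by ring

lemma bil_smul_right (c : ℝ) (α β : Q → ℝ) : bil V α (c • β) = c * bil V α β := by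
  simp only [bil, Finset.mul_sum, Pi.smul_apply, smul_eq_mul]
  exact Finset.sum_congr rfl fun q _ => Finset.sum_congr rfl fun r _ => by ring

/-- `bil V` as a bilinear map. -/
def bilMap : (Q → ℝ) →ₗ[ℝ] (Q → ℝ) →ₗ[ℝ] ℝ :=
  LinearMap.mk₂ ℝ (bil V) (bil_add_left V) (bil_smul_left V) (bil_add_right V)
    (bil_smul_right V)

lemma bil_sum_left {ι : Type*} (s : Finset ι) (f : ι → Q → ℝ) (β : Q → ℝ) :
    bil V (∑ i ∈ s, f i) β = ∑ i ∈ s, bil V (f i) β :=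
  map_sum ((bilMap V).flip β) f s

lemma bil_sum_right {ι : Type*} (s : Finset ι) (α : Q → ℝ) (f : ι → Q → ℝ) :
    bil V α (∑ i ∈ s, f i) = ∑ i ∈ s, bil V α (f i) :=
  map_sum (bilMap V α) f s

lemma bil_sub_left (α β γ : Q → ℝ) : bil V (α - β) γ = bil V α γ - bil V β γ :=
  map_sub ((bilMap V).flip γ) α β

lemma bil_sub_right (α β γ : Q → ℝ) : bil V α (β - γ) = bil V α β - bil V α γ :=
  map_sub (bilMap V α) β γ

lemma bil_zero_right (α : Q → ℝ) : bil V α 0 = 0 := map_zero (bilMap V α)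

lemma bil_comm {V : Q → Q → ℝ} (hV : ∀ q r, V q r = V r q) (α β : Q → ℝ) :
    bil V α β = bil V β α := by
  simp only [bil]
  rw [Finset.sum_comm]
  exact Finset.sum_congr rfl fun q _ => Finset.sum_congr rfl fun r _ => by rw [hV]; ring

end BilLinear

lemma design_inl (x : Reg k → ℝ) (n m : Fin N) : design x n (Sum.inl m) = if n = m then 1 else 0 := by
  simp [design, Matrix.one_apply]

lemma design_inr (x : Reg k → ℝ) (n : Fin N) (c : Reg k) :
    design x n (Sum.inr c) = if c.1 = n then x c else 0 := by
  simp [design]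

/-- The term with `μ c` undoes the centring of the regressor in the observation vector. -/
lemma zForm_dotProduct (μ : Reg k → ℝ) (x : ℤ → Reg k → ℝ) (u : ℤ → Fin N → ℝ) (t : ℤ)
    (i : Fin (p + 1)) (n : Fin N) (c : Coef k) :
    zForm μ i n c ⬝ᵥ obs p μ x u t = design (x (t - (i : ℕ))) n c := by
  rcases c with m | c
  · rw [design_inl]
    simp only [zForm]
    split_ifs
    · simp [obs]
    · simp
  · rw [design_inr]
    simp only [zForm]
    split_ifs
    · simp [add_dotProduct, smul_dotProduct, obs]
    · simp

lemma uForm_dotProduct (μ : Reg k → ℝ) (x : ℤ → Reg k → ℝ) (u : ℤ → Fin N → ℝ) (t : ℤ)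
    (i : Fin (p + 1)) (n : Fin N) :
    uForm i n ⬝ᵥ obs p μ x u t = u (t - (i : ℕ)) n := by
  simp [uForm, obs]

lemma sum_smul_dotProduct {Q ι : Type*} [Fintype Q] (s : Finset ι) (b : ι → ℝ) (f : ι → Q → ℝ)
    (v : Q → ℝ) : (∑ c ∈ s, b c • f c) ⬝ᵥ v = ∑ c ∈ s, b c * (f c ⬝ᵥ v) := by
  rw [sum_dotProduct]
  exact Finset.sum_congr rfl fun c _ => smul_dotProduct _ _ _

lemma wForm_dotProduct (μ : Reg k → ℝ) (x : ℤ → Reg k → ℝ) (u : ℤ → Fin N → ℝ) (t : ℤ)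
    (b : Coef k → ℝ) (i : Fin (p + 1)) (n : Fin N) :
    wForm μ b i n ⬝ᵥ obs p μ x u t =
      u (t - (i : ℕ)) n - Matrix.mulVec (design (x (t - (i : ℕ)))) b n := by
  rw [wForm, sub_dotProduct, uForm_dotProduct, sum_smul_dotProduct]
  congr 1
  simp only [zForm_dotProduct]
  simp only [Matrix.mulVec, dotProduct]
  exact Finset.sum_congr rfl fun c _ => mul_comm _ _

lemma filt_dotProduct {Q : Type*} [Fintype Q] (Φ : Fin p → Matrix (Fin N) (Fin N) ℝ)
    (g : Fin (p + 1) → Fin N → Q → ℝ) (v : Q → ℝ) (w : ℤ → Fin N → ℝ) (t : ℤ)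
    (h : ∀ i n, g i n ⬝ᵥ v = w (t - (i : ℕ)) n) (n : Fin N) :
    filt Φ g n ⬝ᵥ v = filterVec Φ w t n := by
  rw [filt, sub_dotProduct, h, sum_dotProduct, filterVec, Pi.sub_apply, Finset.sum_apply]
  congr 1
  · simp
  · refine Finset.sum_congr rfl fun j _ => ?_
    rw [sum_smul_dotProduct]
    simp only [h, Fin.val_succ, Nat.cast_add, Nat.cast_one]
    simp only [Matrix.mulVec, dotProduct]

lemma fzForm_dotProduct (μ : Reg k → ℝ) (x : ℤ → Reg k → ℝ) (u : ℤ → Fin N → ℝ) (t : ℤ)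
    (Φ : Fin p → Matrix (Fin N) (Fin N) ℝ) (n : Fin N) (c : Coef k) :
    fzForm μ Φ n c ⬝ᵥ obs p μ x u t = filterDesign Φ x t n c := by
  rw [fzForm, filt_dotProduct Φ _ _ (fun s m => design (x s) m c) t
    (fun i n => zForm_dotProduct μ x u t i n c)]
  simp only [filterVec, filterDesign, Pi.sub_apply, Finset.sum_apply, Matrix.sub_apply,
    Matrix.sum_apply, Matrix.mulVec, dotProduct, Matrix.mul_apply]

/-- `∑_t Z_t Z_t'` in terms of the moments. -/
def olsGram (μ : Reg k → ℝ) (V : ObsIdx k p → ObsIdx k p → ℝ) : Matrix (Coef k) (Coef k) ℝ :=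
  Matrix.of fun c d => ∑ n, bil V (zForm μ 0 n c) (zForm μ 0 n d)

/-- `∑_t Z_t u_t` in terms of the moments. -/
def olsCross (μ : Reg k → ℝ) (V : ObsIdx k p → ObsIdx k p → ℝ) (c : Coef k) : ℝ :=
  ∑ n, bil V (zForm μ 0 n c) (uForm 0 n)

/-- The OLS estimator in terms of the moments. -/
def olsFun (μ : Reg k → ℝ) (κ : Coef k → ℝ) (V : ObsIdx k p → ObsIdx k p → ℝ) : Coef k → ℝ :=
  Matrix.mulVec (olsGram μ V)⁻¹ (olsCross μ V + Matrix.mulVec (olsGram μ V) κ)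

/-- The Gram matrix of the lagged residuals `u - Z' b` in terms of the moments. -/
def lagGram (μ : Reg k → ℝ) (V : ObsIdx k p → ObsIdx k p → ℝ) (b : Coef k → ℝ) :
    Matrix (Fin p × Fin N) (Fin p × Fin N) ℝ :=
  Matrix.of fun q r => bil V (wForm μ b q.1.succ q.2) (wForm μ b r.1.succ r.2)

/-- The cross moments of the residuals `u - Z' b` with their lags in terms of the moments. -/
def lagCross (μ : Reg k → ℝ) (V : ObsIdx k p → ObsIdx k p → ℝ) (b : Coef k → ℝ) :
    Matrix (Fin N) (Fin p × Fin N) ℝ :=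
  Matrix.of fun n r => bil V (wForm μ b 0 n) (wForm μ b r.1.succ r.2)

/-- The VAR coefficients fitted to `u - Z' b` in terms of the moments. -/
def varFun (μ : Reg k → ℝ) (V : ObsIdx k p → ObsIdx k p → ℝ) (b : Coef k → ℝ) (j : Fin p) :
    Matrix (Fin N) (Fin N) ℝ :=
  Matrix.of fun a c => (lagCross μ V b * (lagGram μ V b)⁻¹) a (j, c)

/-- The residual second moments of the VAR with coefficients `Φ` for `u - Z' b`. -/
def covFun (μ : Reg k → ℝ) (V : ObsIdx k p → ObsIdx k p → ℝ) (b : Coef k → ℝ)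
    (Φ : Fin p → Matrix (Fin N) (Fin N) ℝ) : Matrix (Fin N) (Fin N) ℝ :=
  Matrix.of fun a c => bil V (filt Φ (wForm μ b) a) (filt Φ (wForm μ b) c)

/-- `∑_t Z̃_t S⁻¹ Z̃_t'` in terms of the moments. -/
def glsGram (μ : Reg k → ℝ) (V : ObsIdx k p → ObsIdx k p → ℝ)
    (Φ : Fin p → Matrix (Fin N) (Fin N) ℝ) (S : Matrix (Fin N) (Fin N) ℝ) :
    Matrix (Coef k) (Coef k) ℝ :=
  Matrix.of fun c d => ∑ n, ∑ m, S⁻¹ n m * bil V (fzForm μ Φ n c) (fzForm μ Φ m d)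

/-- `∑_t Z̃_t S⁻¹ A(L) u_t` in terms of the moments. -/
def glsCross (μ : Reg k → ℝ) (V : ObsIdx k p → ObsIdx k p → ℝ)
    (Φ : Fin p → Matrix (Fin N) (Fin N) ℝ) (S : Matrix (Fin N) (Fin N) ℝ) (c : Coef k) : ℝ :=
  ∑ n, ∑ m, S⁻¹ n m * bil V (fzForm μ Φ n c) (filt Φ uForm m)

/-- The GLS estimator in terms of the moments. -/
def glsFun (μ : Reg k → ℝ) (κ : Coef k → ℝ) (V : ObsIdx k p → ObsIdx k p → ℝ)
    (Φ : Fin p → Matrix (Fin N) (Fin N) ℝ) (S : Matrix (Fin N) (Fin N) ℝ) : Coef k → ℝ :=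
  Matrix.mulVec (glsGram μ V Φ S)⁻¹ (glsCross μ V Φ S + Matrix.mulVec (glsGram μ V Φ S) κ)

variable (μ : Reg k → ℝ) (κ : Coef k → ℝ) (x : ℤ → Reg k → ℝ) (u : ℤ → Fin N → ℝ) (T : ℕ)

/-- Substitute `y = Z' κ + u` in the normal equations. Since `olsFun` keeps the Gram matrix times
`κ` under the inverse, the identity also holds when the Gram matrix is singular. -/
lemma ols_eq (p : ℕ) : ols x (response κ x u) T =
    olsFun μ κ (sampleMoment (obs p μ x u) (Finset.Icc (1 : ℤ) T)) := by
  have hM : ∑ t ∈ Finset.Icc (1 : ℤ) T, (design (x t)).transpose * design (x t) =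
      olsGram μ (sampleMoment (obs p μ x u) (Finset.Icc (1 : ℤ) T)) := by
    ext c d
    simp only [Matrix.sum_apply, Matrix.mul_apply, Matrix.transpose_apply, olsGram, Matrix.of_apply,
      ← sum_mul_eq_bil, zForm_dotProduct]
    rw [Finset.sum_comm]
    simp
  rw [ols, olsFun, ← hM]
  congr 1
  ext c
  have h1 : ∀ t, Matrix.mulVec (design (x t)).transpose (response κ x u t) =
      Matrix.mulVec (design (x t)).transpose (u t) +
        Matrix.mulVec ((design (x t)).transpose * design (x t)) κ := by
    intro t
    rw [response, add_comm, Matrix.mulVec_add, Matrix.mulVec_mulVec]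
  simp only [h1, Finset.sum_add_distrib]
  rw [Matrix.sum_mulVec]
  simp only [Pi.add_apply]
  congr 1
  simp only [olsCross, ← sum_mul_eq_bil, zForm_dotProduct, uForm_dotProduct, Finset.sum_apply]
  simp only [Matrix.mulVec, dotProduct, Matrix.transpose_apply]
  rw [Finset.sum_comm]
  simp

lemma filterVec_response {p : ℕ} (Φ : Fin p → Matrix (Fin N) (Fin N) ℝ) (t : ℤ) :
    filterVec Φ (response κ x u) t = filterVec Φ u t + Matrix.mulVec (filterDesign Φ x t) κ := by
  simp only [filterVec, filterDesign, response, Matrix.mulVec_add, Matrix.sub_mulVec,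
    Matrix.sum_mulVec, Matrix.mulVec_mulVec, Finset.sum_add_distrib]
  abel

lemma gls_eq (Φ : Fin p → Matrix (Fin N) (Fin N) ℝ) (S : Matrix (Fin N) (Fin N) ℝ) :
    gls Φ S x (response κ x u) T =
    glsFun μ κ (sampleMoment (obs p μ x u) (Finset.Icc ((p : ℤ) + 1) T)) Φ S := by
  have hM : ∑ t ∈ Finset.Icc ((p : ℤ) + 1) T,
      (filterDesign Φ x t).transpose * S⁻¹ * filterDesign Φ x t =
      glsGram μ (sampleMoment (obs p μ x u) (Finset.Icc ((p : ℤ) + 1) T)) Φ S := by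
    ext c d
    simp only [Matrix.sum_apply, Matrix.mul_apply, Matrix.transpose_apply, glsGram, Matrix.of_apply,
      ← sum_mul_eq_bil, fzForm_dotProduct, Finset.sum_mul, Finset.mul_sum]
    rw [Finset.sum_comm]
    conv_lhs => enter [2, m]; rw [Finset.sum_comm]
    rw [Finset.sum_comm]
    refine Finset.sum_congr rfl fun n _ => Finset.sum_congr rfl fun m _ =>
      Finset.sum_congr rfl fun t _ => by ring
  rw [gls, glsFun, ← hM]
  congr 1
  ext c
  have h1 : ∀ t, Matrix.mulVec ((filterDesign Φ x t).transpose * S⁻¹)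
      (filterVec Φ (response κ x u) t) =
      Matrix.mulVec ((filterDesign Φ x t).transpose * S⁻¹) (filterVec Φ u t) +
        Matrix.mulVec ((filterDesign Φ x t).transpose * S⁻¹ * filterDesign Φ x t) κ := by
    intro t
    rw [filterVec_response, Matrix.mulVec_add, Matrix.mulVec_mulVec]
  simp only [h1, Finset.sum_add_distrib]
  rw [Matrix.sum_mulVec]
  simp only [Pi.add_apply]
  congr 1
  have h2 : ∀ t m, filt Φ uForm m ⬝ᵥ obs p μ x u t = filterVec Φ u t m := fun t m =>
    filt_dotProduct Φ _ _ u t (fun i n => uForm_dotProduct μ x u t i n) m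
  simp only [glsCross, ← sum_mul_eq_bil, fzForm_dotProduct, h2, Finset.sum_apply]
  simp only [Matrix.mulVec, dotProduct, Matrix.mul_apply, Matrix.transpose_apply, Finset.sum_mul,
    Finset.mul_sum]
  rw [Finset.sum_comm]
  conv_lhs => enter [2, m]; rw [Finset.sum_comm]
  rw [Finset.sum_comm]
  refine Finset.sum_congr rfl fun n _ => Finset.sum_congr rfl fun m _ =>
    Finset.sum_congr rfl fun t _ => by ring

/-- The path `u_t - Z_t' b`. -/
def resid (b : Coef k → ℝ) (t : ℤ) : Fin N → ℝ := u t - Matrix.mulVec (design (x t)) b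

lemma wForm_dotProduct_obs (b : Coef k → ℝ) (t : ℤ) (i : Fin (p + 1)) (n : Fin N) :
    wForm μ b i n ⬝ᵥ obs p μ x u t = resid x u b (t - (i : ℕ)) n :=
  wForm_dotProduct μ x u t b i n

/-- The residuals depend on the data through `u` and the estimation error only, so the VAR step can
be studied for the paths `u - Z' b` with `b` arbitrary. -/
lemma olsResidual_eq : olsResidual x (response κ x u) T =
    resid x u (ols x (response κ x u) T - κ) := by
  funext t
  simp only [olsResidual, resid, response, Matrix.mulVec_sub]
  abel

lemma varFit_eq (b : Coef k → ℝ) : varFit p (resid x u b) T =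
    varFun μ (sampleMoment (obs p μ x u) (Finset.Icc ((p : ℤ) + 1) T)) b := by
  have hG : ∑ t ∈ Finset.Icc ((p : ℤ) + 1) T,
      Matrix.vecMulVec (lagStack p (resid x u b) t) (lagStack p (resid x u b) t) =
      lagGram μ (sampleMoment (obs p μ x u) (Finset.Icc ((p : ℤ) + 1) T)) b := by
    ext q r
    simp only [Matrix.sum_apply, Matrix.vecMulVec_apply, lagGram, Matrix.of_apply,
      ← sum_mul_eq_bil, wForm_dotProduct_obs, lagStack, Fin.val_succ, Nat.cast_add, Nat.cast_one]
  have hC : ∑ t ∈ Finset.Icc ((p : ℤ) + 1) T,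
      Matrix.vecMulVec (resid x u b t) (lagStack p (resid x u b) t) =
      lagCross μ (sampleMoment (obs p μ x u) (Finset.Icc ((p : ℤ) + 1) T)) b := by
    ext q r
    simp only [Matrix.sum_apply, Matrix.vecMulVec_apply, lagCross, Matrix.of_apply,
      ← sum_mul_eq_bil, wForm_dotProduct_obs, lagStack, Fin.val_succ, Nat.cast_add, Nat.cast_one,
      Fin.val_zero, Nat.cast_zero, sub_zero]
  funext j
  rw [varFit, varFun, hG, hC]

lemma varFitCov_eq (b : Coef k → ℝ) : varFitCov p (resid x u b) T =
    ((T : ℝ) - p)⁻¹ • covFun μ (sampleMoment (obs p μ x u) (Finset.Icc ((p : ℤ) + 1) T)) b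
      (varFun μ (sampleMoment (obs p μ x u) (Finset.Icc ((p : ℤ) + 1) T)) b) := by
  rw [varFitCov, ← varFit_eq]
  congr 1
  ext a c
  simp only [Matrix.sum_apply, Matrix.vecMulVec_apply, covFun, Matrix.of_apply, ← sum_mul_eq_bil]
  have h : ∀ t n, filt (varFit p (resid x u b) T) (wForm μ b) n ⬝ᵥ obs p μ x u t =
      filterVec (varFit p (resid x u b) T) (resid x u b) t n := fun t n =>
    filt_dotProduct _ _ _ _ t (fun i n => wForm_dotProduct_obs μ x u b t i n) n
  simp only [h]

/-- Singular matrices need no exception, since their inverse is zero by convention. This makes the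
scale invariance of the estimators unconditional. -/
lemma inv_smul_of_ne_zero {n : Type*} [Fintype n] [DecidableEq n] {c : ℝ} (hc : c ≠ 0)
    (M : Matrix n n ℝ) : (c • M)⁻¹ = c⁻¹ • M⁻¹ := by
  by_cases h : IsUnit M.det
  · let _ : Invertible c := invertibleOfNonzero hc
    rw [Matrix.inv_smul M c h, invOf_eq_inv]
  · rw [Matrix.nonsing_inv_apply_not_isUnit M h, smul_zero, Matrix.nonsing_inv_apply_not_isUnit]
    rw [Matrix.det_smul]
    simpa [isUnit_iff_ne_zero, hc] using h

section Scaling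

variable {c : ℝ} (V : ObsIdx k p → ObsIdx k p → ℝ)

lemma olsGram_smul (c : ℝ) : olsGram μ (c • V) = c • olsGram μ V := by
  ext a b
  simp [olsGram, bil_smul, Finset.mul_sum]

lemma olsCross_smul (c : ℝ) : olsCross μ (c • V) = c • olsCross μ V := by
  ext a
  simp [olsCross, bil_smul, Finset.mul_sum]

lemma olsFun_smul (hc : c ≠ 0) : olsFun μ κ (c • V) = olsFun μ κ V := by
  rw [olsFun, olsFun, olsGram_smul, olsCross_smul, inv_smul_of_ne_zero hc, Matrix.smul_mulVec,
    Matrix.smul_mulVec, ← smul_add, Matrix.mulVec_smul, smul_smul, inv_mul_cancel₀ hc, one_smul]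

lemma varFun_smul (hc : c ≠ 0) (b : Coef k → ℝ) : varFun μ (c • V) b = varFun μ V b := by
  have h1 : lagGram μ (c • V) b = c • lagGram μ V b := by ext; simp [lagGram, bil_smul]
  have h2 : lagCross μ (c • V) b = c • lagCross μ V b := by ext; simp [lagCross, bil_smul]
  funext j
  rw [varFun, varFun, h1, h2, inv_smul_of_ne_zero hc, Matrix.smul_mul, Matrix.mul_smul, smul_smul,
    mul_inv_cancel₀ hc, one_smul]

lemma covFun_smul (c : ℝ) (b : Coef k → ℝ) (Φ : Fin p → Matrix (Fin N) (Fin N) ℝ) :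
    covFun μ (c • V) b Φ = c • covFun μ V b Φ := by
  ext; simp [covFun, bil_smul]

lemma glsGram_smul (c : ℝ) (Φ : Fin p → Matrix (Fin N) (Fin N) ℝ) (S : Matrix (Fin N) (Fin N) ℝ) :
    glsGram μ (c • V) Φ S = c • glsGram μ V Φ S := by
  ext a b
  simp only [glsGram, bil_smul, Finset.mul_sum, Matrix.of_apply, Matrix.smul_apply, smul_eq_mul]
  exact Finset.sum_congr rfl fun n _ => Finset.sum_congr rfl fun m _ => by ring

lemma glsCross_smul (c : ℝ) (Φ : Fin p → Matrix (Fin N) (Fin N) ℝ) (S : Matrix (Fin N) (Fin N) ℝ) :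
    glsCross μ (c • V) Φ S = c • glsCross μ V Φ S := by
  ext a
  simp only [glsCross, bil_smul, Finset.mul_sum, Pi.smul_apply, smul_eq_mul]
  exact Finset.sum_congr rfl fun n _ => Finset.sum_congr rfl fun m _ => by ring

lemma glsFun_smul (hc : c ≠ 0) (Φ : Fin p → Matrix (Fin N) (Fin N) ℝ)
    (S : Matrix (Fin N) (Fin N) ℝ) : glsFun μ κ (c • V) Φ S = glsFun μ κ V Φ S := by
  rw [glsFun, glsFun, glsGram_smul, glsCross_smul, inv_smul_of_ne_zero hc, Matrix.smul_mulVec,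
    Matrix.smul_mulVec, ← smul_add, Matrix.mulVec_smul, smul_smul, inv_mul_cancel₀ hc, one_smul]

/-- The weight enters the Gram matrix and the cross moment with the same factor, which cancels. The
divisor used in the residual covariance is thus immaterial for GLS. -/
lemma glsFun_smul_cov (hc : c ≠ 0) (Φ : Fin p → Matrix (Fin N) (Fin N) ℝ)
    (S : Matrix (Fin N) (Fin N) ℝ) : glsFun μ κ V Φ (c • S) = glsFun μ κ V Φ S := by
  have h1 : glsGram μ V Φ (c • S) = c⁻¹ • glsGram μ V Φ S := by
    ext a b
    simp only [glsGram, inv_smul_of_ne_zero hc, Finset.mul_sum, Matrix.of_apply, Matrix.smul_apply,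
      smul_eq_mul, mul_assoc]
  have h2 : glsCross μ V Φ (c • S) = c⁻¹ • glsCross μ V Φ S := by
    ext a
    simp only [glsCross, inv_smul_of_ne_zero hc, Finset.mul_sum, Pi.smul_apply, Matrix.smul_apply,
      smul_eq_mul, mul_assoc]
  have hc' := inv_ne_zero hc
  rw [glsFun, glsFun, h1, h2, inv_smul_of_ne_zero hc', Matrix.smul_mulVec,
    Matrix.smul_mulVec, ← smul_add, Matrix.mulVec_smul, smul_smul, inv_mul_cancel₀ hc', one_smul]

end Scaling

/-- The CO-type estimator in terms of the moments used by its three steps. -/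
def coFun (μ : Reg k → ℝ) (κ : Coef k → ℝ) (V₀ V : ObsIdx k p → ObsIdx k p → ℝ) : Coef k → ℝ :=
  glsFun μ κ V (varFun μ V (olsFun μ κ V₀ - κ))
    (covFun μ V (olsFun μ κ V₀ - κ) (varFun μ V (olsFun μ κ V₀ - κ)))

/-- All steps are invariant under rescaling of the moments, so each may be fed averages. Two moment
matrices are needed, because OLS sums from date `1` and the later steps from `p + 1`; `p < T` keeps
the divisor `T - p` nonzero. -/
lemma coEstimator_eq (hT : p < T) : coEstimator p x (response κ x u) T =
    coFun μ κ ((T : ℝ)⁻¹ • sampleMoment (obs p μ x u) (Finset.Icc (1 : ℤ) T))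
      ((T : ℝ)⁻¹ • sampleMoment (obs p μ x u) (Finset.Icc ((p : ℤ) + 1) T)) := by
  have hT0 : (T : ℝ)⁻¹ ≠ 0 := by
    have : 0 < T := by omega
    positivity
  have hTp : ((T : ℝ) - p)⁻¹ ≠ 0 := by
    have : (p : ℝ) < T := by exact_mod_cast hT
    exact inv_ne_zero (by linarith)
  rw [coEstimator, coFun, olsFun_smul _ _ _ hT0, varFun_smul _ _ hT0, covFun_smul,
    glsFun_smul_cov _ _ _ hT0, glsFun_smul _ _ _ hT0, gls_eq μ, olsResidual_eq, varFit_eq μ,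
    varFitCov_eq μ, glsFun_smul_cov _ _ _ hTp, ols_eq μ κ x u T p]

end Forms

/-! ### Positivity and least squares -/

section LeastSquares

variable {Q : Type*} [Fintype Q] {V : Q → Q → ℝ}

lemma bil_eq_dotProduct (V : Q → Q → ℝ) (α β : Q → ℝ) :
    bil V α β = α ⬝ᵥ Matrix.mulVec (Matrix.of V) β := by
  simp only [bil, dotProduct, Matrix.mulVec, Matrix.of_apply, Finset.mul_sum]
  exact Finset.sum_congr rfl fun q _ => Finset.sum_congr rfl fun r _ => by ring

lemma symm_of_posDef (hV : (Matrix.of V).PosDef) (q r : Q) : V q r = V r q := by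
  have := hV.isHermitian.apply q r
  simpa using this.symm

lemma bil_pos (hV : (Matrix.of V).PosDef) {α : Q → ℝ} (hα : α ≠ 0) : 0 < bil V α α := by
  rw [bil_eq_dotProduct]
  exact hV.dotProduct_mulVec_pos hα

lemma bil_nonneg (hV : (Matrix.of V).PosDef) (α : Q → ℝ) : 0 ≤ bil V α α := by
  rw [bil_eq_dotProduct]
  exact hV.posSemidef.dotProduct_mulVec_nonneg α

lemma eq_zero_of_bil (hV : (Matrix.of V).PosDef) {α : Q → ℝ} (h : bil V α α = 0) : α = 0 := by
  by_contra hα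
  exact (bil_pos hV hα).ne' h

lemma posDef_of_bil {n : Type*} [Fintype n] {M : Matrix n n ℝ} (hs : ∀ a b, M a b = M b a)
    (h : ∀ α : n → ℝ, α ≠ 0 → 0 < ∑ a, ∑ b, α a * α b * M a b) : M.PosDef := by
  refine Matrix.PosDef.of_dotProduct_mulVec_pos (Matrix.IsHermitian.ext fun a b => by simp [hs])
    fun α hα => ?_
  have := h α hα
  refine this.trans_eq ?_
  simp only [dotProduct, Matrix.mulVec, star_trivial, Finset.mul_sum]
  exact Finset.sum_congr rfl fun q _ => Finset.sum_congr rfl fun r _ => by ring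

lemma bil_le_of_orthogonal (hV : (Matrix.of V).PosDef) {e g : Q → ℝ} (h : bil V e g = 0) :
    bil V e e ≤ bil V (e + g) (e + g) := by
  rw [bil_add_left, bil_add_right, bil_add_right, bil_comm (symm_of_posDef hV) g e, h]
  linarith [bil_nonneg hV g]

lemma bil_eq_zero_of_minimal (hV : (Matrix.of V).PosDef) {e g : Q → ℝ}
    (h : ∀ s : ℝ, bil V e e ≤ bil V (e + s • g) (e + s • g)) : bil V e g = 0 := by
  have hc := bil_nonneg hV g
  set b := bil V e g with hb
  set c := bil V g g with hcdef
  have key : ∀ s : ℝ, 0 ≤ 2 * s * b + s ^ 2 * c := by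
    intro s
    have := h s
    rw [bil_add_left, bil_add_right, bil_add_right, bil_smul_left, bil_smul_right, bil_smul_left,
      bil_smul_right, bil_comm (symm_of_posDef hV) g e, ← hb, ← hcdef] at this
    nlinarith
  -- The minimizing step would be `-b / c`; the denominator `1 + c` avoids the case `c = 0` and
  -- still gives a strict decrease unless `b = 0`.
  have h1 := key (-b / (1 + c))
  have h2 : 2 * (-b / (1 + c)) * b + (-b / (1 + c)) ^ 2 * c = -(b ^ 2 * (2 + c)) / (1 + c) ^ 2 := by
    field_simp; ring
  rw [h2, le_div_iff₀ (by positivity)] at h1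
  have h3 : b ^ 2 * (2 + c) ≤ 0 := by linarith
  have h4 : b ^ 2 ≤ 0 := by nlinarith [sq_nonneg b]
  exact pow_eq_zero_iff two_ne_zero |>.1 (le_antisymm h4 (sq_nonneg b))

/-- The weighted form `∑ W_{nm} α_n' V β_m`, as a form on families of vectors. -/
def wKernel {n : Type*} (W : Matrix n n ℝ) (V : Q → Q → ℝ) (a b : n × Q) : ℝ :=
  W a.1 b.1 * V a.2 b.2

/-- A Kronecker product of positive definite matrices is positive definite. Weighted least squares
becomes ordinary least squares for a single form on families of vectors. -/
lemma wKernel_posDef {n : Type*} [Fintype n] {W : Matrix n n ℝ} (hW : W.PosDef)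
    (hV : (Matrix.of V).PosDef) : (Matrix.of (wKernel W V)).PosDef :=
  Matrix.PosDef.kronecker hW hV

lemma bil_wKernel {n : Type*} [Fintype n] (W : Matrix n n ℝ) (V : Q → Q → ℝ) (f g : n → Q → ℝ) :
    bil (wKernel W V) (fun a => f a.1 a.2) (fun a => g a.1 a.2) =
      ∑ i, ∑ j, W i j * bil V (f i) (g j) := by
  simp only [bil, wKernel, Fintype.sum_prod_type, Finset.mul_sum]
  refine Finset.sum_congr rfl fun i _ => ?_
  rw [Finset.sum_comm]
  refine Finset.sum_congr rfl fun j _ => Finset.sum_congr rfl fun q _ =>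
    Finset.sum_congr rfl fun r _ => by ring

lemma isUnit_det_of_definite {n : Type*} [Fintype n] [DecidableEq n] {M : Matrix n n ℝ}
    (h : ∀ v, v ⬝ᵥ Matrix.mulVec M v = 0 → v = 0) : IsUnit M.det := by
  rw [isUnit_iff_ne_zero]
  intro h0
  obtain ⟨v, hv, hMv⟩ := Matrix.exists_mulVec_eq_zero_iff.2 h0
  exact hv (h v (by rw [hMv, dotProduct_zero]))

end LeastSquares

/-! ### Nondegeneracy of the population normal equations -/

section Population

variable {N : ℕ} {k : Fin N → ℕ} {p : ℕ} {μ : Reg k → ℝ} {V : ObsIdx k p → ObsIdx k p → ℝ}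

/-- The properties of a population moment matrix that matter for the limits of the estimators. -/
structure IsPopMoment (μ : Reg k → ℝ) (V : ObsIdx k p → ObsIdx k p → ℝ) : Prop where
  posDef : (Matrix.of V).PosDef
  stat : ∀ b (i j : Fin p) n m, bil V (wForm μ b i.succ n) (wForm μ b j.succ m) =
    bil V (wForm μ b i.castSucc n) (wForm μ b j.castSucc m)

lemma zForm_inr_apply (i j : Fin (p + 1)) (n : Fin N) (v : Coef k → ℝ) (m : Fin N) :
    (∑ c, v c • zForm μ i n c) (some (j, Sum.inr m)) = 0 := by
  simp only [Finset.sum_apply, Pi.smul_apply]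
  refine Finset.sum_eq_zero fun c _ => ?_
  rcases c with m | c <;> simp only [zForm] <;> split_ifs <;> simp

lemma zForm_sum_inl (i : Fin (p + 1)) (n : Fin N) (v : Coef k → ℝ) (j : Fin (p + 1)) (c : Reg k) :
    (∑ c, v c • zForm μ i n c) (some (j, Sum.inl c)) =
      if j = i ∧ c.1 = n then v (Sum.inr c) else 0 := by
  simp only [Finset.sum_apply, Pi.smul_apply, Fintype.sum_sum_type]
  rw [Finset.sum_eq_zero, zero_add, Finset.sum_eq_single c]
  · simp only [zForm]
    by_cases h1 : c.1 = n <;> by_cases h2 : j = i <;> simp [h1, h2]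
  · intro d _ hd
    simp only [zForm]
    split_ifs <;> simp [Ne.symm hd]
  · simp
  · intro m _
    simp only [zForm]
    split_ifs <;> simp

lemma zForm_sum_none (i : Fin (p + 1)) (n : Fin N) (v : Coef k → ℝ) (hv : ∀ c, v (Sum.inr c) = 0) :
    (∑ c, v c • zForm μ i n c) = v (Sum.inl n) • Pi.single none 1 := by
  rw [Fintype.sum_sum_type]
  simp only [hv, zero_smul, Finset.sum_const_zero, add_zero, zForm]
  simp

lemma wForm_apply_inr (b : Coef k → ℝ) (i j : Fin (p + 1)) (n m : Fin N) :
    wForm μ b i n (some (j, Sum.inr m)) = if j = i ∧ m = n then 1 else 0 := by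
  rw [wForm, Pi.sub_apply, zForm_inr_apply, sub_zero, uForm, Pi.single_apply]
  simp

lemma bil_eq_mulVec_quad {n ι : Type*} [Fintype n] [Fintype ι] {M : Matrix n n ℝ} {Q : Type*}
    [Fintype Q] (V : Q → Q → ℝ) (f : ι → n → Q → ℝ)
    (hM : ∀ c d, M c d = ∑ i, bil V (f i c) (f i d)) (v w : n → ℝ) :
    v ⬝ᵥ Matrix.mulVec M w = ∑ i, bil V (∑ c, v c • f i c) (∑ c, w c • f i c) := by
  simp only [bil_sum_left, bil_sum_right, bil_smul_left, bil_smul_right, dotProduct, Matrix.mulVec,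
    hM, Finset.mul_sum, Finset.sum_mul]
  conv_lhs => enter [2, c]; rw [Finset.sum_comm]
  rw [Finset.sum_comm]
  refine Finset.sum_congr rfl fun i _ => ?_
  rw [Finset.sum_comm]
  refine Finset.sum_congr rfl fun c _ => Finset.sum_congr rfl fun d _ => by ring

namespace IsPopMoment

variable (hV : IsPopMoment μ V)

/-- A null vector gives vanishing linear forms. The coordinate of each regressor at lag zero shows
that the slopes vanish, and then the coordinate of the constant shows that the intercepts do. -/
lemma olsGram_definite (hV : IsPopMoment μ V) (v : Coef k → ℝ)
    (h : v ⬝ᵥ Matrix.mulVec (olsGram μ V) v = 0) : v = 0 := by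
  rw [bil_eq_mulVec_quad (M := olsGram μ V) V (fun n c => zForm μ 0 n c) (fun c d => rfl)] at h
  have h1 := (Finset.sum_eq_zero_iff_of_nonneg fun n _ => bil_nonneg hV.posDef _).1 h
  have h2 : ∀ n, ∑ c, v c • zForm (p := p) μ 0 n c = 0 := fun n =>
    eq_zero_of_bil hV.posDef (h1 n (Finset.mem_univ n))
  have h3 : ∀ c, v (Sum.inr c) = 0 := by
    intro c
    have := congrFun (h2 c.1) (some (0, Sum.inl c))
    rwa [zForm_sum_inl, if_pos ⟨rfl, rfl⟩] at this
  ext c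
  rcases c with n | c
  · have := congrFun (h2 n) none
    rw [zForm_sum_none 0 n v h3] at this
    simpa using this
  · exact h3 c

lemma olsGram_isUnit (hV : IsPopMoment μ V) : IsUnit (olsGram μ V).det :=
  isUnit_det_of_definite hV.olsGram_definite

/-- Among the lagged residual forms, the disturbance of a given lag and equation occurs in exactly
one, with coefficient one; the regressor part does not touch these coordinates. -/
lemma lagGram_isUnit (hV : IsPopMoment μ V) (b : Coef k → ℝ) : IsUnit (lagGram μ V b).det := by
  refine isUnit_det_of_definite fun v h => ?_
  rw [bil_eq_mulVec_quad V (fun (_ : Unit) q => wForm μ b q.1.succ q.2)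
    (fun c d => by simp [lagGram])] at h
  simp only [Finset.univ_unique, Finset.sum_const, Finset.card_singleton, one_smul] at h
  have h1 := eq_zero_of_bil hV.posDef h
  ext ⟨i, n⟩
  have := congrFun h1 (some (i.succ, Sum.inr n))
  simp only [Finset.sum_apply, Pi.smul_apply, wForm_apply_inr, Fin.succ_inj, Pi.zero_apply,
    Fintype.sum_prod_type, smul_eq_mul, mul_ite, mul_one, mul_zero] at this
  rw [Finset.sum_eq_single i (fun j _ hj => by simp [Ne.symm hj]) (by simp)] at this
  simpa using this

lemma filt_wForm_apply (b : Coef k → ℝ) (Φ : Fin p → Matrix (Fin N) (Fin N) ℝ) (n m : Fin N) :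
    filt Φ (wForm μ b) n (some (0, Sum.inr m)) = if m = n then 1 else 0 := by
  simp only [filt, Pi.sub_apply, Finset.sum_apply, Pi.smul_apply, wForm_apply_inr, true_and]
  rw [Finset.sum_eq_zero, sub_zero]
  intro j _
  refine Finset.sum_eq_zero fun m _ => ?_
  rw [if_neg fun h => (Fin.succ_ne_zero j) h.1.symm, smul_zero]

/-- The current disturbances occur with identity coefficients, whatever the filter and `b`, so no
combination of filtered residuals vanishes. -/
lemma covFun_posDef (hV : IsPopMoment μ V) (b : Coef k → ℝ)
    (Φ : Fin p → Matrix (Fin N) (Fin N) ℝ) : (covFun μ V b Φ).PosDef := by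
  refine posDef_of_bil (fun a c => bil_comm (symm_of_posDef hV.posDef) _ _) fun v hv => ?_
  have e : ∑ a, ∑ c, v a * v c * covFun μ V b Φ a c =
      bil V (∑ a, v a • filt Φ (wForm μ b) a) (∑ a, v a • filt Φ (wForm μ b) a) := by
    simp only [bil_sum_left, bil_sum_right, bil_smul_left, bil_smul_right, covFun, Matrix.of_apply,
      Finset.mul_sum]
    rw [Finset.sum_comm]
    exact Finset.sum_congr rfl fun q _ => Finset.sum_congr rfl fun r _ => by ring
  rw [e]
  refine bil_pos hV.posDef fun h0 => hv ?_
  ext m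
  have := congrFun h0 (some (0, Sum.inr m))
  simpa [filt_wForm_apply] using this

lemma fzForm_sum (Φ : Fin p → Matrix (Fin N) (Fin N) ℝ) (v : Coef k → ℝ) (n : Fin N) :
    ∑ c, v c • fzForm μ Φ n c = filt Φ (fun i m => ∑ c, v c • zForm μ i m c) n := by
  simp only [fzForm, filt, smul_sub, Finset.sum_sub_distrib, Finset.smul_sum]
  congr 1
  rw [Finset.sum_comm]
  refine Finset.sum_congr rfl fun j _ => ?_
  rw [Finset.sum_comm]
  refine Finset.sum_congr rfl fun m _ => Finset.sum_congr rfl fun c _ => ?_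
  rw [smul_comm]

/-- `A(1) = I - ∑ Φ_j`. -/
def filterAtOne (Φ : Fin p → Matrix (Fin N) (Fin N) ℝ) : Matrix (Fin N) (Fin N) ℝ := 1 - ∑ j, Φ j

lemma glsGram_eq (Φ : Fin p → Matrix (Fin N) (Fin N) ℝ) (S : Matrix (Fin N) (Fin N) ℝ)
    (v w : Coef k → ℝ) : v ⬝ᵥ Matrix.mulVec (glsGram μ V Φ S) w =
      bil (wKernel S⁻¹ V) (fun a => (∑ c, v c • fzForm μ Φ a.1 c) a.2)
        (fun a => (∑ c, w c • fzForm μ Φ a.1 c) a.2) := by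
  rw [bil_wKernel S⁻¹ V (fun n => ∑ c, v c • fzForm μ Φ n c) (fun n => ∑ c, w c • fzForm μ Φ n c)]
  simp only [bil_sum_left, bil_sum_right, bil_smul_left, bil_smul_right, dotProduct, Matrix.mulVec,
    glsGram, Matrix.of_apply, Finset.mul_sum, Finset.sum_mul]
  conv_lhs => enter [2, c]; rw [Finset.sum_comm]; enter [2, n]; rw [Finset.sum_comm]
  rw [Finset.sum_comm]
  refine Finset.sum_congr rfl fun n _ => ?_
  rw [Finset.sum_comm]
  refine Finset.sum_congr rfl fun m _ => ?_
  rw [Finset.sum_comm]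
  refine Finset.sum_congr rfl fun c _ => Finset.sum_congr rfl fun d _ => by ring

/-- The regressors at lag zero are left alone by the filter, so the slopes of a null vector vanish.
What remains is `A(1)` applied to the intercepts, which is why `A(1)` must be invertible. -/
lemma glsGram_definite (hV : IsPopMoment μ V) {Φ : Fin p → Matrix (Fin N) (Fin N) ℝ}
    {S : Matrix (Fin N) (Fin N) ℝ} (hS : S.PosDef) (hΦ : (filterAtOne Φ).det ≠ 0)
    (v : Coef k → ℝ) (h : v ⬝ᵥ Matrix.mulVec (glsGram μ V Φ S) v = 0) : v = 0 := by
  rw [glsGram_eq] at h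
  have h1 := eq_zero_of_bil (wKernel_posDef hS.inv hV.posDef) h
  have h2 : ∀ n q, filt Φ (fun i m => ∑ c, v c • zForm μ i m c) n q = 0 := fun n q => by
    rw [← fzForm_sum]
    exact congrFun h1 (n, q)
  have h3 : ∀ c, v (Sum.inr c) = 0 := by
    intro c
    have := h2 c.1 (some (0, Sum.inl c))
    simp only [filt, Pi.sub_apply, zForm_sum_inl] at this
    rw [if_pos (by simp), Finset.sum_apply, Finset.sum_eq_zero, sub_zero] at this
    · exact this
    · intro j _
      rw [Finset.sum_apply]
      refine Finset.sum_eq_zero fun m _ => ?_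
      rw [Pi.smul_apply, zForm_sum_inl, if_neg fun h => (Fin.succ_ne_zero j) h.1.symm, smul_zero]
  have h4 : Matrix.mulVec (filterAtOne Φ) (fun n => v (Sum.inl n)) = 0 := by
    ext n
    have := h2 n none
    simp only [filt, zForm_sum_none _ _ v h3, Pi.sub_apply, Pi.smul_apply, Pi.single_eq_same,
      Finset.sum_apply, smul_eq_mul, mul_one] at this
    rw [filterAtOne, Matrix.sub_mulVec, Matrix.one_mulVec, Matrix.sum_mulVec, Pi.sub_apply,
      Finset.sum_apply]
    exact this
  have h5 : (fun n => v (Sum.inl n)) = 0 := by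
    by_contra hne
    exact hΦ (Matrix.exists_mulVec_eq_zero_iff.1 ⟨_, hne, h4⟩)
  ext c
  rcases c with n | c
  · exact congrFun h5 n
  · exact h3 c

lemma glsGram_isUnit (hV : IsPopMoment μ V) {Φ : Fin p → Matrix (Fin N) (Fin N) ℝ}
    {S : Matrix (Fin N) (Fin N) ℝ} (hS : S.PosDef) (hΦ : (filterAtOne Φ).det ≠ 0) :
    IsUnit (glsGram μ V Φ S).det :=
  isUnit_det_of_definite (hV.glsGram_definite hS hΦ)

/-- The normal equations of the population VAR. -/
lemma filt_varFun_orthogonal (hV : IsPopMoment μ V) (b : Coef k → ℝ) (n : Fin N) (j : Fin p)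
    (m : Fin N) : bil V (filt (varFun μ V b) (wForm μ b) n) (wForm μ b j.succ m) = 0 := by
  have h : (lagCross μ V b * (lagGram μ V b)⁻¹) * lagGram μ V b = lagCross μ V b := by
    rw [Matrix.mul_assoc, Matrix.nonsing_inv_mul _ (hV.lagGram_isUnit b), Matrix.mul_one]
  have h1 := congrFun (congrFun h n) (j, m)
  rw [Matrix.mul_apply, Fintype.sum_prod_type] at h1
  simp only [filt, bil_sub_left, bil_sum_left, bil_smul_left]
  rw [sub_eq_zero]
  exact h1.symm

lemma eq_varFun_of_orthogonal (hV : IsPopMoment μ V) (b : Coef k → ℝ)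
    (Φ : Fin p → Matrix (Fin N) (Fin N) ℝ)
    (h : ∀ n (j : Fin p) m, bil V (filt Φ (wForm μ b) n) (wForm μ b j.succ m) = 0) : Φ = varFun μ V b := by
  let M : Matrix (Fin N) (Fin p × Fin N) ℝ := Matrix.of fun n r => Φ r.1 n r.2
  have h1 : M * lagGram μ V b = lagCross μ V b := by
    ext n ⟨j, m⟩
    have := h n j m
    simp only [filt, bil_sub_left, bil_sum_left, bil_smul_left] at this
    rw [Matrix.mul_apply, Fintype.sum_prod_type]
    exact (sub_eq_zero.1 this).symm
  have h2 : M = lagCross μ V b * (lagGram μ V b)⁻¹ := by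
    rw [← h1, Matrix.mul_assoc, Matrix.mul_nonsing_inv _ (hV.lagGram_isUnit b), Matrix.mul_one]
  funext j
  ext a c
  exact congrFun (congrFun h2 a) (j, c)

/-- Summation by parts, needed to write a filter with a unit root as a first difference. -/
lemma sum_telescope {E : Type*} [AddCommGroup E] (g : Fin (p + 1) → E) (j : Fin p) :
    ∑ i : Fin p, (if i ≤ j then g i.castSucc - g i.succ else 0) = g 0 - g j.succ := by
  let G : ℕ → E := fun n => if h : n < p + 1 then g ⟨n, h⟩ else 0
  have h1 : ∀ i : Fin p, (if i ≤ j then g i.castSucc - g i.succ else 0) =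
      if (i : ℕ) ≤ j then G i - G (i + 1) else 0 := by
    intro i
    have e1 : G i = g i.castSucc := by simp only [G]; rw [dif_pos (by omega)]; rfl
    have e2 : G (i + 1) = g i.succ := by simp only [G]; rw [dif_pos (by omega)]; rfl
    rw [e1, e2]; rfl
  rw [Finset.sum_congr rfl fun i _ => h1 i,
    Fin.sum_univ_eq_sum_range (fun i => if i ≤ (j : ℕ) then G i - G (i + 1) else 0) p,
    ← Finset.sum_filter]
  have h2 : (Finset.range p).filter (fun i => i ≤ (j : ℕ)) = Finset.range (j + 1) := by
    ext i; simp only [Finset.mem_filter, Finset.mem_range]; omega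
  rw [h2, Finset.sum_range_sub']
  simp only [G]
  rw [dif_pos (by omega), dif_pos (by omega)]
  rfl

/-- The filter of the population VAR has no unit root at `1`. -/
lemma filterAtOne_varFun_det_ne_zero (hV : IsPopMoment μ V) (b : Coef k → ℝ) :
    (filterAtOne (varFun μ V b)).det ≠ 0 := by
  intro h0
  obtain ⟨v, hv, hvA⟩ := Matrix.exists_vecMul_eq_zero_iff.2 h0
  set Φ := varFun μ V b with hΦ
  have hv1 : ∀ m, v m = ∑ j, ∑ n, v n * Φ j n m := by
    intro m
    have := congrFun hvA m
    rw [filterAtOne, Matrix.vecMul_sub, Matrix.vecMul_one, Pi.sub_apply, Pi.zero_apply,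
      sub_eq_zero] at this
    rw [this]
    simp only [Matrix.vecMul, dotProduct, Matrix.sum_apply, Finset.mul_sum]
    rw [Finset.sum_comm]
  -- If `v' A(1) = 0`, then `v' A(L) w_t` is a difference `s_t - s_{t-1}`, where `s_t` combines
  -- `w_t, …, w_{t-p+1}`. The two values of `s` used below, at `Fin.castSucc` and `Fin.succ`, are
  -- `s_t` and `s_{t-1}`.
  let s : (Fin p → Fin (p + 1)) → ObsIdx k p → ℝ := fun e =>
    ∑ j, ∑ i : Fin p, if i ≤ j then ∑ m, (∑ n, v n * Φ j n m) • wForm μ b (e i) m else 0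
  set e : ObsIdx k p → ℝ := ∑ n, v n • filt Φ (wForm μ b) n with he
  have hs : s Fin.castSucc = s Fin.succ + e := by
    rw [← sub_eq_iff_eq_add']
    simp only [s, ← Finset.sum_sub_distrib]
    have h1 : ∀ j : Fin p, ∑ i : Fin p, ((if i ≤ j then
        ∑ m, (∑ n, v n * Φ j n m) • wForm μ b i.castSucc m else 0) -
        (if i ≤ j then ∑ m, (∑ n, v n * Φ j n m) • wForm μ b i.succ m else 0)) =
        ∑ m, (∑ n, v n * Φ j n m) • wForm μ b 0 m -
          ∑ m, (∑ n, v n * Φ j n m) • wForm μ b j.succ m := by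
      intro j
      rw [← sum_telescope (fun i => ∑ m, (∑ n, v n * Φ j n m) • wForm μ b i m) j]
      refine Finset.sum_congr rfl fun i _ => ?_
      split_ifs <;> simp
    rw [Finset.sum_congr rfl fun j _ => h1 j, Finset.sum_sub_distrib, he]
    simp only [filt, smul_sub, Finset.sum_sub_distrib]
    congr 1
    · rw [Finset.sum_comm]
      refine Finset.sum_congr rfl fun m _ => ?_
      rw [← Finset.sum_smul, ← hv1]
    · simp only [Finset.smul_sum, Finset.sum_smul, smul_smul]
      conv_rhs => rw [Finset.sum_comm]
      refine Finset.sum_congr rfl fun j _ => ?_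
      rw [Finset.sum_comm]
  have horth : bil V e (s Fin.succ) = 0 := by
    simp only [e, s, bil_sum_left, bil_sum_right, bil_smul_left]
    refine Finset.sum_eq_zero fun j _ => Finset.sum_eq_zero fun i _ =>
      Finset.sum_eq_zero fun n _ => mul_eq_zero_of_right _ ?_
    split_ifs
    · rw [bil_sum_right]
      refine Finset.sum_eq_zero fun m _ => ?_
      rw [bil_smul_right, hV.filt_varFun_orthogonal, mul_zero]
    · exact bil_zero_right _ _
  -- By stationarity `s_t` and `s_{t-1}` have the same variance. As `e` is orthogonal to `s_{t-1}`
  -- by the normal equations, its variance is zero, contrary to nondegeneracy.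
  have hstat : bil V (s Fin.castSucc) (s Fin.castSucc) = bil V (s Fin.succ) (s Fin.succ) := by
    have h2 : ∀ e : Fin p → Fin (p + 1), s e =
        ∑ j, ∑ i : Fin p, ∑ m, (if i ≤ j then ∑ n, v n * Φ j n m else 0) • wForm μ b (e i) m := by
      intro e
      refine Finset.sum_congr rfl fun j _ => Finset.sum_congr rfl fun i _ => ?_
      split_ifs <;> simp
    simp only [h2, bil_sum_left, bil_sum_right, bil_smul_left, bil_smul_right, hV.stat]
  rw [hs, bil_add_left, bil_add_right, bil_add_right, bil_comm (symm_of_posDef hV.posDef)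
    (s Fin.succ) e, horth] at hstat
  have h4 : e = 0 := eq_zero_of_bil hV.posDef (by linarith)
  refine hv (funext fun m => ?_)
  have := congrFun h4 (some (0, Sum.inr m))
  simpa [he, filt_wForm_apply] using this

end IsPopMoment

end Population

/-! ### Pseudo-true values -/

section PopulationValues

variable {N : ℕ} {k : Fin N → ℕ} {p : ℕ} {μ : Reg k → ℝ}

/-- The population bias of OLS. -/
def popBias (μ : Reg k → ℝ) (V : ObsIdx k p → ObsIdx k p → ℝ) : Coef k → ℝ :=
  Matrix.mulVec (olsGram μ V)⁻¹ (olsCross μ V)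

/-- The filter of the population VAR of the OLS residuals. -/
def popFilter (μ : Reg k → ℝ) (V : ObsIdx k p → ObsIdx k p → ℝ) :
    Fin p → Matrix (Fin N) (Fin N) ℝ :=
  varFun μ V (popBias μ V)

/-- The error covariance matrix of the population VAR of the OLS residuals. -/
def popCov (μ : Reg k → ℝ) (V : ObsIdx k p → ObsIdx k p → ℝ) : Matrix (Fin N) (Fin N) ℝ :=
  covFun μ V (popBias μ V) (popFilter μ V)

/-- The bias of population GLS with the filter and covariance of the OLS residuals. -/
def popShift (μ : Reg k → ℝ) (V : ObsIdx k p → ObsIdx k p → ℝ) : Coef k → ℝ :=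
  Matrix.mulVec (glsGram μ V (popFilter μ V) (popCov μ V))⁻¹
    (glsCross μ V (popFilter μ V) (popCov μ V))

lemma filt_wForm (Φ : Fin p → Matrix (Fin N) (Fin N) ℝ) (b : Coef k → ℝ) (n : Fin N) :
    filt Φ (wForm μ b) n = filt Φ uForm n - ∑ c, b c • fzForm μ Φ n c := by
  rw [IsPopMoment.fzForm_sum]
  simp only [filt, wForm, smul_sub, Finset.sum_sub_distrib]
  abel

namespace IsPopMoment

variable {V : ObsIdx k p → ObsIdx k p → ℝ}

lemma olsGram_mulVec_popBias (hV : IsPopMoment μ V) :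
    Matrix.mulVec (olsGram μ V) (popBias μ V) = olsCross μ V := by
  rw [popBias, Matrix.mulVec_mulVec, Matrix.mul_nonsing_inv _ hV.olsGram_isUnit, Matrix.one_mulVec]

lemma eq_popBias (hV : IsPopMoment μ V) {b : Coef k → ℝ}
    (h : Matrix.mulVec (olsGram μ V) b = olsCross μ V) : b = popBias μ V := by
  rw [popBias, ← h, Matrix.mulVec_mulVec, Matrix.nonsing_inv_mul _ hV.olsGram_isUnit,
    Matrix.one_mulVec]

lemma popCov_posDef (hV : IsPopMoment μ V) : (popCov μ V).PosDef := hV.covFun_posDef _ _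

lemma popGram_isUnit (hV : IsPopMoment μ V) :
    IsUnit (glsGram μ V (popFilter μ V) (popCov μ V)).det :=
  hV.glsGram_isUnit hV.popCov_posDef (hV.filterAtOne_varFun_det_ne_zero _)

lemma glsGram_mulVec_popShift (hV : IsPopMoment μ V) :
    Matrix.mulVec (glsGram μ V (popFilter μ V) (popCov μ V)) (popShift μ V) =
      glsCross μ V (popFilter μ V) (popCov μ V) := by
  rw [popShift, Matrix.mulVec_mulVec, Matrix.mul_nonsing_inv _ hV.popGram_isUnit, Matrix.one_mulVec]

lemma eq_popShift (hV : IsPopMoment μ V) {d : Coef k → ℝ}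
    (h : Matrix.mulVec (glsGram μ V (popFilter μ V) (popCov μ V)) d =
      glsCross μ V (popFilter μ V) (popCov μ V)) : d = popShift μ V := by
  rw [popShift, ← h, Matrix.mulVec_mulVec, Matrix.nonsing_inv_mul _ hV.popGram_isUnit,
    Matrix.one_mulVec]

/-- Equation by equation, another filter changes the error by a combination of lags, to which the
error of the normal equations is orthogonal. -/
lemma varFun_minimal (hV : IsPopMoment μ V) (b : Coef k → ℝ)
    (Φ' : Fin p → Matrix (Fin N) (Fin N) ℝ) :
    ∑ n, bil V (filt (varFun μ V b) (wForm μ b) n) (filt (varFun μ V b) (wForm μ b) n) ≤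
      ∑ n, bil V (filt Φ' (wForm μ b) n) (filt Φ' (wForm μ b) n) := by
  refine Finset.sum_le_sum fun n _ => ?_
  set Φ := varFun μ V b
  have e : filt Φ' (wForm μ b) n = filt Φ (wForm μ b) n +
      ∑ j : Fin p, ∑ m, (Φ j n m - Φ' j n m) • wForm μ b j.succ m := by
    simp only [filt, sub_smul, Finset.sum_sub_distrib]
    abel
  rw [e]
  refine bil_le_of_orthogonal hV.posDef ?_
  rw [bil_sum_right]
  refine Finset.sum_eq_zero fun j _ => ?_
  rw [bil_sum_right]
  refine Finset.sum_eq_zero fun m _ => ?_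
  rw [bil_smul_right, hV.filt_varFun_orthogonal, mul_zero]

lemma eq_varFun_of_minimal (hV : IsPopMoment μ V) (b : Coef k → ℝ)
    (Φ : Fin p → Matrix (Fin N) (Fin N) ℝ)
    (h : ∀ Φ' : Fin p → Matrix (Fin N) (Fin N) ℝ,
      ∑ n, bil V (filt Φ (wForm μ b) n) (filt Φ (wForm μ b) n) ≤
      ∑ n, bil V (filt Φ' (wForm μ b) n) (filt Φ' (wForm μ b) n)) : Φ = varFun μ V b := by
  refine hV.eq_varFun_of_orthogonal b Φ fun n j m => ?_
  refine bil_eq_zero_of_minimal hV.posDef fun s => ?_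
  -- Perturbing a single coefficient changes the error of equation `n` alone, by a multiple of one
  -- lagged residual; this isolates one orthogonality condition.
  let Δ : Fin p → Matrix (Fin N) (Fin N) ℝ := Pi.single j (Matrix.single n m 1)
  have h1 := h (Φ - s • Δ)
  have e : ∀ n', filt (Φ - s • Δ) (wForm μ b) n' =
      filt Φ (wForm μ b) n' + (if n' = n then s • wForm μ b j.succ m else 0) := by
    intro n'
    have h2 : ∑ j', ∑ m', Δ j' n' m' • wForm μ b (Fin.succ j') m' =
        if n' = n then wForm μ b j.succ m else 0 := by
      rw [Finset.sum_eq_single j, Finset.sum_eq_single m]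
      · by_cases hn : n' = n
        · subst hn; simp [Δ]
        · simp [Δ, hn, Ne.symm hn]
      · intro m' _ hm'
        simp [Δ, Ne.symm hm']
      · simp
      · intro j' _ hj'
        simp [Δ, Pi.single_eq_of_ne hj']
      · simp
    have h3 : (if n' = n then s • wForm μ b j.succ m else 0) =
        s • ∑ j', ∑ m', Δ j' n' m' • wForm μ b (Fin.succ j') m' := by
      rw [h2]; split_ifs <;> simp
    rw [h3]
    simp only [filt, Pi.sub_apply, Pi.smul_apply, Matrix.sub_apply, Matrix.smul_apply, sub_smul,
      Finset.sum_sub_distrib, Finset.smul_sum, smul_smul, smul_eq_mul]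
    abel
  simp only [e] at h1
  rw [← Finset.add_sum_erase _ _ (Finset.mem_univ n),
    ← Finset.add_sum_erase (a := n) _ _ (Finset.mem_univ n)] at h1
  have h2 : ∑ n' ∈ Finset.univ.erase n, bil V (filt Φ (wForm μ b) n' +
      (if n' = n then s • wForm μ b j.succ m else 0)) (filt Φ (wForm μ b) n' +
      (if n' = n then s • wForm μ b j.succ m else 0)) =
      ∑ n' ∈ Finset.univ.erase n, bil V (filt Φ (wForm μ b) n') (filt Φ (wForm μ b) n') :=
    Finset.sum_congr rfl fun n' hn' => by rw [if_neg (Finset.ne_of_mem_erase hn'), add_zero]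
  rw [h2, if_pos rfl] at h1
  linarith

/-- The GLS criterion with filter `Φ` and covariance `S`, at deviation `d` from the true value. -/
def glsObj (μ : Reg k → ℝ) (V : ObsIdx k p → ObsIdx k p → ℝ)
    (Φ : Fin p → Matrix (Fin N) (Fin N) ℝ) (S : Matrix (Fin N) (Fin N) ℝ) (d : Coef k → ℝ) : ℝ :=
  ∑ n, ∑ m, S⁻¹ n m * bil V (filt Φ (wForm μ d) n) (filt Φ (wForm μ d) m)

lemma inv_symm {n : Type*} [Fintype n] [DecidableEq n] {S : Matrix n n ℝ} (hS : S.PosDef)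
    (a b : n) : S⁻¹ a b = S⁻¹ b a := by
  have := hS.inv.isHermitian.apply a b
  simpa using this.symm

/-- Up to a factor, this is the gradient of the GLS criterion: orthogonality of the filtered errors
to the filtered regressors is the normal equation. -/
lemma wKernel_cross (hV : IsPopMoment μ V) {S : Matrix (Fin N) (Fin N) ℝ} (hS : S.PosDef)
    (Φ : Fin p → Matrix (Fin N) (Fin N) ℝ) (d : Coef k → ℝ) (c : Coef k) :
    bil (wKernel S⁻¹ V) (fun a => filt Φ (wForm μ d) a.1 a.2) (fun a => fzForm μ Φ a.1 c a.2) =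
      glsCross μ V Φ S c - Matrix.mulVec (glsGram μ V Φ S) d c := by
  rw [bil_wKernel S⁻¹ V (filt Φ (wForm μ d)) fun n => fzForm μ Φ n c]
  simp only [filt_wForm, bil_sub_left, mul_sub, Finset.sum_sub_distrib, bil_sum_left,
    bil_smul_left]
  have hsym := symm_of_posDef hV.posDef
  congr 1
  · rw [glsCross, Finset.sum_comm]
    refine Finset.sum_congr rfl fun n _ => Finset.sum_congr rfl fun m _ => ?_
    rw [inv_symm hS, bil_comm hsym]
  · simp only [Matrix.mulVec, dotProduct, glsGram, Matrix.of_apply, Finset.mul_sum, Finset.sum_mul]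
    rw [Finset.sum_comm]
    conv_rhs => rw [Finset.sum_comm]
    refine Finset.sum_congr rfl fun n _ => ?_
    conv_rhs => rw [Finset.sum_comm]
    refine Finset.sum_congr rfl fun m _ => Finset.sum_congr rfl fun c _ => ?_
    rw [inv_symm hS, bil_comm hsym]
    ring

lemma filt_wForm_add (Φ : Fin p → Matrix (Fin N) (Fin N) ℝ) (d e : Coef k → ℝ) :
    (fun a : Fin N × ObsIdx k p => filt Φ (wForm μ (d + e)) a.1 a.2) =
      (fun a => filt Φ (wForm μ d) a.1 a.2) + ∑ c, (-e c) • fun a => fzForm μ Φ a.1 c a.2 := by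
  ext ⟨n, q⟩
  simp only [filt_wForm, Pi.add_apply, add_smul, Finset.sum_add_distrib, Pi.sub_apply,
    Finset.sum_apply, Pi.smul_apply, smul_eq_mul, neg_mul, Finset.sum_neg_distrib]
  ring

lemma glsObj_minimal (hV : IsPopMoment μ V) {S : Matrix (Fin N) (Fin N) ℝ} (hS : S.PosDef)
    (Φ : Fin p → Matrix (Fin N) (Fin N) ℝ) {d : Coef k → ℝ}
    (hd : Matrix.mulVec (glsGram μ V Φ S) d = glsCross μ V Φ S) (d' : Coef k → ℝ) :
    glsObj μ V Φ S d ≤ glsObj μ V Φ S d' := by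
  simp only [glsObj, ← bil_wKernel S⁻¹ V]
  have e : d' = d + (d' - d) := by abel
  rw [e, filt_wForm_add]
  refine bil_le_of_orthogonal (wKernel_posDef hS.inv hV.posDef) ?_
  rw [bil_sum_right]
  refine Finset.sum_eq_zero fun c _ => ?_
  rw [bil_smul_right, hV.wKernel_cross hS, hd, sub_self, mul_zero]

lemma normal_equation_of_minimal (hV : IsPopMoment μ V) {S : Matrix (Fin N) (Fin N) ℝ}
    (hS : S.PosDef) (Φ : Fin p → Matrix (Fin N) (Fin N) ℝ) {d : Coef k → ℝ}
    (hd : ∀ d', glsObj μ V Φ S d ≤ glsObj μ V Φ S d') :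
    Matrix.mulVec (glsGram μ V Φ S) d = glsCross μ V Φ S := by
  ext c
  rw [eq_comm, ← sub_eq_zero, ← hV.wKernel_cross hS]
  refine bil_eq_zero_of_minimal (wKernel_posDef hS.inv hV.posDef) fun s => ?_
  have h1 := hd (d + Pi.single c (-s))
  simp only [glsObj, ← bil_wKernel S⁻¹ V] at h1
  rw [filt_wForm_add, Finset.sum_eq_single c (fun c' _ hc' => by simp [hc']) (by simp)] at h1
  simpa using h1

end IsPopMoment

end PopulationValues

/-! ### Population objects of a process in terms of its moment matrix -/

section ProcessMoments

variable {N : ℕ} {k : Fin N → ℕ} {p : ℕ} {Ω : Type*} [MeasurableSpace Ω] {P : Measure Ω}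
  [IsProbabilityMeasure P] {x : ℤ → Ω → Reg k → ℝ} {u : ℤ → Ω → Fin N → ℝ} {μ : Reg k → ℝ}

namespace FinitePredictor

lemma memLp_dotProduct (h : FinitePredictor P x u μ p) (m : ℕ) (t : ℤ) (α : ObsIdx k m → ℝ) :
    MemLp (fun ω => α ⬝ᵥ obs m μ (fun s => x s ω) (fun s => u s ω) t) 2 P := by
  simp only [dotProduct]
  exact memLp_finsetSum _ fun q _ => (h.memLp_obs m t q).const_mul _

lemma integrable_dotProduct_mul (h : FinitePredictor P x u μ p) (m : ℕ) (t : ℤ)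
    (α β : ObsIdx k m → ℝ) :
    Integrable (fun ω => (α ⬝ᵥ obs m μ (fun s => x s ω) (fun s => u s ω) t) *
      (β ⬝ᵥ obs m μ (fun s => x s ω) (fun s => u s ω) t)) P :=
  (h.memLp_dotProduct m t α).integrable_mul (h.memLp_dotProduct m t β)

lemma bil_obsMoment (h : FinitePredictor P x u μ p) (m : ℕ) (t : ℤ) (α β : ObsIdx k m → ℝ) :
    bil (obsMoment P x u μ m) α β = ∫ ω, (α ⬝ᵥ obs m μ (fun s => x s ω) (fun s => u s ω) t) *
      (β ⬝ᵥ obs m μ (fun s => x s ω) (fun s => u s ω) t) ∂P :=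
  bil_eq_integral (h.memLp_obs m t) (h.integral_obs m t) α β

lemma sum_bil_obsMoment (h : FinitePredictor P x u μ p) (m : ℕ) (t : ℤ) {ι : Type*}
    (s : Finset ι) (c : ι → ℝ) (α β : ι → ObsIdx k m → ℝ) :
    ∑ i ∈ s, c i * bil (obsMoment P x u μ m) (α i) (β i) =
      ∫ ω, ∑ i ∈ s, c i * ((α i ⬝ᵥ obs m μ (fun s => x s ω) (fun s => u s ω) t) *
      (β i ⬝ᵥ obs m μ (fun s => x s ω) (fun s => u s ω) t)) ∂P := by
  rw [integral_finsetSum _ fun i _ => (h.integrable_dotProduct_mul m t _ _).const_mul _]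
  refine Finset.sum_congr rfl fun i _ => ?_
  rw [integral_const_mul, h.bil_obsMoment m t]

lemma isPopMoment (h : FinitePredictor P x u μ p) {θ : Param k p} (hθ : HasParam P x u μ θ)
    (m : ℕ) : IsPopMoment μ (obsMoment P x u μ m) where
  posDef := by
    refine posDef_of_bil (fun q r => ?_) fun α hα => ?_
    · simp only [Matrix.of_apply, obsMoment, mul_comm]
    · have h1 : 0 ≤ bil (obsMoment P x u μ m) α α := by
        rw [h.bil_obsMoment m 0]
        exact integral_nonneg fun ω => mul_self_nonneg _
      exact lt_of_le_of_ne h1 fun h0 => hα (h.obsMoment_eq_zero hθ m α h0.symm)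
  stat b i j n l := by
    -- The moments can be computed at any date. Lag `i + 1` seen from date `0` is lag `i` seen from
    -- date `-1`.
    rw [h.bil_obsMoment m 0, h.bil_obsMoment m (-1)]
    simp only [wForm_dotProduct_obs, Fin.val_succ, Fin.val_castSucc]
    have e : ∀ i : ℕ, (0 : ℤ) - ((i + 1 : ℕ) : ℤ) = -1 - (i : ℤ) := fun i => by push_cast; ring
    simp only [e]

lemma designMoment_eq (h : FinitePredictor P x u μ p) (t : ℤ) (m : ℕ) :
    designMoment P x t = olsGram μ (obsMoment P x u μ m) := by
  ext c d
  have := h.sum_bil_obsMoment m t Finset.univ (fun _ : Fin N => 1) (fun n => zForm μ 0 n c)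
    (fun n => zForm μ 0 n d)
  simp only [one_mul, zForm_dotProduct] at this
  rw [olsGram, Matrix.of_apply, this, designMoment, Matrix.of_apply]
  simp only [Matrix.mul_apply, Matrix.transpose_apply, Fin.val_zero, Nat.cast_zero, sub_zero]

lemma designCross_eq (h : FinitePredictor P x u μ p) (t : ℤ) (m : ℕ) (c : Coef k) :
    ∫ ω, Matrix.mulVec (design (x t ω)).transpose (u t ω) c ∂P =
      olsCross μ (obsMoment P x u μ m) c := by
  have := h.sum_bil_obsMoment m t Finset.univ (fun _ : Fin N => 1) (fun n => zForm μ 0 n c)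
    (fun n => uForm 0 n)
  simp only [one_mul, zForm_dotProduct, uForm_dotProduct] at this
  rw [olsCross, this]
  simp only [Matrix.mulVec, dotProduct, Matrix.transpose_apply, Fin.val_zero, Nat.cast_zero,
    sub_zero]

lemma filt_wForm_dotProduct {m : ℕ} (Φ : Fin m → Matrix (Fin N) (Fin N) ℝ) (b : Coef k → ℝ)
    (x : ℤ → Reg k → ℝ) (u : ℤ → Fin N → ℝ) (t : ℤ) (n : Fin N) :
    filt Φ (wForm μ b) n ⬝ᵥ obs m μ x u t = filterVec Φ (resid x u b) t n :=
  filt_dotProduct Φ _ _ _ t (fun i n => wForm_dotProduct_obs μ x u b t i n) n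

lemma filterObj_eq (h : FinitePredictor P x u μ p) (t : ℤ) {m : ℕ}
    (Φ : Fin m → Matrix (Fin N) (Fin N) ℝ) (b : Coef k → ℝ) :
    ∫ ω, ∑ i, (filterVec Φ (fun s => uStar x u b s ω) t i) ^ 2 ∂P =
      ∑ n, bil (obsMoment P x u μ m) (filt Φ (wForm μ b) n) (filt Φ (wForm μ b) n) := by
  have := h.sum_bil_obsMoment m t Finset.univ (fun _ : Fin N => 1) (filt Φ (wForm μ b))
    (filt Φ (wForm μ b))
  simp only [one_mul, filt_wForm_dotProduct] at this
  rw [this]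
  simp only [pow_two]
  rfl

lemma cov_eq (h : FinitePredictor P x u μ p) (t : ℤ) {m : ℕ}
    (Φ : Fin m → Matrix (Fin N) (Fin N) ℝ) (b : Coef k → ℝ) (i j : Fin N) :
    ∫ ω, filterVec Φ (fun s => uStar x u b s ω) t i *
      filterVec Φ (fun s => uStar x u b s ω) t j ∂P = covFun μ (obsMoment P x u μ m) b Φ i j := by
  rw [covFun, Matrix.of_apply, h.bil_obsMoment m t]
  simp only [filt_wForm_dotProduct]
  rfl

lemma yPath_sub (κ κ' : Coef k → ℝ) (ω : Ω) :
    (fun s => yPath x u κ ω s - Matrix.mulVec (design (x s ω)) κ') =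
      resid (fun s => x s ω) (fun s => u s ω) (κ' - κ) := by
  funext s
  simp only [yPath, response, resid, Matrix.mulVec_sub]
  abel

lemma coefObj_eq (h : FinitePredictor P x u μ p) (t : ℤ) {m : ℕ}
    (Φ : Fin m → Matrix (Fin N) (Fin N) ℝ) (S : Matrix (Fin N) (Fin N) ℝ) (κ κ' : Coef k → ℝ) :
    ∫ ω, dotProduct
      (filterVec Φ (fun s => yPath x u κ ω s - Matrix.mulVec (design (x s ω)) κ') t)
      (Matrix.mulVec S⁻¹
        (filterVec Φ (fun s => yPath x u κ ω s - Matrix.mulVec (design (x s ω)) κ') t)) ∂P =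
      IsPopMoment.glsObj μ (obsMoment P x u μ m) Φ S (κ' - κ) := by
  have := h.sum_bil_obsMoment m t Finset.univ (fun a : Fin N × Fin N => S⁻¹ a.1 a.2)
    (fun a => filt Φ (wForm μ (κ' - κ)) a.1) (fun a => filt Φ (wForm μ (κ' - κ)) a.2)
  simp only [Fintype.sum_prod_type, filt_wForm_dotProduct] at this
  rw [IsPopMoment.glsObj, this]
  simp only [yPath_sub]
  simp only [dotProduct, Matrix.mulVec, Finset.mul_sum]
  refine integral_congr_ae (ae_of_all _ fun ω => ?_)
  refine Finset.sum_congr rfl fun n _ => Finset.sum_congr rfl fun m _ => by ring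

variable (κ : Coef k → ℝ)

lemma isPseudoTrue (h : FinitePredictor P x u μ p) {θ : Param k p} (hθ : HasParam P x u μ θ) :
    IsPseudoTrue P x u κ (popBias μ (obsMoment P x u μ p)) (popFilter μ (obsMoment P x u μ p))
      (popCov μ (obsMoment P x u μ p)) (κ + popShift μ (obsMoment P x u μ p)) where
  bias t c := by
    rw [h.designMoment_eq t p, h.designCross_eq t p, (h.isPopMoment hθ p).olsGram_mulVec_popBias]
  filter t := by
    rw [isMinOn_univ_iff]
    intro Φ'
    rw [h.filterObj_eq, h.filterObj_eq]
    exact (h.isPopMoment hθ p).varFun_minimal _ Φ'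
  cov t i j := by
    rw [h.cov_eq]; rfl
  cov_posDef := (h.isPopMoment hθ p).popCov_posDef
  coef t := by
    rw [isMinOn_univ_iff]
    intro κ'
    rw [h.coefObj_eq, h.coefObj_eq, add_sub_cancel_left]
    exact (h.isPopMoment hθ p).glsObj_minimal (h.isPopMoment hθ p).popCov_posDef _
      (h.isPopMoment hθ p).glsGram_mulVec_popShift _

/-- Each defining property is a nonsingular system of normal equations or a formula in earlier
values, so the pseudo-true values are unique. Statements about all pseudo-true values therefore
reduce to the explicit ones. -/
lemma eq_of_isPseudoTrue (h : FinitePredictor P x u μ p) {θ : Param k p}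
    (hθ : HasParam P x u μ θ) {b : Coef k → ℝ} {Φ : Fin p → Matrix (Fin N) (Fin N) ℝ}
    {S : Matrix (Fin N) (Fin N) ℝ} {κs : Coef k → ℝ} (hb : IsPseudoTrue P x u κ b Φ S κs) :
    b = popBias μ (obsMoment P x u μ p) ∧ Φ = popFilter μ (obsMoment P x u μ p) ∧
      S = popCov μ (obsMoment P x u μ p) ∧ κs = κ + popShift μ (obsMoment P x u μ p) := by
  have hV := h.isPopMoment hθ p
  have h1 : b = popBias μ (obsMoment P x u μ p) := by
    refine hV.eq_popBias (funext fun c => ?_)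
    rw [← h.designMoment_eq 0 p, ← h.designCross_eq 0 p]
    exact hb.bias 0 c
  subst h1
  have h2 : Φ = popFilter μ (obsMoment P x u μ p) := by
    refine hV.eq_varFun_of_minimal _ Φ fun Φ' => ?_
    have := isMinOn_univ_iff.1 (hb.filter 0) Φ'
    rwa [h.filterObj_eq, h.filterObj_eq] at this
  subst h2
  have h3 : S = popCov μ (obsMoment P x u μ p) := by
    ext i j
    rw [hb.cov 0 i j, h.cov_eq]; rfl
  subst h3
  refine ⟨rfl, rfl, rfl, ?_⟩
  rw [← sub_eq_iff_eq_add']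
  refine hV.eq_popShift (hV.normal_equation_of_minimal hV.popCov_posDef _ fun d' => ?_)
  have := isMinOn_univ_iff.1 (hb.coef 0) (κ + d')
  rwa [h.coefObj_eq, h.coefObj_eq, add_sub_cancel_left] at this

end FinitePredictor

end ProcessMoments

/-! ### Convergence in probability to constants -/

section InMeasure

variable {Ω : Type*} [MeasurableSpace Ω] {P : Measure Ω}

lemma tendstoInMeasure_comp_continuousAt {E F : Type*} [PseudoEMetricSpace E] [PseudoEMetricSpace F]
    {f : ℕ → Ω → E} {c : E} {g : E → F} (hg : ContinuousAt g c)
    (hf : TendstoInMeasure P f atTop fun _ => c) :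
    TendstoInMeasure P (fun n ω => g (f n ω)) atTop fun _ => g c := by
  intro ε hε
  obtain ⟨δ, hδ, h⟩ := EMetric.tendsto_nhds_nhds.1 hg ε hε
  refine tendsto_of_tendsto_of_tendsto_of_le_of_le tendsto_const_nhds (hf δ hδ)
    (fun _ => zero_le) fun n => measure_mono fun ω hω => ?_
  by_contra hlt
  exact absurd hω (not_le.2 (h (not_le.1 hlt)))

lemma tendstoInMeasure_pi {ι : Type*} [Fintype ι] {E : ι → Type*} [∀ i, PseudoEMetricSpace (E i)]
    {f : ℕ → Ω → ∀ i, E i} {g : Ω → ∀ i, E i}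
    (h : ∀ i, TendstoInMeasure P (fun n ω => f n ω i) atTop fun ω => g ω i) :
    TendstoInMeasure P f atTop g := by
  intro ε hε
  have h1 : Tendsto (fun n => ∑ i, P {ω | ε ≤ edist (f n ω i) (g ω i)}) atTop (𝓝 0) := by
    simpa using tendsto_finsetSum Finset.univ fun i _ => h i ε hε
  refine tendsto_of_tendsto_of_tendsto_of_le_of_le tendsto_const_nhds h1
    (fun _ => zero_le) fun n => ?_
  refine (measure_mono fun ω hω => ?_).trans (measure_biUnion_finset_le _ _)
  by_contra hlt
  simp only [Set.mem_iUnion, not_exists] at hlt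
  refine (not_le.2 ?_) (show ε ≤ edist (f n ω) (g ω) from hω)
  rw [edist_pi_def, Finset.sup_lt_iff (bot_lt_iff_ne_bot.2 hε.ne')]
  exact fun i hi => not_le.1 (hlt i hi)

lemma tendstoInMeasure_prodMk {E F : Type*} [PseudoEMetricSpace E] [PseudoEMetricSpace F]
    {f : ℕ → Ω → E} {f₀ : Ω → E} {g : ℕ → Ω → F} {g₀ : Ω → F}
    (hf : TendstoInMeasure P f atTop f₀) (hg : TendstoInMeasure P g atTop g₀) :
    TendstoInMeasure P (fun n ω => (f n ω, g n ω)) atTop fun ω => (f₀ ω, g₀ ω) := by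
  intro ε hε
  have h1 := (hf ε hε).add (hg ε hε)
  rw [add_zero] at h1
  refine tendsto_of_tendsto_of_tendsto_of_le_of_le tendsto_const_nhds h1
    (fun _ => zero_le) fun n => ?_
  refine (measure_mono fun ω hω => ?_).trans (measure_union_le _ _)
  rcases le_max_iff.1 (show ε ≤ max _ _ from hω) with h | h
  · exact Or.inl h
  · exact Or.inr h

/-- Allows a statistic to be replaced by a formula that is valid only off events of vanishing
probability, such as a wrong order or a singular matrix. No measurability is involved. -/
lemma tendstoInMeasure_congr_off {E : Type*} [PseudoEMetricSpace E] {f f' : ℕ → Ω → E} {g : Ω → E}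
    {B : ℕ → Set Ω} (hB : Tendsto (fun n => P (B n)) atTop (𝓝 0))
    (hff' : ∀ᶠ n in atTop, ∀ ω ∉ B n, f' n ω = f n ω) (hf : TendstoInMeasure P f atTop g) :
    TendstoInMeasure P f' atTop g := by
  intro ε hε
  have h1 := (hf ε hε).add hB
  rw [add_zero] at h1
  refine tendsto_of_tendsto_of_tendsto_of_le_of_le' tendsto_const_nhds h1
    (Eventually.of_forall fun _ => zero_le) ?_
  filter_upwards [hff'] with n hn
  refine (measure_mono fun ω hω => ?_).trans (measure_union_le _ _)
  by_cases hω' : ω ∈ B n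
  · exact Or.inr hω'
  · refine Or.inl ?_
    change ε ≤ edist (f n ω) (g ω)
    rw [← hn ω hω']
    exact hω

lemma tendstoInMeasure_of_sub {E : Type*} [SeminormedAddCommGroup E] {f : ℕ → Ω → E} {g : Ω → E}
    (h : TendstoInMeasure P (fun n ω => f n ω - g ω) atTop fun _ => 0) :
    TendstoInMeasure P f atTop g := by
  intro ε hε
  refine (h ε hε).congr fun n => ?_
  simp only [edist_eq_enorm_sub, sub_zero]

lemma tendstoInMeasure_sub_iff {E : Type*} [SeminormedAddCommGroup E] {f : ℕ → Ω → E} {g : Ω → E} :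
    TendstoInMeasure P (fun n ω => f n ω - g ω) atTop (fun _ => 0) ↔
      TendstoInMeasure P f atTop g := by
  refine ⟨tendstoInMeasure_of_sub, fun h ε hε => (h ε hε).congr fun n => ?_⟩
  simp only [edist_eq_enorm_sub, sub_zero]

/-- Chebyshev's inequality. -/
lemma measure_le_sq_div {B : Ω → ℝ} {K : ℝ} (hK : 0 ≤ K)
    (hB : AEStronglyMeasurable B P) (h : eLpNorm B 2 P ≤ ENNReal.ofReal K) {R : ℝ} (hR : 0 < R) :
    P {ω | R ≤ |B ω|} ≤ ENNReal.ofReal ((K / R) ^ 2) := by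
  have h1 := mul_meas_ge_le_pow_eLpNorm' P (p := 2) (by norm_num) (by norm_num) hB (ENNReal.ofReal R)
  have h2 : {ω | R ≤ |B ω|} = {ω | ENNReal.ofReal R ≤ ‖B ω‖ₑ} := by
    ext ω
    simp only [Set.mem_ofPred_eq]
    rw [← ofReal_norm, ENNReal.ofReal_le_ofReal_iff (norm_nonneg _), Real.norm_eq_abs]
  rw [h2]
  simp only [ENNReal.toReal_ofNat, ENNReal.rpow_ofNat] at h1
  have h3 : ENNReal.ofReal R ^ 2 ≠ 0 := by positivity
  have h4 : ENNReal.ofReal R ^ 2 ≠ ⊤ := by finiteness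
  rw [mul_comm, ← ENNReal.le_div_iff_mul_le (Or.inl h3) (Or.inl h4)] at h1
  refine h1.trans ((ENNReal.div_le_div_right (pow_le_pow_left' h 2) _).trans_eq ?_)
  rw [← ENNReal.ofReal_pow hK, ← ENNReal.ofReal_pow hR.le, ← ENNReal.ofReal_div_of_pos (by positivity),
    div_pow]

/-- A product of a null sequence and an `L²`-bounded one is a null sequence. -/
lemma tendstoInMeasure_mul_bounded {A B : ℕ → Ω → ℝ} {K : ℝ} (hK : 0 ≤ K)
    (hA : TendstoInMeasure P A atTop fun _ => 0) (hB : ∀ n, AEStronglyMeasurable (B n) P)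
    (h : ∀ n, eLpNorm (B n) 2 P ≤ ENNReal.ofReal K) :
    TendstoInMeasure P (fun n ω => A n ω * B n ω) atTop fun _ => 0 := by
  rw [tendstoInMeasure_iff_norm] at hA ⊢
  intro ε hε
  rw [ENNReal.tendsto_nhds_zero]
  intro η hη
  -- A level that the bounded factor exceeds with small probability, uniformly in `n`; below it, the
  -- product is large only if the null factor exceeds `ε / R`.
  obtain ⟨R, hR, hRη⟩ : ∃ R : ℝ, 0 < R ∧ ENNReal.ofReal ((K / R) ^ 2) ≤ η / 2 := by
    have h1 : Tendsto (fun R : ℝ => ENNReal.ofReal ((K / R) ^ 2)) atTop (𝓝 0) := by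
      have : Tendsto (fun R : ℝ => (K / R) ^ 2) atTop (𝓝 0) := by
        simpa using (tendsto_const_nhds.div_atTop tendsto_id : Tendsto (fun R : ℝ => K / R) atTop
          (𝓝 0)).pow 2
      simpa using ENNReal.tendsto_ofReal this
    have h2 := (ENNReal.tendsto_nhds_zero.1 h1) (η / 2) (ENNReal.half_pos hη.ne')
    obtain ⟨R, hR1, hR2⟩ := (h2.and (eventually_gt_atTop 0)).exists
    exact ⟨R, hR2, hR1⟩
  have h3 := (ENNReal.tendsto_nhds_zero.1 (hA (ε / R) (by positivity))) (η / 2)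
    (ENNReal.half_pos hη.ne')
  filter_upwards [h3] with n hn
  calc P {ω | ε ≤ ‖A n ω * B n ω - 0‖} ≤ P ({ω | ε / R ≤ ‖A n ω - 0‖} ∪ {ω | R ≤ |B n ω|}) := by
        refine measure_mono fun ω hω => ?_
        by_contra hc
        simp only [Set.mem_union, Set.mem_ofPred_eq, not_or, not_le, sub_zero,
          Real.norm_eq_abs] at hc hω
        rw [abs_mul] at hω
        have : |A n ω| * |B n ω| < ε / R * R :=
          mul_lt_mul'' hc.1 hc.2 (abs_nonneg _) (abs_nonneg _)
        rw [div_mul_cancel₀ _ hR.ne'] at this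
        linarith
    _ ≤ P {ω | ε / R ≤ ‖A n ω - 0‖} + P {ω | R ≤ |B n ω|} := measure_union_le _ _
    _ ≤ η / 2 + η / 2 := add_le_add hn ((measure_le_sq_div hK (hB n) (h n) hR).trans hRη)
    _ = η := ENNReal.add_halves _

end InMeasure

/-! ### Law of large numbers for sample second moments -/

section Moments

variable {Ω : Type*} [MeasurableSpace Ω] {P : Measure Ω} {Q : Type*} [Fintype Q]
  {v : ℤ → Ω → Q → ℝ} {V : Q → Q → ℝ}

lemma card_sample (s T : ℕ) : (((Finset.Icc ((s : ℤ) + 1) T).card : ℕ) : ℝ) = ((T - s : ℕ) : ℝ) := by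
  rw [Int.card_Icc]
  congr 1
  omega

namespace HasMoments

lemma aestronglyMeasurable_sum (h : HasMoments P v V) (q r : Q) (I : Finset ℤ) :
    AEStronglyMeasurable (fun ω => ∑ t ∈ I, (v t ω q * v t ω r - V q r)) P :=
  Finset.aestronglyMeasurable_fun_sum I fun t _ =>
    ((h.memLp t q).aestronglyMeasurable.mul (h.memLp t r).aestronglyMeasurable).sub
      aestronglyMeasurable_const

/-- The scaled deviations of the sample moments from the population moments. -/
lemma exists_eLpNorm_scaled_le (h : HasMoments P v V) (s : ℕ) : ∃ B : ℝ, 0 ≤ B ∧ ∀ q r (T : ℕ),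
    eLpNorm (fun ω => (√(T : ℝ))⁻¹ * ∑ t ∈ Finset.Icc ((s : ℤ) + 1) T,
      (v t ω q * v t ω r - V q r)) 2 P ≤ ENNReal.ofReal B := by
  obtain ⟨B, hB, hb⟩ := h.bound
  refine ⟨B, hB, fun q r T => ?_⟩
  have e := eLpNorm_const_smul (μ := P) (p := 2) (√(T : ℝ))⁻¹
    (fun ω => ∑ t ∈ Finset.Icc ((s : ℤ) + 1) T, (v t ω q * v t ω r - V q r))
  change eLpNorm ((√(T : ℝ))⁻¹ • fun ω => ∑ t ∈ Finset.Icc ((s : ℤ) + 1) T,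
      (v t ω q * v t ω r - V q r)) 2 P ≤ _
  rw [e]
  refine (mul_le_mul_right (hb q r _) _).trans ?_
  rw [← ofReal_norm, ← ENNReal.ofReal_mul (norm_nonneg _)]
  refine ENNReal.ofReal_le_ofReal ?_
  rw [card_sample, Real.norm_of_nonneg (by positivity)]
  rcases Nat.eq_zero_or_pos T with hT | hT
  · subst hT; simpa using hB
  · have hT' : 0 < √(T : ℝ) := Real.sqrt_pos.2 (by exact_mod_cast hT)
    have : √((T - s : ℕ) : ℝ) ≤ √(T : ℝ) := Real.sqrt_le_sqrt (by exact_mod_cast Nat.sub_le T s)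
    rw [inv_mul_le_iff₀ hT', mul_comm (√(T : ℝ))]
    exact mul_le_mul_of_nonneg_left this hB

/-- The deviation is displayed as `T^{-1/2}` times an `L²`-bounded variable. The last term carries
the share `(T - s) / T` of the dates in the sum, which tends to one. -/
lemma scaled_eq (s T : ℕ) (q r : Q) (ω : Ω) :
    ((T : ℝ)⁻¹ • sampleMoment (fun t => v t ω) (Finset.Icc ((s : ℤ) + 1) T)) q r =
      (√(T : ℝ))⁻¹ * ((√(T : ℝ))⁻¹ * ∑ t ∈ Finset.Icc ((s : ℤ) + 1) T,
        (v t ω q * v t ω r - V q r)) + (T : ℝ)⁻¹ * ((T - s : ℕ) : ℝ) * V q r := by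
  rw [← mul_assoc, ← mul_inv, Real.mul_self_sqrt (Nat.cast_nonneg T), Finset.sum_sub_distrib,
    Finset.sum_const, nsmul_eq_mul, card_sample]
  simp only [Pi.smul_apply, smul_eq_mul, sampleMoment]
  ring

lemma tendsto_ratio (s : ℕ) :
    Tendsto (fun T : ℕ => (T : ℝ)⁻¹ * ((T - s : ℕ) : ℝ)) atTop (𝓝 1) := by
  have h1 : Tendsto (fun T : ℕ => 1 - (s : ℝ) * (T : ℝ)⁻¹) atTop (𝓝 1) := by
    have := tendsto_const_nhds (x := (1 : ℝ)).sub ((tendsto_const_nhds (x := (s : ℝ))).mul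
      ((tendsto_inv_atTop_zero (𝕜 := ℝ)).comp tendsto_natCast_atTop_atTop))
    simpa using this
  refine h1.congr' ?_
  filter_upwards [eventually_gt_atTop s] with T hT
  have : (T : ℝ) ≠ 0 := by
    have : 0 < T := by omega
    positivity
  rw [Nat.cast_sub hT.le]
  field_simp

/-- The law of large numbers for the sample moments. -/
lemma tendstoInMeasure [IsFiniteMeasure P] (h : HasMoments P v V) (s : ℕ) :
    TendstoInMeasure P (fun (T : ℕ) ω => (T : ℝ)⁻¹ •
      sampleMoment (fun t => v t ω) (Finset.Icc ((s : ℤ) + 1) T)) atTop fun _ => V := by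
  obtain ⟨B, hB, hb⟩ := h.exists_eLpNorm_scaled_le s
  refine tendstoInMeasure_pi fun q => tendstoInMeasure_pi fun r => ?_
  simp only [scaled_eq (V := V)]
  have h1 : Tendsto (fun T : ℕ => (√(T : ℝ))⁻¹) atTop (𝓝 0) :=
    tendsto_inv_atTop_zero.comp (Real.tendsto_sqrt_atTop.comp tendsto_natCast_atTop_atTop)
  have h2 := tendstoInMeasure_mul_bounded (P := P) hB (tendstoInMeasure_const_of_tendsto h1)
    (fun T => (h.aestronglyMeasurable_sum q r _).const_mul (√(T : ℝ))⁻¹) (hb q r)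
  have h3 := tendstoInMeasure_const_of_tendsto (P := P) ((tendsto_ratio s).mul_const (V q r))
  have h4 := tendstoInMeasure_comp_continuousAt (g := fun z : ℝ × ℝ => z.1 + z.2)
    (by fun_prop) (tendstoInMeasure_prodMk h2 h3)
  simpa using h4

end HasMoments

end Moments

/-! ### Continuity of the estimators in the moments -/

section Continuity

variable {N : ℕ} {k : Fin N → ℕ} {p : ℕ} {X : Type*} [TopologicalSpace X] {a : X}

/-- The inverse is the adjugate divided by the determinant. -/
lemma continuousAt_matrix_inv {n : Type*} [Fintype n] [DecidableEq n] {M : X → Matrix n n ℝ}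
    (hM : ContinuousAt M a) (h : IsUnit (M a).det) : ContinuousAt (fun z => (M z)⁻¹) a := by
  simp only [Matrix.inv_def, Ring.inverse_eq_inv']
  have h1 : Continuous fun A : Matrix n n ℝ => A.det := Continuous.matrix_det continuous_id
  have h2 : Continuous fun A : Matrix n n ℝ => A.adjugate := Continuous.matrix_adjugate continuous_id
  exact ((h1.continuousAt.comp hM).inv₀ h.ne_zero).smul (h2.continuousAt.comp hM)

lemma continuousAt_mulVec {m n : Type*} [Fintype n] {M : X → Matrix m n ℝ} {w : X → n → ℝ}
    (hM : ContinuousAt M a) (hw : ContinuousAt w a) :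
    ContinuousAt (fun z => Matrix.mulVec (M z) (w z)) a := by
  have : Continuous fun z : Matrix m n ℝ × (n → ℝ) => Matrix.mulVec z.1 z.2 :=
    continuous_fst.matrix_mulVec continuous_snd
  exact ContinuousAt.comp_of_eq this.continuousAt (hM.prodMk hw) rfl

lemma continuousAt_matrix_mul {l m n : Type*} [Fintype m] {A : X → Matrix l m ℝ}
    {B : X → Matrix m n ℝ} (hA : ContinuousAt A a) (hB : ContinuousAt B a) :
    ContinuousAt (fun z => A z * B z) a := by
  have : Continuous fun z : Matrix l m ℝ × Matrix m n ℝ => z.1 * z.2 :=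
    continuous_fst.matrix_mul continuous_snd
  exact ContinuousAt.comp_of_eq this.continuousAt (hA.prodMk hB) rfl

lemma continuousAt_bil {Q : Type*} [Fintype Q] {V : X → Q → Q → ℝ} {α β : X → Q → ℝ}
    (hV : ContinuousAt V a) (hα : ContinuousAt α a) (hβ : ContinuousAt β a) :
    ContinuousAt (fun z => bil (V z) (α z) (β z)) a := by
  have : Continuous fun z : (Q → Q → ℝ) × (Q → ℝ) × (Q → ℝ) => bil z.1 z.2.1 z.2.2 := by
    unfold bil; fun_prop
  have h := ContinuousAt.comp (f := fun z => (V z, α z, β z)) (x := a) this.continuousAt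
    (hV.prodMk (hα.prodMk hβ))
  exact h

lemma continuousAt_sum {ι : Type*} [Fintype ι] {f : ι → X → ℝ} (hf : ∀ i, ContinuousAt (f i) a) :
    ContinuousAt (fun z => ∑ i, f i z) a :=
  tendsto_finsetSum _ fun i _ => hf i

variable {μ : Reg k → ℝ} {V : X → ObsIdx k p → ObsIdx k p → ℝ} {b : X → Coef k → ℝ}
  {Φ : X → Fin p → Matrix (Fin N) (Fin N) ℝ} {S : X → Matrix (Fin N) (Fin N) ℝ}

lemma continuousAt_wForm (hb : ContinuousAt b a) (i : Fin (p + 1)) (n : Fin N) :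
    ContinuousAt (fun z => wForm μ (b z) i n) a := by
  have : Continuous fun b : Coef k → ℝ => wForm μ b i n := by unfold wForm; fun_prop
  exact this.continuousAt.comp hb

lemma continuousAt_filt {Q : Type*} {g : X → Fin (p + 1) → Fin N → Q → ℝ}
    (hΦ : ContinuousAt Φ a) (hg : ∀ i n, ContinuousAt (fun z => g z i n) a) (n : Fin N) :
    ContinuousAt (fun z => filt (Φ z) (g z) n) a := by
  unfold filt
  refine (hg 0 n).sub (tendsto_finsetSum _ fun j _ => tendsto_finsetSum _ fun m _ => ?_)
  have h1 : Continuous fun Φ : Fin p → Matrix (Fin N) (Fin N) ℝ => Φ j n m :=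
    ((continuous_apply j).matrix_elem n m)
  exact (h1.continuousAt.comp hΦ).smul (hg j.succ m)

lemma continuousAt_quad {n : Type*} [Fintype n] {d : X → n → ℝ} {M : X → Matrix n n ℝ}
    (hd : ContinuousAt d a) (hM : ContinuousAt M a) :
    ContinuousAt (fun z => d z ⬝ᵥ Matrix.mulVec (M z) (d z)) a := by
  have : Continuous fun z : (n → ℝ) × Matrix n n ℝ => z.1 ⬝ᵥ Matrix.mulVec z.2 z.1 :=
    continuous_fst.dotProduct (continuous_snd.matrix_mulVec continuous_fst)
  have h := ContinuousAt.comp (f := fun z => (d z, M z)) (x := a) this.continuousAt (hd.prodMk hM)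
  exact h

lemma continuousAt_olsGram (hV : ContinuousAt V a) : ContinuousAt (fun z => olsGram μ (V z)) a := by
  refine continuousAt_pi.2 fun c => continuousAt_pi.2 fun d => ?_
  simp only [olsGram, Matrix.of_apply]
  exact continuousAt_sum fun _ => continuousAt_bil hV continuousAt_const continuousAt_const

lemma continuousAt_olsCross (hV : ContinuousAt V a) : ContinuousAt (fun z => olsCross μ (V z)) a := by
  refine continuousAt_pi.2 fun c => ?_
  simp only [olsCross]
  exact continuousAt_sum fun _ => continuousAt_bil hV continuousAt_const continuousAt_const

lemma continuousAt_olsFun (κ : Coef k → ℝ) (hV : ContinuousAt V a) (h : IsPopMoment μ (V a)) :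
    ContinuousAt (fun z => olsFun μ κ (V z)) a :=
  continuousAt_mulVec (continuousAt_matrix_inv (continuousAt_olsGram hV) h.olsGram_isUnit)
    ((continuousAt_olsCross hV).add
      (continuousAt_mulVec (continuousAt_olsGram hV) continuousAt_const))

lemma continuousAt_varFun (hV : ContinuousAt V a) (hb : ContinuousAt b a)
    (h : IsPopMoment μ (V a)) : ContinuousAt (fun z => varFun μ (V z) (b z)) a := by
  have h1 : ContinuousAt (fun z => lagGram μ (V z) (b z)) a :=
    continuousAt_pi.2 fun _ => continuousAt_pi.2 fun _ =>
      continuousAt_bil hV (continuousAt_wForm hb _ _) (continuousAt_wForm hb _ _)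
  have h2 : ContinuousAt (fun z => lagCross μ (V z) (b z)) a :=
    continuousAt_pi.2 fun _ => continuousAt_pi.2 fun _ =>
      continuousAt_bil hV (continuousAt_wForm hb _ _) (continuousAt_wForm hb _ _)
  have h3 := continuousAt_matrix_mul h2 (continuousAt_matrix_inv h1 (h.lagGram_isUnit _))
  refine continuousAt_pi.2 fun j => continuousAt_pi.2 fun n => continuousAt_pi.2 fun m => ?_
  exact continuousAt_pi.1 (continuousAt_pi.1 h3 n) (j, m)

lemma continuousAt_covFun (hV : ContinuousAt V a) (hb : ContinuousAt b a) (hΦ : ContinuousAt Φ a) :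
    ContinuousAt (fun z => covFun μ (V z) (b z) (Φ z)) a := by
  refine continuousAt_pi.2 fun n => continuousAt_pi.2 fun m => ?_
  simp only [covFun, Matrix.of_apply]
  exact continuousAt_bil hV (continuousAt_filt hΦ (continuousAt_wForm hb) n)
      (continuousAt_filt hΦ (continuousAt_wForm hb) m)

lemma continuousAt_fzForm (hΦ : ContinuousAt Φ a) (n : Fin N) (c : Coef k) :
    ContinuousAt (fun z => fzForm μ (Φ z) n c) a := by
  have h := continuousAt_filt (g := fun _ i m => zForm μ i m c) hΦ (fun _ _ => continuousAt_const) n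
  exact h

lemma continuousAt_entry {m n : Type*} {M : X → Matrix m n ℝ} (hM : ContinuousAt M a) (i : m)
    (j : n) : ContinuousAt (fun z => M z i j) a :=
  continuousAt_pi.1 (continuousAt_pi.1 hM i) j

lemma continuousAt_glsGram (hV : ContinuousAt V a) (hΦ : ContinuousAt Φ a)
    (hS : ContinuousAt S a) (h : IsUnit (S a).det) :
    ContinuousAt (fun z => glsGram μ (V z) (Φ z) (S z)) a := by
  refine continuousAt_pi.2 fun c => continuousAt_pi.2 fun d => ?_
  simp only [glsGram, Matrix.of_apply]
  exact continuousAt_sum fun n => continuousAt_sum fun m =>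
    (continuousAt_entry (continuousAt_matrix_inv hS h) n m).mul
      (continuousAt_bil hV (continuousAt_fzForm hΦ n c) (continuousAt_fzForm hΦ m d))

lemma continuousAt_glsCross (hV : ContinuousAt V a) (hΦ : ContinuousAt Φ a)
    (hS : ContinuousAt S a) (h : IsUnit (S a).det) :
    ContinuousAt (fun z => glsCross μ (V z) (Φ z) (S z)) a := by
  refine continuousAt_pi.2 fun c => ?_
  simp only [glsCross]
  exact continuousAt_sum fun n => continuousAt_sum fun m =>
    (continuousAt_entry (continuousAt_matrix_inv hS h) n m).mul
      (continuousAt_bil hV (continuousAt_fzForm hΦ n c)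
        (continuousAt_filt (g := fun _ => uForm) hΦ (fun _ _ => continuousAt_const) m))

lemma continuousAt_glsFun (κ : Coef k → ℝ) (hV : ContinuousAt V a) (hΦ : ContinuousAt Φ a)
    (hS : ContinuousAt S a) (h : IsUnit (S a).det) (h' : IsUnit (glsGram μ (V a) (Φ a) (S a)).det) :
    ContinuousAt (fun z => glsFun μ κ (V z) (Φ z) (S z)) a :=
  continuousAt_mulVec (continuousAt_matrix_inv (continuousAt_glsGram hV hΦ hS h) h')
    ((continuousAt_glsCross hV hΦ hS h).add
      (continuousAt_mulVec (continuousAt_glsGram hV hΦ hS h) continuousAt_const))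

end Continuity

/-! ### Probability limits of the steps of the procedure -/

section Limits

variable {N : ℕ} {k : Fin N → ℕ} {p : ℕ} {μ : Reg k → ℝ} {κ : Coef k → ℝ}
  {V : ObsIdx k p → ObsIdx k p → ℝ}

lemma mulVec_inv_add {n : Type*} [Fintype n] [DecidableEq n] {M : Matrix n n ℝ}
    (h : IsUnit M.det) (c κ : n → ℝ) :
    Matrix.mulVec M⁻¹ (c + Matrix.mulVec M κ) = κ + Matrix.mulVec M⁻¹ c := by
  rw [Matrix.mulVec_add, Matrix.mulVec_mulVec, Matrix.nonsing_inv_mul _ h, Matrix.one_mulVec,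
    add_comm]

namespace IsPopMoment

lemma olsFun_eq (hV : IsPopMoment μ V) : olsFun μ κ V = κ + popBias μ V := by
  rw [olsFun, mulVec_inv_add hV.olsGram_isUnit, popBias]

lemma coFun_eq (hV : IsPopMoment μ V) : coFun μ κ V V = κ + popShift μ V := by
  rw [coFun, hV.olsFun_eq, add_sub_cancel_left]
  change glsFun μ κ V (popFilter μ V) (popCov μ V) = _
  rw [glsFun, mulVec_inv_add hV.popGram_isUnit, popShift]

lemma continuousAt_bias (hV : IsPopMoment μ V) :
    ContinuousAt (fun z : (ObsIdx k p → ObsIdx k p → ℝ) × (ObsIdx k p → ObsIdx k p → ℝ) =>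
      olsFun μ κ z.1 - κ) (V, V) :=
  (continuousAt_olsFun κ continuousAt_fst hV).sub continuousAt_const

lemma continuousAt_filter (hV : IsPopMoment μ V) :
    ContinuousAt (fun z : (ObsIdx k p → ObsIdx k p → ℝ) × (ObsIdx k p → ObsIdx k p → ℝ) =>
      varFun μ z.2 (olsFun μ κ z.1 - κ)) (V, V) :=
  continuousAt_varFun continuousAt_snd hV.continuousAt_bias hV

lemma continuousAt_cov (hV : IsPopMoment μ V) :
    ContinuousAt (fun z : (ObsIdx k p → ObsIdx k p → ℝ) × (ObsIdx k p → ObsIdx k p → ℝ) =>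
      covFun μ z.2 (olsFun μ κ z.1 - κ) (varFun μ z.2 (olsFun μ κ z.1 - κ))) (V, V) :=
  continuousAt_covFun continuousAt_snd hV.continuousAt_bias hV.continuousAt_filter

/-- A composition of the three steps. At the population matrix, the weight and the GLS Gram matrix
that have to be inverted are nonsingular. -/
lemma continuousAt_coFun (hV : IsPopMoment μ V) :
    ContinuousAt (fun z : (ObsIdx k p → ObsIdx k p → ℝ) × (ObsIdx k p → ObsIdx k p → ℝ) =>
      coFun μ κ z.1 z.2) (V, V) := by
  refine continuousAt_glsFun κ continuousAt_snd hV.continuousAt_filter hV.continuousAt_cov ?_ ?_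
  · have := (Matrix.isUnit_iff_isUnit_det _).1 hV.popCov_posDef.isUnit
    simpa only [hV.olsFun_eq, add_sub_cancel_left, popCov, popFilter] using this
  · have := hV.popGram_isUnit
    simpa only [hV.olsFun_eq, add_sub_cancel_left, popCov, popFilter] using this

end IsPopMoment

variable {Ω : Type*} [MeasurableSpace Ω] {P : Measure Ω} [IsProbabilityMeasure P]
  {x : ℤ → Ω → Reg k → ℝ} {u : ℤ → Ω → Fin N → ℝ}

/-- The scaled sample moments of `(1, z̄_t', …, z̄_{t-p}')'` over `t = s + 1, …, T`. -/
def avgMoment (p : ℕ) (μ : Reg k → ℝ) (x : ℤ → Ω → Reg k → ℝ) (u : ℤ → Ω → Fin N → ℝ) (s T : ℕ)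
    (ω : Ω) : ObsIdx k p → ObsIdx k p → ℝ :=
  (T : ℝ)⁻¹ • sampleMoment (obs p μ (fun s => x s ω) (fun s => u s ω))
    (Finset.Icc ((s : ℤ) + 1) T)

lemma olsHat_eq {T : ℕ} (hT : 0 < T) (ω : Ω) :
    olsHat x u κ T ω = olsFun μ κ (avgMoment p μ x u 0 T ω) := by
  have hT0 : (T : ℝ)⁻¹ ≠ 0 := by positivity
  rw [avgMoment, olsFun_smul _ _ _ hT0, olsHat, yPath, ols_eq μ κ _ _ T p]
  simp

lemma coHat_eq {T : ℕ} (hT : p < T) (phat : ℕ → Ω → ℕ) (ω : Ω) (h : phat T ω = p) :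
    coHat x u κ phat T ω = coFun μ κ (avgMoment p μ x u 0 T ω) (avgMoment p μ x u p T ω) := by
  rw [coHat, h, yPath, coEstimator_eq μ κ _ _ T hT, avgMoment, avgMoment]
  simp

lemma uHat_eq (T : ℕ) (ω : Ω) :
    uHat x u κ T ω = resid (fun s => x s ω) (fun s => u s ω) (olsHat x u κ T ω - κ) := by
  rw [uHat, yPath, olsResidual_eq]; rfl

lemma uHat_sub_uStar (b : Coef k → ℝ) (T : ℕ) (ω : Ω) (t : ℤ) (i : Fin N) :
    uHat x u κ T ω t i - uStar x u b t ω i =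
      -Matrix.mulVec (design (x t ω)) (olsHat x u κ T ω - κ - b) i := by
  rw [uHat_eq, Matrix.mulVec_sub (design (x t ω)) (olsHat x u κ T ω - κ)]
  simp only [resid, uStar, Pi.sub_apply]
  ring

/-- Residuals and limit residuals differ by `Z_t'` times the error of OLS, so the mean square is a
quadratic form in this error with the average Gram matrix. -/
lemma residualMSE_eq {T : ℕ} (b : Coef k → ℝ) (ω : Ω) :
    residualMSE x u κ (uStar x u b) T ω = (olsHat x u κ T ω - κ - b) ⬝ᵥ
      Matrix.mulVec (olsGram μ (avgMoment p μ x u 0 T ω)) (olsHat x u κ T ω - κ - b) := by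
  set d := olsHat x u κ T ω - κ - b with hd
  have h1 := bil_eq_mulVec_quad (M := olsGram μ (avgMoment p μ x u 0 T ω))
    (avgMoment p μ x u 0 T ω) (fun n c => zForm μ 0 n c) (fun c e => rfl) d d
  rw [h1, residualMSE]
  simp only [avgMoment, bil_smul, ← sum_mul_eq_bil]
  rw [← Finset.mul_sum, Finset.sum_comm]
  congr 1
  have h2 : ∀ t n, (∑ c, d c • zForm μ 0 n c) ⬝ᵥ obs p μ (fun s => x s ω) (fun s => u s ω) t =
      Matrix.mulVec (design (x t ω)) d n := by
    intro t n
    rw [sum_smul_dotProduct]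
    simp only [zForm_dotProduct]
    simp only [Matrix.mulVec, dotProduct, Fin.val_zero, Nat.cast_zero, sub_zero]
    exact Finset.sum_congr rfl fun c _ => mul_comm _ _
  simp only [h2, uHat_sub_uStar, ← hd, Nat.cast_zero, zero_add]
  refine Finset.sum_congr rfl fun t _ => ?_
  refine Finset.sum_congr rfl fun n _ => ?_
  rw [neg_sq, pow_two]

namespace FinitePredictor

lemma tendsto_avgMoment (h : FinitePredictor P x u μ p) (hp : 0 < p) {θ : Param k p}
    (hθ : HasParam P x u μ θ) (s : ℕ) :
    TendstoInMeasure P (avgMoment p μ x u s) atTop fun _ => obsMoment P x u μ p :=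
  (h.hasMoments hp hθ p).tendstoInMeasure s

lemma tendsto_avgMoment_pair (h : FinitePredictor P x u μ p) (hp : 0 < p) {θ : Param k p}
    (hθ : HasParam P x u μ θ) :
    TendstoInMeasure P (fun T ω => (avgMoment p μ x u 0 T ω, avgMoment p μ x u p T ω)) atTop
      fun _ => (obsMoment P x u μ p, obsMoment P x u μ p) :=
  tendstoInMeasure_prodMk (h.tendsto_avgMoment hp hθ 0) (h.tendsto_avgMoment hp hθ p)

variable (κ)

lemma tendsto_olsHat (h : FinitePredictor P x u μ p) (hp : 0 < p) {θ : Param k p}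
    (hθ : HasParam P x u μ θ) :
    TendstoInMeasure P (olsHat x u κ) atTop fun _ => κ + popBias μ (obsMoment P x u μ p) := by
  have hV := h.isPopMoment hθ p
  have h1 := tendstoInMeasure_comp_continuousAt
    (continuousAt_olsFun κ (V := fun V => V) continuousAt_id hV) (h.tendsto_avgMoment hp hθ 0)
  rw [hV.olsFun_eq] at h1
  refine tendstoInMeasure_congr_off (B := fun _ => ∅) (by simp) ?_ h1
  filter_upwards [eventually_gt_atTop 0] with T hT ω _
  exact olsHat_eq hT ω

/-- The continuous mapping theorem at the population matrix, applied to the pair of average moment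
matrices over `1, …, T` and over `p + 1, …, T`. -/
lemma convergesTo (h : FinitePredictor P x u μ p) (hp : 0 < p) {θ : Param k p}
    (hθ : HasParam P x u μ θ) :
    ConvergesTo P x u κ (popBias μ (obsMoment P x u μ p)) (popFilter μ (obsMoment P x u μ p))
      (popCov μ (obsMoment P x u μ p)) (κ + popShift μ (obsMoment P x u μ p)) := by
  have hV := h.isPopMoment hθ p
  have hpair := h.tendsto_avgMoment_pair hp hθ
  have hols := h.tendsto_olsHat κ hp hθ
  have hzero : Tendsto (fun _ : ℕ => P (∅ : Set Ω)) atTop (𝓝 0) := by simp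
  have hd : TendstoInMeasure P (fun T ω => olsHat x u κ T ω - κ - popBias μ (obsMoment P x u μ p))
      atTop fun _ => 0 := by
    have := tendstoInMeasure_sub_iff.2 hols
    simpa only [sub_sub] using this
  refine ⟨hols, fun t => ?_, ?_, fun j a c => ?_, fun a c => ?_, fun phat hphat => ?_⟩
  -- At a fixed date the difference is a sum of products of a null sequence, the error of OLS, with
  -- fixed square-integrable regressors.
  · refine tendstoInMeasure_pi fun i => tendstoInMeasure_of_sub ?_
    simp only [uHat_sub_uStar]
    have h1 : ∀ c, TendstoInMeasure P (fun T ω =>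
        (olsHat x u κ T ω - κ - popBias μ (obsMoment P x u μ p)) c * design (x t ω) i c) atTop
        fun _ => 0 := by
      intro c
      have hL : MemLp (fun ω => design (x t ω) i c) 2 P := by
        have := h.memLp_dotProduct p t (zForm μ 0 i c)
        simpa only [zForm_dotProduct, Fin.val_zero, Nat.cast_zero, sub_zero] using this
      refine tendstoInMeasure_mul_bounded (K := (eLpNorm (fun ω => design (x t ω) i c) 2 P).toReal)
        ENNReal.toReal_nonneg ?_ (fun _ => hL.aestronglyMeasurable)
        fun _ => (ENNReal.ofReal_toReal hL.2.ne).ge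
      have h3 := tendstoInMeasure_comp_continuousAt (g := fun d : Coef k → ℝ => d c)
        (continuous_apply c).continuousAt hd
      exact h3
    have h2 := tendstoInMeasure_comp_continuousAt (g := fun d : Coef k → ℝ => -∑ c, d c)
      (by fun_prop) (tendstoInMeasure_pi (f := fun T ω c =>
        (olsHat x u κ T ω - κ - popBias μ (obsMoment P x u μ p)) c * design (x t ω) i c)
        (g := fun _ _ => 0) h1)
    simp only [Finset.sum_const_zero, neg_zero] at h2
    simp only [Matrix.mulVec, dotProduct]
    simpa only [mul_comm] using h2
  · have h1 := tendstoInMeasure_comp_continuousAt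
      (continuousAt_quad (a := ((0 : Coef k → ℝ), obsMoment P x u μ p)) continuousAt_fst
        (continuousAt_olsGram (μ := μ) continuousAt_snd))
      (tendstoInMeasure_prodMk hd (h.tendsto_avgMoment hp hθ 0))
    rw [zero_dotProduct] at h1
    refine tendstoInMeasure_congr_off (B := fun _ => ∅) hzero (Eventually.of_forall ?_) h1
    intro T ω _
    rw [residualMSE_eq (p := p) (μ := μ)]
  · have h1 := tendstoInMeasure_comp_continuousAt
      (continuousAt_entry (continuousAt_pi.1 (hV.continuousAt_filter (κ := κ)) j) a c) hpair
    simp only [hV.olsFun_eq, add_sub_cancel_left] at h1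
    refine tendstoInMeasure_congr_off (B := fun _ => ∅) hzero ?_ h1
    filter_upwards [eventually_gt_atTop 0] with T hT ω _
    have hT0 : (T : ℝ)⁻¹ ≠ 0 := by positivity
    rw [uHat_eq, varFit_eq μ, olsHat_eq (p := p) (μ := μ) hT, avgMoment, avgMoment,
      varFun_smul _ _ hT0]
  -- The fitted covariance divides by `T - p` and the average moments by `T`; the correction factor
  -- tends to one.
  · have h0 : Tendsto (fun T : ℕ => ((T : ℝ)⁻¹ * ((T - p : ℕ) : ℝ))⁻¹) atTop (𝓝 1) := by
      simpa using (HasMoments.tendsto_ratio p).inv₀ one_ne_zero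
    have h1 := tendstoInMeasure_comp_continuousAt
      (continuousAt_entry (hV.continuousAt_cov (κ := κ)) a c) hpair
    simp only [hV.olsFun_eq, add_sub_cancel_left] at h1
    have h2 := tendstoInMeasure_comp_continuousAt (g := fun z : ℝ × ℝ => z.1 * z.2)
      (by fun_prop) (tendstoInMeasure_prodMk (tendstoInMeasure_const_of_tendsto (P := P) h0) h1)
    simp only [one_mul] at h2
    refine tendstoInMeasure_congr_off (B := fun _ => ∅) hzero ?_ h2
    filter_upwards [eventually_gt_atTop p] with T hT ω _
    have hT' : (T : ℝ) ≠ 0 := by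
      have : 0 < T := by omega
      positivity
    have hT0 : (T : ℝ)⁻¹ ≠ 0 := inv_ne_zero hT'
    rw [uHat_eq, varFitCov_eq μ, olsHat_eq (p := p) (μ := μ) (by omega)]
    simp only [avgMoment]
    rw [varFun_smul _ _ hT0, covFun_smul, Nat.cast_sub hT.le]
    simp only [Matrix.smul_apply, smul_eq_mul]
    rw [← mul_assoc, mul_inv, inv_inv]
    congr 1
    field_simp
  · have h1 := tendstoInMeasure_comp_continuousAt (hV.continuousAt_coFun (κ := κ)) hpair
    simp only [hV.coFun_eq] at h1
    -- A wrong order is selected with vanishing probability, so the estimator with order `p`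
    -- determines the limit.
    refine tendstoInMeasure_congr_off hphat.2 ?_ h1
    filter_upwards [eventually_gt_atTop p] with T hT ω hω
    refine coHat_eq hT phat ω ?_
    by_contra hne
    exact hω hne

end FinitePredictor

end Limits

/-! ### Block structure of autoregressions -/

section Blocks

open scoped InnerProductSpace

variable {E : Type*} [NormedAddCommGroup E] [InnerProductSpace ℝ E] {J : Type*} [Fintype J]
  [DecidableEq J] {p : ℕ} {Ψ : Fin p → Matrix J J ℝ} {S : Matrix J J ℝ} {z ε : ℤ → J → E}

/-- Block triangularity of the coefficients is inherited by the companion matrix and then by its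
powers. -/
lemma companion_pow_eq_zero {B : J → Prop} (hΨ : ∀ j a b, B a → ¬ B b → Ψ j a b = 0) (n : ℕ)
    (r s : Fin p × J) (hr : B r.2) (hs : ¬ B s.2) : (companion Ψ ^ n) r s = 0 := by
  induction n generalizing r with
  | zero =>
    rw [pow_zero, Matrix.one_apply_ne]
    rintro rfl
    exact hs hr
  | succ n ih =>
    rw [pow_succ', Matrix.mul_apply]
    refine Finset.sum_eq_zero fun q _ => ?_
    by_cases hq : B q.2
    · rw [ih q hq, mul_zero]
    · have : companion Ψ r q = 0 := by
        simp only [companion, Matrix.of_apply]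
        split_ifs with h1 h2
        · exact hΨ _ _ _ hr hq
        · exact absurd (h2.2 ▸ hr) hq
        · rfl
      rw [this, zero_mul]

namespace IsVAR

/-- Each group of components is a moving average of its own innovations, and innovations of
different groups are uncorrelated at all dates. -/
lemma inner_eq_zero_of_blocks [CompleteSpace E] (h : IsVAR Ψ S z ε) (hp : 0 < p) {B : J → Prop}
    (hΨ : ∀ j a b, B a → ¬ B b → Ψ j a b = 0) (hΨ' : ∀ j a b, ¬ B a → B b → Ψ j a b = 0)
    (hS : ∀ a b, B a → ¬ B b → S a b = 0) (t s : ℤ) (a b : J) (ha : B a) (hb : ¬ B b) :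
    ⟪z t a, z s b⟫_ℝ = 0 := by
  refine tendsto_nhds_unique ((h.hasMA hp t a).inner (h.hasMA hp s b)) ?_
  refine tendsto_const_nhds.congr fun m => ?_
  simp only [sum_inner, inner_sum, inner_smul_left, inner_smul_right, conj_trivial]
  symm
  refine Finset.sum_eq_zero fun n' _ => ?_
  refine Finset.sum_eq_zero fun d _ => ?_
  by_cases hd : B d
  · have h0 : maCoeff Ψ hp n' b d = 0 := companion_pow_eq_zero (B := fun j => ¬ B j)
      (fun j a b ha hb => hΨ' j a b ha (not_not.1 hb)) n' _ _ hb (not_not.2 hd)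
    rw [h0, zero_mul]
  refine mul_eq_zero_of_right _ (Finset.sum_eq_zero fun n _ => ?_)
  refine Finset.sum_eq_zero fun c _ => ?_
  by_cases hc : B c
  · by_cases hts : s - (n' : ℤ) = t - n
    · rw [hts, h.cov, hS c d hc hd, mul_zero]
    · rw [h.inner_innovation_ne hts, mul_zero]
  · have h0 : maCoeff Ψ hp n a c = 0 := companion_pow_eq_zero hΨ n _ _ ha hc
    rw [h0, zero_mul]

/-- Let `D` be the part of the predictor of `z 0 a` due to the other group. The variable, the own
part `G` and the innovation are all orthogonal to `D`, so `D` is orthogonal to itself and vanishes.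
Linear independence of the lags then removes its coefficients. -/
lemma coeff_eq_zero_of_inner (h : IsVAR Ψ S z ε) {B : J → Prop} [DecidablePred B]
    (hz : ∀ t s a b, B a → ¬ B b → ⟪z t a, z s b⟫_ℝ = 0) (j : Fin p) (a b : J) (ha : B a)
    (hb : ¬ B b) : Ψ j a b = 0 := by
  set D : E := ∑ j : Fin p, ∑ b, (if B b then 0 else Ψ j a b) • z (0 - ((j : ℕ) + 1 : ℤ)) b with hD
  set G : E := ∑ j : Fin p, ∑ b, (if B b then Ψ j a b else 0) • z (0 - ((j : ℕ) + 1 : ℤ)) b with hG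
  have e : z 0 a = D + G + ε 0 a := by
    rw [h.eq 0 a, hD, hG, ← Finset.sum_add_distrib]
    congr 1
    refine Finset.sum_congr rfl fun j _ => ?_
    rw [← Finset.sum_add_distrib]
    refine Finset.sum_congr rfl fun b _ => ?_
    split_ifs <;> simp
  have hperp : ∀ g : E, (∀ s c, ¬ B c → ⟪g, z s c⟫_ℝ = 0) → ⟪g, D⟫_ℝ = 0 := by
    intro g hg
    rw [hD, inner_sum, Finset.sum_eq_zero]
    intro i _
    rw [inner_sum, Finset.sum_eq_zero]
    intro c _
    split_ifs with hc
    · simp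
    · rw [inner_smul_right, hg _ _ hc, mul_zero]
  have h1 : ⟪z 0 a, D⟫_ℝ = 0 := hperp _ fun s c hc => hz _ _ _ _ ha hc
  have h2 : ⟪G, D⟫_ℝ = 0 := by
    refine hperp _ fun s c hc => ?_
    rw [hG, sum_inner, Finset.sum_eq_zero]
    intro i _
    rw [sum_inner, Finset.sum_eq_zero]
    intro d _
    split_ifs with hd
    · rw [inner_smul_left, hz _ _ _ _ hd hc, mul_zero]
    · simp
  have h3 : ⟪ε 0 a, D⟫_ℝ = 0 := by
    rw [hD, inner_sum, Finset.sum_eq_zero]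
    intro i _
    rw [inner_sum, Finset.sum_eq_zero]
    intro c _
    rw [inner_smul_right, h.orth _ _ _ _ (by omega), mul_zero]
  have h4 : D = 0 := by
    rw [e, inner_add_left, inner_add_left, h2, h3] at h1
    exact inner_self_eq_zero.1 (by linarith : ⟪D, D⟫_ℝ = 0)
  have h5 := h.eq_zero_of_lag_combination p (-1)
    (fun q : Fin p × J => if B q.2 then 0 else Ψ q.1 a q.2) (by
      rw [Fintype.sum_prod_type, ← h4, hD]
      refine Finset.sum_congr rfl fun i _ => Finset.sum_congr rfl fun c _ => ?_
      have : (-1 : ℤ) - (i : ℕ) = 0 - ((i : ℕ) + 1 : ℤ) := by ring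
      simp only [this])
  have := congrFun h5 (j, b)
  simpa [hb] using this

/-- With block-diagonal coefficients, an innovation is a combination of present and lagged
components of its own group. -/
lemma cov_eq_zero_of_inner (h : IsVAR Ψ S z ε) {B : J → Prop}
    (hz : ∀ t s a b, B a → ¬ B b → ⟪z t a, z s b⟫_ℝ = 0)
    (hΨ : ∀ j a b, B a → ¬ B b → Ψ j a b = 0) (hΨ' : ∀ j a b, ¬ B a → B b → Ψ j a b = 0)
    (a b : J) (ha : B a) (hb : ¬ B b) : S a b = 0 := by
  have e : ∀ a, ε 0 a = z 0 a - ∑ j : Fin p, ∑ b, Ψ j a b • z (0 - ((j : ℕ) + 1 : ℤ)) b := by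
    intro a; rw [h.eq 0 a]; abel
  rw [← h.cov 0 a b]
  have h1 : ∀ t c, B c → ⟪z t c, ε 0 b⟫_ℝ = 0 := by
    intro t c hc
    rw [e b, inner_sub_right, hz _ _ _ _ hc hb, zero_sub, neg_eq_zero, inner_sum,
      Finset.sum_eq_zero]
    intro i _
    rw [inner_sum, Finset.sum_eq_zero]
    intro d _
    rw [inner_smul_right]
    by_cases hd : B d
    · rw [hΨ' i b d hb hd, zero_mul]
    · rw [hz _ _ _ _ hc hd, mul_zero]
  rw [e a, inner_sub_left, h1 _ _ ha, zero_sub, neg_eq_zero, sum_inner, Finset.sum_eq_zero]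
  intro i _
  rw [sum_inner, Finset.sum_eq_zero]
  intro d _
  rw [inner_smul_left]
  by_cases hd : B d
  · rw [h1 _ _ hd, mul_zero]
  · rw [hΨ i a d ha hd]; simp

end IsVAR

end Blocks

/-! ### Strict exogeneity and block-diagonality -/

section StrictExogeneity

variable {N : ℕ} {k : Fin N → ℕ} {p : ℕ} {Ω : Type*} [MeasurableSpace Ω] {P : Measure Ω}
  [IsProbabilityMeasure P] {x : ℤ → Ω → Reg k → ℝ} {u : ℤ → Ω → Fin N → ℝ} {μ : Reg k → ℝ}
  {θ : Param k p}

namespace FinitePredictor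

/-- The mean of the regressor drops out because the disturbance has mean zero. -/
lemma integral_mul_eq (h : FinitePredictor P x u μ p) (t s : ℤ) (i : Fin N) (c : Reg k) :
    ∫ ω, u t ω i * x s ω c ∂P =
      inner ℝ (zL2 P x u μ t (Sum.inr i)) (zL2 P x u μ s (Sum.inl c)) := by
  rw [h.inner_zL2]
  have hu : MemLp (fun ω => u t ω i) 2 P := h.memLp t (Sum.inr i)
  have hx : MemLp (fun ω => x s ω c - μ c) 2 P := h.memLp s (Sum.inl c)
  have h0 : ∫ ω, u t ω i ∂P = 0 := h.mean_zero t (Sum.inr i)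
  have e : ∀ ω, u t ω i * x s ω c = u t ω i * (x s ω c - μ c) + u t ω i * μ c := fun ω => by ring
  simp only [e]
  have hux : Integrable (fun ω => u t ω i * (x s ω c - μ c)) P := hu.integrable_mul hx
  rw [integral_add hux ((hu.integrable one_le_two).mul_const _),
    integral_mul_const, h0, zero_mul, add_zero]
  rfl

lemma strictlyExogenous_iff (h : FinitePredictor P x u μ p) :
    StrictlyExogenous P x u ↔ ∀ t s a b, (a : Joint k).isRight → ¬ (b : Joint k).isRight →
      inner ℝ (zL2 P x u μ t a) (zL2 P x u μ s b) = (0 : ℝ) := by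
  constructor
  · rintro hx t s (a | a) (b | b) ha hb
    · simp at ha
    · simp at ha
    · rw [← h.integral_mul_eq]; exact hx t s a b
    · simp at hb
  · intro hz t s i c
    rw [h.integral_mul_eq]
    exact hz _ _ _ _ rfl (by simp)

/-- Apply the block lemmas to the splitting into regressors and disturbances. For the converse the
coefficient lemma is used twice, once with the groups exchanged, and the remaining block of `Σ`
follows by symmetry. -/
lemma bd_iff_strictlyExogenous (h : FinitePredictor P x u μ p) (hp : 0 < p)
    (hθ : HasParam P x u μ θ) : BD θ ↔ StrictlyExogenous P x u := by
  have hV := h.isVAR hθ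
  rw [h.strictlyExogenous_iff]
  constructor
  · intro hBD t s a b ha hb
    refine hV.inner_eq_zero_of_blocks hp (B := fun a => a.isRight) ?_ ?_ ?_ t s a b ha hb
    · rintro j (a | a) (b | b) ha hb
      · simp at ha
      · simp at ha
      · exact congrFun (congrFun (hBD.1 j).2 a) b
      · simp at hb
    · rintro j (a | a) (b | b) ha hb
      · simp at hb
      · exact congrFun (congrFun (hBD.1 j).1 a) b
      · simp at ha
      · simp at ha
    · rintro (a | a) (b | b) ha hb
      · simp at ha
      · simp at ha
      · exact congrFun (congrFun hBD.2.2 a) b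
      · simp at hb
  · intro hz
    have hz' : ∀ t s a b, ¬ (a : Joint k).isRight → ¬ ¬ (b : Joint k).isRight →
        inner ℝ (zL2 P x u μ t a) (zL2 P x u μ s b) = (0 : ℝ) := fun t s a b ha hb => by
      rw [real_inner_comm]; exact hz _ _ _ _ (not_not.1 hb) ha
    have h1 := hV.coeff_eq_zero_of_inner (B := fun a => a.isRight) hz
    have h2 := hV.coeff_eq_zero_of_inner (B := fun a => ¬ a.isRight) hz'
    have h3 := hV.cov_eq_zero_of_inner (B := fun a => a.isRight) hz h1
      fun j a b ha hb => h2 j a b ha (not_not.2 hb)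
    refine ⟨fun j => ⟨?_, ?_⟩, ?_, ?_⟩
    · ext c i; exact h2 j (Sum.inl c) (Sum.inr i) (by simp) (by simp)
    · ext i c; exact h1 j (Sum.inr i) (Sum.inl c) rfl (by simp)
    · ext c i
      have := hV.pos.isHermitian.apply (Sum.inl c) (Sum.inr i)
      rw [h3 (Sum.inr i) (Sum.inl c) rfl (by simp)] at this
      exact this.symm
    · ext i c; exact h3 (Sum.inr i) (Sum.inl c) rfl (by simp)

end FinitePredictor

end StrictExogeneity

/-! ### Population values under strict exogeneity -/

section Exogenous

variable {N : ℕ} {k : Fin N → ℕ} {p : ℕ} {μ : Reg k → ℝ} {V : ObsIdx k p → ObsIdx k p → ℝ}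

lemma bil_fzForm_filt_eq_zero
    (hV : ∀ i n c (j : Fin (p + 1)) m, bil V (zForm μ i n c) (uForm j m) = 0)
    (Φ : Fin p → Matrix (Fin N) (Fin N) ℝ) (n : Fin N) (c : Coef k) (m : Fin N) :
    bil V (fzForm μ Φ n c) (filt Φ uForm m) = 0 := by
  simp [fzForm, filt, bil_sub_left, bil_sub_right, bil_sum_left, bil_sum_right, bil_smul_left,
    bil_smul_right, hV]

/-- A filter combines only the dates in the window, so exogeneity at all these dates annihilates the
cross moment for an arbitrary filter. This robustness is what makes estimating the filter harmless.
-/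
lemma glsCross_eq_zero (hV : ∀ i n c (j : Fin (p + 1)) m, bil V (zForm μ i n c) (uForm j m) = 0)
    (Φ : Fin p → Matrix (Fin N) (Fin N) ℝ) (S : Matrix (Fin N) (Fin N) ℝ) :
    glsCross μ V Φ S = 0 := by
  ext c
  simp [glsCross, bil_fzForm_filt_eq_zero hV]

lemma popBias_eq_zero (hV : ∀ i n c (j : Fin (p + 1)) m, bil V (zForm μ i n c) (uForm j m) = 0) :
    popBias μ V = 0 := by
  have : olsCross μ V = 0 := by ext c; simp [olsCross, hV]
  rw [popBias, this, Matrix.mulVec_zero]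

lemma popShift_eq_zero (hV : ∀ i n c (j : Fin (p + 1)) m, bil V (zForm μ i n c) (uForm j m) = 0) :
    popShift μ V = 0 := by
  rw [popShift, glsCross_eq_zero hV, Matrix.mulVec_zero]

lemma wForm_zero : wForm (p := p) μ (0 : Coef k → ℝ) = uForm := by
  funext i n
  simp [wForm]

variable {Ω : Type*} [MeasurableSpace Ω] {P : Measure Ω}
  [IsProbabilityMeasure P] {x : ℤ → Ω → Reg k → ℝ} {u : ℤ → Ω → Fin N → ℝ} {θ : Param k p}

namespace FinitePredictor

lemma bil_zForm_uForm (h : FinitePredictor P x u μ p) (hx : StrictlyExogenous P x u)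
    (i : Fin (p + 1)) (n : Fin N) (c : Coef k) (j : Fin (p + 1)) (m : Fin N) :
    bil (obsMoment P x u μ p) (zForm μ i n c) (uForm j m) = 0 := by
  rw [h.bil_obsMoment p 0]
  simp only [zForm_dotProduct, uForm_dotProduct]
  rcases c with c | c
  · simp only [design_inl]
    split_ifs
    · simp only [one_mul]; exact h.mean_zero _ (Sum.inr m)
    · simp
  · simp only [design_inr]
    split_ifs
    · exact (integral_congr_ae (ae_of_all _ fun ω => mul_comm _ _)).trans (hx _ _ _ _)
    · simp

lemma bil_uForm (h : FinitePredictor P x u μ p) (i j : Fin (p + 1)) (n m : Fin N) :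
    bil (obsMoment P x u μ p) (uForm i n) (uForm j m) =
      inner ℝ (zL2 P x u μ (0 - (i : ℕ)) (Sum.inr n)) (zL2 P x u μ (0 - (j : ℕ)) (Sum.inr m)) := by
  rw [h.bil_obsMoment p 0, h.inner_zL2]
  simp only [uForm_dotProduct]
  rfl

/-- Without feedback from `x` to `u`, the filter with coefficients `Ψ_uu` turns the disturbance into
its innovation in the full system. -/
lemma bil_filt_uForm (h : FinitePredictor P x u μ p) (hθ : HasParam P x u μ θ)
    (hux : ∀ j, (θ.1 j).toBlocks₂₁ = 0) (n : Fin N) (j : Fin (p + 1)) (m : Fin N) :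
    bil (obsMoment P x u μ p) (filt (psiUU θ) uForm n) (uForm j m) =
      inner ℝ (innovation P x u μ 0 (Sum.inr n)) (zL2 P x u μ (0 - (j : ℕ)) (Sum.inr m)) := by
  have h1 := (h.isVAR hθ).eq 0 (Sum.inr n)
  have h2 : innovation P x u μ 0 (Sum.inr n) = zL2 P x u μ 0 (Sum.inr n) -
      ∑ j : Fin p, ∑ m, psiUU θ j n m • zL2 P x u μ (0 - ((j : ℕ) + 1 : ℤ)) (Sum.inr m) := by
    rw [eq_sub_iff_add_eq, add_comm]
    refine Eq.trans ?_ h1.symm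
    congr 1
    refine Finset.sum_congr rfl fun j _ => ?_
    rw [Fintype.sum_sum_type]
    have : ∀ c, θ.1 j (Sum.inr n) (Sum.inl c) = 0 := fun c => congrFun (congrFun (hux j) n) c
    simp only [this, zero_smul, Finset.sum_const_zero, zero_add]
    rfl
  rw [h2, inner_sub_left, sum_inner]
  simp only [filt, bil_sub_left, bil_sum_left, bil_smul_left, h.bil_uForm, sum_inner,
    inner_smul_left, conj_trivial, Fin.val_zero, Nat.cast_zero, sub_zero, Fin.val_succ,
    Nat.cast_add, Nat.cast_one]

/-- The bias is zero, so the residuals tend to the disturbances themselves, and the innovations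
satisfy the normal equations of their autoregression. -/
lemma popFilter_eq (h : FinitePredictor P x u μ p) (hθ : HasParam P x u μ θ)
    (hx : StrictlyExogenous P x u) (hux : ∀ j, (θ.1 j).toBlocks₂₁ = 0) :
    popFilter μ (obsMoment P x u μ p) = psiUU θ := by
  refine ((h.isPopMoment hθ p).eq_varFun_of_orthogonal _ _ fun n j m => ?_).symm
  rw [popBias_eq_zero (h.bil_zForm_uForm hx), wForm_zero, h.bil_filt_uForm hθ hux]
  exact (h.isVAR hθ).orth _ _ _ _ (by simp; omega)

/-- The innovation is orthogonal to the lags in the second factor, so only its covariance with the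
current disturbance remains. -/
lemma popCov_eq (h : FinitePredictor P x u μ p) (hθ : HasParam P x u μ θ)
    (hx : StrictlyExogenous P x u) (hux : ∀ j, (θ.1 j).toBlocks₂₁ = 0) :
    popCov μ (obsMoment P x u μ p) = sigmaUU θ := by
  ext n m
  rw [popCov, h.popFilter_eq hθ hx hux, popBias_eq_zero (h.bil_zForm_uForm hx), covFun,
    Matrix.of_apply, wForm_zero]
  have hV := h.isVAR hθ
  conv_lhs => enter [3]; rw [filt]
  rw [bil_sub_right, bil_sum_right, Finset.sum_eq_zero, sub_zero, h.bil_filt_uForm hθ hux]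
  · simp only [Fin.val_zero, Nat.cast_zero, sub_zero]
    exact hV.inner_innovation_self 0 _ _
  · intro j _
    rw [bil_sum_right, Finset.sum_eq_zero]
    intro l _
    rw [bil_smul_right, h.bil_filt_uForm hθ hux, hV.orth _ _ _ _ (by simp; omega), mul_zero]

end FinitePredictor

end Exogenous

/-! ### Measurability of the estimators -/

section Measurability

variable {N : ℕ} {k : Fin N → ℕ} {p : ℕ} {Ω : Type*} [MeasurableSpace Ω] {P : Measure Ω}

lemma aemeasurable_bil {Q : Type*} [Fintype Q] {V : Ω → Q → Q → ℝ} {α β : Ω → Q → ℝ}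
    (hV : ∀ q r, AEMeasurable (fun ω => V ω q r) P) (hα : ∀ q, AEMeasurable (fun ω => α ω q) P)
    (hβ : ∀ q, AEMeasurable (fun ω => β ω q) P) :
    AEMeasurable (fun ω => bil (V ω) (α ω) (β ω)) P := by
  unfold bil
  exact Finset.aemeasurable_fun_sum _ fun q _ => Finset.aemeasurable_fun_sum _ fun r _ =>
    ((hα q).mul (hβ r)).mul (hV q r)

lemma aemeasurable_det {n : Type*} [Fintype n] [DecidableEq n] {M : Ω → Matrix n n ℝ}
    (hM : ∀ i j, AEMeasurable (fun ω => M ω i j) P) : AEMeasurable (fun ω => (M ω).det) P := by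
  simp only [Matrix.det_apply]
  exact Finset.aemeasurable_fun_sum _ fun σ _ =>
    (Finset.aemeasurable_fun_prod _ fun i _ => hM _ _).const_smul _

lemma aemeasurable_matrix_inv {n : Type*} [Fintype n] [DecidableEq n] {M : Ω → Matrix n n ℝ}
    (hM : ∀ i j, AEMeasurable (fun ω => M ω i j) P) (i j : n) :
    AEMeasurable (fun ω => (M ω)⁻¹ i j) P := by
  simp only [Matrix.inv_def, Ring.inverse_eq_inv', Matrix.smul_apply, smul_eq_mul,
    Matrix.adjugate_apply]
  refine (aemeasurable_det hM).inv.mul (aemeasurable_det fun a b => ?_)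
  by_cases h : a = j
  · subst h; simp
  · simpa [Matrix.updateRow_ne h] using hM a b

lemma aemeasurable_mulVec {m n : Type*} [Fintype n] {M : Ω → Matrix m n ℝ} {w : Ω → n → ℝ}
    (hM : ∀ i j, AEMeasurable (fun ω => M ω i j) P) (hw : ∀ j, AEMeasurable (fun ω => w ω j) P)
    (i : m) : AEMeasurable (fun ω => Matrix.mulVec (M ω) (w ω) i) P := by
  simp only [Matrix.mulVec, dotProduct]
  exact Finset.aemeasurable_fun_sum _ fun j _ => (hM i j).mul (hw j)

lemma aemeasurable_solve {n : Type*} [Fintype n] [DecidableEq n] {M : Ω → Matrix n n ℝ}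
    {w : Ω → n → ℝ} {κ : n → ℝ} (hM : ∀ i j, AEMeasurable (fun ω => M ω i j) P)
    (hw : ∀ j, AEMeasurable (fun ω => w ω j) P) (i : n) :
    AEMeasurable (fun ω => Matrix.mulVec (M ω)⁻¹ (w ω + Matrix.mulVec (M ω) κ) i) P := by
  have h1 : ∀ i, AEMeasurable (fun ω => (w ω + Matrix.mulVec (M ω) κ) i) P := fun i =>
    (hw i).add (aemeasurable_mulVec (w := fun _ => κ) hM (fun _ => aemeasurable_const) i)
  exact aemeasurable_mulVec (M := fun ω => (M ω)⁻¹) (aemeasurable_matrix_inv hM) h1 i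

lemma aemeasurable_wForm {μ : Reg k → ℝ} {b : Ω → Coef k → ℝ}
    (hb : ∀ c, AEMeasurable (fun ω => b ω c) P) (i : Fin (p + 1)) (n : Fin N) (q : ObsIdx k p) :
    AEMeasurable (fun ω => wForm μ (b ω) i n q) P := by
  simp only [wForm, Pi.sub_apply, Finset.sum_apply, Pi.smul_apply, smul_eq_mul]
  exact aemeasurable_const.sub (Finset.aemeasurable_fun_sum _ fun c _ => (hb c).mul_const _)

lemma aemeasurable_filt {Q : Type*} {Φ : Ω → Fin p → Matrix (Fin N) (Fin N) ℝ}
    {g : Ω → Fin (p + 1) → Fin N → Q → ℝ}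
    (hΦ : ∀ j n m, AEMeasurable (fun ω => Φ ω j n m) P)
    (hg : ∀ i n q, AEMeasurable (fun ω => g ω i n q) P) (n : Fin N) (q : Q) :
    AEMeasurable (fun ω => filt (Φ ω) (g ω) n q) P := by
  simp only [filt, Pi.sub_apply, Finset.sum_apply, Pi.smul_apply, smul_eq_mul]
  exact (hg 0 n q).sub (Finset.aemeasurable_fun_sum _ fun j _ =>
    Finset.aemeasurable_fun_sum _ fun m _ => (hΦ j n m).mul (hg j.succ m q))

variable {μ : Reg k → ℝ} {κ : Coef k → ℝ} {V V₀ : Ω → ObsIdx k p → ObsIdx k p → ℝ}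
  {b : Ω → Coef k → ℝ} {Φ : Ω → Fin p → Matrix (Fin N) (Fin N) ℝ}
  {S : Ω → Matrix (Fin N) (Fin N) ℝ}

lemma aemeasurable_olsFun (hV : ∀ q r, AEMeasurable (fun ω => V ω q r) P) (c : Coef k) :
    AEMeasurable (fun ω => olsFun μ κ (V ω) c) P := by
  have hG : ∀ c d, AEMeasurable (fun ω => olsGram μ (V ω) c d) P := fun c d => by
    simp only [olsGram, Matrix.of_apply]
    exact Finset.aemeasurable_fun_sum _ fun n _ => aemeasurable_bil (α := fun _ => zForm μ 0 n c)
      (β := fun _ => zForm μ 0 n d) hV (fun _ => aemeasurable_const) fun _ => aemeasurable_const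
  have hC : ∀ c, AEMeasurable (fun ω => olsCross μ (V ω) c) P := fun c => by
    simp only [olsCross]
    exact Finset.aemeasurable_fun_sum _ fun n _ => aemeasurable_bil (α := fun _ => zForm μ 0 n c)
      (β := fun _ => uForm 0 n) hV (fun _ => aemeasurable_const) fun _ => aemeasurable_const
  exact aemeasurable_solve hG hC c

lemma aemeasurable_varFun (hV : ∀ q r, AEMeasurable (fun ω => V ω q r) P)
    (hb : ∀ c, AEMeasurable (fun ω => b ω c) P) (j : Fin p) (n m : Fin N) :
    AEMeasurable (fun ω => varFun μ (V ω) (b ω) j n m) P := by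
  simp only [varFun, Matrix.of_apply, Matrix.mul_apply]
  refine Finset.aemeasurable_fun_sum _ fun q _ => ?_
  have h1 : AEMeasurable (fun ω => lagCross μ (V ω) (b ω) n q) P := by
    simp only [lagCross, Matrix.of_apply]
    exact aemeasurable_bil hV (aemeasurable_wForm hb _ _) (aemeasurable_wForm hb _ _)
  have h2 : ∀ q r, AEMeasurable (fun ω => lagGram μ (V ω) (b ω) q r) P := fun q r => by
    simp only [lagGram, Matrix.of_apply]
    exact aemeasurable_bil hV (aemeasurable_wForm hb _ _) (aemeasurable_wForm hb _ _)
  exact h1.mul (aemeasurable_matrix_inv h2 q (j, m))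

lemma aemeasurable_covFun (hV : ∀ q r, AEMeasurable (fun ω => V ω q r) P)
    (hb : ∀ c, AEMeasurable (fun ω => b ω c) P) (hΦ : ∀ j n m, AEMeasurable (fun ω => Φ ω j n m) P)
    (n m : Fin N) : AEMeasurable (fun ω => covFun μ (V ω) (b ω) (Φ ω) n m) P := by
  simp only [covFun, Matrix.of_apply]
  have h := aemeasurable_filt (g := fun ω => wForm μ (b ω)) hΦ (aemeasurable_wForm hb)
  exact aemeasurable_bil hV (h n) (h m)

lemma aemeasurable_glsFun (hV : ∀ q r, AEMeasurable (fun ω => V ω q r) P)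
    (hΦ : ∀ j n m, AEMeasurable (fun ω => Φ ω j n m) P)
    (hS : ∀ n m, AEMeasurable (fun ω => S ω n m) P) (c : Coef k) :
    AEMeasurable (fun ω => glsFun μ κ (V ω) (Φ ω) (S ω) c) P := by
  have hf : ∀ n c q, AEMeasurable (fun ω => fzForm μ (Φ ω) n c q) P := fun n c q =>
    aemeasurable_filt (g := fun _ i m => zForm μ i m c) hΦ (fun _ _ _ => aemeasurable_const) n q
  have hG : ∀ c d, AEMeasurable (fun ω => glsGram μ (V ω) (Φ ω) (S ω) c d) P := fun c d => by
    simp only [glsGram, Matrix.of_apply]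
    exact Finset.aemeasurable_fun_sum _ fun n _ => Finset.aemeasurable_fun_sum _ fun m _ =>
      (aemeasurable_matrix_inv hS n m).mul (aemeasurable_bil hV (hf _ _) (hf _ _))
  have hC : ∀ c, AEMeasurable (fun ω => glsCross μ (V ω) (Φ ω) (S ω) c) P := fun c => by
    simp only [glsCross]
    exact Finset.aemeasurable_fun_sum _ fun n _ => Finset.aemeasurable_fun_sum _ fun m _ =>
      (aemeasurable_matrix_inv hS n m).mul (aemeasurable_bil hV (hf _ _)
        (aemeasurable_filt (g := fun _ => uForm) hΦ (fun _ _ _ => aemeasurable_const) m))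
  exact aemeasurable_solve hG hC c

lemma aemeasurable_coFun (hV₀ : ∀ q r, AEMeasurable (fun ω => V₀ ω q r) P)
    (hV : ∀ q r, AEMeasurable (fun ω => V ω q r) P) (c : Coef k) :
    AEMeasurable (fun ω => coFun μ κ (V₀ ω) (V ω) c) P := by
  have hb : ∀ c, AEMeasurable (fun ω => (olsFun μ κ (V₀ ω) - κ) c) P := fun c =>
    (aemeasurable_olsFun hV₀ c).sub aemeasurable_const
  have hΦ := aemeasurable_varFun (μ := μ) hV hb
  have hS := aemeasurable_covFun (μ := μ) hV hb hΦ
  simp only [coFun]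
  exact aemeasurable_glsFun hV hΦ hS c

/-- Choose measurable versions for all indices; countably many exceptional null sets do no harm.
This handles a data-dependent order. -/
lemma aemeasurable_of_countable_index {E : Type*} [MeasurableSpace E] {f : ℕ → Ω → E} {τ : Ω → ℕ}
    (hf : ∀ m, AEMeasurable (f m) P) (hτ : Measurable τ) : AEMeasurable (fun ω => f (τ ω) ω) P := by
  refine ⟨fun ω => (hf (τ ω)).mk _ ω, ?_, ?_⟩
  · have : Measurable fun q : ℕ × Ω => (hf q.1).mk _ q.2 :=
      measurable_from_prod_countable_right fun m => (hf m).measurable_mk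
    exact this.comp (hτ.prodMk measurable_id)
  · filter_upwards [ae_all_iff.2 fun m => (hf m).ae_eq_mk] with ω hω
    exact hω (τ ω)

variable [IsProbabilityMeasure P] {x : ℤ → Ω → Reg k → ℝ} {u : ℤ → Ω → Fin N → ℝ}

namespace FinitePredictor

lemma aemeasurable_sampleMoment (h : FinitePredictor P x u μ p) (m : ℕ) (I : Finset ℤ)
    (q r : ObsIdx k m) : AEMeasurable (fun ω => sampleMoment (obs m μ (fun s => x s ω)
      (fun s => u s ω)) I q r) P :=
  Finset.aemeasurable_fun_sum _ fun t _ =>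
    (h.memLp_obs m t q).aestronglyMeasurable.aemeasurable.mul
      (h.memLp_obs m t r).aestronglyMeasurable.aemeasurable

lemma aemeasurable_glsHat (h : FinitePredictor P x u μ p) (κ : Coef k → ℝ) (θ : Param k p)
    (T : ℕ) : AEMeasurable (glsHat x u κ θ T) P := by
  refine aemeasurable_pi_iff.2 fun c => ?_
  simp only [glsHat, yPath, gls_eq μ]
  exact aemeasurable_glsFun (Φ := fun _ => psiUU θ) (S := fun _ => sigmaUU θ)
    (h.aemeasurable_sampleMoment p _) (fun _ _ _ => aemeasurable_const)
    (fun _ _ => aemeasurable_const) c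

lemma aemeasurable_coHat (h : FinitePredictor P x u μ p) (κ : Coef k → ℝ) {phat : ℕ → Ω → ℕ}
    (hphat : ∀ T, Measurable (phat T)) (T : ℕ) : AEMeasurable (coHat x u κ phat T) P := by
  refine aemeasurable_of_countable_index
    (f := fun m ω => coEstimator m (fun t => x t ω) (yPath x u κ ω) T) (fun m => ?_) (hphat T)
  refine aemeasurable_pi_iff.2 fun c => ?_
  rcases lt_or_ge m T with hm | hm
  · simp only [yPath, coEstimator_eq μ κ _ _ T hm]
    exact aemeasurable_coFun (μ := μ) (κ := κ)
      (fun q r => (h.aemeasurable_sampleMoment m (Finset.Icc 1 (T : ℤ)) q r).const_mul _)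
      (fun q r => (h.aemeasurable_sampleMoment m (Finset.Icc ((m : ℤ) + 1) T) q r).const_mul _) c
  -- If the order is at least `T` no transformed observation is left, and the estimator is zero by
  -- convention.
  · have h0 : Finset.Icc ((m : ℤ) + 1) T = ∅ := Finset.Icc_eq_empty (by omega)
    simp only [coEstimator, gls, h0, Finset.sum_empty, Matrix.mulVec_zero]
    exact aemeasurable_const

end FinitePredictor

end Measurability

/-! ### Equivalence with infeasible GLS -/

section Equivalence

variable {N : ℕ} {k : Fin N → ℕ} {p : ℕ} {μ : Reg k → ℝ} {κ : Coef k → ℝ}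

/-- The coefficient of the moment `(q, r)` in `glsCross`. -/
def crossCoef (μ : Reg k → ℝ) (Φ : Fin p → Matrix (Fin N) (Fin N) ℝ)
    (S : Matrix (Fin N) (Fin N) ℝ) (q r : ObsIdx k p) (c : Coef k) : ℝ :=
  ∑ n, ∑ m, S⁻¹ n m * (fzForm μ Φ n c q * filt Φ uForm m r)

lemma glsCross_eq_sum (V : ObsIdx k p → ObsIdx k p → ℝ) (Φ : Fin p → Matrix (Fin N) (Fin N) ℝ)
    (S : Matrix (Fin N) (Fin N) ℝ) :
    glsCross μ V Φ S = ∑ q, ∑ r, V q r • crossCoef μ Φ S q r := by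
  ext c
  simp only [glsCross, bil, crossCoef, Finset.sum_apply, Pi.smul_apply, smul_eq_mul,
    Finset.mul_sum]
  conv_lhs => enter [2, n]; rw [Finset.sum_comm]; enter [2, q]; rw [Finset.sum_comm]
  rw [Finset.sum_comm]
  refine Finset.sum_congr rfl fun q _ => ?_
  rw [Finset.sum_comm]
  refine Finset.sum_congr rfl fun r _ => Finset.sum_congr rfl fun n _ =>
    Finset.sum_congr rfl fun m _ => by ring

lemma continuousAt_crossCoef {X : Type*} [TopologicalSpace X] {a : X}
    {Φ : X → Fin p → Matrix (Fin N) (Fin N) ℝ} {S : X → Matrix (Fin N) (Fin N) ℝ}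
    (hΦ : ContinuousAt Φ a) (hS : ContinuousAt S a) (h : IsUnit (S a).det) (q r : ObsIdx k p) :
    ContinuousAt (fun z => crossCoef μ (Φ z) (S z) q r) a := by
  refine continuousAt_pi.2 fun c => ?_
  simp only [crossCoef]
  exact continuousAt_sum fun n => continuousAt_sum fun m =>
    (continuousAt_entry (continuousAt_matrix_inv hS h) n m).mul
      ((continuousAt_pi.1 (continuousAt_fzForm hΦ n c) q).mul (continuousAt_pi.1
        (continuousAt_filt (g := fun _ => uForm) hΦ (fun _ _ => continuousAt_const) m) r))

/-- The contribution of the moment `(q, r)` to the estimation error of GLS. -/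
def glsInfluence (μ : Reg k → ℝ) (V : ObsIdx k p → ObsIdx k p → ℝ)
    (Φ : Fin p → Matrix (Fin N) (Fin N) ℝ) (S : Matrix (Fin N) (Fin N) ℝ) (q r : ObsIdx k p) :
    Coef k → ℝ :=
  Matrix.mulVec (glsGram μ V Φ S)⁻¹ (crossCoef μ Φ S q r)

/-- The part of the moments proportional to the population matrix contributes nothing to the cross
moment, so the error is linear in the deviations `W`, with the influences as coefficients. -/
lemma glsFun_sub_eq {V V₀ W : ObsIdx k p → ObsIdx k p → ℝ} {a r : ℝ}
    {Φ : Fin p → Matrix (Fin N) (Fin N) ℝ} {S : Matrix (Fin N) (Fin N) ℝ}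
    (hV : ∀ i j, V i j = a * W i j + r * V₀ i j) (h0 : glsCross μ V₀ Φ S = 0)
    (hdet : IsUnit (glsGram μ V Φ S).det) :
    glsFun μ κ V Φ S - κ = a • ∑ i, ∑ j, W i j • glsInfluence μ V Φ S i j := by
  have e : glsCross μ V Φ S = a • ∑ i, ∑ j, W i j • crossCoef μ Φ S i j := by
    rw [glsCross_eq_sum] at h0 ⊢
    simp only [hV, add_smul, Finset.sum_add_distrib, mul_smul, ← Finset.smul_sum]
    rw [h0, smul_zero, add_zero]
  rw [glsFun, mulVec_inv_add hdet, add_sub_cancel_left, e, Matrix.mulVec_smul, Matrix.mulVec_sum]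
  simp only [Matrix.mulVec_sum, Matrix.mulVec_smul, glsInfluence]

variable {Ω : Type*} [MeasurableSpace Ω] {P : Measure Ω} [IsProbabilityMeasure P]
  {x : ℤ → Ω → Reg k → ℝ} {u : ℤ → Ω → Fin N → ℝ} {θ : Param k p}

lemma tendsto_measure_of_eventually {E : Type*} [PseudoEMetricSpace E] {f : ℕ → Ω → E} {c : E}
    (hf : TendstoInMeasure P f atTop fun _ => c) {p : E → Prop} (hp : ∀ᶠ z in 𝓝 c, p z) :
    Tendsto (fun n => P {ω | ¬ p (f n ω)}) atTop (𝓝 0) := by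
  obtain ⟨ε, hε, h⟩ := EMetric.mem_nhds_iff.1 hp
  refine tendsto_of_tendsto_of_tendsto_of_le_of_le tendsto_const_nhds (hf ε hε)
    (fun _ => zero_le) fun n => measure_mono fun ω hω => ?_
  by_contra hlt
  exact hω (h (Metric.mem_eball.2 (not_le.1 hlt)))

namespace FinitePredictor

/-- Feasible and infeasible GLS weight the same scaled deviations, by influences that have the same
limit. The difference is a finite sum of products of null sequences with `L²`-bounded ones. -/
lemma tendsto_sqrt_sub (h : FinitePredictor P x u μ p) (hp : 0 < p) (hθ : HasParam P x u μ θ)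
    (hBD : BD θ) {phat : ℕ → Ω → ℕ} (hphat : SelectsOrder P p phat) :
    TendstoInMeasure P
      (fun (T : ℕ) ω => √(T : ℝ) • (coHat x u κ phat T ω - glsHat x u κ θ T ω)) atTop
      (fun _ => 0) := by
  have hx := (h.bd_iff_strictlyExogenous hp hθ).1 hBD
  have hux : ∀ j, (θ.1 j).toBlocks₂₁ = 0 := fun j => (hBD.1 j).2
  have hz := h.bil_zForm_uForm hx
  have hfilter := h.popFilter_eq hθ hx hux
  have hcov := h.popCov_eq hθ hx hux
  have hV := h.isPopMoment hθ p
  have hpair := h.tendsto_avgMoment_pair hp hθ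
  set V := obsMoment P x u μ p with hVdef
  have hunit : IsUnit (sigmaUU θ).det := by
    rw [← hcov]; exact (Matrix.isUnit_iff_isUnit_det _).1 hV.popCov_posDef.isUnit
  have hgram : IsUnit (glsGram μ V (psiUU θ) (sigmaUU θ)).det := by
    rw [← hcov, ← hfilter]; exact hV.popGram_isUnit
  let Mom := (ObsIdx k p → ObsIdx k p → ℝ) × (ObsIdx k p → ObsIdx k p → ℝ)
  let Φ' : Mom → Fin p → Matrix (Fin N) (Fin N) ℝ := fun z => varFun μ z.2 (olsFun μ κ z.1 - κ)
  let S' : Mom → Matrix (Fin N) (Fin N) ℝ := fun z => covFun μ z.2 (olsFun μ κ z.1 - κ) (Φ' z)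
  have hΦ' : Φ' (V, V) = psiUU θ := by
    simp only [Φ', hV.olsFun_eq, add_sub_cancel_left]; exact hfilter
  have hS' : S' (V, V) = sigmaUU θ := by
    simp only [S', hΦ']
    rw [← hcov, ← hfilter, popCov, hV.olsFun_eq, add_sub_cancel_left]
  have cΦ : ContinuousAt Φ' (V, V) := hV.continuousAt_filter
  have cS : ContinuousAt S' (V, V) := hV.continuousAt_cov
  have hunit' : IsUnit (S' (V, V)).det := by rw [hS']; exact hunit
  have hgram' : IsUnit (glsGram μ V (Φ' (V, V)) (S' (V, V))).det := by
    rw [hΦ', hS']; exact hgram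
  have cG : ContinuousAt (fun z : Mom => glsGram μ z.2 (Φ' z) (S' z)) (V, V) :=
    continuousAt_glsGram continuousAt_snd cΦ cS hunit'
  have cG₀ : ContinuousAt (fun z : Mom => glsGram μ z.2 (psiUU θ) (sigmaUU θ)) (V, V) :=
    continuousAt_glsGram continuousAt_snd continuousAt_const continuousAt_const hunit
  have cdet : Continuous fun A : Matrix (Coef k) (Coef k) ℝ => A.det :=
    Continuous.matrix_det continuous_id
  -- Both error representations require invertible Gram matrices, which holds for moments near the
  -- population matrix, hence with probability tending to one.
  let good : Mom → Prop := fun z => IsUnit (glsGram μ z.2 (Φ' z) (S' z)).det ∧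
    IsUnit (glsGram μ z.2 (psiUU θ) (sigmaUU θ)).det
  have hgood : ∀ᶠ z in 𝓝 (V, V), good z := by
    have h1 := (cdet.continuousAt.comp cG).eventually_ne hgram'.ne_zero
    have h2 := (cdet.continuousAt.comp cG₀).eventually_ne hgram.ne_zero
    filter_upwards [h1, h2] with z h1 h2
    exact ⟨isUnit_iff_ne_zero.2 h1, isUnit_iff_ne_zero.2 h2⟩
  -- The difference of the influences with estimated and true filter and weight; it is continuous at
  -- the population matrix and vanishes there.
  let H : ObsIdx k p → ObsIdx k p → Mom → Coef k → ℝ := fun q r z =>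
    glsInfluence μ z.2 (Φ' z) (S' z) q r - glsInfluence μ z.2 (psiUU θ) (sigmaUU θ) q r
  have cH : ∀ q r, ContinuousAt (H q r) (V, V) := fun q r =>
    (continuousAt_mulVec (continuousAt_matrix_inv cG hgram')
      (continuousAt_crossCoef cΦ cS hunit' q r)).sub
    (continuousAt_mulVec (continuousAt_matrix_inv cG₀ hgram)
      (continuousAt_crossCoef continuousAt_const continuousAt_const hunit q r))
  have hH0 : ∀ q r, H q r (V, V) = 0 := fun q r => by
    simp only [H, hΦ', hS', sub_self]
  let W : ℕ → Ω → ObsIdx k p → ObsIdx k p → ℝ := fun T ω q r => (√(T : ℝ))⁻¹ *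
    ∑ t ∈ Finset.Icc ((p : ℤ) + 1) T, (obs p μ (fun s => x s ω) (fun s => u s ω) t q *
      obs p μ (fun s => x s ω) (fun s => u s ω) t r - V q r)
  have hmom := h.hasMoments hp hθ p
  obtain ⟨B, hB, hWB⟩ := hmom.exists_eLpNorm_scaled_le p
  have hlim : TendstoInMeasure P (fun T ω => ∑ q, ∑ r, W T ω q r •
      H q r (avgMoment p μ x u 0 T ω, avgMoment p μ x u p T ω)) atTop fun _ => 0 := by
    refine tendstoInMeasure_pi fun c => ?_
    have h1 : ∀ q r, TendstoInMeasure P (fun T ω =>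
        H q r (avgMoment p μ x u 0 T ω, avgMoment p μ x u p T ω) c * W T ω q r) atTop
        fun _ => 0 := by
      intro q r
      have h2 := tendstoInMeasure_comp_continuousAt (continuousAt_pi.1 (cH q r) c) hpair
      simp only [hH0] at h2
      exact tendstoInMeasure_mul_bounded hB h2
        (fun T => (hmom.aestronglyMeasurable_sum q r _).const_mul _) (hWB q r)
    have h3 := tendstoInMeasure_comp_continuousAt
      (g := fun d : ObsIdx k p → ObsIdx k p → ℝ => ∑ q, ∑ r, d q r)
      (continuous_finsetSum _ fun q _ => continuous_finsetSum _ fun r _ =>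
        continuous_apply_apply q r).continuousAt
      (tendstoInMeasure_pi (g := fun _ _ => 0) fun q => tendstoInMeasure_pi
        (f := fun T ω r => H q r (avgMoment p μ x u 0 T ω, avgMoment p μ x u p T ω) c * W T ω q r)
        (g := fun _ _ => 0) (h1 q))
    simp only [Pi.zero_apply, Finset.sum_const_zero] at h3
    simpa only [Finset.sum_apply, Pi.smul_apply, smul_eq_mul, mul_comm, Pi.zero_apply] using h3
  refine tendstoInMeasure_congr_off (B := fun T => {ω | phat T ω ≠ p} ∪
    {ω | ¬ good (avgMoment p μ x u 0 T ω, avgMoment p μ x u p T ω)}) ?_ ?_ hlim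
  · have h1 := hphat.2.add (tendsto_measure_of_eventually hpair hgood)
    rw [add_zero] at h1
    exact tendsto_of_tendsto_of_tendsto_of_le_of_le tendsto_const_nhds h1 (fun _ => zero_le)
      fun T => measure_union_le _ _
  · filter_upwards [eventually_gt_atTop p] with T hT ω hω
    simp only [Set.mem_union, Set.mem_ofPred_eq, not_or, not_not] at hω
    obtain ⟨hω1, hω2, hω3⟩ := hω
    have hT0 : 0 < (T : ℝ) := by
      have : 0 < T := by omega
      exact_mod_cast this
    have hVT : ∀ i j, avgMoment p μ x u p T ω i j = (√(T : ℝ))⁻¹ * W T ω i j +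
        ((T : ℝ)⁻¹ * ((T - p : ℕ) : ℝ)) * V i j := fun i j =>
      HasMoments.scaled_eq (v := fun t ω => obs p μ (fun s => x s ω) (fun s => u s ω) t) p T i j ω
    have e1 := glsFun_sub_eq (κ := κ) hVT (glsCross_eq_zero hz _ _) hω2
    have e2 := glsFun_sub_eq (κ := κ) hVT (glsCross_eq_zero hz _ _) hω3
    have e3 : glsHat x u κ θ T ω = glsFun μ κ (avgMoment p μ x u p T ω) (psiUU θ) (sigmaUU θ) := by
      rw [avgMoment, glsFun_smul _ _ _ (inv_ne_zero hT0.ne'), glsHat, yPath, gls_eq μ]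
    rw [coHat_eq (μ := μ) hT phat ω hω1, e3]
    change √(T : ℝ) • (glsFun μ κ (avgMoment p μ x u p T ω)
      (Φ' (avgMoment p μ x u 0 T ω, avgMoment p μ x u p T ω))
      (S' (avgMoment p μ x u 0 T ω, avgMoment p μ x u p T ω)) - _) = _
    rw [← sub_sub_sub_cancel_right _ _ κ, e1, e2, ← smul_sub, smul_smul,
      mul_inv_cancel₀ (Real.sqrt_pos.2 hT0).ne', one_smul, ← Finset.sum_sub_distrib]
    refine Finset.sum_congr rfl fun q _ => ?_
    rw [← Finset.sum_sub_distrib]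
    refine Finset.sum_congr rfl fun r _ => ?_
    rw [← smul_sub]

variable (κ) in
-- Consistency is the general limit with zero shift. The limit laws agree by Slutsky's argument, in
-- both directions, because the scaled difference is null and both estimators are measurable up to
-- null sets.
lemma efficient (h : FinitePredictor P x u μ p) (hp : 0 < p) (hθ : HasParam P x u μ θ)
    (hBD : BD θ) {phat : ℕ → Ω → ℕ} (hphat : SelectsOrder P p phat) :
    Efficient P x u κ θ phat := by
  have hx := (h.bd_iff_strictlyExogenous hp hθ).1 hBD
  have heq := h.tendsto_sqrt_sub (κ := κ) hp hθ hBD hphat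
  have hgm : ∀ T : ℕ, AEMeasurable (fun ω => √(T : ℝ) • (glsHat x u κ θ T ω - κ)) P := fun T =>
    AEMeasurable.const_smul (g := fun ω => glsHat x u κ θ T ω - κ)
      ((h.aemeasurable_glsHat κ θ T).sub aemeasurable_const) (√(T : ℝ))
  have hcm : ∀ T : ℕ, AEMeasurable (fun ω => √(T : ℝ) • (coHat x u κ phat T ω - κ)) P := fun T =>
    AEMeasurable.const_smul (g := fun ω => coHat x u κ phat T ω - κ)
      ((h.aemeasurable_coHat κ hphat.1 T).sub aemeasurable_const) (√(T : ℝ))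
  refine ⟨?_, heq, fun ν _ => ⟨fun hg => ?_, fun hc => ?_⟩⟩
  · have := (h.convergesTo κ hp hθ).coef phat hphat
    rwa [popShift_eq_zero (h.bil_zForm_uForm hx), add_zero] at this
  · refine tendstoInDistribution_of_tendstoInMeasure_sub _ _ hg ?_ hcm
    refine tendstoInMeasure_congr_off (B := fun _ => ∅) (by simp)
      (Eventually.of_forall fun T ω _ => ?_) heq
    simp only [Pi.sub_apply, ← smul_sub, sub_sub_sub_cancel_right]
  · refine tendstoInDistribution_of_tendstoInMeasure_sub _ _ hc ?_ hgm
    have := tendstoInMeasure_comp_continuousAt (g := fun z : Coef k → ℝ => -z) (by fun_prop) heq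
    rw [neg_zero] at this
    refine tendstoInMeasure_congr_off (B := fun _ => ∅) (by simp)
      (Eventually.of_forall fun T ω _ => ?_) this
    simp only [Pi.sub_apply, ← smul_sub, sub_sub_sub_cancel_right, ← smul_neg, neg_sub]

end FinitePredictor

end Equivalence

/-! ### Failure of the two-step procedure -/

section Failure

variable {N : ℕ} {k : Fin N → ℕ} {p : ℕ} {μ : Reg k → ℝ} {Ω : Type*} [MeasurableSpace Ω]
  {P : Measure Ω} [IsProbabilityMeasure P] {x : ℤ → Ω → Reg k → ℝ} {u : ℤ → Ω → Fin N → ℝ}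
  {θ : Param k p}

lemma eq_of_tendstoInMeasure_const {E : Type*} [EMetricSpace E] {f : ℕ → Ω → E} {c d : E}
    (hc : TendstoInMeasure P f atTop fun _ => c) (hd : TendstoInMeasure P f atTop fun _ => d) :
    c = d := by
  have h := tendstoInMeasure_ae_unique hc hd
  exact h.exists.choose_spec

namespace FinitePredictor

/-- The second moment of `Z_t' b` is the quadratic form of the definite OLS Gram matrix at `b`. -/
lemma ae_design_mulVec_eq_zero (h : FinitePredictor P x u μ p) (hθ : HasParam P x u μ θ) (t : ℤ)
    {b : Coef k → ℝ} (hb : ∀ᵐ ω ∂P, Matrix.mulVec (design (x t ω)) b = 0) : b = 0 := by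
  refine (h.isPopMoment hθ p).olsGram_definite b ?_
  rw [bil_eq_mulVec_quad (M := olsGram μ (obsMoment P x u μ p)) (obsMoment P x u μ p)
    (fun n c => zForm μ 0 n c) (fun c d => rfl)]
  refine Finset.sum_eq_zero fun n _ => ?_
  rw [h.bil_obsMoment p t, integral_eq_zero_of_ae]
  filter_upwards [hb] with ω hω
  have : (∑ c, b c • zForm μ 0 n c) ⬝ᵥ obs p μ (fun s => x s ω) (fun s => u s ω) t = 0 := by
    rw [sum_smul_dotProduct]
    simp only [zForm_dotProduct]
    refine Eq.trans ?_ (congrFun hω n)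
    simp only [Matrix.mulVec, dotProduct, Fin.val_zero, Nat.cast_zero, sub_zero]
    exact Finset.sum_congr rfl fun c _ => mul_comm _ _
  rw [this]; simp

/-- The squared size of the bias of the OLS residuals, in the metric of the design. -/
lemma residualMSE_zero_eq (T : ℕ) (ω : Ω) (κ : Coef k → ℝ) :
    residualMSE x u κ u T ω = residualMSE x u κ (uStar x u 0) T ω := by
  simp [residualMSE, uStar]

/-- Limits in probability are unique, so a nonzero bias or shift in the general limits excludes the
correct ones. -/
lemma fails (h : FinitePredictor P x u μ p) (hp : 0 < p) (hθ : HasParam P x u μ θ)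
    (hb : popBias μ (obsMoment P x u μ p) ≠ 0)
    (hΦ : popFilter μ (obsMoment P x u μ p) ≠ psiUU θ)
    (hs : popShift μ (obsMoment P x u μ p) ≠ 0) (κ : Coef k → ℝ) : Fails P x u κ θ := by
  have hc := h.convergesTo κ hp hθ
  have hV := h.isPopMoment hθ p
  set b := popBias μ (obsMoment P x u μ p)
  refine ⟨fun h0 => ?_, fun t h0 => ?_, fun h0 => ?_, fun b' Φ' S' κs hps => ?_,
    fun phat hphat h0 => ?_⟩
  · exact hb (by simpa using eq_of_tendstoInMeasure_const hc.ols h0)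
  · have h1 := tendstoInMeasure_ae_unique (hc.residual t) h0
    refine hb (h.ae_design_mulVec_eq_zero hθ t ?_)
    filter_upwards [h1] with ω hω
    simpa [uStar] using hω
  · have h1 := h.tendsto_olsHat κ hp hθ
    -- The mean square distance to `u` tends to the quadratic form of the Gram matrix at the bias,
    -- which is positive unless `b = 0`.
    have hd : TendstoInMeasure P (fun T ω => olsHat x u κ T ω - κ - 0) atTop fun _ => b := by
      have := tendstoInMeasure_comp_continuousAt (g := fun z : Coef k → ℝ => z - κ - 0)
        (by fun_prop) h1
      simpa only [add_sub_cancel_left, sub_zero] using this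
    have h2 := tendstoInMeasure_comp_continuousAt
      (continuousAt_quad (a := (b, obsMoment P x u μ p)) continuousAt_fst
        (continuousAt_olsGram (μ := μ) continuousAt_snd))
      (tendstoInMeasure_prodMk hd (h.tendsto_avgMoment hp hθ 0))
    have h3 : TendstoInMeasure P (residualMSE x u κ u) atTop fun _ =>
        b ⬝ᵥ Matrix.mulVec (olsGram μ (obsMoment P x u μ p)) b := by
      refine tendstoInMeasure_congr_off (B := fun _ => ∅) (by simp) (Eventually.of_forall ?_) h2
      intro T ω _
      rw [residualMSE_zero_eq, residualMSE_eq (p := p) (μ := μ)]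
    exact hb (hV.olsGram_definite b (eq_of_tendstoInMeasure_const h3 h0))
  · obtain ⟨rfl, rfl, -, rfl⟩ := h.eq_of_isPseudoTrue κ hθ hps
    exact ⟨hb, hΦ, fun h1 => hs (by simpa using h1)⟩
  · exact hs (by simpa using eq_of_tendstoInMeasure_const (hc.coef phat hphat) h0)

end FinitePredictor

end Failure

/-! ### Independence of the population values from the mean of the regressors -/

section Mean

variable {N : ℕ} {k : Fin N → ℕ} {p : ℕ} {μ : Reg k → ℝ} {V : ObsIdx k p → ObsIdx k p → ℝ}

/-- The coefficients on the regressors `x` that correspond to `b` on `x - μ`. -/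
def shift (μ : Reg k → ℝ) (b : Coef k → ℝ) : Coef k → ℝ
  | Sum.inl n => b (Sum.inl n) - ∑ c : Reg k, if c.1 = n then b (Sum.inr c) * μ c else 0
  | Sum.inr c => b (Sum.inr c)

lemma zForm_inr_eq (i : Fin (p + 1)) (n : Fin N) (c : Reg k) :
    zForm μ i n (Sum.inr c) = zForm 0 i n (Sum.inr c) + μ c • zForm 0 i n (Sum.inl c.1) := by
  simp only [zForm]
  by_cases h : c.1 = n
  · subst h; simp
  · simp [h, Ne.symm h]

lemma zForm_inl_eq (i : Fin (p + 1)) (n m : Fin N) :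
    zForm μ i n (Sum.inl m) = zForm 0 i n (Sum.inl m) := rfl

/-- Recentring a regressor is absorbed by the intercept of its equation. Hence the residuals, and
all that is computed from them, do not depend on `μ`. -/
lemma wForm_shift (b : Coef k → ℝ) (i : Fin (p + 1)) (n : Fin N) :
    wForm μ (shift μ b) i n = wForm 0 b i n := by
  have h : ∑ c : Reg k, (b (Sum.inr c) * μ c) • zForm (k := k) (p := p) 0 i n (Sum.inl c.1) =
      ∑ m, (∑ c : Reg k, if c.1 = m then b (Sum.inr c) * μ c else 0) •
        zForm (k := k) (p := p) 0 i n (Sum.inl m) := by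
    simp only [Finset.sum_smul]
    rw [Finset.sum_comm]
    refine Finset.sum_congr rfl fun c _ => ?_
    simp [ite_smul]
  rw [wForm, wForm, Fintype.sum_sum_type, Fintype.sum_sum_type]
  congr 1
  simp only [shift, zForm_inr_eq (μ := μ), zForm_inl_eq (μ := μ), smul_add, sub_smul,
    Finset.sum_add_distrib, Finset.sum_sub_distrib, smul_smul, h]
  abel

lemma olsCross_sub (b : Coef k → ℝ) (c : Coef k) :
    olsCross μ V c - Matrix.mulVec (olsGram μ V) b c =
      ∑ n, bil V (zForm μ 0 n c) (wForm μ b 0 n) := by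
  simp only [wForm, bil_sub_right, Finset.sum_sub_distrib, bil_sum_right, bil_smul_right]
  congr 1
  simp only [Matrix.mulVec, dotProduct, olsGram, Matrix.of_apply, Finset.sum_mul]
  rw [Finset.sum_comm]
  exact Finset.sum_congr rfl fun _ _ => Finset.sum_congr rfl fun _ _ => mul_comm _ _

namespace IsPopMoment

lemma zero_mean (hV : IsPopMoment μ V) : IsPopMoment 0 V where
  posDef := hV.posDef
  stat b i j n m := by
    have := hV.stat (shift μ b) i j n m
    simpa only [wForm_shift] using this

/-- The shifted vector leaves the residual unchanged, and the forms for mean `μ` are combinations of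
those for mean zero, so it solves the normal equations. -/
lemma popBias_eq (hV : IsPopMoment μ V) : popBias μ V = shift μ (popBias 0 V) := by
  symm
  apply hV.eq_popBias
  funext c
  refine (sub_eq_zero.1 ?_).symm
  rw [olsCross_sub]
  simp only [wForm_shift]
  have h0 : ∀ c, ∑ n, bil V (zForm 0 0 n c) (wForm 0 (popBias 0 V) 0 n) = 0 := fun c => by
    rw [← olsCross_sub, hV.zero_mean.olsGram_mulVec_popBias, sub_self]
  rcases c with m | c
  · simp only [zForm_inl_eq (μ := μ), h0]
  · simp only [zForm_inr_eq (μ := μ), bil_add_left, bil_smul_left, Finset.sum_add_distrib,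
      ← Finset.mul_sum, h0, mul_zero, add_zero]

lemma popFilter_eq (hV : IsPopMoment μ V) : popFilter μ V = popFilter 0 V := by
  unfold popFilter varFun lagGram lagCross
  simp only [hV.popBias_eq, wForm_shift]

lemma popCov_eq (hV : IsPopMoment μ V) : popCov μ V = popCov 0 V := by
  have : wForm (p := p) μ (popBias μ V) = wForm 0 (popBias 0 V) := by
    funext i n; rw [hV.popBias_eq, wForm_shift]
  unfold popCov covFun
  rw [this, hV.popFilter_eq]

end IsPopMoment

lemma bil_zForm_inl (h0 : ∀ q, V none (some q) = 0) (i : Fin (p + 1)) (n m : Fin N)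
    (j : Fin (p + 1)) (l : Fin N) : bil V (zForm 0 i n (Sum.inl m)) (uForm j l) = 0 := by
  simp only [zForm, uForm]
  split_ifs
  · simp [bil, Pi.single_apply, h0]
  · simp [bil]

/-- The mean contributes multiples of the cross moments of the constant with the disturbances, which
are zero. -/
lemma olsCross_zero_mean (h0 : ∀ q, V none (some q) = 0) : olsCross μ V = olsCross 0 V := by
  ext c
  rcases c with m | c
  · rfl
  · simp [olsCross, zForm_inr_eq (μ := μ), bil_add_left, bil_smul_left, bil_zForm_inl h0]

lemma glsCross_zero_mean (h0 : ∀ q, V none (some q) = 0) (Φ : Fin p → Matrix (Fin N) (Fin N) ℝ)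
    (S : Matrix (Fin N) (Fin N) ℝ) : glsCross μ V Φ S = glsCross 0 V Φ S := by
  have h1 : ∀ n m l, bil V (fzForm 0 Φ n (Sum.inl m)) (filt Φ uForm l) = 0 := by
    intro n m l
    simp [fzForm, filt, bil_sub_left, bil_sub_right, bil_sum_left, bil_sum_right, bil_smul_left,
      bil_smul_right, bil_zForm_inl h0]
  have h2 : ∀ n (c : Reg k), fzForm μ Φ n (Sum.inr c) =
      fzForm 0 Φ n (Sum.inr c) + μ c • fzForm 0 Φ n (Sum.inl c.1) := by
    intro n c
    simp only [fzForm, filt, zForm_inr_eq (μ := μ), smul_add, smul_sub, Finset.sum_add_distrib,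
      Finset.smul_sum, smul_comm (μ c)]
    abel
  ext c
  rcases c with m | c
  · rfl
  · simp [glsCross, h2, bil_add_left, bil_smul_left, h1]

end Mean

/-! ### Second moments as functions of the parameters -/

section Lyapunov

open scoped InnerProductSpace Kronecker

variable {J : Type*} [Fintype J] [DecidableEq J] {p : ℕ}

/-- The coefficients of an autoregression, with a zero coefficient for one further lag. -/
def padCoeff (Ψ : Fin p → Matrix J J ℝ) : Fin (p + 1) → Matrix J J ℝ := Fin.snoc Ψ 0

/-- The covariance matrix of the innovation of the state equation. -/
def stateCov (p : ℕ) (S : Matrix J J ℝ) (r : (Fin p × J) × (Fin p × J)) : ℝ :=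
  if (r.1.1 : ℕ) = 0 ∧ (r.2.1 : ℕ) = 0 then S r.1.2 r.2.2 else 0

/-- The matrix of the Lyapunov equation. -/
def lyapunov (F : Matrix J J ℝ) : Matrix (J × J) (J × J) ℝ := 1 - F ⊗ₖ F

/-- The autocovariances of an autoregression at the lags `0, …, p`. -/
def stateMoment (Ψ : Fin p → Matrix J J ℝ) (S : Matrix J J ℝ) :
    (Fin (p + 1) × J) × (Fin (p + 1) × J) → ℝ :=
  Matrix.mulVec (lyapunov (companion (padCoeff Ψ)))⁻¹ (stateCov (p + 1) S)

lemma kronecker_pow_apply (F : Matrix J J ℝ) (n : ℕ) (r s : J × J) :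
    ((F ⊗ₖ F) ^ n) r s = (F ^ n) r.1 s.1 * (F ^ n) r.2 s.2 := by
  have : (F ⊗ₖ F) ^ n = (F ^ n) ⊗ₖ (F ^ n) := by
    induction n with
    | zero => simp
    | succ n ih => rw [pow_succ, ih, ← Matrix.mul_kronecker_mul, ← pow_succ]
  rw [this]; rfl

/-- A null vector is fixed by `F ⊗ F`, hence by its powers, and these tend to zero. -/
lemma lyapunov_isUnit {F : Matrix J J ℝ}
    (hF : ∀ r s, Tendsto (fun n : ℕ => (F ^ n) r s) atTop (𝓝 0)) : IsUnit (lyapunov F).det := by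
  rw [isUnit_iff_ne_zero]
  intro h0
  obtain ⟨w, hw, hFw⟩ := Matrix.exists_mulVec_eq_zero_iff.2 h0
  rw [lyapunov, Matrix.sub_mulVec, Matrix.one_mulVec, sub_eq_zero] at hFw
  have hpow : ∀ n : ℕ, Matrix.mulVec ((F ⊗ₖ F) ^ n) w = w := by
    intro n
    induction n with
    | zero => simp
    | succ n ih => rw [pow_succ, ← Matrix.mulVec_mulVec, ← hFw, ih]
  refine hw (funext fun r => ?_)
  have h1 : Tendsto (fun n : ℕ => Matrix.mulVec ((F ⊗ₖ F) ^ n) w r) atTop (𝓝 0) := by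
    have : Tendsto (fun n : ℕ => ∑ s, (F ^ n) r.1 s.1 * (F ^ n) r.2 s.2 * w s) atTop
        (𝓝 (∑ s, 0 * 0 * w s)) :=
      tendsto_finsetSum _ fun s _ => ((hF _ _).mul (hF _ _)).mul_const _
    simp only [mul_zero, zero_mul, Finset.sum_const_zero] at this
    refine this.congr fun n => ?_
    simp only [Matrix.mulVec, dotProduct, kronecker_pow_apply]
  simp only [hpow] at h1
  exact tendsto_nhds_unique tendsto_const_nhds h1

variable {E : Type*} [NormedAddCommGroup E] [InnerProductSpace ℝ E] {Ψ : Fin p → Matrix J J ℝ}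
  {S : Matrix J J ℝ} {z ε : ℤ → J → E}

namespace IsVAR

/-- The state of an autoregression of order `p` holds the lags `0, …, p - 1`. A further zero
coefficient brings lag `p` into the state, as the moment matrix requires. -/
lemma pad (h : IsVAR Ψ S z ε) : IsVAR (padCoeff Ψ) S z ε where
  eq t a := by
    rw [h.eq t a, Fin.sum_univ_castSucc]
    simp [padCoeff]
  orth := h.orth
  cov := h.cov
  pos := h.pos
  stat := h.stat
  pnd := h.pnd

/-- The state equation gives `Γ = F Γ F' + Q` for the covariance of the state: mixed terms vanish
because the innovation is orthogonal to the past, and stationarity identifies the covariances at two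
successive dates. -/
lemma lyapunov_mulVec (h : IsVAR Ψ S z ε) :
    Matrix.mulVec (lyapunov (companion Ψ)) (fun r : (Fin p × J) × (Fin p × J) =>
      ⟪z (0 - (r.1.1 : ℕ)) r.1.2, z (0 - (r.2.1 : ℕ)) r.2.2⟫_ℝ) = stateCov p S := by
  funext ⟨r, s⟩
  rw [lyapunov, Matrix.sub_mulVec, Matrix.one_mulVec, Pi.sub_apply, sub_eq_iff_eq_add']
  have hst : ∀ q q' : Fin p × J, ⟪z (0 - 1 - (q.1 : ℕ)) q.2, z (0 - 1 - (q'.1 : ℕ)) q'.2⟫_ℝ =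
      ⟪z (0 - (q.1 : ℕ)) q.2, z (0 - (q'.1 : ℕ)) q'.2⟫_ℝ := by
    intro q q'
    have := h.stat (0 - (q'.1 : ℕ)) (0 - 1 - (q'.1 : ℕ)) ((q'.1 : ℕ) - (q.1 : ℕ)) q.2 q'.2
    have e1 : (0 : ℤ) - 1 - (q'.1 : ℕ) + ((q'.1 : ℕ) - (q.1 : ℕ)) = 0 - 1 - (q.1 : ℕ) := by ring
    have e2 : (0 : ℤ) - (q'.1 : ℕ) + ((q'.1 : ℕ) - (q.1 : ℕ)) = 0 - (q.1 : ℕ) := by ring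
    rwa [e1, e2] at this
  have horth : ∀ (a : J) (q : Fin p × J), ⟪ε 0 a, z (0 - 1 - (q.1 : ℕ)) q.2⟫_ℝ = 0 := fun a q =>
    h.orth _ _ _ _ (by omega)
  have horth' : ∀ (a : J) (q : Fin p × J), ⟪z (0 - 1 - (q.1 : ℕ)) q.2, ε 0 a⟫_ℝ = 0 := fun a q => by
    rw [real_inner_comm]; exact horth a q
  simp only
  rw [h.state_eq 0 r, h.state_eq 0 s]
  simp only [inner_add_left, inner_add_right, sum_inner, inner_sum, inner_smul_left,
    inner_smul_right, conj_trivial, hst]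
  have e1 : ⟪(if (r.1 : ℕ) = 0 then ε 0 r.2 else 0), (if (s.1 : ℕ) = 0 then ε 0 s.2 else 0)⟫_ℝ =
      stateCov p S (r, s) := by
    simp only [stateCov]
    by_cases hr : (r.1 : ℕ) = 0 <;> by_cases hs : (s.1 : ℕ) = 0 <;> simp [hr, hs, h.cov]
  have e2 : ∀ q : Fin p × J, ⟪z (0 - 1 - (q.1 : ℕ)) q.2,
      (if (s.1 : ℕ) = 0 then ε 0 s.2 else 0)⟫_ℝ = 0 := by
    intro q; split_ifs
    · exact horth' _ q
    · exact inner_zero_right _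
  have e3 : ∀ q : Fin p × J, ⟪(if (r.1 : ℕ) = 0 then ε 0 r.2 else 0),
      z (0 - 1 - (q.1 : ℕ)) q.2⟫_ℝ = 0 := by
    intro q; split_ifs
    · exact horth _ q
    · exact inner_zero_left _
  simp only [e1, e2, e3, mul_zero, Finset.sum_const_zero, add_zero, zero_add]
  congr 1
  simp only [Matrix.mulVec, dotProduct, Fintype.sum_prod_type (α₁ := Fin p × J),
    Matrix.kroneckerMap_apply, Finset.mul_sum]
  rw [Finset.sum_comm]
  exact Finset.sum_congr rfl fun _ _ => Finset.sum_congr rfl fun _ _ => by ring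

lemma stateMoment_eq [CompleteSpace E] (h : IsVAR Ψ S z ε)
    (q r : Fin (p + 1) × J) :
    stateMoment Ψ S (q, r) = ⟪z (0 - (q.1 : ℕ)) q.2, z (0 - (r.1 : ℕ)) r.2⟫_ℝ := by
  have hu := lyapunov_isUnit (h.pad.tendsto_companion_pow (Nat.succ_pos p))
  rw [stateMoment, ← h.pad.lyapunov_mulVec, Matrix.mulVec_mulVec, Matrix.nonsing_inv_mul _ hu,
    Matrix.one_mulVec]

end IsVAR

end Lyapunov

/-! ### Population moments and discrepancy as functions of the parameters -/

section ParamMoment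

variable {N : ℕ} {k : Fin N → ℕ} {p : ℕ}

/-- The second-moment matrix of `(1, z̄_t', …, z̄_{t-p}')'` as a function of the parameters. -/
def paramMoment (θ : Param k p) : ObsIdx k p → ObsIdx k p → ℝ
  | none, none => 1
  | none, some _ => 0
  | some _, none => 0
  | some q, some r => stateMoment θ.1 θ.2 (q, r)

/-- The parameters at which the population values of the procedure are well defined. -/
def Regular (θ : Param k p) : Prop :=
  (lyapunov (companion (padCoeff θ.1))).det ≠ 0 ∧ IsPopMoment 0 (paramMoment θ)

variable {Ω : Type*} [MeasurableSpace Ω] {P : Measure Ω} [IsProbabilityMeasure P]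
  {x : ℤ → Ω → Reg k → ℝ} {u : ℤ → Ω → Fin N → ℝ} {μ : Reg k → ℝ} {θ : Param k p}

namespace FinitePredictor

/-- The parameters determine the moments. A statement about population values therefore holds for
all processes with the same parameters at once. -/
lemma obsMoment_eq (h : FinitePredictor P x u μ p) (hθ : HasParam P x u μ θ) :
    obsMoment P x u μ p = paramMoment θ := by
  funext q r
  rcases q with _ | q <;> rcases r with _ | r
  · simp [obsMoment, obs, paramMoment]
  · simp only [obsMoment, obs_some, obs_none, one_mul]
    exact h.mean_zero _ _
  · simp only [obsMoment, obs_some, obs_none, mul_one]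
    exact h.mean_zero _ _
  · rw [paramMoment, (h.isVAR hθ).stateMoment_eq, h.inner_zL2]
    rfl

lemma regular (h : FinitePredictor P x u μ p) (hθ : HasParam P x u μ θ) : Regular θ := by
  refine ⟨(lyapunov_isUnit ((h.isVAR hθ).pad.tendsto_companion_pow (Nat.succ_pos p))).ne_zero, ?_⟩
  rw [← h.obsMoment_eq hθ]
  exact (h.isPopMoment hθ p).zero_mean

end FinitePredictor

/-- The product of the squared sizes of the regressor bias, of the filter bias, and of the
population GLS moment condition. -/
def discrepancy (θ : Param k p) : ℝ :=
  (∑ c, olsCross 0 (paramMoment θ) c ^ 2) *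
  (∑ j, ∑ n, ∑ m, (popFilter 0 (paramMoment θ) j n m - psiUU θ j n m) ^ 2) *
  ∑ c, glsCross 0 (paramMoment θ) (popFilter 0 (paramMoment θ)) (popCov 0 (paramMoment θ)) c ^ 2

/-- Each factor of `discrepancy` detects one kind of failure: a vanishing bias or shift would make
the corresponding cross moment vanish through its normal equation. Mean zero suffices, since filter,
covariance and cross moments do not depend on `μ`. -/
lemma FinitePredictor.fails_of_discrepancy (h : FinitePredictor P x u μ p) (hp : 0 < p)
    (hθ : HasParam P x u μ θ) (hd : discrepancy θ ≠ 0) (κ : Coef k → ℝ) : Fails P x u κ θ := by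
  have hV := h.isPopMoment hθ p
  have hm := h.obsMoment_eq hθ
  rw [hm] at hV
  have h0 : ∀ q, paramMoment θ none (some q) = 0 := fun _ => rfl
  obtain ⟨h12, h3⟩ := ne_zero_and_ne_zero_of_mul hd
  obtain ⟨h1, h2⟩ := ne_zero_and_ne_zero_of_mul h12
  refine h.fails hp hθ ?_ ?_ ?_ κ <;> rw [hm]
  · intro hb
    refine h1 (Finset.sum_eq_zero fun c _ => ?_)
    rw [← olsCross_zero_mean (μ := μ) h0, ← hV.olsGram_mulVec_popBias, hb, Matrix.mulVec_zero]
    simp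
  · intro hΦ
    refine h2 (Finset.sum_eq_zero fun j _ => Finset.sum_eq_zero fun n _ =>
      Finset.sum_eq_zero fun m _ => ?_)
    rw [← hV.popFilter_eq, hΦ]
    simp
  · intro hs
    refine h3 (Finset.sum_eq_zero fun c _ => ?_)
    rw [← hV.popFilter_eq, ← hV.popCov_eq, ← glsCross_zero_mean (μ := μ) h0,
      ← hV.glsGram_mulVec_popShift, hs, Matrix.mulVec_zero]
    simp

end ParamMoment

/-! ### Rational functions of the parameters -/

section Rational

variable {N : ℕ} {k : Fin N → ℕ} {p : ℕ}

/-- `g` is a rational function of the parameters, with no poles at regular parameters. -/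
def IsRat (g : Param k p → ℝ) : Prop :=
  ∃ num den : MvPolynomial (Coord k p) ℝ, ∀ θ, Regular θ →
    MvPolynomial.eval (coords θ) den ≠ 0 ∧
      g θ * MvPolynomial.eval (coords θ) den = MvPolynomial.eval (coords θ) num

namespace IsRat

lemma const (c : ℝ) : IsRat (fun _ : Param k p => c) :=
  ⟨MvPolynomial.C c, 1, fun θ _ => by simp⟩

lemma coeff (j : Fin p) (a b : Joint k) : IsRat (fun θ : Param k p => θ.1 j a b) :=
  ⟨MvPolynomial.X (Sum.inl (j, a, b)), 1, fun θ _ => by simp [coords]⟩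

lemma cov (a b : Joint k) : IsRat (fun θ : Param k p => θ.2 a b) :=
  ⟨MvPolynomial.X (Sum.inr (a, b)), 1, fun θ _ => by simp [coords]⟩

variable {g h : Param k p → ℝ}

lemma add (hg : IsRat g) (hh : IsRat h) : IsRat fun θ => g θ + h θ := by
  obtain ⟨n, d, e⟩ := hg
  obtain ⟨n', d', e'⟩ := hh
  refine ⟨n * d' + n' * d, d * d', fun θ hθ => ⟨?_, ?_⟩⟩
  · rw [map_mul]; exact mul_ne_zero (e θ hθ).1 (e' θ hθ).1
  · rw [map_mul, map_add, map_mul, map_mul, ← (e θ hθ).2, ← (e' θ hθ).2]; ring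

lemma mul (hg : IsRat g) (hh : IsRat h) : IsRat fun θ => g θ * h θ := by
  obtain ⟨n, d, e⟩ := hg
  obtain ⟨n', d', e'⟩ := hh
  refine ⟨n * n', d * d', fun θ hθ => ⟨?_, ?_⟩⟩
  · rw [map_mul]; exact mul_ne_zero (e θ hθ).1 (e' θ hθ).1
  · rw [map_mul, map_mul, ← (e θ hθ).2, ← (e' θ hθ).2]; ring

/-- Exchange numerator and denominator. -/
lemma inv (hg : IsRat g) (h0 : ∀ θ, Regular θ → g θ ≠ 0) : IsRat fun θ => (g θ)⁻¹ := by
  obtain ⟨n, d, e⟩ := hg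
  refine ⟨d, n, fun θ hθ => ?_⟩
  obtain ⟨h1, h2⟩ := e θ hθ
  rw [← h2]
  refine ⟨mul_ne_zero (h0 θ hθ) h1, ?_⟩
  rw [← mul_assoc, inv_mul_cancel₀ (h0 θ hθ), one_mul]

lemma sub (hg : IsRat g) (hh : IsRat h) : IsRat fun θ => g θ - h θ := by
  have := hg.add ((const (-1)).mul hh)
  simpa only [neg_one_mul, ← sub_eq_add_neg] using this

lemma sum {ι : Type*} (s : Finset ι) {f : ι → Param k p → ℝ} (hf : ∀ i, IsRat (f i)) :
    IsRat fun θ => ∑ i ∈ s, f i θ := by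
  classical
  induction s using Finset.induction_on with
  | empty => simpa using const 0
  | insert i s hi ih => simpa only [Finset.sum_insert hi] using (hf i).add ih

lemma prod {ι : Type*} (s : Finset ι) {f : ι → Param k p → ℝ} (hf : ∀ i, IsRat (f i)) :
    IsRat fun θ => ∏ i ∈ s, f i θ := by
  classical
  induction s using Finset.induction_on with
  | empty => simpa using const 1
  | insert i s hi ih => simpa only [Finset.prod_insert hi] using (hf i).mul ih

variable {n : Type*} [Fintype n] [DecidableEq n]

lemma det {M : Param k p → Matrix n n ℝ} (hM : ∀ i j, IsRat fun θ => M θ i j) :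
    IsRat fun θ => (M θ).det := by
  simp only [Matrix.det_apply, Units.smul_def, zsmul_eq_mul]
  exact sum _ fun σ => (const _).mul (prod _ fun i => hM _ _)

lemma matrix_inv {M : Param k p → Matrix n n ℝ} (hM : ∀ i j, IsRat fun θ => M θ i j)
    (h0 : ∀ θ, Regular θ → (M θ).det ≠ 0) (i j : n) : IsRat fun θ => (M θ)⁻¹ i j := by
  simp only [Matrix.inv_def, Ring.inverse_eq_inv', Matrix.smul_apply, smul_eq_mul,
    Matrix.adjugate_apply]
  refine ((det hM).inv h0).mul (det fun a b => ?_)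
  by_cases h : a = j
  · subst h; simpa using const _
  · simpa [Matrix.updateRow_ne h] using hM a b

lemma mulVec {m : Type*} {M : Param k p → Matrix m n ℝ} {w : Param k p → n → ℝ}
    (hM : ∀ i j, IsRat fun θ => M θ i j) (hw : ∀ j, IsRat fun θ => w θ j) (i : m) :
    IsRat fun θ => Matrix.mulVec (M θ) (w θ) i := by
  simp only [Matrix.mulVec, dotProduct]
  exact sum _ fun j => (hM i j).mul (hw j)

lemma companion_padCoeff (r s : Fin (p + 1) × Joint k) :
    IsRat fun θ => companion (padCoeff θ.1) r s := by
  simp only [companion, Matrix.of_apply]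
  split_ifs
  · obtain ⟨j, b⟩ := s
    refine Fin.lastCases ?_ (fun j => ?_) j
    · simpa [padCoeff] using const 0
    · simpa [padCoeff] using coeff j r.2 b
  · exact const _
  · exact const _

lemma stateMoment (q : (Fin (p + 1) × Joint k) × (Fin (p + 1) × Joint k)) :
    IsRat fun θ => stateMoment θ.1 θ.2 q := by
  unfold CORegression.stateMoment
  refine mulVec (matrix_inv (fun r s => ?_) fun θ hθ => hθ.1) (fun r => ?_) q
  · simp only [lyapunov, Matrix.sub_apply, Matrix.kroneckerMap_apply]
    exact (const _).sub ((companion_padCoeff _ _).mul (companion_padCoeff _ _))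
  · simp only [stateCov]
    split_ifs
    · exact cov _ _
    · exact const 0

lemma paramMoment (q r : ObsIdx k p) : IsRat fun θ => paramMoment θ q r := by
  rcases q with _ | q <;> rcases r with _ | r
  · exact const 1
  · exact const 0
  · exact const 0
  · exact stateMoment _

lemma bil {Q : Type*} [Fintype Q] {V : Param k p → Q → Q → ℝ} {α β : Param k p → Q → ℝ}
    (hV : ∀ q r, IsRat fun θ => V θ q r) (hα : ∀ q, IsRat fun θ => α θ q)
    (hβ : ∀ q, IsRat fun θ => β θ q) : IsRat fun θ => bil (V θ) (α θ) (β θ) := by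
  unfold CORegression.bil
  exact sum _ fun q => sum _ fun r => ((hα q).mul (hβ r)).mul (hV q r)

lemma filt {Q : Type*} {Φ : Param k p → Fin p → Matrix (Fin N) (Fin N) ℝ}
    {g : Param k p → Fin (p + 1) → Fin N → Q → ℝ} (hΦ : ∀ j n m, IsRat fun θ => Φ θ j n m)
    (hg : ∀ i n q, IsRat fun θ => g θ i n q) (n : Fin N) (q : Q) :
    IsRat fun θ => filt (Φ θ) (g θ) n q := by
  simp only [CORegression.filt, Pi.sub_apply, Finset.sum_apply, Pi.smul_apply, smul_eq_mul]
  exact (hg 0 n q).sub (sum _ fun j => sum _ fun m => (hΦ j n m).mul (hg j.succ m q))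

lemma olsCross (c : Coef k) : IsRat fun θ : Param k p => olsCross 0 (CORegression.paramMoment θ) c := by
  unfold CORegression.olsCross
  exact sum _ fun n => bil (α := fun _ => zForm 0 0 n c) (β := fun _ => uForm 0 n) paramMoment
    (fun _ => const _) fun _ => const _

lemma popBias (c : Coef k) : IsRat fun θ : Param k p => popBias 0 (CORegression.paramMoment θ) c := by
  unfold CORegression.popBias
  refine mulVec (matrix_inv (fun c d => ?_) fun θ hθ => hθ.2.olsGram_isUnit.ne_zero) olsCross c
  simp only [olsGram, Matrix.of_apply]
  exact sum _ fun n => bil (α := fun _ => zForm 0 0 n c) (β := fun _ => zForm 0 0 n d) paramMoment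
    (fun _ => const _) fun _ => const _

lemma wForm (i : Fin (p + 1)) (n : Fin N) (q : ObsIdx k p) :
    IsRat fun θ : Param k p =>
      CORegression.wForm 0 (CORegression.popBias 0 (CORegression.paramMoment θ)) i n q := by
  simp only [CORegression.wForm, Pi.sub_apply, Finset.sum_apply, Pi.smul_apply, smul_eq_mul]
  exact (const _).sub (sum _ fun c => (popBias c).mul (const _))

lemma popFilter (j : Fin p) (n m : Fin N) :
    IsRat fun θ : Param k p => popFilter 0 (CORegression.paramMoment θ) j n m := by
  unfold CORegression.popFilter
  simp only [varFun, Matrix.of_apply, Matrix.mul_apply]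
  refine sum _ fun q => IsRat.mul ?_ (matrix_inv (fun r s => ?_)
    (fun θ hθ => (hθ.2.lagGram_isUnit _).ne_zero) q (j, m))
  · simp only [lagCross, Matrix.of_apply]
    exact bil paramMoment (wForm _ _) (wForm _ _)
  · simp only [lagGram, Matrix.of_apply]
    exact bil paramMoment (wForm _ _) (wForm _ _)

lemma popCov (n m : Fin N) :
    IsRat fun θ : Param k p => popCov 0 (CORegression.paramMoment θ) n m := by
  unfold CORegression.popCov covFun
  simp only [Matrix.of_apply]
  have h := filt (g := fun θ : Param k p => CORegression.wForm 0 (CORegression.popBias 0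
    (CORegression.paramMoment θ))) (popFilter (k := k)) wForm
  exact bil paramMoment (h n) (h m)

/-- The population values are built from the moments by sums, products and inverses of matrices that
are nonsingular at regular parameters. -/
lemma discrepancy : IsRat (discrepancy : Param k p → ℝ) := by
  unfold CORegression.discrepancy
  simp only [pow_two]
  refine ((sum _ fun c => (olsCross c).mul (olsCross c)).mul (sum _ fun j => sum _ fun n =>
    sum _ fun m => ?_)).mul (sum _ fun c => ?_)
  · have h : IsRat fun θ : Param k p =>
        CORegression.popFilter 0 (CORegression.paramMoment θ) j n m - psiUU θ j n m :=
      (popFilter j n m).sub (coeff j (Sum.inr n) (Sum.inr m))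
    exact h.mul h
  · have h : IsRat fun θ : Param k p => glsCross 0 (CORegression.paramMoment θ)
        (CORegression.popFilter 0 (CORegression.paramMoment θ))
        (CORegression.popCov 0 (CORegression.paramMoment θ)) c := by
      unfold glsCross
      refine sum _ fun n => sum _ fun m => IsRat.mul (matrix_inv popCov (fun θ hθ => ?_) n m) ?_
      · exact ((Matrix.isUnit_iff_isUnit_det _).1 hθ.2.popCov_posDef.isUnit).ne_zero
      · exact bil paramMoment
          (filt (g := fun _ i m => zForm 0 i m c) popFilter (fun _ _ _ => const _) n)
          (filt (g := fun _ => uForm) popFilter (fun _ _ _ => const _) m)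
    exact h.mul h

end IsRat

end Rational

/-! ### Density of the generic parameters -/

section Density

variable {N : ℕ} {k : Fin N → ℕ} {p : ℕ}

lemma coords_segment (θ θ₀ : Param k p) (s : ℝ) (i : Coord k p) :
    coords (θ + s • (θ₀ - θ)) i = coords θ i + s * (coords θ₀ i - coords θ i) := by
  rcases i with i | i <;> simp [coords]

/-- Restricted to the line through `θ` and `θ₀`, the polynomial is one in `s` that is nonzero at `s
= 1`. It has finitely many roots, so none is positive and arbitrarily small. -/
lemma eventually_eval_ne_zero {θ θ₀ : Param k p} {f : MvPolynomial (Coord k p) ℝ}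
    (hf : MvPolynomial.eval (coords θ₀) f ≠ 0) :
    ∀ᶠ s in 𝓝[>] (0 : ℝ), MvPolynomial.eval (coords (θ + s • (θ₀ - θ))) f ≠ 0 := by
  let q : Polynomial ℝ := MvPolynomial.eval₂ Polynomial.C (fun i => Polynomial.C (coords θ i) +
    Polynomial.X * Polynomial.C (coords θ₀ i - coords θ i)) f
  have hq : ∀ s : ℝ, q.eval s = MvPolynomial.eval (coords (θ + s • (θ₀ - θ))) f := by
    intro s
    have h1 : (Polynomial.evalRingHom s) q = _ := MvPolynomial.hom_eval₂ f Polynomial.C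
      (Polynomial.evalRingHom s) _
    rw [Polynomial.coe_evalRingHom] at h1
    rw [h1, MvPolynomial.eval, MvPolynomial.coe_eval₂Hom]
    congr 1
    · ext r; simp
    · funext i; simp [coords_segment]
  have hq0 : q ≠ 0 := by
    rintro h0
    have := hq 1
    rw [h0, Polynomial.eval_zero, one_smul, add_sub_cancel] at this
    exact hf this.symm
  have hfin : ({s | q.IsRoot s} \ {0}).Finite := (Polynomial.finite_setOfPred_isRoot hq0).subset
    Set.sdiff_subset
  have h1 : ∀ᶠ s in 𝓝 (0 : ℝ), s ∉ ({s | q.IsRoot s} \ {0}) :=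
    hfin.isClosed.isOpen_compl.mem_nhds (by simp)
  filter_upwards [nhdsWithin_le_nhds h1, self_mem_nhdsWithin] with s hs hs0
  rw [← hq]
  exact fun h => hs ⟨h, ne_of_gt hs0⟩

/-- Approach `θ` along the segment towards `θ₀`. Only small positive `s` matter, so `C` need not
contain the whole segment. -/
lemma subset_closure_ne_zero {C : Set (Param k p)} {θ₀ : Param k p}
    {f : MvPolynomial (Coord k p) ℝ} (hf : MvPolynomial.eval (coords θ₀) f ≠ 0)
    (hC : ∀ θ ∈ C, ∀ᶠ s in 𝓝[>] (0 : ℝ), θ + s • (θ₀ - θ) ∈ C) :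
    C ⊆ closure {θ | θ ∈ C ∧ MvPolynomial.eval (coords θ) f ≠ 0} := by
  intro θ hθ
  have hc : Continuous fun s : ℝ => θ + s • (θ₀ - θ) :=
    continuous_const.add (continuous_id.smul continuous_const)
  have h0 : Tendsto (fun s : ℝ => θ + s • (θ₀ - θ)) (𝓝[>] 0) (𝓝 θ) := by
    have := hc.tendsto 0
    rw [zero_smul, add_zero] at this
    exact this.mono_left nhdsWithin_le_nhds
  exact mem_closure_of_tendsto h0 ((hC θ hθ).and (eventually_eval_ne_zero hf))

/-- The determinant does not vanish on the compact unit disc, and this persists for small `s`,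
uniformly in `z`. Positive definiteness is preserved by convexity. -/
lemma eventually_admissible {θ θ₀ : Param k p} (hθ : Admissible θ) (hθ₀ : θ₀.2.PosDef) :
    ∀ᶠ s in 𝓝[>] (0 : ℝ), Admissible (θ + s • (θ₀ - θ)) := by
  have hdet : ∀ᶠ s in 𝓝 (0 : ℝ), ∀ z ∈ Metric.closedBall (0 : ℂ) 1,
      (1 - ∑ j : Fin p, z ^ ((j : ℕ) + 1) • ((θ + s • (θ₀ - θ)).1 j).map Complex.ofReal).det ≠ 0 := by
    refine (isCompact_closedBall (0 : ℂ) 1).eventually_forall_of_forall_eventually fun z hz => ?_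
    have hc : Continuous fun w : ℝ × ℂ => (1 - ∑ j : Fin p, w.2 ^ ((j : ℕ) + 1) •
        ((θ + w.1 • (θ₀ - θ)).1 j).map Complex.ofReal).det := by
      refine Continuous.matrix_det (continuous_const.sub (continuous_finsetSum _ fun j _ =>
        (continuous_snd.pow _).smul ?_))
      refine continuous_pi fun a => continuous_pi fun b => Complex.continuous_ofReal.comp ?_
      exact continuous_const.add (continuous_fst.mul continuous_const)
    refine hc.continuousAt.eventually_ne ?_
    simpa using hθ.1 z (by simpa using hz)
  have hpos : ∀ᶠ s in 𝓝[>] (0 : ℝ), s < 1 := nhdsWithin_le_nhds (gt_mem_nhds one_pos)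
  filter_upwards [nhdsWithin_le_nhds hdet, hpos, self_mem_nhdsWithin] with s h1 h2 h3
  refine ⟨fun z hz => h1 z (by simpa using hz), ?_⟩
  have e : (θ + s • (θ₀ - θ)).2 = (1 - s) • θ.2 + s • θ₀.2 := by
    simp only [Prod.snd_add, Prod.smul_snd, Prod.snd_sub, smul_sub, sub_smul, one_smul]
    abel
  rw [e]
  exact (hθ.2.smul (sub_pos.2 h2)).add (hθ₀.smul h3)

lemma isClosed_bd : IsClosed {θ : Param k p | BD θ} := by
  have h1 : ∀ j a b, Continuous fun θ : Param k p => θ.1 j a b := fun j a b =>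
    ((continuous_apply j).comp continuous_fst).matrix_elem a b
  have h2 : ∀ a b, Continuous fun θ : Param k p => θ.2 a b := fun a b =>
    continuous_snd.matrix_elem a b
  have e : {θ : Param k p | BD θ} = {θ | (∀ j, (∀ c i, θ.1 j (Sum.inl c) (Sum.inr i) = 0) ∧
      ∀ i c, θ.1 j (Sum.inr i) (Sum.inl c) = 0) ∧ (∀ c i, θ.2 (Sum.inl c) (Sum.inr i) = 0) ∧
      ∀ i c, θ.2 (Sum.inr i) (Sum.inl c) = 0} := by
    ext θ
    simp only [BD, ← Matrix.ext_iff, Set.mem_ofPred_eq, Matrix.toBlocks₁₂, Matrix.toBlocks₂₁,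
      Matrix.of_apply, Matrix.zero_apply]
  rw [e]
  simp only [Set.ofPred_and, Set.ofPred_forall]
  refine (isClosed_iInter fun j => ?_).inter (IsClosed.inter ?_ ?_)
  · exact (isClosed_iInter fun c => isClosed_iInter fun i =>
      isClosed_eq (h1 _ _ _) continuous_const).inter (isClosed_iInter fun c => isClosed_iInter fun i =>
      isClosed_eq (h1 _ _ _) continuous_const)
  · exact isClosed_iInter fun c => isClosed_iInter fun i => isClosed_eq (h2 _ _) continuous_const
  · exact isClosed_iInter fun c => isClosed_iInter fun i => isClosed_eq (h2 _ _) continuous_const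

lemma eventually_not_bd {θ θ₀ : Param k p} (hθ : ¬ BD θ) :
    ∀ᶠ s in 𝓝[>] (0 : ℝ), ¬ BD (θ + s • (θ₀ - θ)) := by
  have hc : Continuous fun s : ℝ => θ + s • (θ₀ - θ) :=
    continuous_const.add (continuous_id.smul continuous_const)
  have h0 : Tendsto (fun s : ℝ => θ + s • (θ₀ - θ)) (𝓝 0) (𝓝 θ) := by
    have := hc.tendsto 0
    rwa [zero_smul, add_zero] at this
  exact nhdsWithin_le_nhds (h0.eventually (isClosed_bd.isOpen_compl.mem_nhds hθ))

lemma EBD.segment {θ θ₀ : Param k p} (h : EBD θ) (h₀ : EBD θ₀) (s : ℝ) :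
    EBD (θ + s • (θ₀ - θ)) := by
  constructor
  · ext a b
    have h1 := congrFun (congrFun h.1 a) b
    have h2 := congrFun (congrFun h₀.1 a) b
    simp only [Matrix.toBlocks₁₂, Matrix.of_apply, Matrix.zero_apply] at h1 h2
    simp [Matrix.toBlocks₁₂, h1, h2]
  · ext a b
    have h1 := congrFun (congrFun h.2 a) b
    have h2 := congrFun (congrFun h₀.2 a) b
    simp only [Matrix.toBlocks₂₁, Matrix.of_apply, Matrix.zero_apply] at h1 h2
    simp [Matrix.toBlocks₂₁, h1, h2]

lemma GEXOG.ebd {θ : Param k p} (h : GEXOG θ) : EBD θ := h.2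

lemma GEXOG.segment {θ θ₀ : Param k p} (h : GEXOG θ) (h₀ : GEXOG θ₀) (s : ℝ) :
    GEXOG (θ + s • (θ₀ - θ)) := by
  refine ⟨fun j => ?_, h.ebd.segment h₀.ebd s⟩
  ext a b
  have h1 := congrFun (congrFun (h.1 j) a) b
  have h2 := congrFun (congrFun (h₀.1 j) a) b
  simp only [Matrix.toBlocks₂₁, Matrix.of_apply, Matrix.zero_apply] at h1 h2
  simp [Matrix.toBlocks₂₁, h1, h2]

/-- A nonzero discrepancy at one parameter outside `BD` without feedback makes it nonzero at generic
parameters in each of the classes. -/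
theorem holdsGenerically_discrepancy {θ₀ : Param k p} (hreg : Regular θ₀)
    (hd : discrepancy θ₀ ≠ 0) (hpos : θ₀.2.PosDef) (hG : GEXOG θ₀) :
    ∀ C ∈ ({{θ | Admissible θ ∧ ¬ BD θ}, {θ | Admissible θ ∧ GEXOG θ ∧ ¬ BD θ},
        {θ | Admissible θ ∧ EBD θ ∧ ¬ BD θ}} : Set (Set (Param k p))),
      HoldsGenerically C fun θ => Regular θ → discrepancy θ ≠ 0 := by
  obtain ⟨f, d, hfd⟩ := IsRat.discrepancy (k := k) (p := p)
  have hf : MvPolynomial.eval (coords θ₀) f ≠ 0 := by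
    rw [← (hfd θ₀ hreg).2]
    exact mul_ne_zero hd (hfd θ₀ hreg).1
  have main : ∀ C : Set (Param k p),
      (∀ θ ∈ C, ∀ᶠ s in 𝓝[>] (0 : ℝ), θ + s • (θ₀ - θ) ∈ C) →
      HoldsGenerically C fun θ => Regular θ → discrepancy θ ≠ 0 := by
    refine fun C hC => ⟨f, subset_closure_ne_zero hf hC, fun θ _ hθ hr h0 => hθ ?_⟩
    rw [← (hfd θ hr).2, h0, zero_mul]
  rintro C (rfl | rfl | rfl)
  · refine main _ fun θ hθ => ?_
    filter_upwards [eventually_admissible hθ.1 hpos, eventually_not_bd hθ.2] with s h1 h2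
    exact ⟨h1, h2⟩
  · refine main _ fun θ hθ => ?_
    filter_upwards [eventually_admissible hθ.1 hpos, eventually_not_bd hθ.2.2] with s h1 h2
    exact ⟨h1, hθ.2.1.segment hG s, h2⟩
  · refine main _ fun θ hθ => ?_
    filter_upwards [eventually_admissible hθ.1 hpos, eventually_not_bd hθ.2.2] with s h1 h2
    exact ⟨h1, hθ.2.1.segment hG.ebd s, h2⟩

end Density

/-! ### First-order autoregressions driven by independent signs -/

section SignNoise

open ProbabilityTheory

/-- The law of a fair coin. -/
def coin : Measure Bool := (2⁻¹ : ENNReal) • (Measure.dirac true + Measure.dirac false)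

instance : IsProbabilityMeasure coin := ⟨by
  simp only [coin, Measure.smul_apply, Measure.add_apply, measure_univ, smul_eq_mul]
  rw [one_add_one_eq_two, ENNReal.inv_mul_cancel (by simp) (by simp)]⟩

/-- The sign of a coin toss. -/
def sign (b : Bool) : ℝ := if b then 1 else -1

lemma abs_sign (b : Bool) : |sign b| = 1 := by cases b <;> simp [sign]

lemma integral_sign : ∫ b, sign b ∂coin = 0 := by
  rw [coin, integral_smul_measure, integral_add_measure .of_finite .of_finite, integral_dirac,
    integral_dirac]
  simp [sign]

variable (J : Type) [Fintype J] [DecidableEq J]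

/-- The law of independent fair coins, one for each date and component. -/
def coinLaw : Measure (ℤ × J → Bool) := Measure.infinitePi fun _ => coin

instance : IsProbabilityMeasure (coinLaw J) :=
  inferInstanceAs (IsProbabilityMeasure (Measure.infinitePi fun _ => coin))

variable {J}

/-- Independent signs. -/
def signNoise (t : ℤ) (a : J) (ω : ℤ × J → Bool) : ℝ := sign (ω (t, a))

lemma measurable_signNoise (t : ℤ) (a : J) : Measurable (signNoise t a) :=
  (measurable_of_finite sign).comp (measurable_pi_apply (t, a))

lemma abs_signNoise (t : ℤ) (a : J) (ω : ℤ × J → Bool) : |signNoise t a ω| = 1 := abs_sign _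

lemma iIndepFun_signNoise :
    iIndepFun (fun (q : ℤ × J) ω => signNoise q.1 q.2 ω) (coinLaw J) :=
  iIndepFun_infinitePi (P := fun _ : ℤ × J => coin) (X := fun _ => sign)
    fun _ => measurable_of_finite sign

lemma integral_signNoise (t : ℤ) (a : J) : ∫ ω, signNoise t a ω ∂coinLaw J = 0 := by
  have h := measurePreserving_eval_infinitePi (fun _ : ℤ × J => coin) (t, a)
  have := integral_map (μ := Measure.infinitePi fun _ : ℤ × J => coin) (f := sign) h.measurable.aemeasurable
    (measurable_of_finite sign).aestronglyMeasurable
  rw [h.map_eq, integral_sign] at this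
  exact this.symm

lemma integral_signNoise_mul (t s : ℤ) (a b : J) :
    ∫ ω, signNoise t a ω * signNoise s b ω ∂coinLaw J = if t = s ∧ a = b then 1 else 0 := by
  split_ifs with h
  · obtain ⟨rfl, rfl⟩ := h
    have : ∀ ω : ℤ × J → Bool, signNoise t a ω * signNoise t a ω = 1 := fun ω => by
      rw [← abs_mul_abs_self, abs_signNoise, one_mul]
    simp [this]
  · have hi : signNoise t a ⟂ᵢ[coinLaw J] signNoise s b :=
      iIndepFun_signNoise.indepFun (i := (t, a)) (j := (s, b)) fun e => h (Prod.ext_iff.1 e)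
    rw [hi.integral_fun_mul_eq_mul_integral (measurable_signNoise t a).aestronglyMeasurable
      (measurable_signNoise s b).aestronglyMeasurable, integral_signNoise, zero_mul]

/-- The stationary solution of `z_t = F z_{t-1} + ε_t`, where `ε` are independent signs. -/
def signAR (F : Matrix J J ℝ) (t : ℤ) (a : J) (ω : ℤ × J → Bool) : ℝ :=
  ∑' n : ℕ, ∑ b, (F ^ n) a b * signNoise (t - n) b ω

/-- `F` has geometrically decaying powers. -/
def IsStable (F : Matrix J J ℝ) : Prop :=
  ∃ K ρ : ℝ, 0 ≤ ρ ∧ ρ < 1 ∧ ∀ n a b, |(F ^ n) a b| ≤ K * ρ ^ n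

variable {F : Matrix J J ℝ}

lemma IsStable.exists_summable_bound (hF : IsStable F) :
    ∃ B : ℕ → ℝ, Summable B ∧ ∀ (t : ℤ) (n : ℕ) a ω,
      |∑ b, (F ^ n) a b * signNoise (t - n) b ω| ≤ B n := by
  obtain ⟨K, ρ, hρ0, hρ, hb⟩ := hF
  refine ⟨fun n => Fintype.card J * (K * ρ ^ n),
    ((summable_geometric_of_lt_one hρ0 hρ).mul_left K).mul_left _, fun t n a ω => ?_⟩
  refine (Finset.abs_sum_le_sum_abs _ _).trans ?_
  refine (Finset.sum_le_card_nsmul _ _ (K * ρ ^ n) fun b _ => ?_).trans ?_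
  · rw [abs_mul, abs_signNoise, mul_one]; exact hb n a b
  · simp

lemma IsStable.summable (hF : IsStable F) (t : ℤ) (a : J) (ω : ℤ × J → Bool) :
    Summable fun n : ℕ => ∑ b, (F ^ n) a b * signNoise (t - n) b ω := by
  obtain ⟨B, hB, h⟩ := hF.exists_summable_bound
  exact hB.of_norm_bounded fun n => h t n a ω

lemma IsStable.exists_signAR_bound (hF : IsStable F) : ∃ C : ℝ, ∀ t a ω, |signAR F t a ω| ≤ C := by
  obtain ⟨B, hB, h⟩ := hF.exists_summable_bound
  refine ⟨∑' n, B n, fun t a ω => ?_⟩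
  exact tsum_of_norm_bounded (f := fun n : ℕ => ∑ b, (F ^ n) a b * signNoise (t - n) b ω)
    hB.hasSum fun n => h t n a ω

lemma measurable_signAR_term (F : Matrix J J ℝ) (t : ℤ) (n : ℕ) (a : J) :
    Measurable fun ω => ∑ b, (F ^ n) a b * signNoise (t - n) b ω :=
  Finset.measurable_fun_sum _ fun b _ => (measurable_signNoise _ b).const_mul _

lemma IsStable.measurable_signAR (hF : IsStable F) (t : ℤ) (a : J) : Measurable (signAR F t a) :=
  measurable_of_tendsto_metrizable
    (f := fun (m : ℕ) ω => ∑ n ∈ Finset.range m, ∑ b, (F ^ n) a b * signNoise (t - n) b ω)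
    (fun _ => Finset.measurable_fun_sum _ fun n _ => measurable_signAR_term F t n a)
    (tendsto_pi_nhds.2 fun ω => (hF.summable t a ω).hasSum.tendsto_sum_nat)

lemma IsStable.memLp_signAR (hF : IsStable F) (t : ℤ) (a : J) (q : ENNReal) :
    MemLp (signAR F t a) q (coinLaw J) := by
  obtain ⟨C, hC⟩ := hF.exists_signAR_bound
  exact MemLp.of_bound (hF.measurable_signAR t a).aestronglyMeasurable C
    (ae_of_all _ fun ω => hC t a ω)

lemma IsStable.signAR_eq (hF : IsStable F) (t : ℤ) (a : J) (ω : ℤ × J → Bool) :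
    signAR F t a ω = ∑ c, F a c * signAR F (t - 1) c ω + signNoise t a ω := by
  have e0 : ∑ b, (F ^ 0) a b * signNoise (t - ((0 : ℕ) : ℤ)) b ω = signNoise t a ω := by
    simp [Matrix.one_apply]
  have e1 : ∀ n : ℕ, ∑ b, (F ^ (n + 1)) a b * signNoise (t - ((n + 1 : ℕ) : ℤ)) b ω =
      ∑ c, F a c * ∑ b, (F ^ n) c b * signNoise (t - 1 - n) b ω := by
    intro n
    have : t - ((n + 1 : ℕ) : ℤ) = t - 1 - n := by push_cast; ring
    simp only [this, pow_succ', Matrix.mul_apply, Finset.sum_mul, Finset.mul_sum]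
    rw [Finset.sum_comm]
    exact Finset.sum_congr rfl fun _ _ => Finset.sum_congr rfl fun _ _ => by ring
  rw [signAR, (hF.summable t a ω).tsum_eq_zero_add, e0, add_comm]
  simp only [e1]
  rw [Summable.tsum_finsetSum fun c _ => (hF.summable (t - 1) c ω).mul_left _]
  simp only [tsum_mul_left]
  rfl

/-- The terms of the series are bounded by a summable sequence, so sum and integral can be exchanged
against any integrable factor. All moments of the process are obtained in this way. -/
lemma IsStable.integral_mul_signAR (hF : IsStable F) {g : (ℤ × J → Bool) → ℝ}
    (hg : Integrable g (coinLaw J)) (t : ℤ) (a : J) :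
    ∫ ω, g ω * signAR F t a ω ∂coinLaw J =
      ∑' n : ℕ, ∑ b, (F ^ n) a b * ∫ ω, g ω * signNoise (t - n) b ω ∂coinLaw J := by
  obtain ⟨B, hB, h⟩ := hF.exists_summable_bound
  have hbd : ∀ n : ℕ, Integrable (fun ω => g ω * ∑ b, (F ^ n) a b * signNoise (t - n) b ω)
      (coinLaw J) := fun n =>
    hg.mul_bdd (c := B n) (measurable_signAR_term F t n a).aestronglyMeasurable
      (ae_of_all _ fun ω => h t n a ω)
  have hn : ∀ (s : ℤ) b, Integrable (fun ω => g ω * signNoise s b ω) (coinLaw J) := fun s b =>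
    hg.mul_bdd (c := 1) (measurable_signNoise s b).aestronglyMeasurable
      (ae_of_all _ fun ω => (abs_signNoise s b ω).le)
  have hs : Summable fun n : ℕ =>
      ∫ ω, ‖g ω * ∑ b, (F ^ n) a b * signNoise (t - n) b ω‖ ∂coinLaw J := by
    refine Summable.of_nonneg_of_le (fun n => integral_nonneg fun _ => norm_nonneg _) (fun n => ?_)
      (hB.mul_left (∫ ω, ‖g ω‖ ∂coinLaw J))
    rw [← integral_mul_const]
    refine integral_mono (hbd n).norm (hg.norm.mul_const _) fun ω => ?_
    simp only [norm_mul]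
    exact mul_le_mul_of_nonneg_left (h t n a ω) (norm_nonneg _)
  have := (hasSum_integral_of_summable_integral_norm hbd hs).tsum_eq
  simp only [tsum_mul_left] at this
  simp only [signAR]
  rw [← this]
  refine tsum_congr fun n => ?_
  simp only [Finset.mul_sum]
  rw [integral_finsetSum _ fun b _ =>
    ((hn (t - n) b).const_mul ((F ^ n) a b)).congr (ae_of_all _ fun ω => mul_left_comm _ _ _)]
  refine Finset.sum_congr rfl fun b _ => ?_
  rw [← integral_const_mul]
  exact integral_congr_ae (ae_of_all _ fun ω => mul_left_comm _ _ _)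

lemma IsStable.integral_signAR_mul_signNoise (hF : IsStable F) (t s : ℤ) (a c : J) :
    ∫ ω, signAR F t a ω * signNoise s c ω ∂coinLaw J =
      ∑' n : ℕ, ∑ b, (F ^ n) a b * if s - t + n = 0 ∧ c = b then 1 else 0 := by
  have hi : Integrable (signNoise s c) (coinLaw J) :=
    (MemLp.of_bound (p := 1) (measurable_signNoise s c).aestronglyMeasurable 1
      (ae_of_all _ fun ω => (abs_signNoise s c ω).le)).integrable le_rfl
  simp only [mul_comm (signAR F t a _)]
  rw [hF.integral_mul_signAR hi]
  simp only [integral_signNoise_mul]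
  have e : ∀ n : ℕ, s = t - n ↔ s - t + n = 0 := fun n => by omega
  simp only [e]

/-- The right-hand side does not involve `t`, which is covariance stationarity; no closed form is
needed. -/
lemma IsStable.integral_signAR_mul (hF : IsStable F) (t h : ℤ) (a b : J) :
    ∫ ω, signAR F (t + h) a ω * signAR F t b ω ∂coinLaw J =
      ∑' n : ℕ, ∑ c, (F ^ n) b c * ∑' m : ℕ, ∑ d, (F ^ m) a d *
        if -n - h + m = 0 ∧ c = d then 1 else 0 := by
  rw [hF.integral_mul_signAR ((hF.memLp_signAR (t + h) a 1).integrable le_rfl)]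
  simp only [hF.integral_signAR_mul_signNoise]
  have e : ∀ n : ℕ, t - n - (t + h) = -n - h := fun n => by ring
  simp only [e]

lemma IsStable.integral_signAR_mul_signNoise_of_lt (hF : IsStable F) {t s : ℤ} (hts : t < s)
    (a c : J) : ∫ ω, signNoise s c ω * signAR F t a ω ∂coinLaw J = 0 := by
  simp only [mul_comm (signNoise s c _)]
  rw [hF.integral_signAR_mul_signNoise]
  have e : ∀ n : ℕ, ¬ s - t + n = 0 := fun n => by omega
  simp [e]

lemma IsStable.integral_signAR (hF : IsStable F) (t : ℤ) (a : J) :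
    ∫ ω, signAR F t a ω ∂coinLaw J = 0 := by
  have := hF.integral_mul_signAR (integrable_const (1 : ℝ)) t a
  simpa [integral_signNoise] using this

end SignNoise

/-! ### The sign-driven autoregression as a data-generating process -/

section SignProcess

open ProbabilityTheory
open scoped InnerProductSpace

lemma toL2_coeFn {Ω : Type*} [MeasurableSpace Ω] {P : Measure Ω} {f : Ω → ℝ} (hf : MemLp f 2 P) :
    (⇑(toL2 P f) : Ω → ℝ) =ᵐ[P] f := by
  unfold toL2
  rw [dif_pos hf]
  exact hf.coeFn_toLp

lemma inner_toL2 {Ω : Type*} [MeasurableSpace Ω] {P : Measure Ω} {f : Ω → ℝ} (hf : MemLp f 2 P)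
    (g : Lp ℝ 2 P) : ⟪g, toL2 P f⟫_ℝ = ∫ ω, g ω * f ω ∂P := by
  rw [L2_inner_eq_integral]
  refine integral_congr_ae ?_
  filter_upwards [toL2_coeFn hf] with ω h
  rw [h]

variable {N : ℕ} {k : Fin N → ℕ} {p : ℕ} {F : Matrix (Joint k) (Joint k) ℝ}

/-- The regressors of the autoregression driven by signs. -/
def signX (F : Matrix (Joint k) (Joint k) ℝ) (t : ℤ) (ω : ℤ × Joint k → Bool) (c : Reg k) : ℝ :=
  signAR F t (Sum.inl c) ω

/-- The disturbances of the autoregression driven by signs. -/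
def signU (F : Matrix (Joint k) (Joint k) ℝ) (t : ℤ) (ω : ℤ × Joint k → Bool) (i : Fin N) : ℝ :=
  signAR F t (Sum.inr i) ω

/-- The parameters of a first-order autoregression with unit innovation covariance. -/
def firstOrder (p : ℕ) (F : Matrix (Joint k) (Joint k) ℝ) : Param k p :=
  (fun j => if (j : ℕ) = 0 then F else 0, 1)

lemma zbar_sign (F : Matrix (Joint k) (Joint k) ℝ) (t : ℤ) (ω : ℤ × Joint k → Bool) (a : Joint k) :
    zbar (signX F) (signU F) 0 t ω a = signAR F t a ω := by
  rcases a with c | i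
  · simp [zbar, signX]
  · rfl

/-- The sequence of signs in `L²`. -/
def signL2 (t : ℤ) (a : Joint k) : Lp ℝ 2 (coinLaw (Joint k)) :=
  toL2 (coinLaw (Joint k)) (signNoise t a)

lemma memLp_signNoise (t : ℤ) (a : Joint k) (q : ENNReal) :
    MemLp (signNoise t a) q (coinLaw (Joint k)) :=
  MemLp.of_bound (measurable_signNoise t a).aestronglyMeasurable 1
    (ae_of_all _ fun ω => (abs_signNoise t a ω).le)

lemma zL2_sign (F : Matrix (Joint k) (Joint k) ℝ) (t : ℤ) (a : Joint k) :
    zL2 (coinLaw (Joint k)) (signX F) (signU F) 0 t a = toL2 (coinLaw (Joint k)) (signAR F t a) := by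
  unfold zL2
  simp only [zbar_sign]

namespace IsStable

lemma inner_signL2_of_lt (hF : IsStable F) {s t : ℤ} (h : s < t) (a b : Joint k) :
    ⟪signL2 t a, zL2 (coinLaw (Joint k)) (signX F) (signU F) 0 s b⟫_ℝ = 0 := by
  rw [zL2_sign, inner_toL2 (hF.memLp_signAR s b 2), ← hF.integral_signAR_mul_signNoise_of_lt h b a]
  refine integral_congr_ae ?_
  filter_upwards [toL2_coeFn (memLp_signNoise t a 2)] with ω h
  rw [signL2, h]

lemma zL2_eq (hF : IsStable F) (t : ℤ) (a : Joint k) :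
    zL2 (coinLaw (Joint k)) (signX F) (signU F) 0 t a =
      ∑ c, F a c • zL2 (coinLaw (Joint k)) (signX F) (signU F) 0 (t - 1) c + signL2 t a := by
  simp only [zL2_sign]
  refine Lp.ext ?_
  refine EventuallyEq.trans ?_ (Lp.coeFn_add _ _).symm
  have h1 := Lp.coeFn_fun_finsetSum Finset.univ
    fun c => F a c • toL2 (coinLaw (Joint k)) (signAR F (t - 1) c)
  have h2 : ∀ᵐ ω ∂coinLaw (Joint k), ∀ c,
      (F a c • toL2 (coinLaw (Joint k)) (signAR F (t - 1) c) : Lp ℝ 2 _) ω =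
        F a c * signAR F (t - 1) c ω := by
    rw [ae_all_iff]
    intro c
    filter_upwards [Lp.coeFn_smul (F a c) (toL2 (coinLaw (Joint k)) (signAR F (t - 1) c)),
      toL2_coeFn (hF.memLp_signAR (t - 1) c 2)] with ω h h'
    rw [h, Pi.smul_apply, h', smul_eq_mul]
  filter_upwards [h1, h2, toL2_coeFn (hF.memLp_signAR t a 2),
    toL2_coeFn (memLp_signNoise t a 2)] with ω h1 h2 h3 h4
  rw [h3, hF.signAR_eq, Pi.add_apply, signL2, h4, h1]
  simp only [h2]

lemma sum_firstOrder (hp : 0 < p) {E : Type*} [AddCommGroup E] [Module ℝ E]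
    (F : Matrix (Joint k) (Joint k) ℝ) (z : ℤ → Joint k → E) (t : ℤ) (a : Joint k) :
    ∑ j : Fin p, ∑ b, (firstOrder p F).1 j a b • z (t - ((j : ℕ) + 1 : ℤ)) b =
      ∑ c, F a c • z (t - 1) c := by
  rw [Finset.sum_eq_single (⟨0, hp⟩ : Fin p)]
  · simp [firstOrder]
  · intro j _ hj
    have : (j : ℕ) ≠ 0 := fun h => hj (Fin.ext h)
    simp [firstOrder, this]
  · simp

/-- The candidate lies in the past, and the remaining sign is orthogonal to it; this characterizes
the projection. -/
lemma predictor_sign (hF : IsStable F) (t : ℤ) (a : Joint k) :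
    predictor (coinLaw (Joint k)) (signX F) (signU F) 0 t a =
      ∑ c, F a c • zL2 (coinLaw (Joint k)) (signX F) (signU F) 0 (t - 1) c := by
  refine Submodule.eq_starProjection_of_mem_of_inner_eq_zero ?_ fun g hg => ?_
  · exact Submodule.sum_mem _ fun c _ => Submodule.smul_mem _ _
      (mem_closedPast (zL2 (coinLaw (Joint k)) (signX F) (signU F) 0) le_rfl c)
  · rw [hF.zL2_eq, add_sub_cancel_left]
    exact inner_eq_zero_of_mem_closedPast
      (z := zL2 (coinLaw (Joint k)) (signX F) (signU F) 0)
      (fun s hs b => hF.inner_signL2_of_lt (by omega) a b) hg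

lemma innovation_sign (hF : IsStable F) (t : ℤ) (a : Joint k) :
    innovation (coinLaw (Joint k)) (signX F) (signU F) 0 t a = signL2 t a := by
  rw [innovation, hF.predictor_sign, hF.zL2_eq, add_sub_cancel_left]

lemma innovation_sign_coeFn (hF : IsStable F) (t : ℤ) (a : Joint k) :
    (⇑(innovation (coinLaw (Joint k)) (signX F) (signU F) 0 t a) : _ → ℝ) =ᵐ[coinLaw (Joint k)]
      signNoise t a := by
  rw [hF.innovation_sign]
  exact toL2_coeFn (memLp_signNoise t a 2)

lemma innovationCov_sign (hF : IsStable F) (t : ℤ) :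
    innovationCov (coinLaw (Joint k)) (signX F) (signU F) 0 t = 1 := by
  ext a b
  rw [innovationCov, Matrix.of_apply, Matrix.one_apply]
  refine Eq.trans (integral_congr_ae ?_) ((integral_signNoise_mul t t a b).trans (by simp))
  filter_upwards [hF.innovation_sign_coeFn t a, hF.innovation_sign_coeFn t b] with ω h1 h2
  rw [h1, h2]

/-- The innovations agree almost surely with independent signs, so disjoint sets of dates generate
independent σ-algebras. Only positive lags matter for the summability condition. -/
lemma mixingCoeff_sign (hF : IsStable F) (l : ℕ) :
    mixingCoeff (coinLaw (Joint k)) (signX F) (signU F) 0 (l + 1) = 0 := by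
  have hind : iIndepFun (fun (q : ℤ × Joint k) ω =>
      innovation (coinLaw (Joint k)) (signX F) (signU F) 0 q.1 q.2 ω) (coinLaw (Joint k)) :=
    iIndepFun_signNoise.congr fun q => (hF.innovation_sign_coeFn q.1 q.2).symm
  have hσ : ∀ I : Set ℤ, innovationSigma (coinLaw (Joint k)) (signX F) (signU F) 0 I =
      ⨆ q ∈ {q : ℤ × Joint k | q.1 ∈ I}, MeasurableSpace.comap (fun ω =>
        innovation (coinLaw (Joint k)) (signX F) (signU F) 0 q.1 q.2 ω) inferInstance := by
    intro I
    refine le_antisymm (iSup₂_le fun s hs => iSup_le fun a => ?_) (iSup₂_le fun q hq => ?_)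
    · exact le_iSup₂_of_le (s, a) hs le_rfl
    · exact le_iSup₂_of_le q.1 hq (le_iSup_of_le q.2 le_rfl)
  have h0 : ∀ r ∈ {r | ∃ t : ℤ, ∃ A B : Set (ℤ × Joint k → Bool),
      MeasurableSet[innovationSigma (coinLaw (Joint k)) (signX F) (signU F) 0 (Set.Iic t)] A ∧
      MeasurableSet[innovationSigma (coinLaw (Joint k)) (signX F) (signU F) 0
        (Set.Ici (t + (l + 1 : ℕ)))] B ∧
      r = |(coinLaw (Joint k)).real (A ∩ B) -
        (coinLaw (Joint k)).real A * (coinLaw (Joint k)).real B|}, r = 0 := by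
    rintro r ⟨t, A, B, hA, hB, rfl⟩
    rw [hσ] at hA hB
    have hd : Disjoint {q : ℤ × Joint k | q.1 ∈ Set.Iic t}
        {q : ℤ × Joint k | q.1 ∈ Set.Ici (t + (l + 1 : ℕ))} := by
      rw [Set.disjoint_left]
      intro q h1 h2
      simp only [Set.mem_ofPred_eq, Set.mem_Iic, Set.mem_Ici] at h1 h2
      omega
    have h := (Indep_iff _ _ _).1 (indep_iSup_of_disjoint
      (fun q => (Lp.stronglyMeasurable _).measurable.comap_le) hind.iIndep hd) A B hA hB
    rw [Measure.real, h, ENNReal.toReal_mul, Measure.real, Measure.real, sub_self, abs_zero]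
  unfold mixingCoeff
  exact le_antisymm (Real.sSup_le (fun r hr => (h0 r hr).le) le_rfl)
    (Real.sSup_nonneg fun r hr => (h0 r hr).ge)

/-- An element of every past is orthogonal to every sign, hence to the process, which is a series in
the signs; but it belongs to the closed span of the process. -/
lemma iInf_past_sign (hF : IsStable F) :
    ⨅ t, past (coinLaw (Joint k)) (signX F) (signU F) 0 t = ⊥ := by
  rw [eq_bot_iff]
  intro g hg
  rw [Submodule.mem_iInf] at hg
  have h1 : ∀ t a, ∫ ω, g ω * signNoise t a ω ∂coinLaw (Joint k) = 0 := by
    intro t a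
    rw [← inner_toL2 (memLp_signNoise t a 2), real_inner_comm]
    exact inner_eq_zero_of_mem_closedPast
      (z := zL2 (coinLaw (Joint k)) (signX F) (signU F) 0) (t := t - 1)
      (fun s hs b => hF.inner_signL2_of_lt (by omega) a b) (hg (t - 1))
  have h2 : ∀ t a, ⟪g, zL2 (coinLaw (Joint k)) (signX F) (signU F) 0 t a⟫_ℝ = 0 := by
    intro t a
    rw [zL2_sign, inner_toL2 (hF.memLp_signAR t a 2),
      hF.integral_mul_signAR ((Lp.memLp g).integrable (by norm_num))]
    simp [h1]
  exact inner_self_eq_zero.1 (inner_eq_zero_of_mem_closedPast (fun s _ a => h2 s a) (hg 0))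

lemma hasParam_sign (hF : IsStable F) (hp : 0 < p) :
    HasParam (coinLaw (Joint k)) (signX F) (signU F) 0 (firstOrder p F) where
  predictor_eq t a := by rw [hF.predictor_sign, sum_firstOrder hp]
  cov_eq t := hF.innovationCov_sign t

lemma finitePredictor_sign (hF : IsStable F) (hp : 0 < p) :
    FinitePredictor (coinLaw (Joint k)) (signX F) (signU F) 0 p where
  memLp t a := by simp only [zbar_sign]; exact hF.memLp_signAR t a 2
  mean_zero t a := by simp only [zbar_sign]; exact hF.integral_signAR t a
  cov_stationary s t h a b := by simp only [zbar_sign, hF.integral_signAR_mul]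
  purely_nondeterministic := hF.iInf_past_sign
  exact_predictor t a := by
    rw [hF.predictor_sign]
    exact Submodule.sum_mem _ fun c _ => Submodule.smul_mem _ _
      (Submodule.subset_span ⟨⟨0, hp⟩, c, by simp⟩)
  mixing_moments := by
    -- Signs have absolute value one, so any `δ` serves and the bound on the moments is `1`.
    refine ⟨1, one_pos, ?_, 1, fun t a => ?_⟩
    · simp only [hF.mixingCoeff_sign]
      norm_num [summable_zero]
    · refine (eLpNorm_le_of_ae_bound (C := 1) ?_).trans (by simp)
      filter_upwards [hF.innovation_sign_coeFn t a] with ω h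
      rw [h, Real.norm_eq_abs, abs_signNoise]
  innovationCov_posDef t := by rw [hF.innovationCov_sign]; exact Matrix.PosDef.one

end IsStable

end SignProcess

/-! ### Full-rank conditions -/

section Rank

variable {N : ℕ} {k : Fin N → ℕ} {p : ℕ} {μ : Reg k → ℝ} {V : ObsIdx k p → ObsIdx k p → ℝ}

namespace IsPopMoment

lemma olsGram_posDef (hV : IsPopMoment μ V) : (olsGram μ V).PosDef := by
  refine Matrix.PosDef.of_dotProduct_mulVec_pos ?_ fun v hv => ?_
  · ext c d
    simp only [Matrix.conjTranspose_apply, star_trivial, olsGram, Matrix.of_apply]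
    exact Finset.sum_congr rfl fun n _ => bil_comm (symm_of_posDef hV.posDef) _ _
  · rw [star_trivial]
    refine lt_of_le_of_ne ?_ fun h => hv (hV.olsGram_definite v h.symm)
    rw [bil_eq_mulVec_quad V (fun n c => zForm μ 0 n c) (fun c d => by simp [olsGram])]
    exact Finset.sum_nonneg fun n _ => bil_nonneg hV.posDef _

lemma glsGram_posDef (hV : IsPopMoment μ V) {Φ : Fin p → Matrix (Fin N) (Fin N) ℝ}
    {S : Matrix (Fin N) (Fin N) ℝ} (hS : S.PosDef) (hΦ : (filterAtOne Φ).det ≠ 0) :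
    (glsGram μ V Φ S).PosDef := by
  refine Matrix.PosDef.of_dotProduct_mulVec_pos ?_ fun v hv => ?_
  · ext c d
    simp only [Matrix.conjTranspose_apply, star_trivial, glsGram, Matrix.of_apply]
    rw [Finset.sum_comm]
    refine Finset.sum_congr rfl fun n _ => Finset.sum_congr rfl fun m _ => ?_
    rw [inv_symm hS, bil_comm (symm_of_posDef hV.posDef)]
  · rw [star_trivial]
    refine lt_of_le_of_ne ?_ fun h => hv (hV.glsGram_definite hS hΦ v h.symm)
    rw [glsGram_eq]
    exact bil_nonneg (wKernel_posDef hS.inv hV.posDef) _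

end IsPopMoment

variable {Ω : Type*} [MeasurableSpace Ω] {P : Measure Ω} [IsProbabilityMeasure P]
  {x : ℤ → Ω → Reg k → ℝ} {u : ℤ → Ω → Fin N → ℝ} {θ : Param k p}

namespace FinitePredictor

lemma filteredMoment_eq (h : FinitePredictor P x u μ p) (θ : Param k p) (t : ℤ) :
    filteredMoment P x θ t = glsGram μ (obsMoment P x u μ p) (psiUU θ) (sigmaUU θ) := by
  ext c d
  have := h.sum_bil_obsMoment p t Finset.univ (fun a : Fin N × Fin N => (sigmaUU θ)⁻¹ a.1 a.2)
    (fun a => fzForm μ (psiUU θ) a.1 c) (fun a => fzForm μ (psiUU θ) a.2 d)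
  simp only [Fintype.sum_prod_type, fzForm_dotProduct] at this
  rw [glsGram, Matrix.of_apply, this, filteredMoment, Matrix.of_apply]
  refine integral_congr_ae (ae_of_all _ fun ω => ?_)
  simp only [Matrix.mul_apply, Matrix.transpose_apply, Finset.sum_mul]
  rw [Finset.sum_comm]
  exact Finset.sum_congr rfl fun n _ => Finset.sum_congr rfl fun m _ => by ring

/-- The rank conditions are consequences of the nondegeneracy of the lags, once `A(1)` is
invertible. -/
lemma isDGP (h : FinitePredictor P x u μ p) (hθ : HasParam P x u μ θ)
    (hS : (sigmaUU θ).PosDef) (hΦ : (IsPopMoment.filterAtOne (psiUU θ)).det ≠ 0) : IsDGP P x u μ θ where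
  finitePredictor := h
  hasParam := hθ
  designMoment_posDef t := by
    rw [h.designMoment_eq t p]; exact (h.isPopMoment hθ p).olsGram_posDef
  filteredMoment_posDef t := by
    rw [h.filteredMoment_eq]; exact (h.isPopMoment hθ p).glsGram_posDef hS hΦ

end FinitePredictor

end Rank

/-! ### A regressor that responds to lagged disturbances -/

section Example

open scoped InnerProductSpace

variable {N : ℕ} {k : Fin N → ℕ} {p : ℕ} (c₀ : Reg k)

/-- The coefficients of `u_t = 4/5 u_{t-1} + v_t`, `x_t = 1/2 x_{t-1} + 3/5 u_{t-1} + e_t` for one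
equation and one of its regressors, all other components being white noise. -/
def feedforward : Matrix (Joint k) (Joint k) ℝ :=
  Matrix.single (Sum.inr c₀.1) (Sum.inr c₀.1) (4 / 5) +
    Matrix.single (Sum.inl c₀) (Sum.inl c₀) (1 / 2) +
    Matrix.single (Sum.inl c₀) (Sum.inr c₀.1) (3 / 5)

/-- The factor `2` in the corner is `(3 / 5) / (4 / 5 - 1 / 2)`, as for any triangular matrix with
distinct eigenvalues. -/
lemma feedforward_pow (n : ℕ) : feedforward c₀ ^ (n + 1) =
    Matrix.single (Sum.inr c₀.1) (Sum.inr c₀.1) ((4 / 5) ^ (n + 1)) +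
    Matrix.single (Sum.inl c₀) (Sum.inl c₀) ((1 / 2) ^ (n + 1)) +
    Matrix.single (Sum.inl c₀) (Sum.inr c₀.1) (2 * ((4 / 5) ^ (n + 1) - (1 / 2) ^ (n + 1))) := by
  induction n with
  | zero => rw [zero_add, pow_one, pow_one, pow_one, feedforward]; norm_num
  | succ n ih =>
    rw [pow_succ, ih, feedforward]
    have h1 : (Sum.inl c₀ : Joint k) ≠ Sum.inr c₀.1 := by simp
    simp only [add_mul, mul_add, Matrix.single_mul_single_same,
      Matrix.single_mul_single_of_ne _ _ _ _ h1, Matrix.single_mul_single_of_ne _ _ _ _ h1.symm,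
      add_zero, zero_add, ← pow_succ]
    rw [add_right_comm (Matrix.single _ _ _), add_assoc, ← Matrix.single_add]
    congr 2
    ring

lemma abs_single_le {m n : Type*} [DecidableEq m] [DecidableEq n] (i i' : m) (j j' : n) (r : ℝ) :
    |Matrix.single i j r i' j'| ≤ |r| := by
  rw [Matrix.single_apply]
  split_ifs
  · exact le_rfl
  · simp

lemma feedforward_isStable : IsStable (feedforward c₀) := by
  refine ⟨4, 4 / 5, by norm_num, by norm_num, fun n a b => ?_⟩
  rcases n with _ | n
  · rw [pow_zero, Matrix.one_apply]
    split_ifs <;> norm_num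
  · rw [feedforward_pow, Matrix.add_apply, Matrix.add_apply]
    have h1 : (0 : ℝ) ≤ (1 / 2) ^ (n + 1) := by positivity
    have h2 : ((1 : ℝ) / 2) ^ (n + 1) ≤ (4 / 5) ^ (n + 1) :=
      pow_le_pow_left₀ (by norm_num) (by norm_num) _
    refine (abs_add_three _ _ _).trans ((add_le_add (add_le_add (abs_single_le _ _ _ _ _)
      (abs_single_le _ _ _ _ _)) (abs_single_le _ _ _ _ _)).trans ?_)
    rw [abs_of_nonneg (h1.trans h2), abs_of_nonneg h1,
      abs_of_nonneg (mul_nonneg two_pos.le (sub_nonneg.2 h2))]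
    linarith

section Sum

variable {E : Type*} [AddCommGroup E] [Module ℝ E] (f : Joint k → E)

lemma sum_feedforward_inr : ∑ c, feedforward c₀ (Sum.inr c₀.1) c • f c =
    (4 / 5 : ℝ) • f (Sum.inr c₀.1) := by
  rw [Finset.sum_eq_single (Sum.inr c₀.1)]
  · simp [feedforward]
  · intro b _ hb; simp [feedforward, hb.symm]
  · simp

lemma sum_feedforward_inl : ∑ c, feedforward c₀ (Sum.inl c₀) c • f c =
    (1 / 2 : ℝ) • f (Sum.inl c₀) + (3 / 5 : ℝ) • f (Sum.inr c₀.1) := by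
  rw [Fintype.sum_sum_type, Finset.sum_eq_single c₀, Finset.sum_eq_single c₀.1]
  · simp [feedforward]
  · intro b _ hb; simp [feedforward, hb.symm]
  · simp
  · intro b _ hb; simp [feedforward, hb.symm]
  · simp

lemma sum_feedforward_ne {a : Joint k} (h1 : a ≠ Sum.inr c₀.1) (h2 : a ≠ Sum.inl c₀) :
    ∑ c, feedforward c₀ a c • f c = 0 :=
  Finset.sum_eq_zero fun b _ => by simp [feedforward, h1.symm, h2.symm]

end Sum

variable {c₀}

section Moments

variable {E : Type*} [NormedAddCommGroup E] [InnerProductSpace ℝ E] [CompleteSpace E]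
  {z ε : ℤ → Joint k → E}

/-- The element of `E` that corresponds to a linear form. -/
def realize (z : ℤ → Joint k → E) : (ObsIdx k p → ℝ) →ₗ[ℝ] E where
  toFun α := ∑ q : Fin (p + 1) × Joint k, α (some q) • z (0 - (q.1 : ℕ)) q.2
  map_add' α β := by simp [add_smul, Finset.sum_add_distrib]
  map_smul' r α := by simp [mul_smul, Finset.smul_sum]

lemma realize_single (z : ℤ → Joint k → E) (q : Fin (p + 1) × Joint k) :
    realize z (Pi.single (some q) 1) = z (0 - (q.1 : ℕ)) q.2 := by
  simp only [realize, LinearMap.coe_mk, AddHom.coe_mk]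
  rw [Finset.sum_eq_single q]
  · simp
  · intro r _ hr; simp [hr]
  · simp

lemma realize_none (z : ℤ → Joint k → E) :
    realize z (Pi.single (none : ObsIdx k p) 1) = 0 := by
  simp [realize]

lemma realize_uForm (z : ℤ → Joint k → E) (i : Fin (p + 1)) (n : Fin N) :
    realize z (uForm i n) = z (0 - (i : ℕ)) (Sum.inr n) :=
  realize_single z (i, Sum.inr n)

lemma realize_zForm_inl (z : ℤ → Joint k → E) (i : Fin (p + 1)) (n m : Fin N) :
    realize z (zForm 0 i n (Sum.inl m)) = 0 := by
  simp only [zForm]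
  split_ifs
  · exact realize_none z
  · exact map_zero _

lemma realize_zForm_inr (z : ℤ → Joint k → E) (i : Fin (p + 1)) (n : Fin N) (c : Reg k) :
    realize z (zForm 0 i n (Sum.inr c)) = if c.1 = n then z (0 - (i : ℕ)) (Sum.inl c) else 0 := by
  simp only [zForm, Pi.zero_apply, zero_smul, add_zero]
  split_ifs
  · exact realize_single z (i, Sum.inl c)
  · exact map_zero _

lemma bil_paramMoment {θ : Param k p} (W : IsVAR θ.1 θ.2 z ε) (α β : ObsIdx k p → ℝ) :
    bil (paramMoment θ) α β = α none * β none + ⟪realize z α, realize z β⟫_ℝ := by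
  simp only [bil, Fintype.sum_option, paramMoment, mul_one, mul_zero, Finset.sum_const_zero,
    add_zero, zero_add, realize, LinearMap.coe_mk, AddHom.coe_mk, sum_inner, inner_sum,
    inner_smul_left, inner_smul_right, conj_trivial, W.stateMoment_eq]
  congr 1
  rw [Finset.sum_comm]
  refine Finset.sum_congr rfl fun _ _ => ?_
  rw [Finset.mul_sum]
  exact Finset.sum_congr rfl fun _ _ => by ring

/-- The autoregression with coefficients `feedforward c₀` and unit innovation covariance. -/
abbrev IsFeedforward (p : ℕ) (c₀ : Reg k) (z ε : ℤ → Joint k → E) : Prop :=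
  IsVAR (firstOrder p (feedforward c₀)).1 (firstOrder p (feedforward c₀)).2 z ε

namespace IsFeedforward

lemma eq_inr (W : IsFeedforward p c₀ z ε) (hp : 0 < p) (t : ℤ) :
    z t (Sum.inr c₀.1) = (4 / 5 : ℝ) • z (t - 1) (Sum.inr c₀.1) + ε t (Sum.inr c₀.1) := by
  rw [W.eq t, IsStable.sum_firstOrder hp, sum_feedforward_inr]

lemma eq_inl (W : IsFeedforward p c₀ z ε) (hp : 0 < p) (t : ℤ) :
    z t (Sum.inl c₀) = (1 / 2 : ℝ) • z (t - 1) (Sum.inl c₀) +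
      (3 / 5 : ℝ) • z (t - 1) (Sum.inr c₀.1) + ε t (Sum.inl c₀) := by
  rw [W.eq t, IsStable.sum_firstOrder hp, sum_feedforward_inl]

lemma eq_ne (W : IsFeedforward p c₀ z ε) (hp : 0 < p) {a : Joint k} (h1 : a ≠ Sum.inr c₀.1)
    (h2 : a ≠ Sum.inl c₀) (t : ℤ) : z t a = ε t a := by
  rw [W.eq t, IsStable.sum_firstOrder hp, sum_feedforward_ne c₀ _ h1 h2, zero_add]

lemma inner_innovation (W : IsFeedforward p c₀ z ε) {a b : Joint k} (t : ℤ) :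
    ⟪ε t a, z t b⟫_ℝ = if a = b then 1 else 0 := by
  rw [W.inner_innovation_self]
  exact Matrix.one_apply

/-- Such a component is its own innovation, hence orthogonal to everything earlier and, as `Σ` is
the identity, to the other components at the same date. -/
lemma inner_ne (W : IsFeedforward p c₀ z ε) (hp : 0 < p) {a b : Joint k} (h1 : a ≠ Sum.inr c₀.1)
    (h2 : a ≠ Sum.inl c₀) (hab : a ≠ b) {s t : ℤ} (hst : s ≤ t) : ⟪z t a, z s b⟫_ℝ = 0 := by
  rw [W.eq_ne hp h1 h2]
  rcases hst.eq_or_lt with rfl | h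
  · rw [W.inner_innovation, if_neg hab]
  · exact W.orth _ _ _ _ h

lemma inner_stat (W : IsFeedforward p c₀ z ε) (s t : ℤ) (a b : Joint k) :
    ⟪z s a, z s b⟫_ℝ = ⟪z t a, z t b⟫_ℝ := by
  have := W.stat t s 0 a b
  rwa [add_zero, add_zero] at this

/-- The variance solves `γ = (16 / 25) γ + 1`. -/
lemma inner_inr_inr (W : IsFeedforward p c₀ z ε) (hp : 0 < p) (t : ℤ) :
    ⟪z t (Sum.inr c₀.1), z t (Sum.inr c₀.1)⟫_ℝ = 25 / 9 := by
  have h0 := W.inner_stat (t - 1) t (Sum.inr c₀.1) (Sum.inr c₀.1)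
  have h1 := W.cov t (Sum.inr c₀.1) (Sum.inr c₀.1)
  have h2 := W.orth t (Sum.inr c₀.1) (t - 1) (Sum.inr c₀.1) (by omega)
  have h3 := h2
  rw [real_inner_comm] at h3
  have e : ⟪z t (Sum.inr c₀.1), z t (Sum.inr c₀.1)⟫_ℝ =
      ⟪(4 / 5 : ℝ) • z (t - 1) (Sum.inr c₀.1) + ε t (Sum.inr c₀.1),
        (4 / 5 : ℝ) • z (t - 1) (Sum.inr c₀.1) + ε t (Sum.inr c₀.1)⟫_ℝ := by
    rw [← W.eq_inr hp]
  simp only [inner_add_left, inner_add_right, inner_smul_left, inner_smul_right, conj_trivial,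
    h0, h1, h2, h3, firstOrder, Matrix.one_apply_eq] at e
  linarith

/-- Stationarity gives `c = (2 / 5) c + (12 / 25) (25 / 9)`. -/
lemma inner_inl_inr (W : IsFeedforward p c₀ z ε) (hp : 0 < p) (t : ℤ) :
    ⟪z t (Sum.inl c₀), z t (Sum.inr c₀.1)⟫_ℝ = 20 / 9 := by
  have h0 := W.inner_stat (t - 1) t (Sum.inl c₀) (Sum.inr c₀.1)
  have h1 := W.inner_inr_inr hp (t - 1)
  have h2 := W.orth t (Sum.inr c₀.1) (t - 1) (Sum.inl c₀) (by omega)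
  have h3 := W.orth t (Sum.inr c₀.1) (t - 1) (Sum.inr c₀.1) (by omega)
  have h4 := W.inner_innovation (a := Sum.inl c₀) (b := Sum.inr c₀.1) t
  have e : ⟪z t (Sum.inl c₀), z t (Sum.inr c₀.1)⟫_ℝ =
      ⟪(1 / 2 : ℝ) • z (t - 1) (Sum.inl c₀) + (3 / 5 : ℝ) • z (t - 1) (Sum.inr c₀.1),
        (4 / 5 : ℝ) • z (t - 1) (Sum.inr c₀.1) + ε t (Sum.inr c₀.1)⟫_ℝ := by
    rw [← W.eq_inr hp, ← add_zero ⟪_ + _, _⟫_ℝ, ← h4.trans (if_neg (by simp)), ← inner_add_left,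
      ← W.eq_inl hp]
  rw [real_inner_comm] at h2 h3
  simp only [inner_add_left, inner_add_right, inner_smul_left, inner_smul_right, conj_trivial,
    h0, h1, h2, h3] at e
  linarith

/-- Stationarity gives `v = v / 4 + 1 + 4 / 3 + 1`, the terms after the first coming from the lagged
disturbance, the cross term and the innovation. -/
lemma inner_inl_inl (W : IsFeedforward p c₀ z ε) (hp : 0 < p) (t : ℤ) :
    ⟪z t (Sum.inl c₀), z t (Sum.inl c₀)⟫_ℝ = 40 / 9 := by
  have h0 := W.inner_stat (t - 1) t (Sum.inl c₀) (Sum.inl c₀)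
  have h1 := W.inner_inr_inr hp (t - 1)
  have h2 := W.inner_inl_inr hp (t - 1)
  have h2' := h2
  rw [real_inner_comm] at h2'
  have h3 := W.orth t (Sum.inl c₀) (t - 1) (Sum.inl c₀) (by omega)
  have h4 := W.orth t (Sum.inl c₀) (t - 1) (Sum.inr c₀.1) (by omega)
  have h3' := h3
  have h4' := h4
  rw [real_inner_comm] at h3' h4'
  have h5 := W.cov t (Sum.inl c₀) (Sum.inl c₀)
  have e : ⟪z t (Sum.inl c₀), z t (Sum.inl c₀)⟫_ℝ =
      ⟪(1 / 2 : ℝ) • z (t - 1) (Sum.inl c₀) + (3 / 5 : ℝ) • z (t - 1) (Sum.inr c₀.1) +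
        ε t (Sum.inl c₀), (1 / 2 : ℝ) • z (t - 1) (Sum.inl c₀) +
        (3 / 5 : ℝ) • z (t - 1) (Sum.inr c₀.1) + ε t (Sum.inl c₀)⟫_ℝ := by
    rw [← W.eq_inl hp]
  simp only [inner_add_left, inner_add_right, inner_smul_left, inner_smul_right, conj_trivial,
    h0, h1, h2, h2', h3, h4, h3', h4', h5, firstOrder, Matrix.one_apply_eq] at e
  linarith

/-- The bias of OLS on the feedforward regressor. -/
def bias (c₀ : Reg k) : Coef k → ℝ := Pi.single (Sum.inr c₀) (1 / 2)

/-- The filter of the population VAR of the OLS residuals. -/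
def filter (p : ℕ) (c₀ : Reg k) (j : Fin p) : Matrix (Fin N) (Fin N) ℝ :=
  if (j : ℕ) = 0 then Matrix.single c₀.1 c₀.1 (1 / 2) else 0

lemma olsCross_inr (W : IsFeedforward p c₀ z ε) (hp : 0 < p) (c : Reg k) :
    olsCross 0 (paramMoment (firstOrder p (feedforward c₀))) (Sum.inr c) =
      if c = c₀ then 20 / 9 else 0 := by
  have hn : ∀ n, uForm (k := k) (p := p) 0 n none = 0 := fun n => by simp [uForm]
  simp only [olsCross, bil_paramMoment W, realize_uForm, realize_zForm_inr, hn, mul_zero, zero_add]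
  rw [Finset.sum_eq_single c.1 (fun n _ hn => by rw [if_neg hn.symm, inner_zero_left])
    (by simp), if_pos rfl]
  split_ifs with h
  · subst h; exact W.inner_inl_inr hp _
  · exact W.inner_ne hp (by simp) (by simpa using h) (by simp) le_rfl

/-- The regressor `c₀` is uncorrelated with the other regressors, and it alone is correlated with
the disturbance of its equation, so its bias is `(20 / 9) / (40 / 9)`. -/
lemma popBias_eq (W : IsFeedforward p c₀ z ε) (hp : 0 < p)
    (hV : IsPopMoment 0 (paramMoment (firstOrder p (feedforward c₀)))) :
    popBias 0 (paramMoment (firstOrder p (feedforward c₀))) = bias c₀ := by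
  symm
  apply hV.eq_popBias
  funext d
  rw [bias, Matrix.mulVec_single]
  simp only [MulOpposite.smul_eq_mul_unop, Pi.smul_apply, MulOpposite.unop_op, Matrix.col_apply]
  have hn : ∀ n, zForm (p := p) (0 : Reg k → ℝ) 0 n (Sum.inr c₀) none = 0 := fun n => by
    simp only [zForm]; split_ifs <;> simp
  rcases d with m | c
  · simp [olsGram, olsCross, bil_paramMoment W, realize_zForm_inl, hn, uForm]
  · rw [W.olsCross_inr hp]
    simp only [olsGram, Matrix.of_apply, bil_paramMoment W, realize_zForm_inr, hn, mul_zero,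
      zero_add]
    rw [Finset.sum_eq_single c.1 (fun n _ hn => by rw [if_neg hn.symm, inner_zero_left])
      (by simp), if_pos rfl]
    split_ifs with h h' h'
    · subst h'; rw [W.inner_inl_inl hp]; norm_num
    · rw [W.inner_ne hp (by simp) (by simpa using h') (by simpa using h') le_rfl, zero_mul]
    · subst h'; exact absurd rfl h
    · simp

lemma realize_wForm (z : ℤ → Joint k → E) (i : Fin (p + 1)) (n : Fin N) :
    realize z (wForm 0 (bias c₀) i n) = z (0 - (i : ℕ)) (Sum.inr n) -
      if c₀.1 = n then (1 / 2 : ℝ) • z (0 - (i : ℕ)) (Sum.inl c₀) else 0 := by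
  rw [wForm, map_sub, realize_uForm, map_sum, Finset.sum_eq_single (Sum.inr c₀)]
  · rw [map_smul, realize_zForm_inr, bias, Pi.single_eq_same]
    split_ifs <;> simp
  · intro b _ hb; simp [bias, hb]
  · simp

lemma realize_filt (hp : 0 < p) (z : ℤ → Joint k → E)
    (g : Fin (p + 1) → Fin N → ObsIdx k p → ℝ) (n : Fin N) :
    realize z (filt (filter p c₀) g n) = realize z (g 0 n) -
      if n = c₀.1 then (1 / 2 : ℝ) • realize z (g (Fin.succ ⟨0, hp⟩) c₀.1) else 0 := by
  rw [filt, map_sub, map_sum, Finset.sum_eq_single (⟨0, hp⟩ : Fin p)]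
  · rw [map_sum, Finset.sum_eq_single c₀.1]
    · rw [map_smul]
      split_ifs with h
      · simp [filter, h]
      · simp [filter, Ne.symm h]
    · intro m _ hm; simp [filter, hm.symm]
    · simp
  · intro j _ hj
    have : (j : ℕ) ≠ 0 := fun h => hj (Fin.ext h)
    simp [filter, this]
  · simp

lemma popFilter_eq (W : IsFeedforward p c₀ z ε) (hp : 0 < p)
    (hV : IsPopMoment 0 (paramMoment (firstOrder p (feedforward c₀)))) :
    popFilter 0 (paramMoment (firstOrder p (feedforward c₀))) = filter p c₀ := by
  rw [popFilter, W.popBias_eq hp hV]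
  symm
  refine hV.eq_varFun_of_orthogonal _ _ fun n j m => ?_
  have hn : wForm 0 (bias c₀) j.succ m none = 0 := by
    simp only [wForm, Pi.sub_apply, Finset.sum_apply, Pi.smul_apply, smul_eq_mul]
    rw [Finset.sum_eq_single (Sum.inr c₀)]
    · simp only [zForm, uForm]; split_ifs <;> simp
    · intro b _ hb; simp [bias, hb]
    · simp
  have horth : ∀ a b, ⟪ε 0 a, z (0 - (j.succ : ℕ)) b⟫_ℝ = 0 := fun a b =>
    W.orth _ _ _ _ (by simp only [Fin.val_succ]; omega)
  rw [bil_paramMoment W, hn, mul_zero, zero_add, realize_filt hp]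
  simp only [realize_wForm, if_true]
  have e : z (0 - ((0 : Fin (p + 1)) : ℕ)) (Sum.inr n) -
      (if c₀.1 = n then (1 / 2 : ℝ) • z (0 - ((0 : Fin (p + 1)) : ℕ)) (Sum.inl c₀) else 0) -
      (if n = c₀.1 then (1 / 2 : ℝ) • (z (0 - ((Fin.succ ⟨0, hp⟩ : Fin (p + 1)) : ℕ)) (Sum.inr c₀.1) -
        (1 / 2 : ℝ) • z (0 - ((Fin.succ ⟨0, hp⟩ : Fin (p + 1)) : ℕ)) (Sum.inl c₀)) else 0) =
      ε 0 (Sum.inr n) - if c₀.1 = n then (1 / 2 : ℝ) • ε 0 (Sum.inl c₀) else 0 := by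
    by_cases h : c₀.1 = n
    · subst h
      simp only [if_true, Fin.val_zero, Fin.val_succ, Nat.cast_zero, sub_zero, zero_add,
        Nat.cast_one]
      rw [W.eq_inr hp 0, W.eq_inl hp 0]
      module
    · rw [if_neg h, if_neg (Ne.symm h), if_neg h]
      simp only [Fin.val_zero, Nat.cast_zero, sub_zero]
      exact W.eq_ne hp (by simpa using Ne.symm h) (by simp) 0
  rw [e]
  split_ifs <;> simp only [inner_sub_left, inner_sub_right, inner_smul_left, inner_smul_right,
    horth, mul_zero, sub_zero]

/-- Only the entry of the equation of `c₀` survives. Filtered with coefficient `1 / 2`, regressor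
and disturbance retain `3 / 5` and `3 / 10` of the lagged disturbance, and their covariance is `(9 /
50) (25 / 9) = 1 / 2`. -/
lemma glsCross_ne_zero (W : IsFeedforward p c₀ z ε) (hp : 0 < p)
    {S : Matrix (Fin N) (Fin N) ℝ} (hS : S.PosDef) :
    glsCross 0 (paramMoment (firstOrder p (feedforward c₀))) (filter p c₀) S (Sum.inr c₀) ≠ 0 := by
  have hz : ∀ n, realize z (fzForm (0 : Reg k → ℝ) (filter p c₀) n (Sum.inr c₀)) =
      if n = c₀.1 then z 0 (Sum.inl c₀) - (1 / 2 : ℝ) • z (-1) (Sum.inl c₀) else 0 := by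
    intro n
    rw [fzForm, realize_filt hp]
    simp only [realize_zForm_inr]
    by_cases h : n = c₀.1
    · simp [h]
    · simp [h, Ne.symm h]
  have hu : ∀ n, realize z (filt (filter p c₀) (uForm (k := k)) n) = z 0 (Sum.inr n) -
      if n = c₀.1 then (1 / 2 : ℝ) • z (-1) (Sum.inr c₀.1) else 0 := by
    intro n
    rw [realize_filt hp]
    simp only [realize_uForm]
    simp
  have hn : ∀ m, filt (filter p c₀) (uForm (k := k)) m none = 0 := fun m => by
    simp [filt, uForm]
  have h1 := W.inner_inr_inr hp (-1)
  have h2 := W.inner_inl_inr hp (-1)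
  have h3 : ⟪z 0 (Sum.inl c₀) - (1 / 2 : ℝ) • z (-1) (Sum.inl c₀),
      z 0 (Sum.inr c₀.1) - (1 / 2 : ℝ) • z (-1) (Sum.inr c₀.1)⟫_ℝ = 1 / 2 := by
    have e1 : z 0 (Sum.inl c₀) - (1 / 2 : ℝ) • z (-1) (Sum.inl c₀) =
        (3 / 5 : ℝ) • z (-1) (Sum.inr c₀.1) + ε 0 (Sum.inl c₀) := by
      rw [W.eq_inl hp 0, zero_sub]; module
    have h4 := W.inner_innovation (a := Sum.inl c₀) (b := Sum.inr c₀.1) 0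
    have h5 := W.orth 0 (Sum.inl c₀) (-1) (Sum.inr c₀.1) (by omega)
    have h6 := W.orth 0 (Sum.inr c₀.1) (-1) (Sum.inr c₀.1) (by omega)
    rw [real_inner_comm] at h6
    rw [if_neg (by simp)] at h4
    rw [e1, inner_sub_right, inner_add_left, h4, W.eq_inr hp 0, zero_sub]
    simp only [inner_add_left, inner_add_right, inner_smul_left, inner_smul_right, conj_trivial,
      h1, h5, h6]
    norm_num
  have h4 : ∀ m, m ≠ c₀.1 → ⟪z 0 (Sum.inl c₀) - (1 / 2 : ℝ) • z (-1) (Sum.inl c₀),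
      z 0 (Sum.inr m)⟫_ℝ = 0 := by
    intro m hm
    have h5 : ∀ s ≤ 0, ⟪z s (Sum.inl c₀), z 0 (Sum.inr m)⟫_ℝ = 0 := fun s hs => by
      rw [real_inner_comm]
      exact W.inner_ne hp (by simpa using hm) (by simp) (by simp) hs
    rw [inner_sub_left, inner_smul_left, h5 0 le_rfl, h5 (-1) (by omega)]
    simp
  have e : glsCross 0 (paramMoment (firstOrder p (feedforward c₀))) (filter p c₀) S (Sum.inr c₀) =
      S⁻¹ c₀.1 c₀.1 * (1 / 2) := by
    simp only [glsCross, bil_paramMoment W, hn, mul_zero, zero_add, hz, hu]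
    rw [Finset.sum_eq_single c₀.1, Finset.sum_eq_single c₀.1]
    · rw [if_pos rfl, if_pos rfl, h3]
    · intro m _ hm
      rw [if_pos rfl, if_neg hm, sub_zero, h4 m hm, mul_zero]
    · simp
    · intro n _ hn
      simp [hn]
    · simp
  rw [e]
  exact mul_ne_zero hS.inv.diag_pos.ne' (by norm_num)

lemma discrepancy_ne_zero (W : IsFeedforward p c₀ z ε) (hp : 0 < p)
    (hV : IsPopMoment 0 (paramMoment (firstOrder p (feedforward c₀)))) :
    discrepancy (firstOrder p (feedforward c₀)) ≠ 0 := by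
  rw [discrepancy, W.popFilter_eq hp hV]
  refine mul_ne_zero (mul_ne_zero (fun h => ?_) fun h => ?_) fun h => ?_
  · rw [Finset.sum_eq_zero_iff_of_nonneg fun c _ => sq_nonneg _] at h
    have := h (Sum.inr c₀) (Finset.mem_univ _)
    rw [W.olsCross_inr hp] at this
    norm_num at this
  · rw [Finset.sum_eq_zero_iff_of_nonneg fun j _ => Finset.sum_nonneg fun n _ =>
      Finset.sum_nonneg fun m _ => sq_nonneg _] at h
    have h := h ⟨0, hp⟩ (Finset.mem_univ _)
    rw [Finset.sum_eq_zero_iff_of_nonneg fun n _ => Finset.sum_nonneg fun m _ => sq_nonneg _] at h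
    have h := h c₀.1 (Finset.mem_univ _)
    rw [Finset.sum_eq_zero_iff_of_nonneg fun m _ => sq_nonneg _] at h
    have h := h c₀.1 (Finset.mem_univ _)
    simp [filter, psiUU, firstOrder, feedforward, Matrix.toBlocks₂₂] at h
    norm_num at h
  · rw [Finset.sum_eq_zero_iff_of_nonneg fun c _ => sq_nonneg _] at h
    exact W.glsCross_ne_zero hp hV.popCov_posDef (pow_eq_zero_iff two_ne_zero |>.1
      (h (Sum.inr c₀) (Finset.mem_univ _)))

end IsFeedforward

end Moments

section Parameters

lemma finitePredictor_feedforward (c₀ : Reg k) (hp : 0 < p) :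
    FinitePredictor (coinLaw (Joint k)) (signX (feedforward c₀)) (signU (feedforward c₀)) 0 p :=
  (feedforward_isStable c₀).finitePredictor_sign hp

lemma hasParam_feedforward (c₀ : Reg k) (hp : 0 < p) :
    HasParam (coinLaw (Joint k)) (signX (feedforward c₀)) (signU (feedforward c₀)) 0
      (firstOrder p (feedforward c₀)) :=
  (feedforward_isStable c₀).hasParam_sign hp

lemma regular_feedforward (c₀ : Reg k) (hp : 0 < p) : Regular (firstOrder p (feedforward c₀)) :=
  (finitePredictor_feedforward c₀ hp).regular (hasParam_feedforward c₀ hp)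

lemma discrepancy_feedforward (c₀ : Reg k) (hp : 0 < p) :
    discrepancy (firstOrder p (feedforward c₀)) ≠ 0 :=
  IsFeedforward.discrepancy_ne_zero
    ((finitePredictor_feedforward c₀ hp).isVAR (hasParam_feedforward c₀ hp)) hp
    (regular_feedforward c₀ hp).2

lemma isDGP_feedforward (c₀ : Reg k) (hp : 0 < p) :
    IsDGP (coinLaw (Joint k)) (signX (feedforward c₀)) (signU (feedforward c₀)) 0
      (firstOrder p (feedforward c₀)) := by
  refine (finitePredictor_feedforward c₀ hp).isDGP (hasParam_feedforward c₀ hp) ?_ fun h0 => ?_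
  · have : sigmaUU (firstOrder p (feedforward c₀)) = 1 := by
      ext i j
      simp [sigmaUU, firstOrder, Matrix.toBlocks₂₂, Matrix.one_apply]
    rw [this]
    exact Matrix.PosDef.one
  · obtain ⟨w, hw, h⟩ := Matrix.exists_mulVec_eq_zero_iff.2 h0
    have hs : ∑ j, psiUU (firstOrder p (feedforward c₀)) j = Matrix.single c₀.1 c₀.1 (4 / 5) := by
      rw [Finset.sum_eq_single (⟨0, hp⟩ : Fin p)]
      · ext i j
        simp [psiUU, firstOrder, feedforward, Matrix.toBlocks₂₂, Matrix.single_apply]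
      · intro j _ hj
        have : (j : ℕ) ≠ 0 := fun h => hj (Fin.ext h)
        ext a b
        simp [psiUU, firstOrder, this, Matrix.toBlocks₂₂]
      · simp
    rw [IsPopMoment.filterAtOne, hs, Matrix.sub_mulVec, Matrix.one_mulVec, sub_eq_zero,
      Matrix.single_mulVec] at h
    refine hw (funext fun n => ?_)
    have hn := congrFun h n
    by_cases hc : n = c₀.1
    · subst hc
      simp at hn
      simp only [Pi.zero_apply]
      linarith
    · simpa [hc] using hn

/-- Solve for a null vector by back substitution: the disturbance of the chosen equation, then the
regressor, then the white noise components. The coefficients `4 / 5` and `1 / 2` are below one, so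
none of these can be nonzero when `‖ζ‖ ≤ 1`. -/
lemma admissible_feedforward (c₀ : Reg k) (hp : 0 < p) :
    Admissible (firstOrder p (feedforward c₀)) := by
  refine ⟨fun ζ hζ h0 => ?_, Matrix.PosDef.one⟩
  obtain ⟨w, hw, h⟩ := Matrix.exists_mulVec_eq_zero_iff.2 h0
  have hs : ∑ j : Fin p, ζ ^ ((j : ℕ) + 1) •
      ((firstOrder p (feedforward c₀)).1 j).map Complex.ofReal =
      ζ • (feedforward c₀).map Complex.ofReal := by
    rw [Finset.sum_eq_single (⟨0, hp⟩ : Fin p)]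
    · simp [firstOrder]
    · intro j _ hj
      have : (j : ℕ) ≠ 0 := fun h => hj (Fin.ext h)
      ext a b
      simp [firstOrder, this]
    · simp
  rw [hs, Matrix.sub_mulVec, Matrix.one_mulVec, sub_eq_zero, Matrix.smul_mulVec] at h
  have hrow : ∀ a, Matrix.mulVec ((feedforward c₀).map Complex.ofReal) w a =
      ∑ c, feedforward c₀ a c • w c := fun a => by
    simp [Matrix.mulVec, dotProduct]
  have hsmall : ∀ (r : ℝ) (v : ℂ), |r| < 1 → v = ζ * (r • v) → v = 0 := by
    intro r v hr hv
    by_contra h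
    have h1 := congrArg norm hv
    rw [norm_mul, norm_smul, Real.norm_eq_abs, ← mul_assoc] at h1
    have h2 : ‖ζ‖ * |r| < 1 := (mul_le_of_le_one_left (abs_nonneg r) hζ).trans_lt hr
    nlinarith [norm_pos_iff.2 h]
  have hU : w (Sum.inr c₀.1) = 0 := by
    have := congrFun h (Sum.inr c₀.1)
    rw [Pi.smul_apply, hrow, sum_feedforward_inr] at this
    exact hsmall (4 / 5) _ (by norm_num [abs_of_pos]) this
  have hX : w (Sum.inl c₀) = 0 := by
    have := congrFun h (Sum.inl c₀)
    rw [Pi.smul_apply, hrow, sum_feedforward_inl, hU, smul_zero, add_zero] at this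
    exact hsmall (1 / 2) _ (by norm_num [abs_of_pos]) this
  refine hw (funext fun a => ?_)
  by_cases h1 : a = Sum.inr c₀.1
  · rw [h1, hU]; rfl
  by_cases h2 : a = Sum.inl c₀
  · rw [h2, hX]; rfl
  have := congrFun h a
  rw [Pi.smul_apply, hrow, sum_feedforward_ne c₀ _ h1 h2, smul_zero] at this
  exact this

lemma gexog_feedforward (c₀ : Reg k) : GEXOG (firstOrder p (feedforward c₀)) := by
  refine ⟨fun j => ?_, ?_, ?_⟩
  · ext i c
    by_cases h : (j : ℕ) = 0
    · simp [firstOrder, feedforward, Matrix.toBlocks₂₁, h]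
    · simp [firstOrder, Matrix.toBlocks₂₁, h]
  · ext c i
    simp [firstOrder, Matrix.toBlocks₁₂]
  · ext i c
    simp [firstOrder, Matrix.toBlocks₂₁]

lemma not_bd_feedforward (c₀ : Reg k) (hp : 0 < p) : ¬ BD (firstOrder p (feedforward c₀)) := by
  intro h
  have := congrFun (congrFun (h.1 ⟨0, hp⟩).1 c₀) c₀.1
  simp [firstOrder, feedforward, Matrix.toBlocks₁₂] at this

end Parameters

end Example

lemma HoldsGenerically.mono {N : ℕ} {k : Fin N → ℕ} {p : ℕ} {C : Set (Param k p)}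
    {Q R : Param k p → Prop} (h : HoldsGenerically C Q) (hQR : ∀ θ, Q θ → R θ) :
    HoldsGenerically C R := by
  obtain ⟨f, hf, hQ⟩ := h
  exact ⟨f, hf, fun θ hθ h0 => hQR θ (hQ θ hθ h0)⟩

lemma bd_of_isEmpty {N : ℕ} {k : Fin N → ℕ} {p : ℕ} [IsEmpty (Reg k)] (θ : Param k p) : BD θ :=
  ⟨fun _ => ⟨Matrix.ext fun c => isEmptyElim c, Matrix.ext fun _ c => isEmptyElim c⟩,
    Matrix.ext fun c => isEmptyElim c, Matrix.ext fun _ c => isEmptyElim c⟩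

lemma HoldsGenerically.of_eq_empty {N : ℕ} {k : Fin N → ℕ} {p : ℕ} {C : Set (Param k p)}
    (hC : C = ∅) (Q : Param k p → Prop) : HoldsGenerically C Q := by
  subst hC
  exact ⟨0, Set.empty_subset _, fun θ hθ => hθ.elim⟩

end CORegression

end

theorem proposition5 {N : ℕ} (k : Fin N → ℕ) (p : ℕ) (hp : 1 ≤ p) :
    -- (i) inside the class BD
    (∀ (Ω : Type v) [MeasurableSpace Ω] (P : Measure Ω) [IsProbabilityMeasure P]
        (x : ℤ → Ω → Reg k → ℝ) (u : ℤ → Ω → Fin N → ℝ) (μ : Reg k → ℝ) (κ : Coef k → ℝ)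
        (θ : Param k p), IsDGP P x u μ θ →
        (BD θ ↔ StrictlyExogenous P x u) ∧
        (BD θ → ∀ phat, SelectsOrder P p phat → Efficient P x u κ θ phat)) ∧
    -- (ii) limits of the steps of the procedure, for every data-generating process
    (∀ (Ω : Type v) [MeasurableSpace Ω] (P : Measure Ω) [IsProbabilityMeasure P]
        (x : ℤ → Ω → Reg k → ℝ) (u : ℤ → Ω → Fin N → ℝ) (μ : Reg k → ℝ) (κ : Coef k → ℝ)
        (θ : Param k p), IsDGP P x u μ θ →
        ∃ b Φ S κs, IsPseudoTrue P x u κ (p := p) b Φ S κs ∧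
          ConvergesTo P x u κ (p := p) b Φ S κs) ∧
    -- (ii) generic failure outside BD, and in particular on GEXOG ∖ BD and on EBD ∖ BD
    (∀ C ∈ ({{θ | Admissible θ ∧ ¬ BD θ}, {θ | Admissible θ ∧ GEXOG θ ∧ ¬ BD θ},
        {θ | Admissible θ ∧ EBD θ ∧ ¬ BD θ}} : Set (Set (Param k p))),
      HoldsGenerically C fun θ =>
        ∀ (Ω : Type v) [MeasurableSpace Ω] (P : Measure Ω) [IsProbabilityMeasure P]
          (x : ℤ → Ω → Reg k → ℝ) (u : ℤ → Ω → Fin N → ℝ) (μ : Reg k → ℝ) (κ : Coef k → ℝ),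
          IsDGP P x u μ θ → Fails P x u κ θ) ∧
    -- (ii) failure does occur on GEXOG ∖ BD, hence on EBD ∖ BD
    ((∃ i, k i ≠ 0) →
      ∃ (Ω : Type) (_ : MeasurableSpace Ω) (P : Measure Ω) (_ : IsProbabilityMeasure P)
        (x : ℤ → Ω → Reg k → ℝ) (u : ℤ → Ω → Fin N → ℝ) (μ : Reg k → ℝ) (θ : Param k p),
        IsDGP P x u μ θ ∧ Admissible θ ∧ GEXOG θ ∧ EBD θ ∧ ¬ BD θ ∧
          ∀ κ : Coef k → ℝ, Fails P x u κ θ) := by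
  refine ⟨fun Ω _ P _ x u μ κ θ h => ⟨?_, fun hBD phat hphat => ?_⟩,
    fun Ω _ P _ x u μ κ θ h => ?_, ?_, ?_⟩
  · exact h.finitePredictor.bd_iff_strictlyExogenous hp h.hasParam
  · exact h.finitePredictor.efficient κ hp h.hasParam hBD hphat
  · exact ⟨_, _, _, _, h.finitePredictor.isPseudoTrue κ h.hasParam,
      h.finitePredictor.convergesTo κ hp h.hasParam⟩
  · intro C hC
    rcases isEmpty_or_nonempty (Reg k) with hk | ⟨⟨c₀⟩⟩
    -- Without regressors every parameter is in `BD`, and the classes are empty.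
    · refine HoldsGenerically.of_eq_empty ?_ _
      rcases hC with rfl | rfl | rfl
      · exact Set.eq_empty_of_forall_notMem fun θ hθ => hθ.2 (bd_of_isEmpty θ)
      · exact Set.eq_empty_of_forall_notMem fun θ hθ => hθ.2.2 (bd_of_isEmpty θ)
      · exact Set.eq_empty_of_forall_notMem fun θ hθ => hθ.2.2 (bd_of_isEmpty θ)
    -- The same witness serves all three classes. Regularity is supplied by the process itself, so
    -- admissibility of `θ` is not needed to conclude failure.
    · refine (holdsGenerically_discrepancy (regular_feedforward c₀ hp)
        (discrepancy_feedforward c₀ hp) Matrix.PosDef.one (gexog_feedforward c₀) C hC).mono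
        fun θ hθ Ω _ P _ x u μ κ h => ?_
      exact h.finitePredictor.fails_of_discrepancy hp h.hasParam
        (hθ (h.finitePredictor.regular h.hasParam)) κ
  · rintro ⟨i, hi⟩
    let c₀ : Reg k := ⟨i, ⟨0, Nat.pos_of_ne_zero hi⟩⟩
    exact ⟨_, _, _, inferInstance, _, _, _, _, isDGP_feedforward c₀ hp,
      admissible_feedforward c₀ hp, gexog_feedforward c₀, (gexog_feedforward c₀).ebd,
      not_bd_feedforward c₀ hp, (finitePredictor_feedforward c₀ hp).fails_of_discrepancy hp
        (hasParam_feedforward c₀ hp) (discrepancy_feedforward c₀ hp)⟩
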